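/- **Setting.** Let $\Theta\subset\mathbb R^d$ be compact and let $f_\theta, M_\theta:\mathbb R^{\mathbb N}\to\mathbb R$ ($\theta\in\Theta$) be measurable, twice continuously differentiable in $\theta$ on (a neighbourhood of every point of) $\Theta$; put $h_\theta=M_\theta^2$. Let $(\xi_t)_{t\in\mathbb Z}$ be i.i.d. with $E\xi_0=0$, $E\xi_0^2=1$, $E\xi_0^4<\infty$, and suppose that the law of $\xi_0$ is not concentrated on two points. The model with parameter $\theta$ holds at time $t$ if, almost surely, $$X_t=M_\theta(X_{t-1},X_{t-2},\dots)\,\xi_t+f_\theta(X_{t-1},X_{t-2},\dots).$$ **Assumptions on the functions.** For $S\subset\Theta$, $i\in\{0,1,2\}$ and $\Psi\in\{f,M\}$, $A_i(\Psi_\theta,S)$ means that $\sup_{\theta\in S}\|\partial_\theta^i\Psi_\theta(0)\|<\infty$ and that there are $\alpha^{(i)}_k(\Psi,S)\ge0$ with $\sum_{k\ge1}\alpha^{(i)}_k(\Psi,S)<\infty$ and $\sup_{\theta\in S}\|\partial^i_\theta\Psi_\theta(x)-\partial^i_\theta\Psi_\theta(y)\|\le\sum_{k\ge 1}\alpha^{(i)}_k(\Psi,S)|x_k-y_k|$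 for all sequences $x,y$; $A_i(h_\theta,S)$ is the same for $h$ with $|x_k^2-y_k^2|$ in place of $|x_k-y_k|$. With $\|\xi_0\|_4=(E\xi_0^4)^{1/4}$, $\Theta(4)$ is the set of $\theta\in\Theta$ such that either $A_0(f,\{\theta\})$ and $A_0(M,\{\theta\})$ hold with $\sum_k\alpha^{(0)}_k(f,\{\theta\})+\|\xi_0\|_4\sum_k\alpha_k^{(0)}(M,\{\theta\})<1$, or $f_\theta=0$, $M_\theta>0$ and $A_0(h,\{\theta\})$ holds with $\|\xi_0\|_4^2\sum_k\alpha^{(0)}_k(h,\{\theta\})<1$. * $D(\Theta)$: there is $\underline h>0$ with $h_\theta(x)\ge\underline h$ for all $\theta\in\Theta$ and all $x$. * $K$: for some $l>2$ and for $i=0,1,2$, $A_i(f,\Theta)$ holds, and $A_i(M,\Theta)$ or $A_i(h,\Theta)$ holds, where for $i=0,1$ the coefficients are $O(k^{-l})$ as $k\to\infty$. A *stationary solution* for $\theta$ is a process $Y_t=H(\xi_t,\xi_{t-1},\dots)$, $t\in\mathbb Z$, with $H$ measurable and $EY_0^4<\infty$, that satisfies the model with parameter $\theta$ at all times. For such $Y$: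 * $Id(\Theta)$: for $\theta,\theta'\in\Theta$, if $f_\theta(Y_0,Y_{-1},\dots)=f_{\theta'}(Y_0,Y_{-1},\dots)$ and $h_\theta(Y_0,Y_{-1},\dots)=h_{\theta'}(Y_0,Y_{-1},\dots)$ a.s., then $\theta=\theta'$. * $Var(\Theta)$: for every $\theta\in\Theta$, one of the families $\big(\tfrac{\partial f_\theta}{\partial\theta_i}(Y_0,Y_{-1},\dots)\big)_{1\le i\le d}$, $\big(\tfrac{\partial h_\theta}{\partial\theta_i}(Y_0,Y_{-1},\dots)\big)_{1\le i\le d}$ is linearly independent modulo a.s. equality. **Alternative $H_1^{(loc)}$.** Let $\tau^*\in(0,1)$, $\theta^*_1\ne\theta^*_2$. For every $n$, the process $X=X^{(n)}$ coincides for $t\le[n\tau^*]$ with a stationary solution for $\theta_1^*$ (the same for all $n$), and satisfies the model with parameter $\theta_2^*$ at all times $t>[n\tau^*]$; all these processes are driven by the same $(\xi_t)$. The observations are $X_1,\dots,X_n$. **Test statistic.** Let $x^{(t)}=(X_{t-1},\dots,X_1,0,0,\dots)$, $\hat q_t(\theta)=(X_t-f_\theta(x^{(t)}))^2/h_\theta(x^{(t)})+\log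 h_\theta(x^{(t)})$, and, for $T\subset\{1,\dots,n\}$, $\hat L_n(T,\theta)=-\frac12\sum_{t\in T}\hat q_t(\theta)$; let $\hat\theta_n(T)$ be any maximizer of $\hat L_n(T,\cdot)$ over $\Theta$. Put $$\hat G_n(T)=\frac1{|T|}\sum_{t\in T}\frac{\partial\hat q_t}{\partial\theta}\frac{\partial\hat q_t}{\partial\theta}'\big(\hat\theta_n(T)\big),\qquad \hat F_n(T)=-\frac2{|T|}\frac{\partial^2\hat L_n(T,\cdot)}{\partial\theta\,\partial\theta'}\big(\hat\theta_n(T)\big),$$ $T_k=\{1,\dots,k\}$, $\overline T_k=\{k+1,\dots,n\}$, $S_n(T)=\hat F_n(T)\hat G_n(T)^{-1}\hat F_n(T)$ if $\det\hat G_n(T)\neq0$ and $S_n(T)=0$ otherwise, $\hat\Sigma_{n,k}=\frac kn S_n(T_k)+\frac{n-k}nS_n(\overline T_k)$. Let $v_n\to\infty$, $v_n/n\to0$, $\Pi_n=[v_n,n-v_n]\cap\mathbb N$ and, with $\|u\|^2_{\Sigma}=u'\Sigma u$, $$\hat Q_n=\max\Big(\max_{k\in\Pi_n}\tfrac{k^2}n\big\|\hat\theta_n(T_k)-\hat\theta_n(T_n)\big\|^2_{\hat\Sigma_{n,k}},\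 \max_{k\in\Pi_n}\tfrac{(n-k)^2}n\big\|\hat\theta_n(\overline T_k)-\hat\theta_n(T_n)\big\|^2_{\hat\Sigma_{n,k}}\Big).$$ **Theorem.** Assume $D(\Theta)$, $K$, that $Id(\Theta)$ and $Var(\Theta)$ hold for the stationary solutions for $\theta^*_1$ and $\theta^*_2$, and $H_1^{(loc)}$ with $\theta_1^*,\theta_2^*$ in the interior of $\Theta(4)$. Then $\hat Q_n\to\infty$ almost surely as $n\to\infty$; in particular $P(\hat Q_n>C)\to1$ for every real $C$, so the test is consistent in power. -/

import Mathlib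

open MeasureTheory ProbabilityTheory Filter Topology
open scoped Matrix

noncomputable section

namespace CausalChange

/-- The parameter space `ℝ^d` with its Euclidean norm. -/
abbrev Param (d : ℕ) := EuclideanSpace ℝ (Fin d)

/-- A parametric family of real functions of a sequence. Coordinate `i` of the sequence is
the value at lag `i + 1`. -/
abbrev Family (d : ℕ) := Param d → (ℕ → ℝ) → ℝ

/-- `h_θ = M_θ ^ 2`. -/
def hFun {d : ℕ} (M : Family d) : Family d := fun θ x => (M θ x) ^ 2

/-! ### Assumptions on the functions `f_θ` and `M_θ` -/

/-- The order-`i` derivative in `θ` of `Ψ_θ` at the zero sequence is bounded on `S`, and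
`sup_{θ ∈ S} ‖∂^i Ψ_θ(x) - ∂^i Ψ_θ(y)‖ ≤ ∑ α_k |g(x_k) - g(y_k)|` for all `x`, `y`
(no condition when the right-hand side is infinite), with nonnegative summable `α`. -/
def LipschitzWithCoeff {d : ℕ} (g : ℝ → ℝ) (Ψ : Family d) (S : Set (Param d)) (i : ℕ)
    (α : ℕ → ℝ) : Prop :=
  (∀ k, 0 ≤ α k) ∧ Summable α ∧
  (∃ C : ℝ, ∀ θ ∈ S, ‖iteratedFDeriv ℝ i (fun η => Ψ η 0) θ‖ ≤ C) ∧
  ∀ x y : ℕ → ℝ, Summable (fun k => α k * |g (x k) - g (y k)|) → ∀ θ ∈ S,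
    ‖iteratedFDeriv ℝ i (fun η => Ψ η x) θ - iteratedFDeriv ℝ i (fun η => Ψ η y) θ‖
      ≤ ∑' k, α k * |g (x k) - g (y k)|

/-- Assumption `A_i(Ψ_θ, S)` for `Ψ = f` or `Ψ = M`, with coefficients `α`. -/
def AssumptionA {d : ℕ} (Ψ : Family d) (S : Set (Param d)) (i : ℕ) (α : ℕ → ℝ) : Prop :=
  LipschitzWithCoeff (fun u => u) Ψ S i α

/-- Assumption `A_i(h_θ, S)`, with coefficients `α`: Lipschitz in the squares. -/
def AssumptionAh {d : ℕ} (M : Family d) (S : Set (Param d)) (i : ℕ) (α : ℕ → ℝ) : Prop :=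
  LipschitzWithCoeff (fun u => u ^ 2) (hFun M) S i α

/-- Assumption `D(Θ)`. -/
def AssumptionD {d : ℕ} (M : Family d) (Θ : Set (Param d)) : Prop :=
  ∃ hlow : ℝ, 0 < hlow ∧ ∀ θ ∈ Θ, ∀ x, hlow ≤ |hFun M θ x|

/-- Assumption `K(f_θ, M_θ, Θ)`. -/
def AssumptionK {d : ℕ} (f M : Family d) (Θ : Set (Param d)) : Prop :=
  ∃ l : ℝ, 2 < l ∧ ∀ i : ℕ, i ≤ 2 →
    ∃ αf αv : ℕ → ℝ, AssumptionA f Θ i αf ∧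
      (AssumptionA M Θ i αv ∨ AssumptionAh M Θ i αv) ∧
      (i ≤ 1 → (fun k => αf k + αv k) =O[atTop] (fun k : ℕ => ((k : ℝ) + 1) ^ (-l)))

section Probability

variable {Ω : Type*} [MeasurableSpace Ω]

/-- `‖ξ_0‖_r = (E|ξ_0|^r)^{1/r}`. -/
def innovNorm (μ : Measure Ω) (ξ : ℤ → Ω → ℝ) (r : ℝ) : ℝ :=
  (∫ ω, |ξ 0 ω| ^ r ∂μ) ^ (1 / r)

/-- The set `Θ(r)`: contraction for general causal models, or for ARCH-type models
(`f_θ = 0` and `M_θ` the positive square root of `h_θ`). -/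
def ThetaSet {d : ℕ} (μ : Measure Ω) (ξ : ℤ → Ω → ℝ) (f M : Family d) (Θ : Set (Param d))
    (r : ℝ) : Set (Param d) :=
  {θ ∈ Θ | ∃ αf αM : ℕ → ℝ, AssumptionA f {θ} 0 αf ∧ AssumptionA M {θ} 0 αM ∧
      (∑' k, αf k) + innovNorm μ ξ r * (∑' k, αM k) < 1} ∪
  {θ ∈ Θ | (∀ x, f θ x = 0) ∧ (∀ x, 0 < M θ x) ∧
    ∃ αh : ℕ → ℝ, AssumptionAh M {θ} 0 αh ∧ (innovNorm μ ξ r) ^ 2 * (∑' k, αh k) < 1}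

/-- Centered iid innovations with unit variance, finite fourth moment, and a law that is not
concentrated on two points. -/
structure IsInnovation (μ : Measure Ω) (ξ : ℤ → Ω → ℝ) : Prop where
  measurable : ∀ t, Measurable (ξ t)
  indep : iIndepFun ξ μ
  ident : ∀ t, IdentDistrib (ξ t) (ξ 0) μ μ
  memLp : MemLp (ξ 0) 4 μ
  mean : ∫ ω, ξ 0 ω ∂μ = 0
  variance : ∫ ω, (ξ 0 ω) ^ 2 ∂μ = 1
  not_two_points : ∀ a b : ℝ, ¬ ∀ᵐ ω ∂μ, ξ 0 ω = a ∨ ξ 0 ω = b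

/-- The past `(x_{t-1}, x_{t-2}, …)` of a path. -/
def past (x : ℤ → ℝ) (t : ℤ) : ℕ → ℝ := fun i => x (t - 1 - i)

/-- The model equation at time `t`, almost surely:
`X_t = M_θ(X_{t-1}, X_{t-2}, …) ξ_t + f_θ(X_{t-1}, X_{t-2}, …)`. -/
def ModelAt {d : ℕ} (μ : Measure Ω) (ξ : ℤ → Ω → ℝ) (f M : Family d) (θ : Param d)
    (X : ℤ → Ω → ℝ) (t : ℤ) : Prop :=
  ∀ᵐ ω ∂μ, X t ω = M θ (past (fun s => X s ω) t) * ξ t ω + f θ (past (fun s => X s ω) t)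

/-- `X` is a causal stationary solution, of order 4, of the model with parameter `θ` on `ℤ`:
`X_t = H(ξ_t, ξ_{t-1}, …)` with one measurable `H` for all `t`, a finite fourth moment, and the
model equation at every time. -/
structure IsStationarySolution {d : ℕ} (μ : Measure Ω) (ξ : ℤ → Ω → ℝ) (f M : Family d)
    (θ : Param d) (X : ℤ → Ω → ℝ) : Prop where
  causal : ∃ H : (ℕ → ℝ) → ℝ, Measurable H ∧
    ∀ t : ℤ, ∀ᵐ ω ∂μ, X t ω = H (fun i => ξ (t - i) ω)
  memLp : MemLp (X 0) 4 μ
  model : ∀ t, ModelAt μ ξ f M θ X t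

/-- Assumption `Id(Θ)` for the process `X`. -/
def AssumptionId {d : ℕ} (μ : Measure Ω) (f M : Family d) (Θ : Set (Param d))
    (X : ℤ → Ω → ℝ) : Prop :=
  ∀ θ ∈ Θ, ∀ θ' ∈ Θ,
    (∀ᵐ ω ∂μ, f θ (past (fun s => X s ω) 1) = f θ' (past (fun s => X s ω) 1) ∧
      hFun M θ (past (fun s => X s ω) 1) = hFun M θ' (past (fun s => X s ω) 1)) → θ = θ'

/-- The partial derivatives in `θ` of `Ψ_θ(X_0, X_{-1}, …)` are linearly independent random
variables (modulo almost sure equality). -/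
def DerivIndependent {d : ℕ} (μ : Measure Ω) (Ψ : Family d) (θ : Param d)
    (X : ℤ → Ω → ℝ) : Prop :=
  ∀ c : Fin d → ℝ, (∀ᵐ ω ∂μ, ∑ i, c i *
    fderiv ℝ (fun η => Ψ η (past (fun s => X s ω) 1)) θ (EuclideanSpace.single i 1) = 0) →
    c = 0

/-- Assumption `Var(Θ)` for the process `X`. -/
def AssumptionVar {d : ℕ} (μ : Measure Ω) (f M : Family d) (Θ : Set (Param d))
    (X : ℤ → Ω → ℝ) : Prop :=
  ∀ θ ∈ Θ, DerivIndependent μ f θ X ∨ DerivIndependent μ (hFun M) θ X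

/-- The alternative of one change: for every sample size `n`, up to time `[nτ]` the process
`X n` is the stationary solution for `θ₁`, and after time `[nτ]` it obeys the model with
parameter `θ₂`. All the processes are driven by the same innovations. -/
def LocalAlternative {d : ℕ} (μ : Measure Ω) (ξ : ℤ → Ω → ℝ) (f M : Family d) (τ : ℝ)
    (θ₁ θ₂ : Param d) (X : ℕ → ℤ → Ω → ℝ) : Prop :=
  (∃ Y : ℤ → Ω → ℝ, IsStationarySolution μ ξ f M θ₁ Y ∧
    ∀ n : ℕ, ∀ t : ℤ, t ≤ ⌊(n : ℝ) * τ⌋ → ∀ᵐ ω ∂μ, X n t ω = Y t ω) ∧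
  ∀ n : ℕ, ∀ t : ℤ, ⌊(n : ℝ) * τ⌋ < t → ModelAt μ ξ f M θ₂ (X n) t

end Probability

/-! ### The quasi-likelihood and the test statistic, for one path `x` -/

/-- `(x_{t-1}, …, x_1, 0, 0, …)`. -/
def truncPast (x : ℤ → ℝ) (t : ℕ) : ℕ → ℝ :=
  fun i => if i + 1 < t then x ((t : ℤ) - 1 - i) else 0

/-- `q̂_t(θ)`. -/
def qHat {d : ℕ} (f M : Family d) (x : ℤ → ℝ) (t : ℕ) (θ : Param d) : ℝ :=
  (x t - f θ (truncPast x t)) ^ 2 / hFun M θ (truncPast x t)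
    + Real.log (hFun M θ (truncPast x t))

/-- `L̂(T, θ)`. -/
def LHat {d : ℕ} (f M : Family d) (x : ℤ → ℝ) (T : Finset ℕ) (θ : Param d) : ℝ :=
  -(1 / 2) * ∑ t ∈ T, qHat f M x t θ

/-- `θ` is a quasi-likelihood estimator computed on `T`: a maximizer of `L̂(T, ·)` over `Θ`. -/
def IsQLME {d : ℕ} (f M : Family d) (Θ : Set (Param d)) (x : ℤ → ℝ) (T : Finset ℕ)
    (θ : Param d) : Prop :=
  θ ∈ Θ ∧ IsMaxOn (LHat f M x T) Θ θ

/-- The partial derivative `∂g/∂θ_i`. -/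
def pderiv {d : ℕ} (i : Fin d) (g : Param d → ℝ) (θ : Param d) : ℝ :=
  fderiv ℝ g θ (EuclideanSpace.single i 1)

/-- `Ĝ(T)`, evaluated at the estimate `θ`. -/
def GHat {d : ℕ} (f M : Family d) (x : ℤ → ℝ) (T : Finset ℕ) (θ : Param d) :
    Matrix (Fin d) (Fin d) ℝ :=
  Matrix.of fun i j => (1 / (T.card : ℝ)) *
    ∑ t ∈ T, pderiv i (qHat f M x t) θ * pderiv j (qHat f M x t) θ

/-- `F̂(T)`, evaluated at the estimate `θ`. -/
def FHat {d : ℕ} (f M : Family d) (x : ℤ → ℝ) (T : Finset ℕ) (θ : Param d) :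
    Matrix (Fin d) (Fin d) ℝ :=
  Matrix.of fun i j => -(2 / (T.card : ℝ)) * pderiv i (pderiv j (LHat f M x T)) θ

/-- `F̂(T) Ĝ(T)⁻¹ F̂(T) 1_{det Ĝ(T) ≠ 0}`. -/
def sandwich {d : ℕ} (f M : Family d) (x : ℤ → ℝ) (T : Finset ℕ) (θ : Param d) :
    Matrix (Fin d) (Fin d) ℝ :=
  open Classical in
  if (GHat f M x T θ).det ≠ 0 then
    FHat f M x T θ * (GHat f M x T θ)⁻¹ * FHat f M x T θ
  else 0

/-- `T_k = {1, …, k}`. -/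
def Tinit (k : ℕ) : Finset ℕ := Finset.Icc 1 k

/-- `T̄_k = {k + 1, …, n}`. -/
def Ttail (n k : ℕ) : Finset ℕ := Finset.Icc (k + 1) n

/-- `Σ̂_{n,k}`; `est T` is the estimate computed on `T`. -/
def SigmaHat {d : ℕ} (f M : Family d) (x : ℤ → ℝ) (est : Finset ℕ → Param d) (n k : ℕ) :
    Matrix (Fin d) (Fin d) ℝ :=
  ((k : ℝ) / n) • sandwich f M x (Tinit k) (est (Tinit k))
    + (((n : ℝ) - k) / n) • sandwich f M x (Ttail n k) (est (Ttail n k))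

/-- `(a - b)' S (a - b)`. -/
def quadDiff {d : ℕ} (S : Matrix (Fin d) (Fin d) ℝ) (a b : Param d) : ℝ :=
  (fun i => a i - b i) ⬝ᵥ (S *ᵥ (fun i => a i - b i))

/-- `Q̂^{(1)}_{n,k}`. -/
def Q1 {d : ℕ} (f M : Family d) (x : ℤ → ℝ) (est : Finset ℕ → Param d) (n k : ℕ) : ℝ :=
  ((k : ℝ) ^ 2 / n) *
    quadDiff (SigmaHat f M x est n k) (est (Tinit k)) (est (Tinit n))

/-- `Q̂^{(2)}_{n,k}`. -/
def Q2 {d : ℕ} (f M : Family d) (x : ℤ → ℝ) (est : Finset ℕ → Param d) (n k : ℕ) : ℝ :=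
  (((n : ℝ) - k) ^ 2 / n) *
    quadDiff (SigmaHat f M x est n k) (est (Ttail n k)) (est (Tinit n))

/-- `Π_n = [v_n, n - v_n] ∩ ℕ`, a finite set. -/
def PiSet (v : ℕ → ℝ) (n : ℕ) : Set ℕ := {k : ℕ | v n ≤ k ∧ (k : ℝ) ≤ n - v n}

/-- The test statistic `Q̂_n = max (max_{k ∈ Π_n} Q̂^{(1)}_{n,k}, max_{k ∈ Π_n} Q̂^{(2)}_{n,k})`. -/
def QStat {d : ℕ} (f M : Family d) (v : ℕ → ℝ) (x : ℤ → ℝ) (est : Finset ℕ → Param d)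
    (n : ℕ) : ℝ :=
  max (sSup (Q1 f M x est n '' PiSet v n)) (sSup (Q2 f M x est n '' PiSet v n))

end CausalChange

end

/-!
The statistic is a maximum over all the admissible times `k`, but the true time of change
`k_n = [n τ]` alone makes it diverge.

*The estimators.* Before the change, the process is a stationary functional `H₁(ξ_t, ξ_{t-1}, …)` of
the innovations. After the change, it follows the recursion with parameter `θ₂`, which contracts,
in `L⁴` for a general causal model and in `L²` for the signed squares of an ARCH-type model; hence it
forgets its past and approaches a stationary solution `H₂(ξ_t, …)` (`exists_isAttracting`,
`LocalAlternative.exists_isVanishing`). So on both sides of the change, the observable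
quasi-likelihood has the same averages as the one of a stationary solution, up to `o(1)` and
uniformly in the parameter (`ae_exists_qHat_sub_le`). These averages converge by Birkhoff's ergodic
theorem, which is proved here for the Bernoulli shift (`IsInnovation.ae_tendsto_average`), and Gibbs'
inequality with `Id(Θ)` says that the limit is minimal at the true parameter only
(`IsSolution.integral_quasiLik_lt`). With compactness of `Θ`, the estimators computed on `T_{k_n}` and
on its complement converge to `θ₁` and to `θ₂` (`IsSolution.ae_tendsto_of_isQLME`). Since
`θ₁ ≠ θ₂`, at least one of them keeps away from the estimator computed on all the observations.

*The weight.* It remains to bound the weight matrix from below, for which the sandwich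
`S = F G⁻¹ F` on `T_{k_n}` is enough, the other one being positive semidefinite. With
`y = G⁻¹ F u`, the Cauchy-Schwarz inequality for the form of `G` gives
`(u' F u)² = (u' G y)² ≤ (u' G u) (y' G y) = (u' G u) (u' S u)`
(`le_dotProduct_sandwich`). Near `θ₁`, the sum of the second derivatives of the quasi-likelihood is at
least `c k` (`IsSolution.exists_sum_fderiv_fderiv_ge`), as its mean at `θ₁` is positive by `Var(Θ)`,
so that `u' F u ≥ c ‖u‖²`. The scores are dominated by a stationary integrable process, hence the sum
of their squares is `o(k²)` (`IsSolution.ae_sum_fderiv_sq_le`) and `u' G u = o(k) ‖u‖²`; with only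
four moments, the scores may fail to be square integrable, and `G` need not converge. As the statistic
is at least a constant times `n u' S u` with a vector `u` bounded away from `0`, it diverges
(`tendsto_QStat_atTop`). That `G` is invertible follows in the same way from the means of the truncated
squared scores, where the law of `ξ_0` not being concentrated on two points is needed
(`IsSolution.exists_sum_fderiv_sq_ge`).

*Truncation of the past.* The derivatives of `h_θ` at the truncated past must converge to those at the
full past. The assumptions control, for each order of derivation separately, either `M_θ` or
`h_θ = M_θ²`, so `M_θ` is only known to converge up to its sign; but if the sign is wrong, an assumed
convergence of derivatives of `M_θ` forces the limits of these derivatives to vanish, and the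
derivatives of the squares converge in any case (`jointTendsto_fderiv_sq`).
-/


open MeasureTheory ProbabilityTheory Filter Topology
open scoped Matrix ENNReal

set_option linter.unusedSectionVars false

noncomputable section

namespace CausalChange

/-! ### The pointwise ergodic theorem -/

section

section Birkhoff

variable {α : Type*} [MeasurableSpace α] {P : Measure α} {T : α → α} {g : α → ℝ}

/-- The running maximum `max_{1 ≤ k ≤ n + 1} (g + g ∘ T + ⋯ + g ∘ T^{k-1})`, defined by the
recursion that makes its increments computable. -/
def birkhoffMax (T : α → α) (g : α → ℝ) : ℕ → α → ℝ
  | 0 => g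
  | n + 1 => fun x => g x + max 0 (birkhoffMax T g n (T x))

theorem birkhoffSum_le_birkhoffMax (k : ℕ) (x : α) :
    birkhoffSum T g (k + 1) x ≤ birkhoffMax T g k x := by
  induction k generalizing x with
  | zero => simp [birkhoffMax]
  | succ k ih =>
    rw [birkhoffSum_succ']
    simp only [birkhoffMax]
    gcongr
    exact (ih (T x)).trans (le_max_right _ _)

theorem birkhoffMax_mono (x : α) : Monotone fun n => birkhoffMax T g n x := by
  refine monotone_nat_of_le_succ fun n => ?_
  induction n generalizing x with
  | zero => simp [birkhoffMax]
  | succ n ih =>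
    simp only [birkhoffMax] at ih ⊢
    have := ih (T x)
    gcongr

theorem measurable_birkhoffMax (hT : Measurable T) (hg : Measurable g) (n : ℕ) :
    Measurable (birkhoffMax T g n) := by
  induction n with
  | zero => exact hg
  | succ n ih => exact hg.add (measurable_const.max (ih.comp hT))

theorem integrable_birkhoffMax (hT : MeasurePreserving T P P) (hg : Integrable g P) (n : ℕ) :
    Integrable (birkhoffMax T g n) P := by
  induction n with
  | zero => exact hg
  | succ n ih =>
    have h1 : Integrable (fun x => max 0 (birkhoffMax T g n x)) P := by
      simpa only [max_comm] using ih.pos_part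
    exact hg.add (hT.integrable_comp_of_integrable h1)

/-- The core of the ergodic theorem: if `∫ g < 0`, the Birkhoff sums are almost surely bounded
above. Otherwise, by ergodicity, the running maxima tend to infinity almost surely; as they have
nonnegative increments of mean `∫ g + ∫ (running maximum)⁻`, this would give `0 ≤ ∫ g`. -/
theorem ae_bddAbove_birkhoffSum [IsProbabilityMeasure P] (hT : Ergodic T P) (hgm : Measurable g)
    (hg : Integrable g P) (hneg : ∫ x, g x ∂P < 0) :
    ∀ᵐ x ∂P, ∃ C, ∀ n, birkhoffSum T g n x ≤ C := by
  set A : Set α := {x | ∀ m : ℕ, ∃ n, (m : ℝ) < birkhoffMax T g n x} with hA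
  have hmeas := measurable_birkhoffMax hT.measurable hgm
  have hAm : MeasurableSet A := by
    have : A = ⋂ m : ℕ, ⋃ n, {x | (m : ℝ) < birkhoffMax T g n x} := by
      ext x; simp [hA]
    rw [this]
    exact MeasurableSet.iInter fun m => MeasurableSet.iUnion fun n =>
      measurableSet_lt measurable_const (hmeas n)
  have hinv : T ⁻¹' A = A := by
    ext x
    simp only [hA, Set.mem_preimage, Set.mem_ofPred_eq]
    constructor
    · intro h m
      obtain ⟨k, hk⟩ := exists_nat_gt (m - g x)
      obtain ⟨n, hn⟩ := h k
      refine ⟨n + 1, ?_⟩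
      simp only [birkhoffMax]
      have := le_max_right 0 (birkhoffMax T g n (T x))
      linarith
    · intro h m
      obtain ⟨k, hk⟩ := exists_nat_gt (m + |g x|)
      obtain ⟨n, hn⟩ := h k
      have hn' := hn.trans_le (birkhoffMax_mono (T := T) (g := g) x (Nat.le_succ n))
      simp only [birkhoffMax] at hn'
      refine ⟨n, ?_⟩
      have h1 := le_abs_self (g x)
      have h2 : (m : ℝ) < max 0 (birkhoffMax T g n (T x)) := by linarith
      rcases lt_max_iff.1 h2 with h3 | h3
      · exact absurd h3 (not_lt.2 (Nat.cast_nonneg m))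
      · exact h3
  -- the event `A` that the running maxima are unbounded is invariant
  rcases hT.toPreErgodic.prob_eq_zero_or_one hAm hinv with h0 | h1
  · have : ∀ᵐ x ∂P, x ∉ A := measure_eq_zero_iff_ae_notMem.1 h0
    filter_upwards [this] with x hx
    simp only [hA, Set.mem_ofPred_eq, not_forall, not_exists, not_lt] at hx
    obtain ⟨m, hm⟩ := hx
    refine ⟨m, fun n => ?_⟩
    rcases n with _ | n
    · simp
    · exact (birkhoffSum_le_birkhoffMax n x).trans (hm n)
  · exfalso
    have hae : ∀ᵐ x ∂P, x ∈ A := (prob_compl_eq_zero_iff hAm).2 h1 |> fun h => by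
      have := measure_eq_zero_iff_ae_notMem.1 h
      simpa using this
    have hint := integrable_birkhoffMax hT.toMeasurePreserving hg
    have hpos : ∀ n, Integrable (fun x => max 0 (birkhoffMax T g n x)) P := fun n => by
      simpa only [max_comm] using (hint n).pos_part
    have hnegp : ∀ n, Integrable (fun x => max (-birkhoffMax T g n x) 0) P := fun n =>
      (hint n).neg_part
    have key : ∀ n, 0 ≤ ∫ x, g x ∂P + ∫ x, max (-birkhoffMax T g n x) 0 ∂P := by
      intro n
      have e1 : ∫ x, birkhoffMax T g n x ∂P ≤ ∫ x, birkhoffMax T g (n + 1) x ∂P :=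
        integral_mono (hint n) (hint (n + 1)) fun x => birkhoffMax_mono x (Nat.le_succ n)
      have e2 : ∫ x, birkhoffMax T g (n + 1) x ∂P
          = ∫ x, g x ∂P + ∫ x, max 0 (birkhoffMax T g n x) ∂P := by
        have e : ∫ x, birkhoffMax T g (n + 1) x ∂P = ∫ x, g x ∂P
            + ∫ x, max 0 (birkhoffMax T g n (T x)) ∂P :=
          integral_add hg (hT.toMeasurePreserving.integrable_comp_of_integrable (hpos n))
        rw [e]
        congr 1
        have := integral_map (μ := P) hT.measurable.aemeasurable
          (f := fun x => max 0 (birkhoffMax T g n x))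
          ((measurable_const.max (hmeas n)).aestronglyMeasurable)
        rw [hT.toMeasurePreserving.map_eq] at this
        exact this.symm
      have e3 : ∫ x, birkhoffMax T g n x ∂P = ∫ x, max 0 (birkhoffMax T g n x) ∂P
          - ∫ x, max (-birkhoffMax T g n x) 0 ∂P := by
        rw [← integral_sub (hpos n) (hnegp n)]
        refine integral_congr_ae (Eventually.of_forall fun x => ?_)
        simp only
        rcases le_total 0 (birkhoffMax T g n x) with h | h
        · rw [max_eq_right h, max_eq_right (neg_nonpos.2 h), sub_zero]
        · rw [max_eq_left h, max_eq_left (neg_nonneg.2 h)]; ring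
      linarith
    have hlim : Tendsto (fun n => ∫ x, max (-birkhoffMax T g n x) 0 ∂P) atTop (𝓝 (∫ _, 0 ∂P)) := by
      refine tendsto_integral_of_dominated_convergence (fun x => |g x|)
        (fun n => (hnegp n).aestronglyMeasurable) hg.abs (fun n => ?_) ?_
      · refine Eventually.of_forall fun x => ?_
        rw [Real.norm_of_nonneg (le_max_right _ _)]
        refine max_le ?_ (abs_nonneg _)
        have : g x ≤ birkhoffMax T g n x := birkhoffMax_mono x (Nat.zero_le n)
        exact (neg_le_neg this).trans (neg_le_abs _)
      · filter_upwards [hae] with x hx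
        obtain ⟨n, hn⟩ := hx 0
        refine tendsto_const_nhds.congr' ?_
        filter_upwards [eventually_ge_atTop n] with k hk
        have : birkhoffMax T g n x ≤ birkhoffMax T g k x := birkhoffMax_mono x hk
        rw [max_eq_right]
        simp only [Nat.cast_zero] at hn
        linarith
    simp only [integral_zero] at hlim
    have := ge_of_tendsto (hlim.const_add (∫ x, g x ∂P)) (Eventually.of_forall key)
    linarith

theorem ae_eventually_birkhoffSum_le [IsProbabilityMeasure P] (hT : Ergodic T P)
    (hgm : Measurable g) (hg : Integrable g P) :
    ∀ᵐ x ∂P, ∀ δ > 0, ∀ᶠ n : ℕ in atTop, birkhoffSum T g n x ≤ n * (∫ x, g x ∂P + δ) := by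
  have h : ∀ k : ℕ, ∀ᵐ x ∂P, ∃ C, ∀ n,
      birkhoffSum T (fun x => g x - (∫ x, g x ∂P + 1 / ((k : ℝ) + 1))) n x ≤ C := by
    intro k
    refine ae_bddAbove_birkhoffSum hT (hgm.sub measurable_const)
      (hg.sub (integrable_const _)) ?_
    rw [integral_sub hg (integrable_const _)]
    simp only [integral_const, probReal_univ, one_smul]
    have : (0 : ℝ) < 1 / ((k : ℝ) + 1) := by positivity
    linarith
  filter_upwards [ae_all_iff.2 h] with x hx δ hδ
  obtain ⟨k, hk⟩ := exists_nat_one_div_lt (half_pos hδ)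
  obtain ⟨C, hC⟩ := hx k
  obtain ⟨N, hN⟩ := exists_nat_gt (C / (δ / 2))
  filter_upwards [eventually_ge_atTop N] with n hn
  have h1 := hC n
  have h2 : birkhoffSum T (fun x => g x - (∫ x, g x ∂P + 1 / ((k : ℝ) + 1))) n x
      = birkhoffSum T g n x - n * (∫ x, g x ∂P + 1 / ((k : ℝ) + 1)) := by
    simp only [birkhoffSum, Finset.sum_sub_distrib, Finset.sum_const, Finset.card_range,
      nsmul_eq_mul]
  rw [h2] at h1
  have h3 : C < n * (δ / 2) := by
    have : (N : ℝ) ≤ n := by exact_mod_cast hn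
    rw [div_lt_iff₀ (by positivity)] at hN
    nlinarith
  have h4 : (n : ℝ) * (1 / ((k : ℝ) + 1)) ≤ n * (δ / 2) := by gcongr
  nlinarith

/-- Birkhoff's pointwise ergodic theorem for an ergodic map and an integrable function. -/
theorem ae_tendsto_birkhoffSum_div [IsProbabilityMeasure P] (hT : Ergodic T P)
    (hgm : Measurable g) (hg : Integrable g P) :
    ∀ᵐ x ∂P, Tendsto (fun n : ℕ => birkhoffSum T g n x / n) atTop (𝓝 (∫ x, g x ∂P)) := by
  filter_upwards [ae_eventually_birkhoffSum_le hT hgm hg,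
    ae_eventually_birkhoffSum_le hT hgm.neg hg.neg] with x h1 h2
  rw [Metric.tendsto_atTop']
  intro δ hδ
  have := (h1 (δ / 2) (half_pos hδ)).and ((h2 (δ / 2) (half_pos hδ)).and (eventually_gt_atTop 0))
  obtain ⟨N, hN⟩ := eventually_atTop.1 this
  refine ⟨N, fun n hn => ?_⟩
  obtain ⟨a, b, c⟩ := hN n hn.le
  have hn0 : (0 : ℝ) < n := by exact_mod_cast c
  simp only [Pi.neg_apply, integral_neg] at b
  have hb : birkhoffSum T (-g) n x = - birkhoffSum T g n x := by
    simp [birkhoffSum]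
  rw [hb] at b
  rw [Real.dist_eq, abs_lt]
  constructor
  · rw [neg_lt_sub_iff_lt_add, ← sub_lt_iff_lt_add', lt_div_iff₀ hn0]
    nlinarith
  · rw [sub_lt_iff_lt_add, div_lt_iff₀ hn0]
    nlinarith

end Birkhoff

/-! ### Ergodicity of the Bernoulli shift -/

section Mixing

variable {α : Type*} [MeasurableSpace α]

/-- Convergence of dominated measures on a generating `π`-system extends to all measurable sets. -/
theorem tendsto_measureReal_of_piSystem {P ρ : Measure α} {ρn : ℕ → Measure α}
    [IsFiniteMeasure P] (hn : ∀ n, ρn n ≤ P) (h : ρ ≤ P) {s : Set (Set α)}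
    (hs : ‹MeasurableSpace α› = MeasurableSpace.generateFrom s) (hpi : IsPiSystem s)
    (huniv : Tendsto (fun n => (ρn n).real Set.univ) atTop (𝓝 (ρ.real Set.univ)))
    (hconv : ∀ t ∈ s, Tendsto (fun n => (ρn n).real t) atTop (𝓝 (ρ.real t)))
    {t : Set α} (ht : MeasurableSet t) :
    Tendsto (fun n => (ρn n).real t) atTop (𝓝 (ρ.real t)) := by
  have : IsFiniteMeasure ρ := isFiniteMeasure_of_le P h
  have : ∀ n, IsFiniteMeasure (ρn n) := fun n => isFiniteMeasure_of_le P (hn n)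
  induction t, ht using MeasurableSpace.induction_on_inter hs hpi with
  | empty => simp
  | basic t ht => exact hconv t ht
  | compl t htm ih =>
    have e : ∀ (ν : Measure α) [IsFiniteMeasure ν], ν.real tᶜ = ν.real Set.univ - ν.real t :=
      fun ν _ => by rw [measureReal_compl htm]
    simp only [e]
    exact huniv.sub ih
  | iUnion f hd hfm ih =>
    have e : ∀ (ν : Measure α) [IsFiniteMeasure ν], ν.real (⋃ i, f i) = ∑' i, ν.real (f i) := by
      intro ν _
      simp only [Measure.real]
      rw [measure_iUnion hd hfm, ENNReal.tsum_toReal_eq fun i => measure_ne_top _ _]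
    simp only [e]
    refine tendsto_tsum_of_dominated_convergence (bound := fun i => P.real (f i)) ?_ ih ?_
    · simp only [Measure.real]
      refine ENNReal.summable_toReal ?_
      rw [← measure_iUnion hd hfm]
      exact measure_ne_top _ _
    · refine Eventually.of_forall fun n i => ?_
      rw [Real.norm_of_nonneg measureReal_nonneg]
      exact ENNReal.toReal_mono (measure_ne_top _ _) (hn n _)

/-- The shift of two-sided sequences. -/
def zshift (x : ℤ → ℝ) : ℤ → ℝ := fun s => x (s + 1)

theorem measurable_zshift : Measurable zshift :=
  measurable_pi_lambda _ fun _ => measurable_pi_apply _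

theorem zshift_iterate (n : ℕ) (x : ℤ → ℝ) : zshift^[n] x = fun s => x (s + n) := by
  induction n generalizing x with
  | zero => simp
  | succ n ih =>
    rw [Function.iterate_succ_apply, ih]
    funext s
    simp only [zshift]
    congr 1
    push_cast; ring

variable (ν : Measure ℝ) [IsProbabilityMeasure ν]

theorem measurePreserving_zshift :
    MeasurePreserving zshift (Measure.infinitePi fun _ : ℤ => ν)
      (Measure.infinitePi fun _ : ℤ => ν) :=
  ⟨measurable_zshift, Measure.map_infinitePi_infinitePi_of_inj (P := fun _ : ℤ => ν)
    (f := fun s : ℤ => s + 1) (add_left_injective 1)⟩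

theorem measureReal_inter_preimage_zshift_of_boxes (s s' : Finset ℤ) (t t' : ℤ → Set ℝ)
    (ht : ∀ i, MeasurableSet (t i)) (ht' : ∀ i, MeasurableSet (t' i)) :
    ∀ᶠ n : ℕ in atTop, (Measure.infinitePi fun _ : ℤ => ν).real
      ((s : Set ℤ).pi t ∩ zshift^[n] ⁻¹' (s' : Set ℤ).pi t')
      = (Measure.infinitePi fun _ : ℤ => ν).real ((s : Set ℤ).pi t)
        * (Measure.infinitePi fun _ : ℤ => ν).real ((s' : Set ℤ).pi t') := by
  classical
  obtain ⟨a, ha⟩ := s.bddAbove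
  obtain ⟨b, hb⟩ := s'.bddBelow
  filter_upwards [eventually_gt_atTop (a - b).toNat] with n hn
  have hdisj : Disjoint s (s'.image fun i => i + n) := by
    rw [Finset.disjoint_left]
    intro i hi hi'
    obtain ⟨j, hj, rfl⟩ := Finset.mem_image.1 hi'
    have h1 := ha hi
    have h2 := hb hj
    have : (a - b) < n := by omega
    omega
  -- the shifted box restricts other coordinates, so the intersection is a box as well
  have hset : (s : Set ℤ).pi t ∩ zshift^[n] ⁻¹' (s' : Set ℤ).pi t'
      = ((s ∪ s'.image fun i => i + n : Finset ℤ) : Set ℤ).pi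
        (fun i => if i ∈ s then t i else t' (i - n)) := by
    ext x
    simp only [Set.mem_inter_iff, Set.mem_preimage, Set.mem_pi, Finset.mem_coe, zshift_iterate,
      Finset.mem_union, Finset.mem_image]
    constructor
    · rintro ⟨h1, h2⟩ i hi
      by_cases his : i ∈ s
      · simp [his, h1 i his]
      · rcases hi with hi | ⟨j, hj, rfl⟩
        · exact absurd hi his
        · simp [his, h2 j hj]
    · intro h
      refine ⟨fun i hi => by simpa [hi] using h i (Or.inl hi), fun j hj => ?_⟩
      have := h (j + n) (Or.inr ⟨j, hj, rfl⟩)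
      have hns : j + (n : ℤ) ∉ s := fun hmem =>
        Finset.disjoint_left.1 hdisj hmem (Finset.mem_image_of_mem _ hj)
      simpa [hns] using this
  have hm : ∀ i, MeasurableSet (if i ∈ s then t i else t' (i - n)) := by
    intro i; split_ifs
    · exact ht i
    · exact ht' _
  simp only [Measure.real]
  rw [hset, Measure.infinitePi_pi _ (fun i _ => hm i), Measure.infinitePi_pi _ (fun i _ => ht i),
    Measure.infinitePi_pi _ (fun i _ => ht' i), Finset.prod_union hdisj, ← ENNReal.toReal_mul]
  congr 2
  · exact Finset.prod_congr rfl fun i hi => by simp [hi]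
  · rw [Finset.prod_image (fun i _ j _ h => by simpa using h)]
    refine Finset.prod_congr rfl fun j hj => ?_
    have hns : j + (n : ℤ) ∉ s := fun hmem =>
      Finset.disjoint_left.1 hdisj hmem (Finset.mem_image_of_mem _ hj)
    simp [hns]

/-- The Bernoulli shift is mixing. -/
theorem tendsto_measureReal_inter_preimage_zshift {B C : Set (ℤ → ℝ)} (hB : MeasurableSet B)
    (hC : MeasurableSet C) :
    Tendsto (fun n : ℕ => (Measure.infinitePi fun _ : ℤ => ν).real (B ∩ zshift^[n] ⁻¹' C)) atTop
      (𝓝 ((Measure.infinitePi fun _ : ℤ => ν).real B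
        * (Measure.infinitePi fun _ : ℤ => ν).real C)) := by
  set P := Measure.infinitePi fun _ : ℤ => ν with hP
  set s := squareCylinders fun _ : ℤ => {s : Set ℝ | MeasurableSet s} with hs
  have hgen : (inferInstance : MeasurableSpace (ℤ → ℝ)) = MeasurableSpace.generateFrom s :=
    generateFrom_squareCylinders.symm
  have hpi : IsPiSystem s := isPiSystem_squareCylinders
    (fun _ => MeasurableSpace.isPiSystem_measurableSet)
    (fun _ => by simp)
  have hTn : ∀ n : ℕ, MeasurePreserving (zshift^[n]) P P := fun n =>
    (measurePreserving_zshift ν).iterate n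
  have hscale : ∀ D : Set (ℤ → ℝ), (P D • P) ≤ P := by
    intro D S
    simp only [Measure.smul_apply, smul_eq_mul]
    calc P D * P S ≤ 1 * P S := by gcongr; exact prob_le_one
      _ = P S := one_mul _
  have hreal : ∀ D S : Set (ℤ → ℝ), (P D • P).real S = P.real D * P.real S := by
    intro D S
    simp [Measure.real, ENNReal.toReal_mul]
  have step : ∀ D ∈ s, ∀ S, MeasurableSet S →
      Tendsto (fun n : ℕ => P.real (S ∩ zshift^[n] ⁻¹' D)) atTop (𝓝 (P.real S * P.real D)) := by
    rintro D ⟨sD, tD, htD, rfl⟩ S hS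
    have hDm : MeasurableSet ((sD : Set ℤ).pi tD) :=
      MeasurableSet.pi sD.countable_toSet fun i _ => htD i trivial
    have hpre : ∀ n : ℕ, MeasurableSet (zshift^[n] ⁻¹' (sD : Set ℤ).pi tD) := fun n =>
      (hTn n).measurable hDm
    have e : ∀ (n : ℕ) (S : Set (ℤ → ℝ)), MeasurableSet S →
        P.real (S ∩ zshift^[n] ⁻¹' (sD : Set ℤ).pi tD)
        = (P.restrict (zshift^[n] ⁻¹' (sD : Set ℤ).pi tD)).real S := by
      intro n S hS
      simp only [Measure.real]
      rw [Measure.restrict_apply hS]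
    have := tendsto_measureReal_of_piSystem (P := P) (ρ := P ((sD : Set ℤ).pi tD) • P)
      (ρn := fun n : ℕ => P.restrict (zshift^[n] ⁻¹' (sD : Set ℤ).pi tD))
      (fun n => Measure.restrict_le_self) (hscale _) hgen hpi ?_ ?_ hS
    · simp only [← e _ S hS, hreal] at this
      rwa [mul_comm]
    · simp only [← e _ _ MeasurableSet.univ, hreal, Set.univ_inter]
      simp only [probReal_univ, mul_one]
      refine tendsto_const_nhds.congr fun n => ?_
      simp only [Measure.real]
      rw [(hTn n).measure_preimage hDm.nullMeasurableSet]
    · rintro _ ⟨sS, tS, htS, rfl⟩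
      have hSm : MeasurableSet ((sS : Set ℤ).pi tS) :=
        MeasurableSet.pi sS.countable_toSet fun i _ => htS i trivial
      simp only [← e _ _ hSm, hreal]
      refine tendsto_const_nhds.congr' ?_
      filter_upwards [measureReal_inter_preimage_zshift_of_boxes ν sS sD tS tD
        (fun i => htS i trivial) (fun i => htD i trivial)] with n hn
      rw [hn, mul_comm]
  have e : ∀ (n : ℕ) (S : Set (ℤ → ℝ)), MeasurableSet S →
      P.real (B ∩ zshift^[n] ⁻¹' S) = ((P.restrict B).map (zshift^[n])).real S := by
    intro n S hS
    simp only [Measure.real]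
    rw [Measure.map_apply (hTn n).measurable hS,
      Measure.restrict_apply ((hTn n).measurable hS), Set.inter_comm]
  have := tendsto_measureReal_of_piSystem (P := P) (ρ := P B • P)
      (ρn := fun n : ℕ => (P.restrict B).map (zshift^[n])) ?_ (hscale _) hgen hpi ?_ ?_ hC
  · simpa only [← e _ C hC, hreal] using this
  · intro n
    refine (Measure.map_mono Measure.restrict_le_self (hTn n).measurable).trans ?_
    rw [(hTn n).map_eq]
  · simp only [← e _ _ MeasurableSet.univ, hreal]
    simp
  · rintro D hD
    have hDm : MeasurableSet D := by
      obtain ⟨sD, tD, htD, rfl⟩ := hD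
      exact MeasurableSet.pi sD.countable_toSet fun i _ => htD i trivial
    simp only [← e _ _ hDm, hreal]
    exact step D hD B hB

theorem ergodic_zshift : Ergodic zshift (Measure.infinitePi fun _ : ℤ => ν) := by
  refine ⟨measurePreserving_zshift ν, ⟨fun {A} hA hinv => ?_⟩⟩
  set P := Measure.infinitePi fun _ : ℤ => ν
  have hit : ∀ n : ℕ, zshift^[n] ⁻¹' A = A := by
    intro n
    rw [Set.preimage_iterate_eq]
    exact Function.iterate_fixed hinv n
  have := tendsto_measureReal_inter_preimage_zshift ν hA hA
  simp only [hit, Set.inter_self] at this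
  have h : P.real A = P.real A * P.real A := tendsto_nhds_unique tendsto_const_nhds this
  rw [eventuallyConst_set']
  have h' : P.real A = 0 ∨ P.real A = 1 := by
    rcases eq_or_ne (P.real A) 0 with h0 | h0
    · exact Or.inl h0
    · exact Or.inr (mul_left_cancel₀ h0 (by linarith))
  rcases h' with h0 | h1
  · left
    rw [measureReal_eq_zero_iff] at h0
    exact ae_eq_empty.2 h0
  · right
    rw [ae_eq_univ]
    rw [prob_compl_eq_zero_iff hA]
    have : (P A).toReal = 1 := h1
    rwa [ENNReal.toReal_eq_one_iff] at this

end Mixing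

/-! ### Functionals of the innovations -/

section Innovations

variable {Ω : Type*} [MeasurableSpace Ω] {μ : Measure Ω} {ξ : ℤ → Ω → ℝ}

/-- The innovations `(ξ_t, ξ_{t-1}, …)` up to time `t`, most recent first. -/
def innovPast (ξ : ℤ → Ω → ℝ) (t : ℤ) (ω : Ω) : ℕ → ℝ := fun i => ξ (t - i) ω

/-- The law of `(ξ_t, ξ_{t-1}, …)`. -/
def innovLaw (μ : Measure Ω) (ξ : ℤ → Ω → ℝ) : Measure (ℕ → ℝ) :=
  Measure.infinitePi fun _ : ℕ => μ.map (ξ 0)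

/-- The map that forgets the most recent innovations: `(σ_k e)_i = e_{i + k}`. -/
def dropFirst (k : ℕ) (e : ℕ → ℝ) : ℕ → ℝ := fun i => e (i + k)

theorem measurable_dropFirst (k : ℕ) : Measurable (dropFirst k) :=
  measurable_pi_lambda _ fun _ => measurable_pi_apply _

@[simp] theorem dropFirst_dropFirst (j k : ℕ) (e : ℕ → ℝ) :
    dropFirst j (dropFirst k e) = dropFirst (j + k) e := by
  funext i; simp [dropFirst, add_assoc]

@[simp] theorem dropFirst_zero (e : ℕ → ℝ) : dropFirst 0 e = e := rfl

theorem dropFirst_innovPast (k : ℕ) (t : ℤ) (ω : Ω) :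
    dropFirst k (innovPast ξ t ω) = innovPast ξ (t - k) ω := by
  funext i
  simp only [dropFirst, innovPast]
  congr 1
  push_cast; ring

variable [IsProbabilityMeasure μ]

theorem IsInnovation.isProbabilityMeasure_map (hξ : IsInnovation μ ξ) :
    IsProbabilityMeasure (μ.map (ξ 0)) :=
  Measure.isProbabilityMeasure_map (hξ.measurable 0).aemeasurable

theorem IsInnovation.isProbabilityMeasure_innovLaw (hξ : IsInnovation μ ξ) :
    IsProbabilityMeasure (innovLaw μ ξ) := by
  have := hξ.isProbabilityMeasure_map
  unfold innovLaw; infer_instance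

theorem IsInnovation.map_path (hξ : IsInnovation μ ξ) :
    μ.map (fun ω s => ξ s ω) = Measure.infinitePi fun _ : ℤ => μ.map (ξ 0) := by
  rw [(iIndepFun_iff_map_fun_eq_infinitePi_map hξ.measurable).1 hξ.indep]
  congr 1
  funext s
  exact (hξ.ident s).map_eq

theorem measurable_innovPast (hξ : IsInnovation μ ξ) (t : ℤ) : Measurable (innovPast ξ t) :=
  measurable_pi_lambda _ fun _ => hξ.measurable _

theorem IsInnovation.measurePreserving_innovPast (hξ : IsInnovation μ ξ) (t : ℤ) :
    MeasurePreserving (innovPast ξ t) μ (innovLaw μ ξ) := by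
  have := hξ.isProbabilityMeasure_map
  refine ⟨measurable_innovPast hξ t, ?_⟩
  have h1 := Measure.map_infinitePi_infinitePi_of_inj (P := fun _ : ℤ => μ.map (ξ 0))
    (f := fun i : ℕ => t - (i : ℤ)) (fun i j h => by simpa using h)
  rw [← hξ.map_path, Measure.map_map (measurable_pi_lambda _ fun _ => measurable_pi_apply _)
    (measurable_pi_lambda _ fun s => hξ.measurable s)] at h1
  exact h1

theorem IsInnovation.measurePreserving_dropFirst (hξ : IsInnovation μ ξ) (k : ℕ) :
    MeasurePreserving (dropFirst k) (innovLaw μ ξ) (innovLaw μ ξ) := by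
  have := hξ.isProbabilityMeasure_map
  exact ⟨measurable_dropFirst k, Measure.map_infinitePi_infinitePi_of_inj
    (P := fun _ : ℕ => μ.map (ξ 0)) (f := fun i : ℕ => i + k) (add_left_injective k)⟩

/-- The most recent innovation and the earlier ones are independent, with the expected laws. -/
theorem IsInnovation.measurePreserving_head_tail (hξ : IsInnovation μ ξ) :
    MeasurePreserving (fun e : ℕ → ℝ => (e 0, dropFirst 1 e)) (innovLaw μ ξ)
      ((μ.map (ξ 0)).prod (innovLaw μ ξ)) := by
  have := hξ.isProbabilityMeasure_map
  have := hξ.isProbabilityMeasure_innovLaw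
  refine ⟨(measurable_pi_apply 0).prodMk (measurable_dropFirst 1), ?_⟩
  -- the inverse map sends the product law to the law of the sequence
  set c : ℝ × (ℕ → ℝ) → (ℕ → ℝ) := fun p i => Nat.casesOn i p.1 p.2 with hc
  have hcm : Measurable c := by
    refine measurable_pi_lambda _ fun i => ?_
    rcases i with _ | i
    · exact measurable_fst
    · exact (measurable_pi_apply i).comp measurable_snd
  have key : ((μ.map (ξ 0)).prod (innovLaw μ ξ)).map c = innovLaw μ ξ := by
    refine Measure.eq_infinitePi _ fun s t ht => ?_
    classical
    rw [Measure.map_apply hcm (MeasurableSet.pi s.countable_toSet fun i _ => ht i)]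
    set s' : Finset ℕ := (s.erase 0).image Nat.pred with hs'
    have hpre : c ⁻¹' (s : Set ℕ).pi t
        = (if 0 ∈ s then t 0 else Set.univ) ×ˢ (s' : Set ℕ).pi (fun i => t (i + 1)) := by
      ext ⟨a, b⟩
      simp only [hc, Set.mem_preimage, Set.mem_pi, Finset.mem_coe, Set.mem_prod, hs',
        Finset.mem_image, Finset.mem_erase]
      constructor
      · intro h
        refine ⟨?_, ?_⟩
        · split_ifs with h0
          · exact h 0 h0
          · trivial
        · rintro i ⟨j, ⟨hj, hjs⟩, rfl⟩
          obtain ⟨j, rfl⟩ := Nat.exists_eq_succ_of_ne_zero hj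
          exact h _ hjs
      · rintro ⟨h0, h1⟩ i hi
        rcases i with _ | i
        · simpa [hi] using h0
        · exact h1 i ⟨i + 1, ⟨by simp, hi⟩, rfl⟩
    rw [hpre, Measure.prod_prod]
    unfold innovLaw
    rw [Measure.infinitePi_pi _ (fun i _ => ht (i + 1)), hs', Finset.prod_image]
    · have e2 : ∏ x ∈ s.erase 0, (μ.map (ξ 0)) (t (Nat.pred x + 1))
          = ∏ x ∈ s.erase 0, (μ.map (ξ 0)) (t x) := by
        refine Finset.prod_congr rfl fun i hi => ?_
        rw [Nat.pred_eq_sub_one, Nat.sub_add_cancel]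
        exact Nat.one_le_iff_ne_zero.2 (Finset.ne_of_mem_erase hi)
      rw [e2]
      split_ifs with h0
      · rw [Finset.mul_prod_erase s (fun i => (μ.map (ξ 0)) (t i)) h0]
      · rw [Finset.erase_eq_of_notMem h0]; simp
    · intro i hi j hj hij
      have h1 := Finset.ne_of_mem_erase hi
      have h2 := Finset.ne_of_mem_erase hj
      simp only [Nat.pred_eq_sub_one] at hij
      omega
  conv_lhs => rw [← key]
  rw [Measure.map_map ((measurable_pi_apply 0).prodMk (measurable_dropFirst 1)) hcm]
  have hid : (fun a : ℕ → ℝ => (a 0, dropFirst 1 a)) ∘ c = id := rfl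
  rw [hid, Measure.map_id]

/-- The strong law of large numbers for integrable functionals of the innovations. -/
theorem IsInnovation.ae_tendsto_average (hξ : IsInnovation μ ξ) {φ : (ℕ → ℝ) → ℝ}
    (hφm : Measurable φ) (hφ : Integrable φ (innovLaw μ ξ)) :
    ∀ᵐ ω ∂μ, Tendsto (fun n : ℕ => (∑ t ∈ Finset.Icc 1 n, φ (innovPast ξ t ω)) / n) atTop
      (𝓝 (∫ e, φ e ∂(innovLaw μ ξ))) := by
  have := hξ.isProbabilityMeasure_map
  set π : (ℤ → ℝ) → (ℕ → ℝ) := fun x i => x (1 - (i : ℤ)) with hπ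
  have hπm : Measurable π := measurable_pi_lambda _ fun _ => measurable_pi_apply _
  have hπp : MeasurePreserving π (Measure.infinitePi fun _ : ℤ => μ.map (ξ 0)) (innovLaw μ ξ) :=
    ⟨hπm, Measure.map_infinitePi_infinitePi_of_inj (P := fun _ : ℤ => μ.map (ξ 0))
      (f := fun i : ℕ => 1 - (i : ℤ)) (fun i j h => by simpa using h)⟩
  have h := ae_tendsto_birkhoffSum_div (ergodic_zshift (μ.map (ξ 0))) (hφm.comp hπm)
    (hπp.integrable_comp_of_integrable hφ)
  have hint : ∫ x, (φ ∘ π) x ∂(Measure.infinitePi fun _ : ℤ => μ.map (ξ 0))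
      = ∫ e, φ e ∂(innovLaw μ ξ) := by
    rw [← hπp.map_eq, integral_map hπm.aemeasurable hφm.aestronglyMeasurable]
    rfl
  rw [hint, ← hξ.map_path] at h
  have h' := ae_of_ae_map (measurable_pi_lambda _ fun s => hξ.measurable s).aemeasurable h
  filter_upwards [h'] with ω hω
  refine hω.congr fun n => ?_
  congr 1
  have hI : Finset.Icc 1 n = Finset.Ico (0 + 1) (n + 1) := by ext; simp
  rw [birkhoffSum, Finset.range_eq_Ico, hI,
    ← Finset.sum_Ico_add' (fun t : ℕ => φ (innovPast ξ t ω)) 0 n 1]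
  refine Finset.sum_congr rfl fun t _ => ?_
  simp only [Function.comp_apply, zshift_iterate, hπ]
  congr 1
  funext i
  simp only [innovPast]
  congr 1
  push_cast; ring

end Innovations

end

/-! ### Linear operators on functionals of the innovations -/

section

section Lp

variable {α : Type*} [MeasurableSpace α] {P : Measure α} {p : ℝ}

/-- The `L^p` norm of a function with values in `[0, ∞]`. -/
def lpn (P : Measure α) (p : ℝ) (g : α → ℝ≥0∞) : ℝ≥0∞ := (∫⁻ x, g x ^ p ∂P) ^ (1 / p)

theorem lpn_mono (hp : 1 ≤ p) {f g : α → ℝ≥0∞} (h : ∀ x, f x ≤ g x) : lpn P p f ≤ lpn P p g := by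
  unfold lpn
  have : 0 ≤ p := by linarith
  gcongr with x
  exact h x

theorem lpn_const_mul (hp : 1 ≤ p) (c : ℝ≥0∞) {g : α → ℝ≥0∞} (hg : Measurable g) :
    lpn P p (fun x => c * g x) = c * lpn P p g := by
  have hp0 : 0 < p := by linarith
  unfold lpn
  simp_rw [ENNReal.mul_rpow_of_nonneg _ _ hp0.le]
  rw [lintegral_const_mul _ (hg.pow_const p), ENNReal.mul_rpow_of_nonneg _ _ (by positivity),
    ← ENNReal.rpow_mul, mul_one_div_cancel hp0.ne', ENNReal.rpow_one]

theorem lpn_add_le (hp : 1 ≤ p) {f g : α → ℝ≥0∞} (hf : Measurable f) (hg : Measurable g) :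
    lpn P p (fun x => f x + g x) ≤ lpn P p f + lpn P p g :=
  ENNReal.lintegral_Lp_add_le hf.aemeasurable hg.aemeasurable hp

theorem lpn_zero (hp : 1 ≤ p) : lpn P p (fun _ => 0) = 0 := by
  have hp0 : 0 < p := by linarith
  simp [lpn, hp0]

/-- Minkowski's inequality for countable sums. -/
theorem lpn_tsum_le (hp : 1 ≤ p) {f : ℕ → α → ℝ≥0∞} (hf : ∀ k, Measurable (f k)) :
    lpn P p (fun x => ∑' k, f k x) ≤ ∑' k, lpn P p (f k) := by
  have hp0 : 0 < p := by linarith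
  have hfin : ∀ n, lpn P p (fun x => ∑ k ∈ Finset.range n, f k x)
      ≤ ∑ k ∈ Finset.range n, lpn P p (f k) := by
    intro n
    induction n with
    | zero => simp [lpn_zero hp]
    | succ n ih =>
      simp_rw [Finset.sum_range_succ]
      exact (lpn_add_le hp (Finset.measurable_sum _ fun k _ => hf k) (hf n)).trans (by gcongr)
  have hsup : ∀ x, (∑' k, f k x) ^ p = ⨆ n, (∑ k ∈ Finset.range n, f k x) ^ p := by
    intro x
    rw [ENNReal.tsum_eq_iSup_nat]
    exact (ENNReal.orderIsoRpow p hp0).map_iSup _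
  have hbound : ∫⁻ x, (∑' k, f k x) ^ p ∂P ≤ (∑' k, lpn P p (f k)) ^ p := by
    simp_rw [hsup]
    rw [lintegral_iSup]
    · refine iSup_le fun n => ?_
      have h1 := (hfin n).trans (ENNReal.sum_le_tsum (Finset.range n))
      rw [lpn, one_div, ENNReal.rpow_inv_le_iff hp0] at h1
      exact h1
    · exact fun n => (Finset.measurable_sum _ fun k _ => hf k).pow_const p
    · intro m n hmn x
      simp only
      gcongr
  calc lpn P p (fun x => ∑' k, f k x) ≤ ((∑' k, lpn P p (f k)) ^ p) ^ (1 / p) :=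
        ENNReal.rpow_le_rpow hbound (by positivity)
    _ = _ := by rw [← ENNReal.rpow_mul, mul_one_div_cancel hp0.ne', ENNReal.rpow_one]

theorem lpn_comp {β : Type*} [MeasurableSpace β] {Q : Measure β} {T : α → β}
    (hT : MeasurePreserving T P Q) {g : β → ℝ≥0∞} (hg : Measurable g) :
    lpn P p (fun x => g (T x)) = lpn Q p g := by
  unfold lpn
  rw [hT.lintegral_comp (f := fun y => g y ^ p) (hg.pow_const p)]

theorem ae_lt_top_of_lpn (hp : 1 ≤ p) {g : α → ℝ≥0∞} (hg : Measurable g) (h : lpn P p g < ∞) :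
    ∀ᵐ x ∂P, g x < ∞ := by
  have hp0 : 0 < p := by linarith
  have h1 : ∫⁻ x, g x ^ p ∂P ≠ ∞ := by
    intro h2
    unfold lpn at h
    rw [h2, ENNReal.top_rpow_of_pos (by positivity)] at h
    exact lt_irrefl _ h
  filter_upwards [ae_lt_top (hg.pow_const p) h1] with x hx
  by_contra h3
  rw [not_lt_top_iff] at h3
  rw [h3, ENNReal.top_rpow_of_pos hp0] at hx
  exact lt_irrefl _ hx

theorem ae_eq_zero_of_lpn (hp : 1 ≤ p) {g : α → ℝ≥0∞} (hg : Measurable g) (h : lpn P p g = 0) :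
    ∀ᵐ x ∂P, g x = 0 := by
  have hp0 : 0 < p := by linarith
  unfold lpn at h
  rw [ENNReal.rpow_eq_zero_iff_of_pos (by positivity), lintegral_eq_zero_iff (hg.pow_const p)] at h
  filter_upwards [h] with x hx
  simpa [ENNReal.rpow_eq_zero_iff_of_pos hp0] using hx

end Lp

section LagOp

variable {Ω : Type*} [MeasurableSpace Ω] {μ : Measure Ω} {ξ : ℤ → Ω → ℝ} {p : ℝ}

/-- `∑_k α_k g_k(e_{k+1}, e_{k+2}, …)`: a linear combination of functionals of the pasts. -/
def lagSum (α : ℕ → ℝ≥0∞) (g : ℕ → (ℕ → ℝ) → ℝ≥0∞) (e : ℕ → ℝ) : ℝ≥0∞ :=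
  ∑' k, α k * g k (dropFirst (k + 1) e)

/-- `∑_k (α_k + s(e_0) β_k) g_k(e_{k+1}, …)`: the operator which dominates one step of an
autoregressive recursion with random Lipschitz coefficients `α_k + s(ξ_t) β_k`. -/
def lagOp (α β : ℕ → ℝ≥0∞) (s : ℝ → ℝ≥0∞) (g : ℕ → (ℕ → ℝ) → ℝ≥0∞) (e : ℕ → ℝ) : ℝ≥0∞ :=
  lagSum α g e + s (e 0) * lagSum β g e

variable {α β : ℕ → ℝ≥0∞} {s : ℝ → ℝ≥0∞}

theorem measurable_lagSum {g : ℕ → (ℕ → ℝ) → ℝ≥0∞} (hg : ∀ k, Measurable (g k)) :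
    Measurable (lagSum α g) :=
  Measurable.tsum fun k => ((hg k).comp (measurable_dropFirst _)).const_mul _

theorem measurable_lagOp (hs : Measurable s) {g : ℕ → (ℕ → ℝ) → ℝ≥0∞}
    (hg : ∀ k, Measurable (g k)) : Measurable (lagOp α β s g) :=
  (measurable_lagSum hg).add ((hs.comp (measurable_pi_apply 0)).mul (measurable_lagSum hg))

theorem lagSum_mono {g g' : ℕ → (ℕ → ℝ) → ℝ≥0∞} (h : ∀ k e, g k e ≤ g' k e) (e : ℕ → ℝ) :
    lagSum α g e ≤ lagSum α g' e :=
  ENNReal.tsum_le_tsum fun k => by gcongr; exact h _ _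

theorem lagOp_mono {g g' : ℕ → (ℕ → ℝ) → ℝ≥0∞} (h : ∀ k e, g k e ≤ g' k e) (e : ℕ → ℝ) :
    lagOp α β s g e ≤ lagOp α β s g' e := by
  unfold lagOp
  gcongr
  · exact lagSum_mono h e
  · exact lagSum_mono h e

theorem lagSum_tsum (g : ℕ → (ℕ → ℝ) → ℝ≥0∞) (e : ℕ → ℝ) :
    lagSum α (fun _ e => ∑' j, g j e) e = ∑' j, lagSum α (fun _ => g j) e := by
  unfold lagSum
  simp_rw [← ENNReal.tsum_mul_left]
  exact ENNReal.tsum_comm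

theorem lagOp_tsum (g : ℕ → (ℕ → ℝ) → ℝ≥0∞) (e : ℕ → ℝ) :
    lagOp α β s (fun _ e => ∑' j, g j e) e = ∑' j, lagOp α β s (fun _ => g j) e := by
  unfold lagOp
  rw [lagSum_tsum, lagSum_tsum, ENNReal.tsum_add, ENNReal.tsum_mul_left]

/-- The mean contraction rate of `lagOp`. -/
def lagRate (P : Measure (ℕ → ℝ)) (p : ℝ) (α β : ℕ → ℝ≥0∞) (s : ℝ → ℝ≥0∞) : ℝ≥0∞ :=
  ∑' k, (α k + lpn P p (fun e => s (e 0)) * β k)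

variable [IsProbabilityMeasure μ]

theorem IsInnovation.lpn_lagSum_le (hξ : IsInnovation μ ξ) (hp : 1 ≤ p)
    {g : ℕ → (ℕ → ℝ) → ℝ≥0∞} (hg : ∀ k, Measurable (g k)) :
    lpn (innovLaw μ ξ) p (lagSum α g) ≤ ∑' k, α k * lpn (innovLaw μ ξ) p (g k) := by
  refine (lpn_tsum_le hp fun k =>
    ((hg k).comp (measurable_dropFirst _)).const_mul _).trans (le_of_eq ?_)
  congr 1
  funext k
  rw [lpn_const_mul hp _ ((hg k).comp (measurable_dropFirst _))]
  congr 1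
  exact lpn_comp (hξ.measurePreserving_dropFirst (k + 1)) (hg k)

theorem IsInnovation.lpn_head_mul_tail (hξ : IsInnovation μ ξ) (hp : 1 ≤ p) (hs : Measurable s)
    {g : (ℕ → ℝ) → ℝ≥0∞} (hg : Measurable g) :
    lpn (innovLaw μ ξ) p (fun e => s (e 0) * g (dropFirst 1 e))
      = lpn (innovLaw μ ξ) p (fun e => s (e 0)) * lpn (innovLaw μ ξ) p g := by
  have hp0 : 0 < p := by linarith
  have := hξ.isProbabilityMeasure_innovLaw
  have := hξ.isProbabilityMeasure_map
  have h1 := lpn_comp (p := p) hξ.measurePreserving_head_tail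
    (g := fun q : ℝ × (ℕ → ℝ) => s q.1 * g q.2)
    ((hs.comp measurable_fst).mul (hg.comp measurable_snd))
  have h2 := lpn_comp (p := p) hξ.measurePreserving_head_tail
    (g := fun q : ℝ × (ℕ → ℝ) => s q.1) (hs.comp measurable_fst)
  simp only at h1 h2
  rw [h1, h2]
  unfold lpn
  simp_rw [ENNReal.mul_rpow_of_nonneg _ _ hp0.le]
  rw [lintegral_prod_mul (f := fun a => s a ^ p) (g := fun b => g b ^ p)
    (hs.pow_const p).aemeasurable (hg.pow_const p).aemeasurable,
    ENNReal.mul_rpow_of_nonneg _ _ (by positivity)]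
  congr 2
  rw [lintegral_prod (fun q : ℝ × (ℕ → ℝ) => s q.1 ^ p)
    ((hs.comp measurable_fst).pow_const p).aemeasurable]
  simp

theorem IsInnovation.lpn_lagOp_le (hξ : IsInnovation μ ξ) (hp : 1 ≤ p) (hs : Measurable s)
    {g : ℕ → (ℕ → ℝ) → ℝ≥0∞} (hg : ∀ k, Measurable (g k)) :
    lpn (innovLaw μ ξ) p (lagOp α β s g) ≤
      ∑' k, (α k + lpn (innovLaw μ ξ) p (fun e => s (e 0)) * β k)
        * lpn (innovLaw μ ξ) p (g k) := by
  have hm := fun γ : ℕ → ℝ≥0∞ => measurable_lagSum (α := γ) hg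
  refine (lpn_add_le hp (hm α) ((hs.comp (measurable_pi_apply 0)).mul (hm β))).trans ?_
  simp_rw [add_mul]
  rw [ENNReal.tsum_add]
  refine add_le_add (hξ.lpn_lagSum_le hp hg) ?_
  -- the sum over the lags is a functional of the tail, so it is independent of `e 0`
  set G : (ℕ → ℝ) → ℝ≥0∞ := fun e => ∑' k, β k * g k (dropFirst k e) with hG
  have hGm : Measurable G :=
    Measurable.tsum fun k => ((hg k).comp (measurable_dropFirst _)).const_mul _
  have e1 : (fun e : ℕ → ℝ => s (e 0) * lagSum β g e) = fun e => s (e 0) * G (dropFirst 1 e) := by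
    funext e
    simp only [lagSum, hG, dropFirst_dropFirst]
  change lpn _ p (fun e : ℕ → ℝ => s (e 0) * lagSum β g e) ≤ _
  rw [e1, hξ.lpn_head_mul_tail hp hs hGm]
  simp_rw [mul_assoc]
  rw [ENNReal.tsum_mul_left]
  gcongr
  refine (lpn_tsum_le hp fun k =>
    ((hg k).comp (measurable_dropFirst _)).const_mul _).trans (le_of_eq ?_)
  congr 1
  funext k
  rw [lpn_const_mul hp _ ((hg k).comp (measurable_dropFirst _))]
  congr 1
  exact lpn_comp (hξ.measurePreserving_dropFirst k) (hg k)

/-- The terms `A^j δ` of the Neumann series of `A = lagOp α β s`. -/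
def lagIter (α β : ℕ → ℝ≥0∞) (s : ℝ → ℝ≥0∞) (δ : (ℕ → ℝ) → ℝ≥0∞) (j : ℕ) : (ℕ → ℝ) → ℝ≥0∞ :=
  (fun g => lagOp α β s fun _ => g)^[j] δ

/-- The Neumann series `U = ∑_j A^j δ`, which solves `U = δ + A U`. -/
def lagSolution (α β : ℕ → ℝ≥0∞) (s : ℝ → ℝ≥0∞) (δ : (ℕ → ℝ) → ℝ≥0∞) (e : ℕ → ℝ) : ℝ≥0∞ :=
  ∑' j, lagIter α β s δ j e

theorem lagIter_succ (δ : (ℕ → ℝ) → ℝ≥0∞) (j : ℕ) :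
    lagIter α β s δ (j + 1) = lagOp α β s fun _ => lagIter α β s δ j :=
  Function.iterate_succ_apply' _ _ _

theorem measurable_lagIter (hs : Measurable s) {δ : (ℕ → ℝ) → ℝ≥0∞} (hδ : Measurable δ) (j : ℕ) :
    Measurable (lagIter α β s δ j) := by
  induction j with
  | zero => exact hδ
  | succ j ih =>
    rw [lagIter_succ]
    exact measurable_lagOp hs fun _ => ih

theorem measurable_lagSolution (hs : Measurable s) {δ : (ℕ → ℝ) → ℝ≥0∞} (hδ : Measurable δ) :
    Measurable (lagSolution α β s δ) :=
  Measurable.tsum fun j => measurable_lagIter hs hδ j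

/-- The remainder of the Neumann series is mapped to the next remainder. -/
theorem lagOp_tail (δ : (ℕ → ℝ) → ℝ≥0∞) (n : ℕ) (e : ℕ → ℝ) :
    lagOp α β s (fun _ e => ∑' j, lagIter α β s δ (j + n) e) e
      = ∑' j, lagIter α β s δ (j + (n + 1)) e := by
  rw [lagOp_tsum (g := fun j => lagIter α β s δ (j + n))]
  congr 1
  funext j
  rw [← lagIter_succ]
  rfl

theorem lagSolution_eq (δ : (ℕ → ℝ) → ℝ≥0∞) (e : ℕ → ℝ) :
    lagSolution α β s δ e = δ e + lagOp α β s (fun _ => lagSolution α β s δ) e := by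
  have h := lagOp_tail (α := α) (β := β) (s := s) δ 0 e
  simp only [add_zero, zero_add] at h
  have h2 : lagOp α β s (fun _ => lagSolution α β s δ) e = ∑' j, lagIter α β s δ (j + 1) e := h
  rw [h2]
  exact tsum_eq_zero_add' ENNReal.summable

theorem IsInnovation.lpn_lagSolution_lt_top (hξ : IsInnovation μ ξ) (hp : 1 ≤ p)
    (hs : Measurable s) (hρ : lagRate (innovLaw μ ξ) p α β s < 1) {δ : (ℕ → ℝ) → ℝ≥0∞}
    (hδ : Measurable δ) (hfin : lpn (innovLaw μ ξ) p δ < ∞) :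
    lpn (innovLaw μ ξ) p (lagSolution α β s δ) < ∞ := by
  set ρ := lagRate (innovLaw μ ξ) p α β s with hρdef
  have hj : ∀ j, lpn (innovLaw μ ξ) p (lagIter α β s δ j) ≤ ρ ^ j * lpn (innovLaw μ ξ) p δ := by
    intro j
    induction j with
    | zero => simp [lagIter]
    | succ j ih =>
      rw [lagIter_succ]
      refine (hξ.lpn_lagOp_le hp hs fun _ => measurable_lagIter hs hδ j).trans ?_
      rw [ENNReal.tsum_mul_right, pow_succ', mul_assoc]
      gcongr
      exact le_of_eq rfl
  calc lpn (innovLaw μ ξ) p (lagSolution α β s δ)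
      ≤ ∑' j, lpn (innovLaw μ ξ) p (lagIter α β s δ j) :=
        lpn_tsum_le hp fun j => measurable_lagIter hs hδ j
    _ ≤ ∑' j, ρ ^ j * lpn (innovLaw μ ξ) p δ := ENNReal.tsum_le_tsum hj
    _ = (1 - ρ)⁻¹ * lpn (innovLaw μ ξ) p δ := by rw [ENNReal.tsum_mul_right, ENNReal.tsum_geometric]
    _ < ∞ := ENNReal.mul_lt_top (by simpa [ENNReal.inv_lt_top] using hρ) hfin

/-- The part of the Neumann series which comes from at least `m` time units ago. It bounds the
distance between two solutions of the same recursion which have been driven by the same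
innovations for `m` time units. -/
def lagForget (α β : ℕ → ℝ≥0∞) (s : ℝ → ℝ≥0∞) (δ : (ℕ → ℝ) → ℝ≥0∞) :
    ℕ → (ℕ → ℝ) → ℝ≥0∞
  | 0 => lagSolution α β s δ
  | m + 1 => fun e => lagOp α β s (fun k => lagForget α β s δ (m - k)) e
  termination_by m => m
  decreasing_by omega

theorem lagForget_zero (δ : (ℕ → ℝ) → ℝ≥0∞) :
    lagForget α β s δ 0 = lagSolution α β s δ := by rw [lagForget]

theorem lagForget_succ (δ : (ℕ → ℝ) → ℝ≥0∞) (m : ℕ) :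
    lagForget α β s δ (m + 1) = lagOp α β s (fun k => lagForget α β s δ (m - k)) := by
  funext e
  rw [lagForget]

theorem measurable_lagForget (hs : Measurable s) {δ : (ℕ → ℝ) → ℝ≥0∞} (hδ : Measurable δ)
    (m : ℕ) : Measurable (lagForget α β s δ m) := by
  induction m using Nat.strong_induction_on with
  | _ m ih =>
    rcases m with _ | m
    · rw [lagForget_zero]; exact measurable_lagSolution hs hδ
    · rw [lagForget_succ]
      exact measurable_lagOp hs fun k => ih _ (by omega)

theorem lagForget_antitone (δ : (ℕ → ℝ) → ℝ≥0∞) (e : ℕ → ℝ) :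
    Antitone fun m => lagForget α β s δ m e := by
  refine antitone_nat_of_succ_le fun m => ?_
  induction m using Nat.strong_induction_on generalizing e with
  | _ m ih =>
    rw [lagForget_succ]
    rcases m with _ | m
    · rw [lagForget_zero, lagSolution_eq]
      simp only [Nat.zero_sub, lagForget_zero]
      exact le_add_self
    · rw [lagForget_succ]
      refine lagOp_mono (fun k e => ?_) e
      rcases Nat.lt_or_ge m k with h | h
      · rw [show m + 1 - k = 0 by omega, show m - k = 0 by omega]
      · rw [show m + 1 - k = (m - k) + 1 by omega]
        exact ih (m - k) (by omega) e

/-- A nonincreasing sequence dominated by a subunit convolution of its own past tends to `0`. -/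
theorem tendsto_zero_of_le_convolution {a γ : ℕ → ℝ≥0∞} (ha : Antitone a) (h0 : a 0 < ∞)
    (hγ : ∑' k, γ k < 1) (h : ∀ m, a (m + 1) ≤ ∑' k, γ k * a (m - k)) :
    Tendsto a atTop (𝓝 0) := by
  set ρ := ∑' k, γ k with hρ
  have hlim := tendsto_atTop_iInf ha
  set L := ⨅ n, a n with hL
  have hLtop : L < ∞ := (iInf_le a 0).trans_lt h0
  -- the lags below `N` see `a` at times after `N`, and the other lags have a small total weight
  have hb : ∀ N, a (2 * N + 1) ≤ ρ * a N + (∑' k, γ (k + N)) * a 0 := by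
    intro N
    refine (h (2 * N)).trans ?_
    have hsplit : ∑' k, γ k * a (2 * N - k) = ∑ k ∈ Finset.range N, γ k * a (2 * N - k)
        + ∑' k, γ (k + N) * a (2 * N - (k + N)) :=
      (ENNReal.summable.sum_add_tsum_nat_add' (f := fun k => γ k * a (2 * N - k))).symm
    rw [hsplit]
    refine add_le_add ?_ ?_
    · calc ∑ k ∈ Finset.range N, γ k * a (2 * N - k) ≤ ∑ k ∈ Finset.range N, γ k * a N := by
            refine Finset.sum_le_sum fun k hk => ?_
            gcongr
            exact ha (by have := Finset.mem_range.1 hk; omega)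
        _ = (∑ k ∈ Finset.range N, γ k) * a N := by rw [Finset.sum_mul]
        _ ≤ ρ * a N := by gcongr; exact ENNReal.sum_le_tsum _
    · rw [← ENNReal.tsum_mul_right]
      refine ENNReal.tsum_le_tsum fun k => ?_
      gcongr
      exact ha (Nat.zero_le _)
  have ht : Tendsto (fun N => ∑' k, γ (k + N)) atTop (𝓝 0) :=
    ENNReal.tendsto_sum_nat_add γ (hγ.trans ENNReal.one_lt_top).ne
  have h1 : Tendsto (fun N => ρ * a N + (∑' k, γ (k + N)) * a 0) atTop (𝓝 (ρ * L + 0 * a 0)) := by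
    refine Tendsto.add (ENNReal.Tendsto.const_mul hlim (Or.inr (hγ.trans ENNReal.one_lt_top).ne)) ?_
    exact ENNReal.Tendsto.mul_const ht (Or.inr h0.ne)
  have h2 : Tendsto (fun N => a (2 * N + 1)) atTop (𝓝 L) :=
    hlim.comp (tendsto_atTop_mono (fun n => by simp only [id]; omega) tendsto_id)
  have h3 : L ≤ ρ * L := by simpa using le_of_tendsto_of_tendsto' h2 h1 hb
  have h4 : L = 0 := by
    by_contra hne
    have : ρ * L < 1 * L := by
      gcongr
      · exact hLtop.ne
    rw [one_mul] at this
    exact absurd h3 (not_le.2 this)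
  rwa [h4] at hlim

theorem IsInnovation.ae_tendsto_lagForget (hξ : IsInnovation μ ξ) (hp : 1 ≤ p)
    (hs : Measurable s) (hρ : lagRate (innovLaw μ ξ) p α β s < 1) {δ : (ℕ → ℝ) → ℝ≥0∞}
    (hδ : Measurable δ) (hfin : lpn (innovLaw μ ξ) p δ < ∞) :
    ∀ᵐ e ∂(innovLaw μ ξ), Tendsto (fun m => lagForget α β s δ m e) atTop (𝓝 0) := by
  have hm := measurable_lagForget (α := α) (β := β) hs hδ
  have h := tendsto_zero_of_le_convolution
    (a := fun m => lpn (innovLaw μ ξ) p (lagForget α β s δ m))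
    (fun m n hmn => lpn_mono hp fun e => lagForget_antitone δ e hmn)
    (by simpa only [lagForget_zero] using hξ.lpn_lagSolution_lt_top hp hs hρ hδ hfin) hρ
    (fun m => by
      simp only [lagForget_succ]
      exact hξ.lpn_lagOp_le hp hs fun k => hm _)
  have hinf : lpn (innovLaw μ ξ) p (fun e => ⨅ m, lagForget α β s δ m e) = 0 := by
    refine le_antisymm (ge_of_tendsto' h fun m => lpn_mono hp fun e => iInf_le _ m) bot_le
  filter_upwards [ae_eq_zero_of_lpn hp (Measurable.iInf hm) hinf] with e he
  rw [← he]
  exact tendsto_atTop_iInf (lagForget_antitone δ e)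

end LagOp

end

/-! ### Contractive recursions with infinite memory -/

section

section Recursion

variable {Ω : Type*} [MeasurableSpace Ω] {μ : Measure Ω} {ξ : ℤ → Ω → ℝ} {p : ℝ}
  {α β : ℕ → ℝ≥0∞} {s : ℝ → ℝ≥0∞}

/-- The recursion `X_t = F(ξ_t; X_{t-1}, X_{t-2}, …)` has the random Lipschitz coefficients
`α_k + s(ξ_t) β_k`. -/
def LagLipschitz (α β : ℕ → ℝ≥0∞) (s : ℝ → ℝ≥0∞) (F : ℝ → (ℕ → ℝ) → ℝ) : Prop :=
  ∀ e x y, edist (F e x) (F e y)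
    ≤ (∑' k, α k * edist (x k) (y k)) + s e * ∑' k, β k * edist (x k) (y k)

/-- Two paths which follow the same recursion after time `k` forget their distance `D` before
time `k`. -/
theorem le_lagForget {D : ℤ → ℝ≥0∞} {ζ : ℤ → ℕ → ℝ} (hζ : ∀ (j : ℕ) t, dropFirst j (ζ t) = ζ (t - j))
    {δ : (ℕ → ℝ) → ℝ≥0∞} {k : ℤ} (hle : ∀ t ≤ k, D t ≤ δ (ζ t))
    (hrec : ∀ t > k, D t ≤ (∑' j : ℕ, α j * D (t - 1 - j))
      + s (ζ t 0) * ∑' j : ℕ, β j * D (t - 1 - j)) (m : ℕ) (t : ℤ) (hm : m = 0 ∨ k + m ≤ t) :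
    D t ≤ lagForget α β s δ m (ζ t) := by
  have hold : ∀ t ≤ k, D t ≤ lagForget α β s δ 0 (ζ t) := by
    intro t ht
    rw [lagForget_zero, lagSolution_eq]
    exact (hle t ht).trans le_self_add
  have main : ∀ (j : ℕ) (m : ℕ), m ≤ j → D (k + j) ≤ lagForget α β s δ m (ζ (k + j)) := by
    intro j
    induction j using Nat.strong_induction_on with
    | _ j ih =>
      intro m hmj
      rcases j with _ | j
      · obtain rfl : m = 0 := by omega
        exact hold _ (by simp)
      -- one step of the recursion: the value at lag `i + 1` has had `m - i` time units to forget
      have hstep : ∀ m, m ≤ j →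
          D (k + (j + 1 : ℕ)) ≤ lagOp α β s (fun i => lagForget α β s δ (m - i)) (ζ (k + (j + 1 : ℕ))) := by
        intro m hmj
        have hterm : ∀ i : ℕ, D (k + (j + 1 : ℕ) - 1 - i)
            ≤ lagForget α β s δ (m - i) (dropFirst (i + 1) (ζ (k + (j + 1 : ℕ)))) := by
          intro i
          have e1 : k + ((j + 1 : ℕ) : ℤ) - ((i + 1 : ℕ) : ℤ) = k + ((j + 1 : ℕ) : ℤ) - 1 - i := by
            push_cast; ring
          rw [hζ, e1]
          rcases Nat.lt_or_ge j i with h | h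
          · rw [show m - i = 0 by omega]
            exact hold _ (by push_cast; omega)
          · have e2 : k + ((j + 1 : ℕ) : ℤ) - 1 - i = k + ((j - i : ℕ) : ℤ) := by
              push_cast [Nat.cast_sub h]; ring
            rw [e2]
            exact ih (j - i) (by omega) (m - i) (by omega)
        refine (hrec _ (by push_cast; omega)).trans ?_
        unfold lagOp lagSum
        gcongr with i i
        · exact hterm i
        · exact hterm i
      rcases m with _ | m
      · rw [lagForget_zero, lagSolution_eq]
        refine (hstep 0 (Nat.zero_le _)).trans ?_
        simp only [Nat.zero_sub, lagForget_zero]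
        exact le_add_self
      · rw [lagForget_succ]
        exact hstep m (by omega)
  rcases le_or_gt t k with h | h
  · have : m = 0 := by
      rcases hm with hm | hm
      · exact hm
      · omega
    subst this
    exact hold t h
  · have e : t = k + ((t - k).toNat : ℤ) := by omega
    rw [e]
    exact main _ m (by omega)

/-- The Picard iterates of the recursion, as functionals of the innovations. -/
def picard (F : ℝ → (ℕ → ℝ) → ℝ) : ℕ → (ℕ → ℝ) → ℝ
  | 0 => fun _ => 0
  | j + 1 => fun e => F (e 0) fun k => picard F j (dropFirst (k + 1) e)

variable {F : ℝ → (ℕ → ℝ) → ℝ}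

theorem measurable_picard (hF : Measurable fun q : ℝ × (ℕ → ℝ) => F q.1 q.2) (j : ℕ) :
    Measurable (picard F j) := by
  induction j with
  | zero => exact measurable_const
  | succ j ih =>
    exact hF.comp ((measurable_pi_apply 0).prodMk
      (measurable_pi_lambda _ fun k => ih.comp (measurable_dropFirst _)))

theorem edist_picard_le (hL : LagLipschitz α β s F) (j : ℕ) (e : ℕ → ℝ) :
    edist (picard F j e) (picard F (j + 1) e)
      ≤ lagIter α β s (fun e => edist 0 (F (e 0) fun _ => 0)) j e := by
  induction j generalizing e with
  | zero => exact le_of_eq rfl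
  | succ j ih =>
    rw [lagIter_succ]
    refine (hL (e 0) _ _).trans ?_
    unfold lagOp lagSum
    gcongr with k k
    · exact ih _
    · exact ih _

variable [IsProbabilityMeasure μ]

/-- Existence of a stationary solution of a contractive recursion, with a moment of order `p`. -/
theorem IsInnovation.exists_stationary (hξ : IsInnovation μ ξ) (hp : 1 ≤ p) (hs : Measurable s)
    (hρ : lagRate (innovLaw μ ξ) p α β s < 1)
    (hF : Measurable fun q : ℝ × (ℕ → ℝ) => F q.1 q.2) (hL : LagLipschitz α β s F)
    (h0 : lpn (innovLaw μ ξ) p (fun e => edist 0 (F (e 0) fun _ => 0)) < ∞) :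
    ∃ H : (ℕ → ℝ) → ℝ, Measurable H ∧ lpn (innovLaw μ ξ) p (fun e => edist 0 (H e)) < ∞ ∧
      ∀ᵐ e ∂(innovLaw μ ξ), H e = F (e 0) fun k => H (dropFirst (k + 1) e) := by
  have hp0 : 0 < p := by linarith
  set δ : (ℕ → ℝ) → ℝ≥0∞ := fun e => edist 0 (F (e 0) fun _ => 0) with hδ
  have hδm : Measurable δ :=
    measurable_const.edist (hF.comp (f := fun e : ℕ → ℝ => (e 0, fun _ => 0))
      ((measurable_pi_apply 0).prodMk measurable_const))
  have hU := hξ.lpn_lagSolution_lt_top hp hs hρ hδm h0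
  have hUm : Measurable (lagSolution α β s δ) := measurable_lagSolution hs hδm
  have hae : ∀ᵐ e ∂(innovLaw μ ξ), ∀ k, lagSolution α β s δ (dropFirst k e) < ∞ :=
    ae_all_iff.2 fun k => (hξ.measurePreserving_dropFirst k).quasiMeasurePreserving.ae
      (ae_lt_top_of_lpn hp hUm hU)
  -- the increments of the Picard iterates are dominated by the terms of the Neumann series
  have hconv : ∀ᵐ e ∂(innovLaw μ ξ), ∃ l, Tendsto (fun j => picard F j e) atTop (𝓝 l) := by
    filter_upwards [hae] with e he
    exact cauchySeq_tendsto_of_complete (cauchySeq_of_edist_le_of_tsum_ne_top _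
      (fun j => edist_picard_le hL j e) (he 0).ne)
  obtain ⟨H, hHm, hH⟩ := measurable_limit_of_tendsto_metrizable_ae
    (fun j => (measurable_picard hF j).aemeasurable) hconv
  have hH' : ∀ᵐ e ∂(innovLaw μ ξ), ∀ k, Tendsto (fun j => picard F j (dropFirst k e)) atTop
      (𝓝 (H (dropFirst k e))) :=
    ae_all_iff.2 fun k => (hξ.measurePreserving_dropFirst k).quasiMeasurePreserving.ae hH
  have htail : ∀ e, (∀ k, Tendsto (fun j => picard F j (dropFirst k e)) atTop
      (𝓝 (H (dropFirst k e)))) → ∀ j k, edist (picard F j (dropFirst k e)) (H (dropFirst k e))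
        ≤ ∑' i, lagIter α β s δ (i + j) (dropFirst k e) := by
    intro e he j k
    have := edist_le_tsum_of_edist_le_of_tendsto _
      (fun j => edist_picard_le hL j (dropFirst k e)) (he k) j
    simpa only [add_comm j] using this
  refine ⟨H, hHm, ?_, ?_⟩
  · refine lt_of_le_of_lt ?_ hU
    unfold lpn
    refine ENNReal.rpow_le_rpow (lintegral_mono_ae ?_) (by positivity)
    filter_upwards [hH'] with e he
    have := htail e he 0 0
    simp only [dropFirst_zero, add_zero, picard] at this
    exact ENNReal.rpow_le_rpow this hp0.le
  · filter_upwards [hae, hH'] with e hfin he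
    have h1 : Tendsto (fun j => picard F (j + 1) e) atTop (𝓝 (H e)) :=
      (tendsto_add_atTop_iff_nat 1).2 (he 0)
    refine tendsto_nhds_unique h1 ?_
    rw [tendsto_iff_edist_tendsto_0]
    have h2 : Tendsto (fun j => ∑' i, lagIter α β s δ (i + (j + 1)) e) atTop (𝓝 0) :=
      (tendsto_add_atTop_iff_nat 1).2 (ENNReal.tendsto_sum_nat_add _ (hfin 0).ne)
    refine tendsto_of_tendsto_of_tendsto_of_le_of_le tendsto_const_nhds h2 (fun _ => bot_le)
      fun j => ?_
    refine (hL (e 0) _ _).trans ?_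
    rw [← lagOp_tail]
    unfold lagOp lagSum
    gcongr with k k
    · exact htail e he j (k + 1)
    · exact htail e he j (k + 1)

end Recursion

end

/-! ### The stationary solution and the loss of memory of the model -/

section

theorem LipschitzWithCoeff.edist_le {d : ℕ} {g : ℝ → ℝ} {Ψ : Family d} {S : Set (Param d)} {i : ℕ}
    {a : ℕ → ℝ} (h : LipschitzWithCoeff g Ψ S i a) {θ : Param d} (hθ : θ ∈ S) (x y : ℕ → ℝ) :
    edist (iteratedFDeriv ℝ i (fun η => Ψ η x) θ) (iteratedFDeriv ℝ i (fun η => Ψ η y) θ)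
      ≤ ∑' k, ENNReal.ofReal (a k) * edist (g (x k)) (g (y k)) := by
  have e1 : ∀ k, ENNReal.ofReal (a k) * edist (g (x k)) (g (y k))
      = ENNReal.ofReal (a k * |g (x k) - g (y k)|) := by
    intro k
    rw [ENNReal.ofReal_mul (h.1 k), edist_dist, Real.dist_eq]
  simp_rw [e1]
  have hnn : ∀ k, 0 ≤ a k * |g (x k) - g (y k)| := fun k => mul_nonneg (h.1 k) (abs_nonneg _)
  by_cases htop : ∑' k, ENNReal.ofReal (a k * |g (x k) - g (y k)|) = ∞
  · rw [htop]; exact le_top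
  have hsum : Summable fun k => a k * |g (x k) - g (y k)| := by
    have := ENNReal.summable_toReal htop
    simpa only [ENNReal.toReal_ofReal (hnn _)] using this
  rw [← ENNReal.ofReal_tsum_of_nonneg hnn hsum, edist_dist, dist_eq_norm]
  exact ENNReal.ofReal_le_ofReal (h.2.2.2 x y hsum θ hθ)

theorem edist_iteratedFDeriv_zero {E : Type*} [NormedAddCommGroup E] [NormedSpace ℝ E]
    (f g : E → ℝ) (x : E) :
    edist (iteratedFDeriv ℝ 0 f x) (iteratedFDeriv ℝ 0 g x) = edist (f x) (g x) := by
  simp only [iteratedFDeriv_zero_eq_comp, Function.comp_apply]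
  exact LinearIsometryEquiv.edist_map _ _ _

theorem LipschitzWithCoeff.edist_le_zero {d : ℕ} {g : ℝ → ℝ} {Ψ : Family d} {S : Set (Param d)}
    {a : ℕ → ℝ} (h : LipschitzWithCoeff g Ψ S 0 a) {θ : Param d} (hθ : θ ∈ S) (x y : ℕ → ℝ) :
    edist (Ψ θ x) (Ψ θ y) ≤ ∑' k, ENNReal.ofReal (a k) * edist (g (x k)) (g (y k)) := by
  have := h.edist_le hθ x y
  rwa [edist_iteratedFDeriv_zero] at this

section

variable {α : Type*} [MeasurableSpace α] {P : Measure α} {p : ℝ}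

theorem lpn_lt_top_iff_memLp (hp : 1 ≤ p) {g : α → ℝ} (hg : Measurable g) :
    lpn P p (fun x => edist 0 (g x)) < ∞ ↔ MemLp g (ENNReal.ofReal p) P := by
  have hp0 : 0 < p := by linarith
  have e : lpn P p (fun x => edist 0 (g x)) = eLpNorm g (ENNReal.ofReal p) P := by
    rw [eLpNorm_eq_lintegral_rpow_enorm_toReal (by simpa using hp0) ENNReal.ofReal_ne_top,
      ENNReal.toReal_ofReal hp0.le]
    simp only [lpn, edist_zero_left, one_div]
    rfl
  rw [e]
  exact ⟨fun h => ⟨hg.aestronglyMeasurable, h⟩, fun h => h.2⟩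

end

/-- A sequence of functions which tends to `0` almost everywhere and is dominated by its first
term, a function of `L^q`. -/
structure IsVanishing {α : Type*} [MeasurableSpace α] (P : Measure α) (q : ℝ≥0∞)
    (r : ℕ → α → ℝ) : Prop where
  measurable : ∀ m, Measurable (r m)
  nonneg : ∀ m x, 0 ≤ r m x
  le_zero : ∀ m x, r m x ≤ r 0 x
  memLp : MemLp (r 0) q P
  tendsto : ∀ᵐ x ∂P, Tendsto (fun m => r m x) atTop (𝓝 0)

theorem exists_isVanishing {α : Type*} [MeasurableSpace α] {P : Measure α} {p : ℝ} (hp : 1 ≤ p)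
    {g : ℕ → α → ℝ≥0∞} (hg : ∀ m, Measurable (g m)) (hle : ∀ m x, g m x ≤ g 0 x)
    (hfin : lpn P p (g 0) < ∞) (hlim : ∀ᵐ x ∂P, Tendsto (fun m => g m x) atTop (𝓝 0)) :
    ∃ r, IsVanishing P (ENNReal.ofReal p) r ∧ ∀ᵐ x ∂P, ∀ m, g m x = ENNReal.ofReal (r m x) := by
  set g' : ℕ → α → ℝ≥0∞ := fun m x => if g 0 x = ∞ then 0 else g m x with hg'
  have hgm : ∀ m, Measurable (g' m) := fun m =>
    Measurable.ite (hg 0 (measurableSet_singleton ∞)) measurable_const (hg m)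
  have hgle : ∀ m x, g' m x ≤ g' 0 x := by
    intro m x
    simp only [hg']
    split_ifs
    · exact le_rfl
    · exact hle m x
  have hg0 : ∀ x, g' 0 x ≤ g 0 x := by
    intro x
    simp only [hg']
    split_ifs
    · exact bot_le
    · exact le_rfl
  have hgtop : ∀ m x, g' m x < ∞ := by
    intro m x
    simp only [hg']
    split_ifs with h
    · exact ENNReal.zero_lt_top
    · exact (hle m x).trans_lt (lt_top_iff_ne_top.2 h)
  have hae : ∀ᵐ x ∂P, g 0 x ≠ ∞ := by
    filter_upwards [ae_lt_top_of_lpn hp (hg 0) hfin] with x hx using hx.ne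
  refine ⟨fun m x => (g' m x).toReal, ⟨fun m => (hgm m).ennreal_toReal,
    fun m x => ENNReal.toReal_nonneg, fun m x => ENNReal.toReal_mono (hgtop 0 x).ne (hgle m x),
    ?_, ?_⟩, ?_⟩
  · rw [← lpn_lt_top_iff_memLp hp (hgm 0).ennreal_toReal]
    refine lt_of_le_of_lt (lpn_mono hp fun x => ?_) hfin
    rw [edist_dist, Real.dist_eq, zero_sub, abs_neg, abs_of_nonneg ENNReal.toReal_nonneg,
      ENNReal.ofReal_toReal (hgtop 0 x).ne]
    exact hg0 x
  · filter_upwards [hae, hlim] with x hx ht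
    have h1 : Tendsto (fun m => g' m x) atTop (𝓝 0) := by
      simpa only [hg', if_neg hx] using ht
    have h2 := (ENNReal.tendsto_toReal ENNReal.zero_ne_top).comp h1
    rwa [ENNReal.toReal_zero] at h2
  · filter_upwards [hae] with x hx m
    rw [ENNReal.ofReal_toReal (hgtop m x).ne]
    simp only [hg', if_neg hx]

theorem edist_mul_add_le (a b c a' c' : ℝ) :
    edist (a * b + c) (a' * b + c') ≤ edist c c' + edist 0 b * edist a a' := by
  simp only [edist_dist, Real.dist_eq, zero_sub, abs_neg]
  rw [← ENNReal.ofReal_mul (abs_nonneg _), ← ENNReal.ofReal_add (abs_nonneg _) (by positivity)]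
  refine ENNReal.ofReal_le_ofReal ?_
  have : a * b + c - (a' * b + c') = (c - c') + b * (a - a') := by ring
  rw [this, ← abs_mul]
  exact abs_add_le _ _

variable {Ω : Type*} [MeasurableSpace Ω] {μ : Measure Ω} [IsProbabilityMeasure μ]
  {ξ : ℤ → Ω → ℝ} {d : ℕ} {f M : Family d} {θ : Param d}

/-- `H(ξ_t, ξ_{t-1}, …)` is a solution of the model with parameter `θ`, of order 4, and it attracts
every other solution: if a path coincides up to time `k` with a stationary process of order 4 and
follows the model afterwards, then `m` time units later its distance to the stationary solution is
at most `u_m`, where `u_m → 0`; the bound `u_0` holds at all times, also before `k`. -/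
structure IsAttracting (μ : Measure Ω) (ξ : ℤ → Ω → ℝ) (f M : Family d) (θ : Param d)
    (H : (ℕ → ℝ) → ℝ) : Prop where
  measurable : Measurable H
  memLp : MemLp H 4 (innovLaw μ ξ)
  model : ∀ᵐ e ∂(innovLaw μ ξ), H e = M θ (fun k => H (dropFirst (k + 1) e)) * e 0
    + f θ (fun k => H (dropFirst (k + 1) e))
  attracts : ∀ G : (ℕ → ℝ) → ℝ, Measurable G → MemLp G 4 (innovLaw μ ξ) →
    ∃ u : ℕ → (ℕ → ℝ) → ℝ, IsVanishing (innovLaw μ ξ) 4 u ∧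
      ∀ᵐ ω ∂μ, ∀ (x : ℤ → ℝ) (k : ℤ), (∀ t ≤ k, x t = G (innovPast ξ t ω)) →
        (∀ t > k, x t = M θ (past x t) * ξ t ω + f θ (past x t)) →
        ∀ (m : ℕ) (t : ℤ), m = 0 ∨ k + m ≤ t →
          |x t - H (innovPast ξ t ω)| ≤ u m (innovPast ξ t ω)

/-- The model has an attracting solution as soon as, after a change `φ` of the scale of the
observations, it becomes a contractive recursion in `L^p`. -/
theorem exists_isAttracting_of_conj (hξ : IsInnovation μ ξ) {p : ℝ} (hp : 1 ≤ p)
    {α β : ℕ → ℝ≥0∞} {s : ℝ → ℝ≥0∞} {F : ℝ → (ℕ → ℝ) → ℝ} (hs : Measurable s)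
    (hρ : lagRate (innovLaw μ ξ) p α β s < 1)
    (hF : Measurable fun q : ℝ × (ℕ → ℝ) => F q.1 q.2) (hL : LagLipschitz α β s F)
    (h0 : lpn (innovLaw μ ξ) p (fun e => edist 0 (F (e 0) fun _ => 0)) < ∞)
    {φ ψ : ℝ → ℝ} (hφ : Measurable φ) (hψ : Measurable ψ) (hψφ : ∀ x, ψ (φ x) = x)
    (hφψ : ∀ x, φ (ψ x) = x) (hφ0 : φ 0 = 0)
    (hcomm : ∀ e x, F e (fun k => φ (x k)) = φ (M θ x * e + f θ x))
    {κ : ℝ≥0∞ → ℝ≥0∞} (hκm : Monotone κ) (hκ0 : Tendsto κ (𝓝 0) (𝓝 0))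
    (hκψ : ∀ a b, edist (ψ a) (ψ b) ≤ κ (edist a b))
    (hκp : ∀ g : (ℕ → ℝ) → ℝ≥0∞, Measurable g → lpn (innovLaw μ ξ) p g < ∞ →
      lpn (innovLaw μ ξ) 4 (fun e => κ (g e)) < ∞)
    (hφp : ∀ g : (ℕ → ℝ) → ℝ, Measurable g → MemLp g 4 (innovLaw μ ξ) →
      lpn (innovLaw μ ξ) p (fun e => edist 0 (φ (g e))) < ∞) :
    ∃ H, IsAttracting μ ξ f M θ H := by
  have h4 : (4 : ℝ≥0∞) = ENNReal.ofReal 4 := by simp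
  have hκmeas : Measurable κ := hκm.measurable
  have hψ0 : ψ 0 = 0 := by rw [← hφ0, hψφ]; exact hφ0.symm ▸ rfl
  obtain ⟨K, hKm, hKp, hK⟩ := hξ.exists_stationary hp hs hρ hF hL h0
  refine ⟨fun e => ψ (K e), hψ.comp hKm, ?_, ?_, ?_⟩
  · rw [h4, ← lpn_lt_top_iff_memLp (g := fun e => ψ (K e)) (by norm_num) (hψ.comp hKm)]
    refine lt_of_le_of_lt (lpn_mono (by norm_num) fun e => ?_)
      (hκp _ (measurable_const.edist hKm) hKp)
    have := hκψ 0 (K e)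
    rwa [hψ0] at this
  · filter_upwards [hK] with e he
    have h1 := hcomm (e 0) (fun k => ψ (K (dropFirst (k + 1) e)))
    simp only [hφψ] at h1
    rw [he, h1, hψφ]
  · intro G hGm hG
    -- the distance of the two processes before time `k`, on the changed scale
    set δ : (ℕ → ℝ) → ℝ≥0∞ := fun e => edist (φ (G e)) (K e) with hδ
    have hδm : Measurable δ := (hφ.comp hGm).edist hKm
    have hδp : lpn (innovLaw μ ξ) p δ < ∞ := by
      refine lt_of_le_of_lt ((lpn_mono hp fun e => ?_).trans (lpn_add_le hp
        (measurable_const.edist (hφ.comp hGm)) (measurable_const.edist hKm)))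
        (ENNReal.add_lt_top.2 ⟨hφp G hGm hG, hKp⟩)
      exact (edist_triangle_left _ _ _)
    have hU := hξ.lpn_lagSolution_lt_top hp hs hρ hδm hδp
    have hUm : Measurable (lagSolution α β s δ) := measurable_lagSolution hs hδm
    have hle : ∀ m e, lagForget α β s δ m e ≤ lagForget α β s δ 0 e := fun m e =>
      lagForget_antitone δ e (Nat.zero_le m)
    obtain ⟨u, hu, hu'⟩ := exists_isVanishing (p := 4) (P := innovLaw μ ξ) (by norm_num)
      (g := fun m e => κ (lagForget α β s δ m e))
      (fun m => hκmeas.comp (measurable_lagForget hs hδm m)) (fun m e => hκm (hle m e))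
      (by simp only [lagForget_zero]; exact hκp _ hUm hU)
      (by
        filter_upwards [hξ.ae_tendsto_lagForget hp hs hρ hδm hδp] with e he
        exact hκ0.comp he)
    rw [← h4] at hu
    refine ⟨u, hu, ?_⟩
    have hall : ∀ᵐ ω ∂μ, ∀ t : ℤ, (∀ m, κ (lagForget α β s δ m (innovPast ξ t ω))
          = ENNReal.ofReal (u m (innovPast ξ t ω))) ∧
        K (innovPast ξ t ω) = F (innovPast ξ t ω 0)
          fun k => K (dropFirst (k + 1) (innovPast ξ t ω)) :=
      ae_all_iff.2 fun t => (hξ.measurePreserving_innovPast t).quasiMeasurePreserving.ae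
        (hu'.and hK)
    filter_upwards [hall] with ω hω x k hold hnew m t hmt
    have hD := le_lagForget (α := α) (β := β) (s := s)
      (D := fun t => edist (φ (x t)) (K (innovPast ξ t ω)))
      (ζ := fun t => innovPast ξ t ω) (fun j t => dropFirst_innovPast j t ω) (δ := δ) (k := k)
      (fun t ht => by simp only [hδ, hold t ht]; exact le_rfl) (fun t ht => ?_) m t hmt
    · have h1 := hκψ (φ (x t)) (K (innovPast ξ t ω))
      rw [hψφ] at h1
      have h3 := h1.trans (hκm hD)
      rw [(hω t).1 m, edist_dist, Real.dist_eq] at h3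
      exact (ENNReal.ofReal_le_ofReal_iff (hu.nonneg _ _)).1 h3
    · have h1 : φ (x t) = F (innovPast ξ t ω 0) fun k => φ (past x t k) := by
        rw [hcomm, hnew t ht]
        simp [innovPast]
      rw [h1, (hω t).2]
      refine (hL _ _ _).trans (le_of_eq ?_)
      have h2 : ∀ j : ℕ, dropFirst (j + 1) (innovPast ξ t ω) = innovPast ξ (t - 1 - j) ω := by
        intro j
        rw [dropFirst_innovPast]
        congr 1
        push_cast; ring
      simp only [h2, past]

theorem lpn_innov_four (hξ : IsInnovation μ ξ) :
    lpn (innovLaw μ ξ) 4 (fun e => edist 0 (e 0)) = ENNReal.ofReal (innovNorm μ ξ 4) := by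
  have h1 := lpn_comp (p := 4) (hξ.measurePreserving_innovPast 0)
    (g := fun e => edist 0 (e 0)) (measurable_const.edist (measurable_pi_apply 0))
  rw [← h1]
  have hint : Integrable (fun ω => |ξ 0 ω| ^ (4 : ℝ)) μ := by
    have := hξ.memLp.integrable_norm_rpow (by norm_num) (by norm_num)
    simpa using this
  unfold lpn innovNorm
  rw [← ENNReal.ofReal_rpow_of_nonneg (integral_nonneg fun ω => by positivity) (by norm_num),
    ofReal_integral_eq_lintegral_ofReal hint (Eventually.of_forall fun ω => by positivity)]
  congr 2
  funext ω
  simp only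
  rw [edist_dist, Real.dist_eq, zero_sub, abs_neg,
    ENNReal.ofReal_rpow_of_nonneg (abs_nonneg _) (by norm_num)]
  simp [innovPast]

theorem lpn_innov_two (hξ : IsInnovation μ ξ) :
    lpn (innovLaw μ ξ) 2 (fun e => edist 0 (e 0) ^ 2) = ENNReal.ofReal (innovNorm μ ξ 4 ^ 2) := by
  have h0 : 0 ≤ innovNorm μ ξ 4 := by
    unfold innovNorm
    exact Real.rpow_nonneg (integral_nonneg fun ω => by positivity) _
  rw [ENNReal.ofReal_pow h0, ← lpn_innov_four hξ]
  unfold lpn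
  rw [← ENNReal.rpow_natCast, ← ENNReal.rpow_mul]
  congr 1
  · congr 1
    funext e
    simp only
    rw [← ENNReal.rpow_natCast, ← ENNReal.rpow_mul]
    norm_num
  · norm_num

theorem lagRate_lt_one {P : Measure (ℕ → ℝ)} {p : ℝ} {s : ℝ → ℝ≥0∞} {a b : ℕ → ℝ} {c : ℝ}
    (ha : ∀ k, 0 ≤ a k) (hb : ∀ k, 0 ≤ b k) (has : Summable a) (hbs : Summable b) (hc : 0 ≤ c)
    (hs : lpn P p (fun e => s (e 0)) = ENNReal.ofReal c) (h : (∑' k, a k) + c * (∑' k, b k) < 1) :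
    lagRate P p (fun k => ENNReal.ofReal (a k)) (fun k => ENNReal.ofReal (b k)) s < 1 := by
  unfold lagRate
  rw [ENNReal.tsum_add, ENNReal.tsum_mul_left, hs, ← ENNReal.ofReal_tsum_of_nonneg ha has,
    ← ENNReal.ofReal_tsum_of_nonneg hb hbs, ← ENNReal.ofReal_mul hc,
    ← ENNReal.ofReal_add (tsum_nonneg ha) (mul_nonneg hc (tsum_nonneg hb))]
  rwa [ENNReal.ofReal_lt_one]

/-- The signed square, the scale on which an ARCH-type model is an affine recursion. -/
def signedSq (x : ℝ) : ℝ := x * |x|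

/-- The inverse of the signed square. -/
def signedSqrt (x : ℝ) : ℝ := SignType.sign x * √|x|

theorem signedSqrt_of_nonneg {x : ℝ} (hx : 0 ≤ x) : signedSqrt x = √x := by
  rcases hx.eq_or_lt with rfl | h
  · simp [signedSqrt]
  · simp [signedSqrt, sign_pos h, abs_of_pos h]

theorem signedSqrt_neg (x : ℝ) : signedSqrt (-x) = -signedSqrt x := by
  simp [signedSqrt, Left.sign_neg]

theorem signedSq_neg (x : ℝ) : signedSq (-x) = -signedSq x := by
  simp [signedSq]

theorem signedSq_of_nonneg {x : ℝ} (hx : 0 ≤ x) : signedSq x = x ^ 2 := by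
  rw [signedSq, abs_of_nonneg hx, sq]

theorem signedSqrt_signedSq (x : ℝ) : signedSqrt (signedSq x) = x := by
  have key : ∀ x : ℝ, 0 ≤ x → signedSqrt (signedSq x) = x := fun x hx => by
    rw [signedSq_of_nonneg hx, signedSqrt_of_nonneg (sq_nonneg x), Real.sqrt_sq hx]
  rcases le_total 0 x with h | h
  · exact key x h
  · have := key (-x) (neg_nonneg.2 h)
    rw [signedSq_neg, signedSqrt_neg] at this
    linarith

theorem signedSq_signedSqrt (x : ℝ) : signedSq (signedSqrt x) = x := by
  have key : ∀ x : ℝ, 0 ≤ x → signedSq (signedSqrt x) = x := fun x hx => by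
    rw [signedSqrt_of_nonneg hx, signedSq_of_nonneg (Real.sqrt_nonneg x), Real.sq_sqrt hx]
  rcases le_total 0 x with h | h
  · exact key x h
  · have := key (-x) (neg_nonneg.2 h)
    rw [signedSqrt_neg, signedSq_neg] at this
    linarith

theorem abs_signedSqrt_sub_sq_le (a b : ℝ) : (signedSqrt a - signedSqrt b) ^ 2 ≤ 2 * |a - b| := by
  obtain ⟨x, rfl⟩ : ∃ x, a = signedSq x := ⟨_, (signedSq_signedSqrt a).symm⟩
  obtain ⟨y, rfl⟩ : ∃ y, b = signedSq y := ⟨_, (signedSq_signedSqrt b).symm⟩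
  rw [signedSqrt_signedSq, signedSqrt_signedSq]
  unfold signedSq
  rcases le_total 0 x with hx | hx <;> rcases le_total 0 y with hy | hy <;>
    rcases le_total x y with h | h <;>
    simp only [abs_of_nonneg, abs_of_nonpos, hx, hy] <;>
    first
    | (refine le_trans ?_ (mul_le_mul_of_nonneg_left (le_abs_self _) (by norm_num))
       nlinarith [sq_nonneg (x + y), mul_nonneg hx hy])
    | (refine le_trans ?_ (mul_le_mul_of_nonneg_left (neg_le_abs _) (by norm_num))
       nlinarith [sq_nonneg (x + y), mul_nonneg hx hy])
    | (refine le_trans ?_ (mul_le_mul_of_nonneg_left (le_abs_self _) (by norm_num))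
       nlinarith [sq_nonneg (x + y), mul_nonneg_of_nonpos_of_nonpos hx hy])
    | (refine le_trans ?_ (mul_le_mul_of_nonneg_left (neg_le_abs _) (by norm_num))
       nlinarith [sq_nonneg (x + y), mul_nonneg_of_nonpos_of_nonpos hx hy])
    | (refine le_trans ?_ (mul_le_mul_of_nonneg_left (le_abs_self _) (by norm_num))
       nlinarith [sq_nonneg (x + y)])
    | (refine le_trans ?_ (mul_le_mul_of_nonneg_left (neg_le_abs _) (by norm_num))
       nlinarith [sq_nonneg (x + y)])

theorem measurable_signedSq : Measurable signedSq := measurable_id.mul measurable_id.abs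

theorem measurable_signedSqrt : Measurable signedSqrt := by
  have : signedSqrt = fun x => if 0 ≤ x then √x else -√(-x) := by
    funext x
    split_ifs with h
    · exact signedSqrt_of_nonneg h
    · have := signedSqrt_of_nonneg (neg_nonneg.2 (not_le.1 h).le)
      rw [signedSqrt_neg] at this
      linarith
  rw [this]
  exact Measurable.ite measurableSet_Ici Real.continuous_sqrt.measurable
    (Real.continuous_sqrt.measurable.comp measurable_neg).neg

theorem abs_sq_sub_sq_le_signedSq (x y : ℝ) : |x ^ 2 - y ^ 2| ≤ |signedSq x - signedSq y| := by
  have h : ∀ z : ℝ, z ^ 2 = |signedSq z| := fun z => by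
    rw [signedSq, abs_mul, abs_abs, ← sq, sq_abs]
  rw [h x, h y]
  exact abs_abs_sub_abs_le _ _

/-- Every parameter of `Θ(4)` has an attracting stationary solution. -/
theorem exists_isAttracting (hξ : IsInnovation μ ξ) {Θ : Set (Param d)} (hfm : Measurable (f θ))
    (hMm : Measurable (M θ)) (hθ : θ ∈ ThetaSet μ ξ f M Θ 4) :
    ∃ H, IsAttracting μ ξ f M θ H := by
  have hc : 0 ≤ innovNorm μ ξ 4 := by
    unfold innovNorm
    exact Real.rpow_nonneg (integral_nonneg fun ω => by positivity) _
  have := hξ.isProbabilityMeasure_innovLaw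
  have hs4 : Measurable fun e : ℝ => edist 0 e := measurable_const.edist measurable_id
  have h4 : (4 : ℝ≥0∞) = ENNReal.ofReal 4 := by simp
  have hconst : ∀ {p : ℝ} (hp : 1 ≤ p) (c : ℝ), lpn (innovLaw μ ξ) p (fun _ => edist 0 c) < ∞ := by
    intro p hp c
    rw [lpn_lt_top_iff_memLp hp measurable_const]
    exact memLp_const c
  rcases hθ with ⟨-, αf, αM, hAf, hAM, hlt⟩ | ⟨-, hf0, hMpos, αh, hAh, hlt⟩
  -- the general case is contractive in `L⁴` on the original scale
  · refine exists_isAttracting_of_conj hξ (p := 4) (by norm_num) (s := fun e => edist 0 e)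
      (F := fun e x => M θ x * e + f θ x) hs4
      (lagRate_lt_one hAf.1 hAM.1 hAf.2.1 hAM.2.1 hc (lpn_innov_four hξ) hlt) ?_ ?_ ?_
      (φ := id) (ψ := id) measurable_id measurable_id (fun _ => rfl) (fun _ => rfl) rfl
      (fun _ _ => rfl) (κ := id) monotone_id tendsto_id (fun _ _ => le_rfl)
      (fun _ _ h => h) (fun g hg h => ?_)
    · exact ((hMm.comp measurable_snd).mul measurable_fst).add (hfm.comp measurable_snd)
    · intro e x y
      refine (edist_mul_add_le _ _ _ _ _).trans ?_
      gcongr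
      · exact hAf.edist_le_zero rfl x y
      · exact hAM.edist_le_zero rfl x y
    · refine lt_of_le_of_lt ((lpn_mono (by norm_num) fun e => ?_).trans
        (lpn_add_le (f := fun _ => edist 0 (f θ fun _ => 0))
          (g := fun e : ℕ → ℝ => edist 0 (M θ fun _ => 0) * edist 0 (e 0)) (by norm_num)
          measurable_const ((measurable_const.edist (measurable_pi_apply 0)).const_mul _))) ?_
      · have h1 := edist_mul_add_le 0 (e 0) 0 (M θ fun _ => 0) (f θ fun _ => 0)
        rw [zero_mul, add_zero, mul_comm (edist 0 (e 0))] at h1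
        exact h1
      · rw [lpn_const_mul (g := fun e : ℕ → ℝ => edist 0 (e 0)) (by norm_num) _
          (hs4.comp (measurable_pi_apply 0))]
        refine ENNReal.add_lt_top.2 ⟨hconst (by norm_num) _, ENNReal.mul_lt_top (edist_lt_top _ _) ?_⟩
        rw [lpn_innov_four hξ]
        exact ENNReal.ofReal_lt_top
    · rw [h4, ← lpn_lt_top_iff_memLp (by norm_num) hg] at h
      exact h
  -- an ARCH-type model is contractive in `L²` for the signed squares `x |x|`
  · have hh : Measurable (hFun M θ) := hMm.pow_const 2
    refine exists_isAttracting_of_conj hξ (p := 2) (by norm_num) (s := fun e => edist 0 e ^ 2)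
      (F := fun e y => hFun M θ (fun k => signedSqrt (y k)) * signedSq e) (hs4.pow_const 2)
      (lagRate_lt_one (a := fun _ => 0) (fun _ => le_rfl) hAh.1 summable_zero hAh.2.1
        (sq_nonneg _) (lpn_innov_two hξ) (by simpa using hlt)) ?_ ?_ ?_
      measurable_signedSq measurable_signedSqrt signedSqrt_signedSq signedSq_signedSqrt
      (by simp [signedSq]) ?_ (κ := fun a => (2 * a) ^ (1 / 2 : ℝ)) ?_ ?_ ?_ ?_ ?_
    · exact (hh.comp (measurable_pi_lambda _ fun k => measurable_signedSqrt.comp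
        ((measurable_pi_apply k).comp measurable_snd))).mul (measurable_signedSq.comp measurable_fst)
    · intro e x y
      have h1 := edist_mul_add_le (hFun M θ fun k => signedSqrt (x k)) (signedSq e) 0
        (hFun M θ fun k => signedSqrt (y k)) 0
      simp only [add_zero, edist_self, zero_add] at h1
      refine h1.trans (le_add_left ?_)
      have h2 : edist 0 (signedSq e) = edist 0 e ^ 2 := by
        simp only [edist_dist, Real.dist_eq, zero_sub, abs_neg, signedSq, abs_mul, abs_abs]
        rw [← sq, ENNReal.ofReal_pow (abs_nonneg e)]
      rw [h2]
      gcongr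
      refine (hAh.edist_le_zero rfl _ _).trans (ENNReal.tsum_le_tsum fun k => ?_)
      gcongr
      simp only [edist_dist, Real.dist_eq]
      refine ENNReal.ofReal_le_ofReal ((abs_sq_sub_sq_le_signedSq _ _).trans ?_)
      rw [signedSq_signedSqrt, signedSq_signedSqrt]
    · refine lt_of_le_of_lt (lpn_mono (g := fun e : ℕ → ℝ =>
        edist 0 (hFun M θ fun _ => signedSqrt 0) * edist 0 (e 0) ^ 2) (by norm_num) fun e => ?_) ?_
      · simp only [edist_dist, Real.dist_eq, zero_sub, abs_neg, signedSq, abs_mul, abs_abs]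
        rw [ENNReal.ofReal_mul (abs_nonneg _), ← sq, ENNReal.ofReal_pow (abs_nonneg _)]
      · rw [lpn_const_mul (g := fun e : ℕ → ℝ => edist 0 (e 0) ^ 2) (by norm_num) _
          ((measurable_const.edist (measurable_pi_apply 0)).pow_const 2), lpn_innov_two hξ]
        exact ENNReal.mul_lt_top (edist_lt_top _ _) ENNReal.ofReal_lt_top
    · intro e x
      simp only [signedSqrt_signedSq, hf0, add_zero]
      simp only [signedSq, hFun, abs_mul, abs_of_pos (hMpos x)]
      ring
    · intro a b hab
      simp only
      gcongr
    · have hcont : Continuous fun a : ℝ≥0∞ => (2 * a) ^ (1 / 2 : ℝ) :=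
        ENNReal.continuous_rpow_const.comp (ENNReal.continuous_const_mul (by norm_num))
      have := hcont.tendsto 0
      simpa using this
    · intro a b
      simp only [edist_dist, Real.dist_eq]
      rw [show (2 : ℝ≥0∞) = ENNReal.ofReal 2 by simp, ← ENNReal.ofReal_mul (by norm_num),
        ENNReal.ofReal_rpow_of_nonneg (by positivity) (by norm_num)]
      refine ENNReal.ofReal_le_ofReal ?_
      rw [← Real.sqrt_eq_rpow]
      exact Real.abs_le_sqrt (abs_signedSqrt_sub_sq_le a b)
    · intro g hg hfin
      have h1 : lpn (innovLaw μ ξ) 4 (fun e => (2 * g e) ^ (1 / 2 : ℝ))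
          = lpn (innovLaw μ ξ) 2 (fun e => 2 * g e) ^ (1 / 2 : ℝ) := by
        unfold lpn
        rw [← ENNReal.rpow_mul]
        congr 1
        · congr 1
          funext e
          rw [← ENNReal.rpow_mul]
          norm_num
        · norm_num
      rw [h1, lpn_const_mul (by norm_num) _ hg]
      exact ENNReal.rpow_lt_top_of_nonneg (by norm_num)
        (ENNReal.mul_lt_top (by norm_num) hfin).ne
    · intro g hg h
      rw [lpn_lt_top_iff_memLp (g := fun e => signedSq (g e)) (by norm_num)
        (measurable_signedSq.comp hg)]
      have h1 : MemLp (fun e => g e ^ 2) 2 (innovLaw μ ξ) := by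
        have := h.norm_rpow_div 2
        simp only [Real.norm_eq_abs] at this
        convert this using 2 with e
        · simp
        · rw [show (4 : ℝ≥0∞) = 2 * 2 by norm_num, ENNReal.mul_div_cancel_right] <;> norm_num
      simp only [ENNReal.ofReal_ofNat]
      refine h1.of_le (measurable_signedSq.comp hg).aestronglyMeasurable
        (Eventually.of_forall fun e => ?_)
      simp only [signedSq, Real.norm_eq_abs, abs_mul, abs_abs, sq, le_refl]

end

/-! ### Envelopes and approximation of the likelihood contributions -/

section

section Vanishing

variable {α : Type*} [MeasurableSpace α] {P : Measure α} {p q s : ℝ≥0∞} {r r' : ℕ → α → ℝ}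

theorem IsVanishing.add (h : IsVanishing P p r) (h' : IsVanishing P p r') :
    IsVanishing P p fun m x => r m x + r' m x where
  measurable m := (h.measurable m).add (h'.measurable m)
  nonneg m x := add_nonneg (h.nonneg m x) (h'.nonneg m x)
  le_zero m x := add_le_add (h.le_zero m x) (h'.le_zero m x)
  memLp := h.memLp.add h'.memLp
  tendsto := by
    filter_upwards [h.tendsto, h'.tendsto] with x hx hx'
    simpa using hx.add hx'

theorem IsVanishing.mul (h : IsVanishing P p r) {B : α → ℝ} (hBm : Measurable B)
    (hB0 : ∀ x, 0 ≤ B x) (hB : MemLp B q P) [ENNReal.HolderTriple p q s] :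
    IsVanishing P s fun m x => r m x * B x where
  measurable m := (h.measurable m).mul hBm
  nonneg m x := mul_nonneg (h.nonneg m x) (hB0 x)
  le_zero m x := mul_le_mul_of_nonneg_right (h.le_zero m x) (hB0 x)
  memLp := by
    have := hB.mul' (r := s) h.memLp
    simpa only [mul_comm] using this
  tendsto := by
    filter_upwards [h.tendsto] with x hx
    simpa using hx.mul_const (B x)

theorem IsVanishing.mono_exponent [IsFiniteMeasure P] (h : IsVanishing P p r) (hqp : q ≤ p) :
    IsVanishing P q r :=
  { h with memLp := h.memLp.mono_exponent hqp }

/-- The mean of a vanishing sequence tends to `0`. -/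
theorem IsVanishing.tendsto_integral (h : IsVanishing P 1 r) :
    Tendsto (fun m => ∫ x, r m x ∂P) atTop (𝓝 0) := by
  have := tendsto_integral_of_dominated_convergence (F := r) (f := fun _ => 0) (μ := P) (r 0)
    (fun m => (h.measurable m).aestronglyMeasurable) (memLp_one_iff_integrable.1 h.memLp)
    (fun m => Eventually.of_forall fun x => by
      rw [Real.norm_of_nonneg (h.nonneg m x)]; exact h.le_zero m x) h.tendsto
  simpa using this

theorem IsVanishing.integrable (h : IsVanishing P 1 r) (m : ℕ) : Integrable (r m) P :=
  (memLp_one_iff_integrable.1 h.memLp).mono (h.measurable m).aestronglyMeasurable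
    (Eventually.of_forall fun x => by
      rw [Real.norm_of_nonneg (h.nonneg m x), Real.norm_of_nonneg (h.nonneg 0 x)]
      exact h.le_zero m x)

end Vanishing

instance holderTriple_four_four_two : ENNReal.HolderTriple 4 4 2 :=
  ⟨by
    rw [← ENNReal.toReal_eq_toReal_iff' (by simp) (by simp), ENNReal.toReal_add (by simp) (by simp)]
    simp only [ENNReal.toReal_inv, ENNReal.toReal_ofNat]
    norm_num⟩

instance holderTriple_two_two_one : ENNReal.HolderTriple 2 2 1 :=
  ⟨by
    rw [← ENNReal.toReal_eq_toReal_iff' (by simp) (by simp), ENNReal.toReal_add (by simp) (by simp)]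
    simp only [ENNReal.toReal_inv, ENNReal.toReal_ofNat, ENNReal.toReal_one]
    norm_num⟩

/-- The past of the process `H(ξ_t, ξ_{t-1}, …)`, as a function of the innovations. -/
def pastOf (H : (ℕ → ℝ) → ℝ) (e : ℕ → ℝ) : ℕ → ℝ := fun k => H (dropFirst (k + 1) e)

theorem measurable_pastOf {H : (ℕ → ℝ) → ℝ} (hH : Measurable H) : Measurable (pastOf H) :=
  measurable_pi_lambda _ fun _ => hH.comp (measurable_dropFirst _)

/-- The regularity assumptions on the functions `f_θ` and `M_θ`, with names for the Lipschitz
coefficients and for the lower bound of `h_θ`. -/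
structure IsRegular {d : ℕ} (f M : Family d) (Θ : Set (Param d)) (αf αv : ℕ → ℕ → ℝ) (h₀ : ℝ) :
    Prop where
  compact : IsCompact Θ
  measurable_f : ∀ θ ∈ Θ, Measurable (f θ)
  measurable_M : ∀ θ ∈ Θ, Measurable (M θ)
  smooth_f : ∀ x, ∀ θ ∈ Θ, ContDiffAt ℝ 2 (fun η => f η x) θ
  smooth_M : ∀ x, ∀ θ ∈ Θ, ContDiffAt ℝ 2 (fun η => M η x) θ
  pos : 0 < h₀
  le_h : ∀ θ ∈ Θ, ∀ x, h₀ ≤ hFun M θ x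
  lip_f : ∀ i ≤ 2, AssumptionA f Θ i (αf i)
  lip_M : ∀ i ≤ 2, AssumptionA M Θ i (αv i) ∨ AssumptionAh M Θ i (αv i)

/-- On all the sequences dominated by `z`, the functions `f_θ`, `M_θ`, `h_θ` and their derivatives
of order at most 2 are bounded by `v` (by `v ^ 2` where only `h_θ` is Lipschitz). -/
def IsDominated {d : ℕ} (f M : Family d) (Θ : Set (Param d)) (αv : ℕ → ℕ → ℝ) (z : ℕ → ℝ)
    (v : ℝ) : Prop :=
  ∀ i ≤ 2, ∀ θ ∈ Θ, ∀ y : ℕ → ℝ, (∀ k, |y k| ≤ |z k|) →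
    ‖iteratedFDeriv ℝ i (fun η => f η y) θ‖ ≤ v ∧
    (AssumptionA M Θ i (αv i) → ‖iteratedFDeriv ℝ i (fun η => M η y) θ‖ ≤ v) ∧
    (AssumptionAh M Θ i (αv i) → ‖iteratedFDeriv ℝ i (fun η => hFun M η y) θ‖ ≤ v ^ 2)

/-- An envelope of the process `H(ξ_t, …)`: a functional of order 4 which bounds the process and
everything that the model computes from its past. -/
structure IsEnvelope {d : ℕ} (P : Measure (ℕ → ℝ)) (f M : Family d) (Θ : Set (Param d))
    (αv : ℕ → ℕ → ℝ) (H V : (ℕ → ℝ) → ℝ) : Prop where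
  measurable : Measurable V
  memLp : MemLp V 4 P
  one_le : ∀ e, 1 ≤ V e
  ae_le : ∀ᵐ e ∂P, |H e| ≤ V e
  ae_dominated : ∀ᵐ e ∂P, IsDominated f M Θ αv (pastOf H e) (V e)

theorem LipschitzWithCoeff.norm_le {d : ℕ} {g : ℝ → ℝ} {Ψ : Family d} {S : Set (Param d)} {i : ℕ}
    {a : ℕ → ℝ} (h : LipschitzWithCoeff g Ψ S i a) {C : ℝ}
    (hC : ∀ θ ∈ S, ‖iteratedFDeriv ℝ i (fun η => Ψ η 0) θ‖ ≤ C) {θ : Param d} (hθ : θ ∈ S)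
    (y : ℕ → ℝ) {b : ℝ≥0∞} (hb : ∑' k, ENNReal.ofReal (a k) * edist (g (y k)) (g 0) ≤ b)
    (hbt : b < ∞) : ‖iteratedFDeriv ℝ i (fun η => Ψ η y) θ‖ ≤ C + b.toReal := by
  have h1 := (h.edist_le hθ y 0).trans hb
  rw [edist_dist, dist_eq_norm, ENNReal.ofReal_le_iff_le_toReal hbt.ne] at h1
  have h2 := norm_le_norm_add_norm_sub (iteratedFDeriv ℝ i (fun η => Ψ η 0) θ)
    (iteratedFDeriv ℝ i (fun η => Ψ η y) θ)
  rw [norm_sub_rev] at h2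
  have := hC θ hθ
  linarith

variable {Ω : Type*} [MeasurableSpace Ω] {μ : Measure Ω} [IsProbabilityMeasure μ]
  {ξ : ℤ → Ω → ℝ} {d : ℕ} {f M : Family d} {Θ : Set (Param d)} {αf αv : ℕ → ℕ → ℝ} {h₀ : ℝ}
  {H : (ℕ → ℝ) → ℝ}

theorem IsInnovation.lpn_lagSum_const_lt_top (hξ : IsInnovation μ ξ) {p : ℝ} (hp : 1 ≤ p)
    {c : ℕ → ℝ≥0∞} (hc : ∑' k, c k < ∞) {g : (ℕ → ℝ) → ℝ≥0∞} (hg : Measurable g)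
    (hfin : lpn (innovLaw μ ξ) p g < ∞) :
    lpn (innovLaw μ ξ) p (lagSum c fun _ => g) < ∞ := by
  refine (hξ.lpn_lagSum_le hp fun _ => hg).trans_lt ?_
  rw [ENNReal.tsum_mul_right]
  exact ENNReal.mul_lt_top hc hfin

theorem lpn_sq_lt_top {α : Type*} [MeasurableSpace α] {P : Measure α} {g : α → ℝ≥0∞}
    (h : lpn P 4 g < ∞) : lpn P 2 (fun x => g x ^ 2) < ∞ := by
  have : lpn P 2 (fun x => g x ^ 2) = lpn P 4 g ^ (2 : ℝ) := by
    unfold lpn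
    rw [← ENNReal.rpow_mul]
    congr 1
    · congr 1
      funext e
      simp only
      rw [← ENNReal.rpow_natCast, ← ENNReal.rpow_mul]
      norm_num
    · norm_num
  rw [this]
  exact ENNReal.rpow_lt_top_of_nonneg (by norm_num) h.ne

/-- Every process of order 4 has an envelope. -/
theorem exists_isEnvelope (hξ : IsInnovation μ ξ) (hR : IsRegular f M Θ αf αv h₀)
    (hHm : Measurable H) (hH : MemLp H 4 (innovLaw μ ξ)) :
    ∃ V, IsEnvelope (innovLaw μ ξ) f M Θ αv H V := by
  have := hξ.isProbabilityMeasure_innovLaw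
  have h4 : (4 : ℝ≥0∞) = ENNReal.ofReal 4 := by simp
  choose! Cf hCf using fun i (hi : i ≤ 2) => (hR.lip_f i hi).2.2.1
  have hav : ∀ i ≤ 2, (∀ k, 0 ≤ αv i k) ∧ Summable (αv i) := fun i hi => by
    rcases hR.lip_M i hi with h | h
    · exact ⟨h.1, h.2.1⟩
    · exact ⟨h.1, h.2.1⟩
  -- one constant for both alternatives, so that no case distinction is needed later
  have hM' : ∀ i ≤ 2, ∃ C, (AssumptionA M Θ i (αv i) →
      ∀ θ ∈ Θ, ‖iteratedFDeriv ℝ i (fun η => M η 0) θ‖ ≤ C) ∧ (AssumptionAh M Θ i (αv i) →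
      ∀ θ ∈ Θ, ‖iteratedFDeriv ℝ i (fun η => hFun M η 0) θ‖ ≤ C) := by
    intro i hi
    by_cases hA : AssumptionA M Θ i (αv i)
    · obtain ⟨C, hC⟩ := hA.2.2.1
      by_cases hB : AssumptionAh M Θ i (αv i)
      · obtain ⟨C', hC'⟩ := hB.2.2.1
        exact ⟨max C C', fun _ θ hθ => (hC θ hθ).trans (le_max_left _ _),
          fun _ θ hθ => (hC' θ hθ).trans (le_max_right _ _)⟩
      · exact ⟨C, fun _ => hC, fun h => absurd h hB⟩
    · by_cases hB : AssumptionAh M Θ i (αv i)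
      · obtain ⟨C', hC'⟩ := hB.2.2.1
        exact ⟨C', fun h => absurd h hA, fun _ => hC'⟩
      · exact ⟨0, fun h => absurd h hA, fun h => absurd h hB⟩
  choose! Cv hCv using hM'
  -- a bound for all the constants, and a common upper bound `c` for the Lipschitz coefficients
  set C : ℝ := 1 + ∑ i ∈ Finset.range 3, (|Cf i| + |Cv i|) with hC
  have hCnn : 0 ≤ ∑ i ∈ Finset.range 3, (|Cf i| + |Cv i|) := Finset.sum_nonneg fun i _ => by positivity
  have hCle : ∀ i ≤ 2, Cf i ≤ C ∧ Cv i ≤ C := by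
    intro i hi
    have h1 := Finset.single_le_sum (f := fun i => |Cf i| + |Cv i|) (fun i _ => by positivity)
      (Finset.mem_range.2 (Nat.lt_succ_of_le hi))
    have h2 := le_abs_self (Cf i)
    have h3 := le_abs_self (Cv i)
    have h4 := abs_nonneg (Cf i)
    have h5 := abs_nonneg (Cv i)
    constructor <;> linarith
  set c : ℕ → ℝ≥0∞ := fun k => ∑ i ∈ Finset.range 3,
    (ENNReal.ofReal (αf i k) + ENNReal.ofReal (αv i k)) with hc
  have hcle : ∀ i ≤ 2, ∀ k, ENNReal.ofReal (αf i k) ≤ c k ∧ ENNReal.ofReal (αv i k) ≤ c k := by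
    intro i hi k
    have h1 := Finset.single_le_sum (f := fun i => ENNReal.ofReal (αf i k) + ENNReal.ofReal (αv i k))
      (fun i _ => bot_le) (Finset.mem_range.2 (Nat.lt_succ_of_le hi))
    exact ⟨le_self_add.trans h1, le_add_self.trans h1⟩
  have hcsum : ∑' k, c k < ∞ := by
    simp only [hc]
    rw [Summable.tsum_finsetSum fun _ _ => ENNReal.summable]
    refine ENNReal.sum_lt_top.2 fun i hi => ?_
    have hi2 : i ≤ 2 := Nat.lt_succ_iff.1 (Finset.mem_range.1 hi)
    rw [ENNReal.tsum_add, ← ENNReal.ofReal_tsum_of_nonneg (hR.lip_f i hi2).1 (hR.lip_f i hi2).2.1,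
      ← ENNReal.ofReal_tsum_of_nonneg (hav i hi2).1 (hav i hi2).2]
    exact ENNReal.add_lt_top.2 ⟨ENNReal.ofReal_lt_top, ENNReal.ofReal_lt_top⟩
  set G : (ℕ → ℝ) → ℝ≥0∞ := fun e => edist 0 (H e) with hG
  have hGm : Measurable G := measurable_const.edist hHm
  have hGp : lpn (innovLaw μ ξ) 4 G < ∞ := by
    rw [lpn_lt_top_iff_memLp (by norm_num) hHm, ← h4]; exact hH
  -- `S₁` bounds the functions Lipschitz in the values, `S₂` those Lipschitz in the squares
  set S₁ : (ℕ → ℝ) → ℝ≥0∞ := lagSum c fun _ => G with hS₁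
  set S₂ : (ℕ → ℝ) → ℝ≥0∞ := lagSum c fun _ e => G e ^ 2 with hS₂
  have hS₁m : Measurable S₁ := measurable_lagSum fun _ => hGm
  have hS₂m : Measurable S₂ := measurable_lagSum fun _ => hGm.pow_const 2
  have hS₁p : lpn (innovLaw μ ξ) 4 S₁ < ∞ :=
    hξ.lpn_lagSum_const_lt_top (by norm_num) hcsum hGm hGp
  have hS₂p : lpn (innovLaw μ ξ) 2 S₂ < ∞ :=
    hξ.lpn_lagSum_const_lt_top (by norm_num) hcsum (hGm.pow_const 2) (lpn_sq_lt_top hGp)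
  have hL₁ : MemLp (fun e => (S₁ e).toReal) 4 (innovLaw μ ξ) := by
    rw [h4, ← lpn_lt_top_iff_memLp (by norm_num) hS₁m.ennreal_toReal]
    refine (lpn_mono (by norm_num) fun e => ?_).trans_lt hS₁p
    rw [edist_dist, Real.dist_eq, zero_sub, abs_neg, abs_of_nonneg ENNReal.toReal_nonneg]
    exact ENNReal.ofReal_toReal_le
  have hL₂ : MemLp (fun e => √(S₂ e).toReal) 4 (innovLaw μ ξ) := by
    rw [h4, ← lpn_lt_top_iff_memLp (g := fun e => √(S₂ e).toReal) (by norm_num)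
      (Real.continuous_sqrt.measurable.comp hS₂m.ennreal_toReal)]
    have h1 : ∀ e, edist 0 (√(S₂ e).toReal) ≤ S₂ e ^ (1 / 2 : ℝ) := by
      intro e
      rw [edist_dist, Real.dist_eq, zero_sub, abs_neg, abs_of_nonneg (Real.sqrt_nonneg _),
        Real.sqrt_eq_rpow, ← ENNReal.ofReal_rpow_of_nonneg ENNReal.toReal_nonneg (by norm_num)]
      gcongr
      exact ENNReal.ofReal_toReal_le
    refine (lpn_mono (by norm_num) h1).trans_lt ?_
    have h2 : lpn (innovLaw μ ξ) 4 (fun e => S₂ e ^ (1 / 2 : ℝ))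
        = lpn (innovLaw μ ξ) 2 S₂ ^ (1 / 2 : ℝ) := by
      unfold lpn
      rw [← ENNReal.rpow_mul]
      congr 1
      · congr 1
        funext e
        rw [← ENNReal.rpow_mul]
        norm_num
      · norm_num
    rw [h2]
    exact ENNReal.rpow_lt_top_of_nonneg (by norm_num) hS₂p.ne
  refine ⟨fun e => C + |H e| + (S₁ e).toReal + √(S₂ e).toReal,
    (((measurable_const.add hHm.abs).add hS₁m.ennreal_toReal).add
      (Real.continuous_sqrt.measurable.comp hS₂m.ennreal_toReal)),
    (((memLp_const C).add hH.abs).add hL₁).add hL₂, fun e => ?_, Eventually.of_forall fun e => ?_, ?_⟩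
  · have := abs_nonneg (H e)
    have := ENNReal.toReal_nonneg (a := S₁ e)
    have := Real.sqrt_nonneg (S₂ e).toReal
    linarith
  · have := ENNReal.toReal_nonneg (a := S₁ e)
    have := Real.sqrt_nonneg (S₂ e).toReal
    linarith
  · filter_upwards [ae_lt_top_of_lpn (by norm_num) hS₁m hS₁p,
      ae_lt_top_of_lpn (by norm_num) hS₂m hS₂p] with e he₁ he₂ i hi θ hθ y hy
    have n1 := abs_nonneg (H e)
    have n2 := ENNReal.toReal_nonneg (a := S₁ e)
    have n3 := Real.sqrt_nonneg (S₂ e).toReal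
    have hy' : ∀ k, edist (y k) 0 ≤ G (dropFirst (k + 1) e) := by
      intro k
      simp only [hG, edist_dist, Real.dist_eq, sub_zero, zero_sub, abs_neg]
      exact ENNReal.ofReal_le_ofReal (hy k)
    have hy₂ : ∀ k, edist (y k ^ 2) (0 ^ 2) ≤ G (dropFirst (k + 1) e) ^ 2 := by
      intro k
      have h1 : edist (y k ^ 2) (0 ^ 2) = edist (y k) 0 ^ 2 := by
        simp only [edist_dist, Real.dist_eq, sub_zero, ne_eq, OfNat.ofNat_ne_zero,
          not_false_eq_true, zero_pow, abs_pow]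
        rw [ENNReal.ofReal_pow (abs_nonneg _)]
      rw [h1]
      gcongr
      exact hy' k
    have b1 : ∀ a : ℕ → ℝ, (∀ k, ENNReal.ofReal (a k) ≤ c k) →
        ∑' k, ENNReal.ofReal (a k) * edist (y k) 0 ≤ S₁ e := fun a ha =>
      ENNReal.tsum_le_tsum fun k => mul_le_mul' (ha k) (hy' k)
    have b2 : ∀ a : ℕ → ℝ, (∀ k, ENNReal.ofReal (a k) ≤ c k) →
        ∑' k, ENNReal.ofReal (a k) * edist (y k ^ 2) (0 ^ 2) ≤ S₂ e := fun a ha =>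
      ENNReal.tsum_le_tsum fun k => mul_le_mul' (ha k) (hy₂ k)
    refine ⟨?_, fun hA => ?_, fun hA => ?_⟩
    · have := (hR.lip_f i hi).norm_le (hCf i hi) hθ y (b1 _ fun k => (hcle i hi k).1) he₁
      linarith [(hCle i hi).1]
    · have := hA.norm_le ((hCv i hi).1 hA) hθ y (b1 _ fun k => (hcle i hi k).2) he₁
      linarith [(hCle i hi).2]
    · have h1 := hA.norm_le ((hCv i hi).2 hA) hθ y (b2 _ fun k => (hcle i hi k).2) he₂
      have h2 := (hCle i hi).2
      have h3 : (1 : ℝ) ≤ C := by linarith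
      have h4 := Real.sq_sqrt (ENNReal.toReal_nonneg (a := S₂ e))
      have h5 : (C + √(S₂ e).toReal) ^ 2
          ≤ (C + |H e| + (S₁ e).toReal + √(S₂ e).toReal) ^ 2 := by
        gcongr
        linarith
      nlinarith

/-- A discounted sum over the lags of a vanishing sequence is vanishing, even if it is only
known at the `m` most recent lags that the `m`-th term may be used. -/
theorem IsVanishing.lagSum (hξ : IsInnovation μ ξ) {p : ℝ} (hp : 1 ≤ p) {a : ℕ → ℝ}
    (ha : ∀ k, 0 ≤ a k) (has : Summable a) {r : ℕ → (ℕ → ℝ) → ℝ}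
    (h : IsVanishing (innovLaw μ ξ) (ENNReal.ofReal p) r) :
    ∃ R, IsVanishing (innovLaw μ ξ) (ENNReal.ofReal p) R ∧ ∀ᵐ e ∂(innovLaw μ ξ), ∀ m,
      ∑' k, ENNReal.ofReal (a k) * ENNReal.ofReal
        ((if k < m then r m else r 0) (dropFirst (k + 1) e)) = ENNReal.ofReal (R m e) := by
  have hif : ∀ m k, Measurable (if k < m then r m else r 0) := fun m k => by
    split_ifs
    · exact h.measurable m
    · exact h.measurable 0
  have hifle : ∀ m k e, (if k < m then r m else r 0) e ≤ r 0 e := fun m k e => by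
    split_ifs
    · exact h.le_zero m e
    · exact le_rfl
  have hfin : lpn (innovLaw μ ξ) p (CausalChange.lagSum (fun k => ENNReal.ofReal (a k))
      fun _ e => ENNReal.ofReal (r 0 e)) < ∞ := by
    refine hξ.lpn_lagSum_const_lt_top hp ?_ (h.measurable 0).ennreal_ofReal ?_
    · rw [← ENNReal.ofReal_tsum_of_nonneg ha has]; exact ENNReal.ofReal_lt_top
    · have := (lpn_lt_top_iff_memLp hp (h.measurable 0)).2 h.memLp
      convert this using 3 with e
      rw [edist_dist, Real.dist_eq, zero_sub, abs_neg, abs_of_nonneg (h.nonneg 0 e)]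
  refine exists_isVanishing hp
    (g := fun m => CausalChange.lagSum (fun k => ENNReal.ofReal (a k)) fun k e =>
      ENNReal.ofReal ((if k < m then r m else r 0) e))
    (fun m => measurable_lagSum fun k => (hif m k).ennreal_ofReal)
    (fun m e => lagSum_mono (fun k e => by
      simp only [Nat.not_lt_zero, if_false]
      exact ENNReal.ofReal_le_ofReal (hifle m k e)) e)
    (by simpa only [Nat.not_lt_zero, if_false] using hfin) ?_
  have hlim : ∀ᵐ e ∂(innovLaw μ ξ), ∀ k, Tendsto (fun m => r m (dropFirst (k + 1) e)) atTop (𝓝 0) :=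
    ae_all_iff.2 fun k => (hξ.measurePreserving_dropFirst (k + 1)).quasiMeasurePreserving.ae h.tendsto
  filter_upwards [hlim, ae_lt_top_of_lpn hp (measurable_lagSum fun _ =>
    (h.measurable 0).ennreal_ofReal) hfin] with e he hefin
  have hs0 : Summable fun k => a k * r 0 (dropFirst (k + 1) e) := by
    have h1 := ENNReal.summable_toReal hefin.ne
    simpa only [ENNReal.toReal_mul, ENNReal.toReal_ofReal (ha _),
      ENNReal.toReal_ofReal (h.nonneg 0 _)] using h1
  have hnn : ∀ m k, 0 ≤ a k * (if k < m then r m else r 0) (dropFirst (k + 1) e) := by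
    intro m k
    refine mul_nonneg (ha k) ?_
    split_ifs
    · exact h.nonneg m _
    · exact h.nonneg 0 _
  have hle : ∀ m k, a k * (if k < m then r m else r 0) (dropFirst (k + 1) e)
      ≤ a k * r 0 (dropFirst (k + 1) e) := fun m k =>
    mul_le_mul_of_nonneg_left (hifle m k _) (ha k)
  have ht : Tendsto (fun m => ∑' k, a k * (if k < m then r m else r 0) (dropFirst (k + 1) e)) atTop
      (𝓝 (∑' _ : ℕ, (0 : ℝ))) := by
    refine tendsto_tsum_of_dominated_convergence hs0 (fun k => ?_)
      (Eventually.of_forall fun m k => ?_)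
    · have h1 := (he k).const_mul (a k)
      rw [mul_zero] at h1
      refine h1.congr' ?_
      filter_upwards [eventually_gt_atTop k] with m hm
      rw [if_pos hm]
    · rw [Real.norm_of_nonneg (hnn m k)]
      exact hle m k
  rw [tsum_zero] at ht
  have h2 := (ENNReal.continuous_ofReal.tendsto 0).comp ht
  rw [ENNReal.ofReal_zero] at h2
  refine h2.congr fun m => ?_
  simp only [Function.comp_apply, CausalChange.lagSum]
  rw [ENNReal.ofReal_tsum_of_nonneg (hnn m) (Summable.of_nonneg_of_le (hnn m) (hle m) hs0)]
  refine tsum_congr fun k => ?_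
  rw [ENNReal.ofReal_mul (ha k)]

/-- The contribution to the quasi-likelihood of an observation `u` with past `y`. -/
def quasiLik (f M : Family d) (θ : Param d) (u : ℝ) (y : ℕ → ℝ) : ℝ :=
  (u - f θ y) ^ 2 / hFun M θ y + Real.log (hFun M θ y)

theorem abs_quasiLik_diff_le {a b g h h₀ δ η B : ℝ} (h0 : 0 < h₀) (hg : h₀ ≤ g) (hh : h₀ ≤ h)
    (hab : |a - b| ≤ δ) (hgh : |g - h| ≤ η) (hB : |b| ≤ B) :
    |(a ^ 2 / g + Real.log g) - (b ^ 2 / h + Real.log h)|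
      ≤ h₀⁻¹ * (δ * (2 * B + δ)) + (B ^ 2 / h₀ ^ 2 + h₀⁻¹) * η := by
  have hg0 : 0 < g := h0.trans_le hg
  have hh0 : 0 < h := h0.trans_le hh
  have hδ : 0 ≤ δ := (abs_nonneg _).trans hab
  have hη : 0 ≤ η := (abs_nonneg _).trans hgh
  have hB0 : 0 ≤ B := (abs_nonneg _).trans hB
  have e : (a ^ 2 / g + Real.log g) - (b ^ 2 / h + Real.log h)
      = (a ^ 2 - b ^ 2) / g + b ^ 2 * (h - g) / (g * h) + (Real.log g - Real.log h) := by
    field_simp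
    ring
  have t1 : |(a ^ 2 - b ^ 2) / g| ≤ h₀⁻¹ * (δ * (2 * B + δ)) := by
    rw [abs_div, abs_of_pos hg0, div_eq_inv_mul]
    have h1 : |a ^ 2 - b ^ 2| ≤ δ * (2 * B + δ) := by
      have : a ^ 2 - b ^ 2 = (a - b) * (2 * b + (a - b)) := by ring
      rw [this, abs_mul]
      have h2 : |2 * b + (a - b)| ≤ 2 * B + δ := by
        refine (abs_add_le _ _).trans ?_
        rw [abs_mul, abs_two]
        linarith
      gcongr
    gcongr
  have t2 : |b ^ 2 * (h - g) / (g * h)| ≤ B ^ 2 / h₀ ^ 2 * η := by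
    rw [abs_div, abs_mul, abs_of_pos (mul_pos hg0 hh0), abs_sub_comm h g, abs_pow,
      div_mul_eq_mul_div, sq h₀]
    gcongr
  have t3 : |Real.log g - Real.log h| ≤ h₀⁻¹ * η := by
    have key : ∀ x y : ℝ, h₀ ≤ x → h₀ ≤ y → Real.log x - Real.log y ≤ h₀⁻¹ * |x - y| := by
      intro x y hx hy
      have hx0 : 0 < x := h0.trans_le hx
      have hy0 : 0 < y := h0.trans_le hy
      rw [← Real.log_div hx0.ne' hy0.ne']
      have h1 := Real.log_le_sub_one_of_pos (div_pos hx0 hy0)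
      have h2 : x / y - 1 = y⁻¹ * (x - y) := by field_simp
      rw [h2] at h1
      refine h1.trans ?_
      calc y⁻¹ * (x - y) ≤ y⁻¹ * |x - y| := by gcongr; exact le_abs_self _
        _ ≤ h₀⁻¹ * |x - y| := by gcongr
    rw [abs_le]
    have h1 := key g h hg hh
    have h2 := key h g hh hg
    rw [abs_sub_comm] at h2
    have h3 : h₀⁻¹ * |g - h| ≤ h₀⁻¹ * η := by gcongr
    constructor <;> linarith
  rw [e]
  refine (abs_add_le _ _).trans ((add_le_add (abs_add_le _ _) le_rfl).trans ?_)
  linarith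

theorem IsEnvelope.abs_le {V : (ℕ → ℝ) → ℝ} (hR : IsRegular f M Θ αf αv h₀) {e : ℕ → ℝ}
    (hd : IsDominated f M Θ αv (pastOf H e) (V e)) (h1 : 1 ≤ V e) {θ : Param d} (hθ : θ ∈ Θ)
    {y : ℕ → ℝ} (hy : ∀ k, |y k| ≤ |pastOf H e k|) :
    |f θ y| ≤ V e ∧ |M θ y| ≤ V e ∧ hFun M θ y ≤ V e ^ 2 := by
  have h := hd 0 (by norm_num) θ hθ y hy
  simp only [norm_iteratedFDeriv_zero, Real.norm_eq_abs] at h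
  have h2 : hFun M θ y ≤ V e ^ 2 := by
    rcases hR.lip_M 0 (by norm_num) with hA | hA
    · unfold hFun
      rw [← sq_abs]
      have := h.2.1 hA
      gcongr
    · exact (le_abs_self _).trans (h.2.2 hA)
  refine ⟨h.1, ?_, h2⟩
  unfold hFun at h2
  exact abs_le_of_sq_le_sq h2 (by linarith)

/-- If a path is close to the stationary process `H(ξ_t, …)`, then its contribution to the
quasi-likelihood is close to that of the stationary process, uniformly in the parameter. -/
theorem exists_isVanishing_quasiLik (hξ : IsInnovation μ ξ) (hR : IsRegular f M Θ αf αv h₀)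
    (hHm : Measurable H) (hH : MemLp H 4 (innovLaw μ ξ)) {w : ℕ → (ℕ → ℝ) → ℝ}
    (hw : IsVanishing (innovLaw μ ξ) 4 w) :
    ∃ ε, IsVanishing (innovLaw μ ξ) 1 ε ∧ ∀ᵐ e ∂(innovLaw μ ξ), ∀ (u : ℝ) (y : ℕ → ℝ) (m : ℕ),
      |u - H e| ≤ w m e → (∀ k, |y k - pastOf H e k|
        ≤ (if k < m then w m else w 0) (dropFirst (k + 1) e)) →
      ∀ θ ∈ Θ, |quasiLik f M θ u y - quasiLik f M θ (H e) (pastOf H e)| ≤ ε m e := by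
  have := hξ.isProbabilityMeasure_innovLaw
  have h4 : (4 : ℝ≥0∞) = ENNReal.ofReal 4 := by simp
  have h2 : (2 : ℝ≥0∞) = ENNReal.ofReal 2 := by simp
  obtain ⟨V, hV⟩ := exists_isEnvelope hξ hR hHm hH
  have hV0 : ∀ e, 0 ≤ V e := fun e => zero_le_one.trans (hV.one_le e)
  -- the bound for a Lipschitz function of the past
  have hlip : ∀ (Ψ : Family d) (a : ℕ → ℝ), AssumptionA Ψ Θ 0 a →
      ∃ δ, IsVanishing (innovLaw μ ξ) 4 δ ∧ ∀ᵐ e ∂(innovLaw μ ξ), ∀ (y : ℕ → ℝ) (m : ℕ),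
        (∀ k, |y k - pastOf H e k| ≤ (if k < m then w m else w 0) (dropFirst (k + 1) e)) →
        ∀ θ ∈ Θ, |Ψ θ y - Ψ θ (pastOf H e)| ≤ δ m e := by
    intro Ψ a hA
    have hw' := hw
    rw [h4] at hw'
    obtain ⟨δ, hδ, hδ'⟩ := hw'.lagSum hξ (by norm_num) hA.1 hA.2.1
    refine ⟨δ, by rwa [h4], ?_⟩
    filter_upwards [hδ'] with e he y m hy θ hθ
    have h1 := hA.edist_le_zero hθ y (pastOf H e)
    have h5 : ∑' k, ENNReal.ofReal (a k) * edist (y k) (pastOf H e k) ≤ ENNReal.ofReal (δ m e) := by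
      rw [← he m]
      refine ENNReal.tsum_le_tsum fun k => ?_
      gcongr
      rw [edist_dist, Real.dist_eq]
      exact ENNReal.ofReal_le_ofReal (hy k)
    have h6 := h1.trans h5
    rw [edist_dist, Real.dist_eq] at h6
    exact (ENNReal.ofReal_le_ofReal_iff (hδ.nonneg _ _)).1 h6
  obtain ⟨δf, hδf, hδf'⟩ := hlip f _ (hR.lip_f 0 (by norm_num))
  -- the bound for `h_θ`, which follows either from the one for `M_θ` or from a Lipschitz bound in
  -- the squares of the past; both are of order 2 only
  have hvar : ∃ η, IsVanishing (innovLaw μ ξ) 2 η ∧ ∀ᵐ e ∂(innovLaw μ ξ), ∀ (y : ℕ → ℝ) (m : ℕ),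
        (∀ k, |y k - pastOf H e k| ≤ (if k < m then w m else w 0) (dropFirst (k + 1) e)) →
        ∀ θ ∈ Θ, |hFun M θ y - hFun M θ (pastOf H e)| ≤ η m e := by
    rcases hR.lip_M 0 (by norm_num) with hA | hA
    · obtain ⟨δ, hδ, hδ'⟩ := hlip M _ hA
      refine ⟨_, hδ.mul (s := 2) (B := fun e => 2 * V e + δ 0 e)
        ((hV.measurable.const_mul 2).add (hδ.measurable 0))
        (fun e => add_nonneg (mul_nonneg (by norm_num) (hV0 e)) (hδ.nonneg 0 e))
        ((hV.memLp.const_mul 2).add hδ.memLp), ?_⟩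
      filter_upwards [hδ', hV.ae_dominated] with e he hd y m hy θ hθ
      have h1 := he y m hy θ hθ
      have h3 := (IsEnvelope.abs_le hR hd (hV.one_le e) hθ (fun k => le_rfl)).2.1
      have h5 : hFun M θ y - hFun M θ (pastOf H e) = (M θ y - M θ (pastOf H e))
          * (2 * M θ (pastOf H e) + (M θ y - M θ (pastOf H e))) := by
        unfold hFun; ring
      rw [h5, abs_mul]
      have h6 : |2 * M θ (pastOf H e) + (M θ y - M θ (pastOf H e))| ≤ 2 * V e + δ 0 e := by
        refine (abs_add_le _ _).trans ?_
        rw [abs_mul, abs_two]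
        linarith [hδ.le_zero m e]
      have := hδ.nonneg m e
      gcongr
    · have hr := hw.mul (s := 2) (B := fun e => 2 * |H e| + w 0 e)
        ((hHm.abs.const_mul 2).add (hw.measurable 0))
        (fun e => add_nonneg (by positivity) (hw.nonneg 0 e))
        ((hH.abs.const_mul 2).add hw.memLp)
      rw [h2] at hr
      obtain ⟨η, hη, hη'⟩ := hr.lagSum hξ (by norm_num) hA.1 hA.2.1
      refine ⟨η, by rwa [h2], ?_⟩
      filter_upwards [hη'] with e he y m hy θ hθ
      have h1 := hA.edist_le_zero hθ y (pastOf H e)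
      have h5 : ∑' k, ENNReal.ofReal (αv 0 k) * edist (y k ^ 2) (pastOf H e k ^ 2)
          ≤ ENNReal.ofReal (η m e) := by
        rw [← he m]
        refine ENNReal.tsum_le_tsum fun k => ?_
        gcongr
        rw [edist_dist, Real.dist_eq]
        refine ENNReal.ofReal_le_ofReal ?_
        have h6 : y k ^ 2 - pastOf H e k ^ 2 = (y k - pastOf H e k)
            * (2 * pastOf H e k + (y k - pastOf H e k)) := by ring
        rw [h6, abs_mul]
        set D := (if k < m then w m else w 0) (dropFirst (k + 1) e) with hD
        have hDle : D ≤ w 0 (dropFirst (k + 1) e) := by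
          rw [hD]; split_ifs
          · exact hw.le_zero m _
          · exact le_rfl
        have hD0 : 0 ≤ D := (abs_nonneg _).trans (hy k)
        have h7 : |2 * pastOf H e k + (y k - pastOf H e k)|
            ≤ 2 * |H (dropFirst (k + 1) e)| + w 0 (dropFirst (k + 1) e) := by
          refine (abs_add_le _ _).trans ?_
          rw [abs_mul, abs_two]
          have := hy k
          have h8 : |pastOf H e k| = |H (dropFirst (k + 1) e)| := rfl
          linarith
        have h9 : (if k < m then fun x => w m x * (2 * |H x| + w 0 x)
            else fun x => w 0 x * (2 * |H x| + w 0 x)) (dropFirst (k + 1) e)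
            = D * (2 * |H (dropFirst (k + 1) e)| + w 0 (dropFirst (k + 1) e)) := by
          rw [hD]; split_ifs <;> rfl
        rw [h9]
        exact mul_le_mul (hy k) h7 (abs_nonneg _) hD0
      have h6 := h1.trans h5
      rw [edist_dist, Real.dist_eq] at h6
      exact (ENNReal.ofReal_le_ofReal_iff (hη.nonneg _ _)).1 h6
  obtain ⟨η, hη, hη'⟩ := hvar
  have hδ := hw.add hδf
  have hV2 : MemLp (fun e => V e * V e) 2 (innovLaw μ ξ) := hV.memLp.mul' hV.memLp
  have e1 := ((hδ.mul (s := 2) (B := fun e => 4 * V e + (w 0 e + δf 0 e))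
    ((hV.measurable.const_mul 4).add (hδ.measurable 0))
    (fun e => add_nonneg (mul_nonneg (by norm_num) (hV0 e)) (hδ.nonneg 0 e))
    ((hV.memLp.const_mul 4).add hδ.memLp)).mono_exponent (q := 1) (by norm_num)).mul (s := 1)
    (q := ∞) (B := fun _ => h₀⁻¹) measurable_const (fun _ => (inv_pos.2 hR.pos).le) (memLp_const _)
  have e2 := hη.mul (s := 1) (q := 2) (B := fun e => 4 / h₀ ^ 2 * (V e * V e) + h₀⁻¹)
    (((hV.measurable.mul hV.measurable).const_mul _).add measurable_const)
    (fun e => add_nonneg (mul_nonneg (by positivity) (mul_self_nonneg _)) (inv_pos.2 hR.pos).le)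
    ((hV2.const_mul _).add (memLp_const _))
  refine ⟨_, e1.add e2, ?_⟩
  filter_upwards [hδf', hη', hV.ae_dominated, hV.ae_le] with e hf hh hd hVe u y m hu hy θ hθ
  have hB : |H e - f θ (pastOf H e)| ≤ 2 * V e := by
    have := (IsEnvelope.abs_le hR hd (hV.one_le e) hθ (fun k => le_rfl)).1
    refine (abs_sub _ _).trans ?_
    linarith
  have hab : |(u - f θ y) - (H e - f θ (pastOf H e))| ≤ w m e + δf m e := by
    have : (u - f θ y) - (H e - f θ (pastOf H e)) = (u - H e) - (f θ y - f θ (pastOf H e)) := by ring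
    rw [this]
    exact (abs_sub _ _).trans (add_le_add hu (hf y m hy θ hθ))
  refine (abs_quasiLik_diff_le hR.pos (hR.le_h θ hθ y) (hR.le_h θ hθ _) hab (hh y m hy θ hθ)
    hB).trans ?_
  have l1 := hδ.le_zero m e
  have l2 := hδ.nonneg m e
  have l3 := hη.nonneg m e
  have hi := inv_pos.2 hR.pos
  have k1 : h₀⁻¹ * ((w m e + δf m e) * (2 * (2 * V e) + (w m e + δf m e)))
      ≤ (w m e + δf m e) * (4 * V e + (w 0 e + δf 0 e)) * h₀⁻¹ := by
    rw [mul_comm]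
    have : 2 * (2 * V e) + (w m e + δf m e) ≤ 4 * V e + (w 0 e + δf 0 e) := by
      linarith
    gcongr
  have k2 : ((2 * V e) ^ 2 / h₀ ^ 2 + h₀⁻¹) * η m e
      = η m e * (4 / h₀ ^ 2 * (V e * V e) + h₀⁻¹) := by ring
  rw [k2]
  exact add_le_add k1 le_rfl

end

/-! ### Averages over segments and lower envelopes -/

section

/-- If the averages of `c` converge to `L`, the sum of `c` over any segment `(a, b]` is
`(b - a) L`, up to an error which is small with respect to `a + b`. -/
theorem exists_abs_sum_segment_sub_le {c : ℕ → ℝ} {L : ℝ}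
    (h : Tendsto (fun n : ℕ => (∑ t ∈ Finset.Icc 1 n, c t) / n) atTop (𝓝 L)) {ε : ℝ} (hε : 0 < ε) :
    ∃ K, ∀ a b : ℕ, a ≤ b →
      |∑ t ∈ Finset.Icc (a + 1) b, c t - ((b : ℝ) - a) * L| ≤ ε * (a + b) + K := by
  set E : ℕ → ℝ := fun n => ∑ t ∈ Finset.Icc 1 n, c t - n * L with hE
  obtain ⟨N, hN⟩ := Metric.tendsto_atTop.1 h ε hε
  set K := ∑ n ∈ Finset.range N, |E n| with hK
  have hEn : ∀ n : ℕ, |E n| ≤ ε * n + K := by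
    intro n
    have hK0 : 0 ≤ K := Finset.sum_nonneg fun _ _ => abs_nonneg _
    rcases Nat.lt_or_ge n N with hn | hn
    · have := Finset.single_le_sum (f := fun n => |E n|) (fun _ _ => abs_nonneg _)
        (Finset.mem_range.2 hn)
      have : (0 : ℝ) ≤ ε * n := by positivity
      linarith
    · rcases Nat.eq_zero_or_pos n with rfl | hpos
      · simp [hE, hK0]
      · have h1 := hN n hn
        have hn0 : (0 : ℝ) < n := by exact_mod_cast hpos
        rw [Real.dist_eq] at h1
        have h2 : E n = ((∑ t ∈ Finset.Icc 1 n, c t) / n - L) * n := by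
          simp only [hE]; field_simp
        rw [h2, abs_mul, abs_of_pos hn0]
        nlinarith
  refine ⟨2 * K, fun a b hab => ?_⟩
  have hsplit : ∑ t ∈ Finset.Icc (a + 1) b, c t
      = ∑ t ∈ Finset.Icc 1 b, c t - ∑ t ∈ Finset.Icc 1 a, c t := by
    have e1 : ∀ n, Finset.Icc 1 n = Finset.Ico 1 (n + 1) := fun n => by ext; simp
    have e2 : Finset.Icc (a + 1) b = Finset.Ico (a + 1) (b + 1) := by ext; simp
    rw [e1, e1, e2, eq_sub_iff_add_eq', Finset.sum_Ico_consecutive _ (by omega) (by omega)]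
  have h3 : ∑ t ∈ Finset.Icc (a + 1) b, c t - ((b : ℝ) - a) * L = E b - E a := by
    rw [hsplit]; simp only [hE]; ring
  rw [h3]
  have := hEn a
  have := hEn b
  have := abs_sub (E b) (E a)
  linarith

/-- The segments `(a_n, b_n]`: long, and of length comparable with `b_n`. -/
structure IsLongSegment (a b : ℕ → ℕ) : Prop where
  tendsto : Tendsto (fun n => (b n : ℝ) - a n) atTop atTop
  le : ∃ C : ℝ, ∀ᶠ n in atTop, (b n : ℝ) ≤ C * ((b n : ℝ) - a n)

/-- Averages over long segments have the same limit as averages. -/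
theorem IsLongSegment.tendsto_average {a b : ℕ → ℕ} (hs : IsLongSegment a b) {c : ℕ → ℝ} {L : ℝ}
    (h : Tendsto (fun n : ℕ => (∑ t ∈ Finset.Icc 1 n, c t) / n) atTop (𝓝 L)) :
    Tendsto (fun n => (∑ t ∈ Finset.Icc (a n + 1) (b n), c t) / ((b n : ℝ) - a n)) atTop (𝓝 L) := by
  obtain ⟨C, hC⟩ := hs.le
  rw [Metric.tendsto_nhds]
  intro δ hδ
  obtain ⟨K, hK⟩ := exists_abs_sum_segment_sub_le h (ε := δ / (4 * (|C| + 1))) (by positivity)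
  filter_upwards [hC, hs.tendsto.eventually_gt_atTop 0,
    hs.tendsto.eventually_gt_atTop (2 * K / δ)] with n h1 h2 h3
  set N := (b n : ℝ) - a n with hN
  have hab : a n ≤ b n := by
    have : (a n : ℝ) < b n := by linarith
    exact_mod_cast this.le
  have h4 := hK (a n) (b n) hab
  rw [Real.dist_eq]
  have h5 : (∑ t ∈ Finset.Icc (a n + 1) (b n), c t) / N - L
      = (∑ t ∈ Finset.Icc (a n + 1) (b n), c t - N * L) / N := by field_simp
  rw [h5, abs_div, abs_of_pos h2, div_lt_iff₀ h2]
  refine lt_of_le_of_lt h4 ?_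
  have h6 : (a n : ℝ) + b n ≤ 2 * (|C| + 1) * N := by
    have : C * N ≤ |C| * N := by gcongr; exact le_abs_self C
    have : (a n : ℝ) ≤ b n := by exact_mod_cast hab
    nlinarith
  have h7 : δ / (4 * (|C| + 1)) * ((a n : ℝ) + b n) ≤ δ / 2 * N := by
    calc δ / (4 * (|C| + 1)) * ((a n : ℝ) + b n) ≤ δ / (4 * (|C| + 1)) * (2 * (|C| + 1) * N) := by
          gcongr
      _ = δ / 2 * N := by field_simp; ring
  have h8 : K < δ / 2 * N := by
    rw [div_lt_iff₀ hδ] at h3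
    linarith
  linarith

/-- Errors at time `t` of the segment which are bounded by `c_m(t)` from `2m` time units after the
beginning of the segment are negligible in the mean, if the mean of `c_m` tends to `0`. -/
theorem IsLongSegment.tendsto_average_zero {a b : ℕ → ℕ} (hs : IsLongSegment a b) {c : ℕ → ℕ → ℝ}
    {L : ℕ → ℝ} (hc : ∀ m t, 0 ≤ c m t)
    (h : ∀ m, Tendsto (fun n : ℕ => (∑ t ∈ Finset.Icc 1 n, c m t) / n) atTop (𝓝 (L m)))
    (hL : Tendsto L atTop (𝓝 0)) {r : ℕ → ℕ → ℝ} (hr0 : ∀ n t, 0 ≤ r n t)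
    (hr : ∀ n m t, t ∈ Finset.Icc (a n + 1) (b n) → m = 0 ∨ a n + 2 * m ≤ t → r n t ≤ c m t) :
    Tendsto (fun n => (∑ t ∈ Finset.Icc (a n + 1) (b n), r n t) / ((b n : ℝ) - a n)) atTop (𝓝 0) := by
  obtain ⟨C, hC⟩ := hs.le
  rw [Metric.tendsto_nhds]
  intro δ hδ
  obtain ⟨m, hm⟩ := (hL.eventually_lt_const (half_pos hδ)).exists
  have h1 := hs.tendsto_average (h m)
  -- the first `2m` terms are bounded with the help of `c 0`
  obtain ⟨K, hK⟩ := exists_abs_sum_segment_sub_le (h 0) (ε := δ / (8 * (|C| + 1))) (by positivity)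
  have hev := h1.eventually_lt_const hm
  set K' := 2 * m * |L 0| + δ / (8 * (|C| + 1)) * (2 * m) + K with hK'
  filter_upwards [hev, hC, hs.tendsto.eventually_gt_atTop 0,
    hs.tendsto.eventually_gt_atTop (4 * K' / δ), hs.tendsto.eventually_ge_atTop (2 * m : ℝ)]
    with n e1 e2 e3 e4 e5
  set N := (b n : ℝ) - a n with hN
  have hab : a n ≤ b n := by
    have : (a n : ℝ) < b n := by linarith
    exact_mod_cast this.le
  have habm : a n + 2 * m ≤ b n := by
    have : (a n : ℝ) + 2 * m ≤ b n := by linarith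
    exact_mod_cast this
  rw [Real.dist_eq, sub_zero, abs_of_nonneg (div_nonneg (Finset.sum_nonneg fun t _ => hr0 n t) e3.le),
    div_lt_iff₀ e3]
  have hsum : ∑ t ∈ Finset.Icc (a n + 1) (b n), r n t
      ≤ ∑ t ∈ Finset.Icc (a n + 1) (a n + 2 * m), c 0 t
        + ∑ t ∈ Finset.Icc (a n + 1) (b n), c m t := by
    have hpt : ∀ t ∈ Finset.Icc (a n + 1) (b n), r n t
        ≤ (if t ≤ a n + 2 * m then c 0 t else 0) + c m t := by
      intro t ht
      split_ifs with h
      · exact (hr n 0 t ht (Or.inl rfl)).trans (le_add_of_nonneg_right (hc m t))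
      · rw [zero_add]
        exact hr n m t ht (Or.inr (by omega))
    refine (Finset.sum_le_sum hpt).trans ?_
    rw [Finset.sum_add_distrib, ← Finset.sum_filter]
    refine add_le_add (Finset.sum_le_sum_of_subset_of_nonneg (fun t ht => ?_)
      fun t _ _ => hc 0 t) le_rfl
    simp only [Finset.mem_filter, Finset.mem_Icc] at ht ⊢
    omega
  have h0 := hK (a n) (a n + 2 * m) (by omega)
  push_cast at h0
  have h0' := (abs_le.1 h0).2
  have h2 : ∑ t ∈ Finset.Icc (a n + 1) (b n), c m t < δ / 2 * N := by
    rwa [div_lt_iff₀ e3] at e1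
  have h3 : (a n : ℝ) ≤ (|C| + 1) * N := by
    have : C * N ≤ |C| * N := by gcongr; exact le_abs_self C
    have : (a n : ℝ) ≤ b n := by exact_mod_cast hab
    nlinarith
  have h4 : δ / (8 * (|C| + 1)) * ((a n : ℝ) + (a n + 2 * m))
      ≤ δ / 4 * N + δ / (8 * (|C| + 1)) * (2 * m) := by
    have : δ / (8 * (|C| + 1)) * (2 * (a n : ℝ)) ≤ δ / 4 * N := by
      calc δ / (8 * (|C| + 1)) * (2 * (a n : ℝ)) ≤ δ / (8 * (|C| + 1)) * (2 * ((|C| + 1) * N)) := by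
            gcongr
        _ = δ / 4 * N := by field_simp; ring
    linarith
  have h5 : ((a n : ℝ) + 2 * m - a n) * L 0 ≤ 2 * m * |L 0| := by
    have : ((a n : ℝ) + 2 * m - a n) = 2 * m := by ring
    rw [this]
    gcongr
    exact le_abs_self _
  have h6 : K' < δ / 4 * N := by
    rw [div_lt_iff₀ hδ] at e4
    linarith
  linarith

section Lower

variable {E : Type*} [MeasurableSpace E] {P : Measure E}

/-- Lower bound by an integrable function, uniformly over a neighbourhood: if the functions `Φ_i`
are dominated from below and, as the index set `I_j` shrinks, have an inferior limit of at least
`Φ₀`, then over some `I_j` they have an integrable lower bound of mean almost `∫ Φ₀`. -/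
theorem exists_integrable_lower_bound {ι : Type*} [Countable ι] {Φ : ι → E → ℝ}
    (hm : ∀ i, Measurable (Φ i)) {I : ℕ → Set ι} (hI : ∀ j, (I j).Nonempty) (hanti : Antitone I)
    {g Φ₀ : E → ℝ} (hgm : Measurable g) (hg : Integrable g P)
    (hlow : ∀ᵐ e ∂P, ∀ i ∈ I 0, -g e ≤ Φ i e) (hm₀ : Measurable Φ₀) (h₀ : Integrable Φ₀ P)
    (hlim : ∀ᵐ e ∂P, ∀ δ > 0, ∃ j, ∀ i ∈ I j, Φ₀ e - δ ≤ Φ i e) {c : ℝ} (hc : c < ∫ e, Φ₀ e ∂P) :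
    ∃ (j : ℕ) (ψ : E → ℝ), Measurable ψ ∧ Integrable ψ P ∧ c < ∫ e, ψ e ∂P ∧
      ∀ᵐ e ∂P, ∀ i ∈ I j, ψ e ≤ Φ i e := by
  set B : E → ℝ := fun e => |g e| + |Φ₀ e| with hB
  have hBi : Integrable B P := hg.abs.add h₀.abs
  -- truncation at `Φ₀` and `-B` makes the infima over the index sets dominated
  set F : ι → E → ℝ := fun i e => max (min (Φ i e) (Φ₀ e)) (-B e) with hF
  have hFlow : ∀ i e, -B e ≤ F i e := fun i e => le_max_right _ _
  have hFup : ∀ i e, F i e ≤ Φ₀ e := fun i e => by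
    refine max_le (min_le_right _ _) ?_
    have := neg_abs_le (Φ₀ e)
    have := abs_nonneg (g e)
    simp only [hB]; linarith
  set ψ : ℕ → E → ℝ := fun j e => ⨅ i : I j, F i e with hψ
  have hψm : ∀ j, Measurable (ψ j) := fun j =>
    Measurable.iInf fun i => (((hm i).min hm₀).max (hgm.abs.add hm₀.abs).neg)
  have hbdd : ∀ j e, BddBelow (Set.range fun i : I j => F i e) := fun j e =>
    ⟨-B e, by rintro _ ⟨i, rfl⟩; exact hFlow i e⟩
  have hψlow : ∀ j e, -B e ≤ ψ j e := fun j e => by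
    have := (hI j).to_subtype
    exact le_ciInf fun i => hFlow i e
  have hψup : ∀ j e, ψ j e ≤ Φ₀ e := fun j e => by
    obtain ⟨i, hi⟩ := hI j
    exact (ciInf_le (hbdd j e) ⟨i, hi⟩).trans (hFup i e)
  have hbound : ∀ j e, ‖ψ j e‖ ≤ B e := fun j e => by
    rw [Real.norm_eq_abs, abs_le]
    refine ⟨hψlow j e, (hψup j e).trans ?_⟩
    have := le_abs_self (Φ₀ e)
    have := abs_nonneg (g e)
    simp only [hB]; linarith
  have hψi : ∀ j, Integrable (ψ j) P := fun j =>
    hBi.mono' (hψm j).aestronglyMeasurable (Eventually.of_forall (hbound j))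
  have ht : Tendsto (fun j => ∫ e, ψ j e ∂P) atTop (𝓝 (∫ e, Φ₀ e ∂P)) := by
    refine tendsto_integral_of_dominated_convergence B (fun j => (hψm j).aestronglyMeasurable) hBi
      (fun j => Eventually.of_forall (hbound j)) ?_
    filter_upwards [hlim] with e he
    rw [Metric.tendsto_atTop]
    intro δ hδ
    obtain ⟨j, hj⟩ := he (δ / 2) (half_pos hδ)
    refine ⟨j, fun k hk => ?_⟩
    have h1 : Φ₀ e - δ / 2 ≤ ψ k e := by
      have := (hI k).to_subtype
      refine le_ciInf fun i => ?_
      refine le_trans ?_ (le_max_left _ _)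
      exact le_min (hj i (hanti hk i.2)) (by linarith)
    have h2 := hψup k e
    rw [Real.dist_eq, abs_lt]
    constructor <;> linarith
  obtain ⟨j, hj⟩ := (ht.eventually_const_lt hc).exists
  refine ⟨j, ψ j, hψm j, hψi j, hj, ?_⟩
  filter_upwards [hlow] with e he i hi
  refine (ciInf_le (hbdd j e) ⟨i, hi⟩).trans ?_
  simp only [hF]
  have h1 := he i (hanti (Nat.zero_le j) hi)
  rcases max_choice (min (Φ i e) (Φ₀ e)) (-B e) with h | h
  · rw [h]; exact min_le_left _ _
  · rw [h]
    refine le_trans ?_ h1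
    have := le_abs_self (g e)
    have := abs_nonneg (Φ₀ e)
    simp only [hB]; linarith

/-- The case of functions `Φ_t`, `t ∈ ℕ`, which are continuous in a parameter, near a point `p₀` and
for large `t`. -/
theorem exists_integrable_lower_bound_of_continuousOn {X : Type*} [PseudoMetricSpace X]
    [SecondCountableTopology X] {K : Set X} {Φ : ℕ → X → E → ℝ}
    (hm : ∀ t, ∀ p ∈ K, Measurable (Φ t p)) (hcont : ∀ t e, ContinuousOn (fun p => Φ t p e) K)
    {g Φ₀ : E → ℝ} (hgm : Measurable g) (hg : Integrable g P)
    (hlow : ∀ᵐ e ∂P, ∀ t, ∀ p ∈ K, -g e ≤ Φ t p e) {p₀ : X} (hp₀ : p₀ ∈ K) (hm₀ : Measurable Φ₀)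
    (h₀ : Integrable Φ₀ P)
    (hlim : ∀ᵐ e ∂P, Tendsto (fun q : ℕ × X => Φ q.1 q.2 e) (atTop ×ˢ 𝓝[K] p₀) (𝓝 (Φ₀ e)))
    {c : ℝ} (hc : c < ∫ e, Φ₀ e ∂P) :
    ∃ U ∈ 𝓝 p₀, ∃ (T : ℕ) (ψ : E → ℝ), Measurable ψ ∧ Integrable ψ P ∧ c < ∫ e, ψ e ∂P ∧
      ∀ᵐ e ∂P, ∀ t ≥ T, ∀ p ∈ U, p ∈ K → ψ e ≤ Φ t p e := by
  have hne : Nonempty K := ⟨⟨p₀, hp₀⟩⟩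
  set D : ℕ → K := TopologicalSpace.denseSeq K with hD
  have hdense : DenseRange D := TopologicalSpace.denseRange_denseSeq K
  set I : ℕ → Set (ℕ × ℕ) := fun j => {i | j ≤ i.1 ∧ dist (D i.2 : X) p₀ < 1 / ((j : ℝ) + 1)} with hI
  have hIne : ∀ j, (I j).Nonempty := by
    intro j
    obtain ⟨i, hi⟩ := hdense.exists_dist_lt (⟨p₀, hp₀⟩ : K)
      (show (0 : ℝ) < 1 / ((j : ℝ) + 1) by positivity)
    exact ⟨(j, i), by simp only [hI, Set.mem_ofPred_eq]; rw [dist_comm]; exact ⟨le_rfl, hi⟩⟩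
  have hanti : Antitone I := by
    intro j k hjk i hi
    simp only [hI, Set.mem_ofPred_eq] at hi ⊢
    refine ⟨hjk.trans hi.1, hi.2.trans_le ?_⟩
    gcongr
  obtain ⟨j, ψ, hψm, hψi, hψc, hψ⟩ := exists_integrable_lower_bound
    (Φ := fun i : ℕ × ℕ => Φ i.1 (D i.2))
    (fun i => hm _ _ (D i.2).2) hIne hanti hgm hg
    (by filter_upwards [hlow] with e he i _ using he _ _ (D i.2).2) hm₀ h₀
    (by
      filter_upwards [hlim] with e he δ hδ
      have h1 := he (Metric.ball_mem_nhds (Φ₀ e) hδ)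
      obtain ⟨A, hA, B, hB, hAB⟩ := Filter.mem_prod_iff.1 (Filter.mem_map.1 h1)
      obtain ⟨T, hT⟩ := Filter.mem_atTop_sets.1 hA
      obtain ⟨ρ, hρ, hρB⟩ := Metric.mem_nhdsWithin_iff.1 hB
      obtain ⟨j, hj⟩ := exists_nat_one_div_lt hρ
      refine ⟨max j T, fun i hi => ?_⟩
      have hi' := hanti (le_max_left j T) hi
      simp only [hI, Set.mem_ofPred_eq] at hi hi'
      have h3 := @hAB (i.1, (D i.2 : X))
        ⟨hT _ ((le_max_right _ _).trans hi.1), hρB ⟨hi'.2.trans hj, (D i.2).2⟩⟩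
      have h4 : dist (Φ i.1 (D i.2) e) (Φ₀ e) < δ := h3
      rw [Real.dist_eq, abs_lt] at h4
      linarith [h4.1]) hc
  refine ⟨Metric.ball p₀ (1 / ((j : ℝ) + 1)), Metric.ball_mem_nhds _ (by positivity), j, ψ, hψm, hψi,
    hψc, ?_⟩
  filter_upwards [hψ] with e he t ht p hp hpK
  -- approximate `p` by points of the dense sequence
  have h1 : ContinuousWithinAt (fun p => Φ t p e) K p := hcont t e p hpK
  refine le_of_forall_pos_le_add fun δ hδ => ?_
  obtain ⟨ρ, hρ, h2⟩ := Metric.continuousWithinAt_iff.1 h1 δ hδ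
  have hp' : 0 < 1 / ((j : ℝ) + 1) - dist p p₀ := by
    rw [Metric.mem_ball] at hp; linarith
  obtain ⟨i, hi⟩ := hdense.exists_dist_lt (⟨p, hpK⟩ : K) (lt_min hρ hp')
  have hi' : dist (D i : X) p < min ρ (1 / ((j : ℝ) + 1) - dist p p₀) := by
    rw [dist_comm]; exact hi
  have h3 := h2 (D i).2 (hi'.trans_le (min_le_left _ _))
  have h4 := he (t, i) (by
    simp only [hI, Set.mem_ofPred_eq]
    have := dist_triangle (D i : X) p p₀
    have := hi'.trans_le (min_le_right _ _)
    exact ⟨ht, by linarith⟩)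
  rw [Real.dist_eq, abs_lt] at h3
  linarith [h3.2]

end Lower

end

/-! ### Solutions as functionals of the innovations, and identification of the parameter -/

section

variable {Ω : Type*} [MeasurableSpace Ω] {μ : Measure Ω} [IsProbabilityMeasure μ] {ξ : ℤ → Ω → ℝ}
variable {d : ℕ} {f M : Family d} {Θ : Set (Param d)} {αf αv : ℕ → ℕ → ℝ} {h₀ : ℝ}
variable {θ θ' : Param d} {H : (ℕ → ℝ) → ℝ}

/-- `H(ξ_t, ξ_{t-1}, …)` is a solution, of order 4, of the model with parameter `θ`. -/
structure IsSolution (μ : Measure Ω) (ξ : ℤ → Ω → ℝ) (f M : Family d) (θ : Param d)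
    (H : (ℕ → ℝ) → ℝ) : Prop where
  measurable : Measurable H
  memLp : MemLp H 4 (innovLaw μ ξ)
  model : ∀ᵐ e ∂(innovLaw μ ξ), H e = M θ (pastOf H e) * e 0 + f θ (pastOf H e)

theorem IsAttracting.isSolution (h : IsAttracting μ ξ f M θ H) : IsSolution μ ξ f M θ H :=
  ⟨h.measurable, h.memLp, h.model⟩

/-- The sequence `H(e), H(σ e), …` for the shift `σ`. -/
def historyOf (H : (ℕ → ℝ) → ℝ) (e : ℕ → ℝ) : ℕ → ℝ := fun k => H (dropFirst k e)

theorem measurable_historyOf (hH : Measurable H) : Measurable (historyOf H) :=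
  measurable_pi_lambda _ fun k => hH.comp (measurable_dropFirst k)

theorem pastOf_eq_historyOf (H : (ℕ → ℝ) → ℝ) (e : ℕ → ℝ) :
    pastOf H e = historyOf H (dropFirst 1 e) := by
  funext k
  simp only [pastOf, historyOf, dropFirst_dropFirst]

theorem pastOf_innovPast (H : (ℕ → ℝ) → ℝ) (t : ℤ) (ω : Ω) :
    pastOf H (innovPast ξ t ω) = past (fun s => H (innovPast ξ s ω)) t := by
  funext k
  simp only [pastOf, past, dropFirst_innovPast]
  congr 2
  push_cast
  ring

theorem IsSolution.isStationarySolution (hξ : IsInnovation μ ξ) (h : IsSolution μ ξ f M θ H) :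
    IsStationarySolution μ ξ f M θ (fun t ω => H (innovPast ξ t ω)) where
  causal := ⟨H, h.measurable, fun t => Eventually.of_forall fun ω => rfl⟩
  memLp := h.memLp.comp_measurePreserving (hξ.measurePreserving_innovPast 0)
  model t := by
    filter_upwards [(hξ.measurePreserving_innovPast t).quasiMeasurePreserving.ae h.model] with ω hω
    rw [hω, pastOf_innovPast]
    simp [innovPast]

/-- A stationary solution of the model is a functional of the innovations. -/
theorem IsStationarySolution.exists_isSolution (hξ : IsInnovation μ ξ) (hfm : Measurable (f θ))
    (hMm : Measurable (M θ)) {Y : ℤ → Ω → ℝ} (h : IsStationarySolution μ ξ f M θ Y) :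
    ∃ H, IsSolution μ ξ f M θ H ∧ ∀ᵐ ω ∂μ, ∀ t, Y t ω = H (innovPast ξ t ω) := by
  obtain ⟨H, hHm, hH⟩ := h.causal
  have hall : ∀ᵐ ω ∂μ, ∀ t, Y t ω = H (innovPast ξ t ω) := ae_all_iff.2 hH
  have hmem : MemLp (fun ω => H (innovPast ξ 0 ω)) 4 μ := h.memLp.ae_eq (hH 0)
  have hmp := hξ.measurePreserving_innovPast 0
  refine ⟨H, ⟨hHm, ?_, ?_⟩, hall⟩
  · rw [← hmp.map_eq]
    exact (memLp_map_measure_iff hHm.aestronglyMeasurable hmp.measurable.aemeasurable).2 hmem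
  · have hpm := measurable_pastOf hHm
    have hset : MeasurableSet
        {e : ℕ → ℝ | H e = M θ (pastOf H e) * e 0 + f θ (pastOf H e)} :=
      measurableSet_eq_fun hHm
        (((hMm.comp hpm).mul (measurable_pi_apply 0)).add (hfm.comp hpm))
    rw [← hmp.map_eq, ae_map_iff hmp.measurable.aemeasurable hset]
    filter_upwards [hall, h.model 0] with ω h1 h2
    have h3 : (fun s => Y s ω) = fun s => H (innovPast ξ s ω) := funext h1
    rw [h3, h1 0] at h2
    rw [pastOf_innovPast, h2]
    simp [innovPast]

/-- The parameter is identified by the solution `H`, and the derivatives with respect to the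
parameter do not degenerate. -/
structure IsIdentified (P : Measure (ℕ → ℝ)) (f M : Family d) (Θ : Set (Param d))
    (H : (ℕ → ℝ) → ℝ) : Prop where
  eq_of_ae_eq : ∀ θ ∈ Θ, ∀ θ' ∈ Θ, (∀ᵐ e ∂P, f θ (pastOf H e) = f θ' (pastOf H e) ∧
    hFun M θ (pastOf H e) = hFun M θ' (pastOf H e)) → θ = θ'
  eq_zero_of_fderiv : ∀ θ ∈ Θ, ∀ u : Param d,
    (∀ᵐ e ∂P, fderiv ℝ (fun η => f η (pastOf H e)) θ u = 0 ∧
      fderiv ℝ (fun η => hFun M η (pastOf H e)) θ u = 0) → u = 0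

theorem DerivIndependent.eq_zero {Ψ : Family d} {Y : ℤ → Ω → ℝ} (h : DerivIndependent μ Ψ θ Y)
    {u : Param d}
    (hu : ∀ᵐ ω ∂μ, fderiv ℝ (fun η => Ψ η (past (fun s => Y s ω) 1)) θ u = 0) : u = 0 := by
  have hsum : ∑ i, u i • (EuclideanSpace.single i (1 : ℝ) : Param d) = u := by
    ext j
    simp [Finset.sum_apply, Pi.single_apply]
  have h1 := h u (by
    filter_upwards [hu] with ω hω
    rw [← hsum, map_sum] at hω
    simpa [map_smul] using hω)
  ext j
  exact congrFun h1 j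

theorem IsIdentified.of_stationarySolution (hξ : IsInnovation μ ξ) {Y : ℤ → Ω → ℝ}
    (hY : ∀ᵐ ω ∂μ, ∀ t, Y t ω = H (innovPast ξ t ω)) (hId : AssumptionId μ f M Θ Y)
    (hVar : AssumptionVar μ f M Θ Y) : IsIdentified (innovLaw μ ξ) f M Θ H := by
  have hpast : ∀ᵐ ω ∂μ, past (fun s => Y s ω) 1 = pastOf H (innovPast ξ 1 ω) := by
    filter_upwards [hY] with ω hω
    rw [pastOf_innovPast, funext hω]
  have hq := (hξ.measurePreserving_innovPast 1).quasiMeasurePreserving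
  refine ⟨fun θ hθ θ' hθ' h => hId θ hθ θ' hθ' ?_, fun θ hθ u h => ?_⟩
  · filter_upwards [hpast, hq.ae h] with ω h1 h2
    rw [h1]
    exact h2
  · rcases hVar θ hθ with hv | hv
    · refine hv.eq_zero ?_
      filter_upwards [hpast, hq.ae h] with ω h1 h2
      rw [h1]
      exact h2.1
    · refine hv.eq_zero ?_
      filter_upwards [hpast, hq.ae h] with ω h1 h2
      rw [h1]
      exact h2.2

/-- An innovation is independent of the past. -/
theorem IsInnovation.integral_head_mul_tail (hξ : IsInnovation μ ξ) {φ : ℝ → ℝ}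
    (hφm : Measurable φ) (hφ : Integrable (fun ω => φ (ξ 0 ω)) μ) {B : (ℕ → ℝ) → ℝ}
    (hBm : Measurable B) (hB : Integrable (fun e => B (dropFirst 1 e)) (innovLaw μ ξ)) :
    Integrable (fun e => φ (e 0) * B (dropFirst 1 e)) (innovLaw μ ξ) ∧
      ∫ e, φ (e 0) * B (dropFirst 1 e) ∂(innovLaw μ ξ)
        = (∫ ω, φ (ξ 0 ω) ∂μ) * ∫ e, B (dropFirst 1 e) ∂(innovLaw μ ξ) := by
  have := hξ.isProbabilityMeasure_innovLaw
  have := hξ.isProbabilityMeasure_map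
  have h := hξ.measurePreserving_head_tail
  have hd := hξ.measurePreserving_dropFirst 1
  have hφ' : Integrable φ (μ.map (ξ 0)) :=
    (integrable_map_measure hφm.aestronglyMeasurable (hξ.measurable 0).aemeasurable).2 hφ
  have hB' : Integrable B (innovLaw μ ξ) := (hd.integrable_comp hBm.aestronglyMeasurable).1 hB
  have hprod := hφ'.mul_prod hB'
  have hpm : Measurable fun q : ℝ × (ℕ → ℝ) => φ q.1 * B q.2 :=
    (hφm.comp measurable_fst).mul (hBm.comp measurable_snd)
  refine ⟨(h.integrable_comp (g := fun q : ℝ × (ℕ → ℝ) => φ q.1 * B q.2)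
    hpm.aestronglyMeasurable).2 hprod, ?_⟩
  have h1 : ∫ e, φ (e 0) * B (dropFirst 1 e) ∂(innovLaw μ ξ)
      = ∫ q, φ q.1 * B q.2 ∂((μ.map (ξ 0)).prod (innovLaw μ ξ)) := by
    rw [← h.map_eq, integral_map h.measurable.aemeasurable hpm.aestronglyMeasurable]
  have h2 : ∫ e, B (dropFirst 1 e) ∂(innovLaw μ ξ) = ∫ e, B e ∂(innovLaw μ ξ) := by
    conv_rhs => rw [← hd.map_eq]
    rw [integral_map hd.measurable.aemeasurable hBm.aestronglyMeasurable]
  rw [h1, h2, integral_prod_mul,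
    integral_map (hξ.measurable 0).aemeasurable hφm.aestronglyMeasurable]

/-- The change of the quasi-likelihood with the parameter, as a polynomial of the innovation `e`.
Its coefficients depend on the past only. -/
theorem quasiLik_sub_eq {M₀ g D e : ℝ} (hM : M₀ ≠ 0) (hg : 0 < g) :
    ((M₀ * e + D) ^ 2 / g + Real.log g) - ((M₀ * e) ^ 2 / M₀ ^ 2 + Real.log (M₀ ^ 2))
      = (D ^ 2 / g + (M₀ ^ 2 / g - 1 - Real.log (M₀ ^ 2 / g))) + e * (2 * M₀ * D / g)
        + (e ^ 2 - 1) * (M₀ ^ 2 / g - 1) := by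
  rw [Real.log_div (pow_ne_zero 2 hM) hg.ne']
  field_simp
  ring

theorem abs_log_le_add {h h₀ : ℝ} (h0 : 0 < h₀) (hh : h₀ ≤ h) :
    |Real.log h| ≤ |Real.log h₀| + h := by
  have h1 := Real.log_le_log h0 hh
  have h2 := Real.log_le_sub_one_of_pos (h0.trans_le hh)
  have := neg_abs_le (Real.log h₀)
  have := abs_nonneg (Real.log h₀)
  rw [abs_le]
  constructor <;> linarith

theorem measurable_quasiLik (hR : IsRegular f M Θ αf αv h₀) (hHm : Measurable H) {η : Param d}
    (hη : η ∈ Θ) : Measurable fun e => quasiLik f M η (H e) (pastOf H e) := by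
  have hp := measurable_pastOf hHm
  have h1 : Measurable fun e => f η (pastOf H e) := (hR.measurable_f η hη).comp hp
  have h2 : Measurable fun e => hFun M η (pastOf H e) := ((hR.measurable_M η hη).comp hp).pow_const 2
  exact ((hHm.sub h1).pow_const 2 |>.div h2).add (Real.measurable_log.comp h2)

theorem integrable_quasiLik (hξ : IsInnovation μ ξ) (hR : IsRegular f M Θ αf αv h₀)
    (hHm : Measurable H) (hH : MemLp H 4 (innovLaw μ ξ)) {η : Param d} (hη : η ∈ Θ) :
    Integrable (fun e => quasiLik f M η (H e) (pastOf H e)) (innovLaw μ ξ) := by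
  have := hξ.isProbabilityMeasure_innovLaw
  obtain ⟨V, hV⟩ := exists_isEnvelope hξ hR hHm hH
  have hV2 : Integrable (fun e => V e ^ 2) (innovLaw μ ξ) :=
    (hV.memLp.mono_exponent (by norm_num)).integrable_sq
  refine Integrable.mono' (g := fun e => (4 / h₀ + 1) * V e ^ 2 + |Real.log h₀|)
    ((hV2.const_mul _).add (integrable_const _))
    (measurable_quasiLik hR hHm hη).aestronglyMeasurable ?_
  filter_upwards [hV.ae_le, hV.ae_dominated] with e h1 h2
  obtain ⟨b1, b2, b3⟩ := IsEnvelope.abs_le hR h2 (hV.one_le e) hη fun k => le_rfl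
  have hh := hR.le_h η hη (pastOf H e)
  have hpos := hR.pos
  have h3 := abs_log_le_add hpos hh
  rw [Real.norm_eq_abs, quasiLik]
  refine (abs_add_le _ _).trans ?_
  have h4 : |(H e - f η (pastOf H e)) ^ 2 / hFun M η (pastOf H e)| ≤ 4 / h₀ * V e ^ 2 := by
    rw [abs_of_nonneg (div_nonneg (sq_nonneg _) (hpos.le.trans hh)), ← sq_abs, div_mul_eq_mul_div]
    have h5 : |H e - f η (pastOf H e)| ≤ 2 * V e := by
      have := abs_sub (H e) (f η (pastOf H e))
      linarith
    have h6 : |H e - f η (pastOf H e)| ^ 2 ≤ 4 * V e ^ 2 := by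
      calc _ ≤ (2 * V e) ^ 2 := by gcongr
        _ = 4 * V e ^ 2 := by ring
    gcongr
  linarith

/-- Gibbs' inequality for the Gaussian quasi-likelihood: its mean is minimal at the parameter of the
solution, and only there. -/
theorem IsSolution.integral_quasiLik_lt (hξ : IsInnovation μ ξ) (hR : IsRegular f M Θ αf αv h₀)
    (hS : IsSolution μ ξ f M θ H) (hθ : θ ∈ Θ) (hI : IsIdentified (innovLaw μ ξ) f M Θ H)
    {η : Param d} (hη : η ∈ Θ) (hne : η ≠ θ) :
    ∫ e, quasiLik f M θ (H e) (pastOf H e) ∂(innovLaw μ ξ)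
      < ∫ e, quasiLik f M η (H e) (pastOf H e) ∂(innovLaw μ ξ) := by
  have := hξ.isProbabilityMeasure_innovLaw
  have hpos := hR.pos
  obtain ⟨V, hV⟩ := exists_isEnvelope hξ hR hS.measurable hS.memLp
  have hV2 : Integrable (fun e => V e ^ 2) (innovLaw μ ξ) :=
    (hV.memLp.mono_exponent (by norm_num)).integrable_sq
  have iθ := integrable_quasiLik hξ hR hS.measurable hS.memLp hθ
  have iη := integrable_quasiLik hξ hR hS.measurable hS.memLp hη
  set D : (ℕ → ℝ) → ℝ := fun y => f θ y - f η y with hD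
  set r : (ℕ → ℝ) → ℝ := fun y => hFun M θ y / hFun M η y with hr
  set B₁ : (ℕ → ℝ) → ℝ := fun y => 2 * M θ y * D y / hFun M η y with hB₁
  set B₂ : (ℕ → ℝ) → ℝ := fun y => r y - 1 with hB₂
  have hhm : ∀ η ∈ Θ, Measurable (hFun M η) := fun η hη => (hR.measurable_M η hη).pow_const 2
  have hDm : Measurable D := (hR.measurable_f θ hθ).sub (hR.measurable_f η hη)
  have hrm : Measurable r := (hhm θ hθ).div (hhm η hη)
  have hB₁m : Measurable B₁ := (((hR.measurable_M θ hθ).const_mul 2).mul hDm).div (hhm η hη)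
  have hB₂m : Measurable B₂ := hrm.sub_const 1
  have hhist := measurable_historyOf hS.measurable
  have hpm := measurable_pastOf hS.measurable
  have hB₁i : Integrable (fun e => B₁ (pastOf H e)) (innovLaw μ ξ) := by
    refine Integrable.mono' (hV2.const_mul (4 / h₀)) (hB₁m.comp hpm).aestronglyMeasurable ?_
    filter_upwards [hV.ae_dominated] with e h2
    obtain ⟨a1, a2, -⟩ := IsEnvelope.abs_le hR h2 (hV.one_le e) hθ fun k => le_rfl
    obtain ⟨b1, -, -⟩ := IsEnvelope.abs_le hR h2 (hV.one_le e) hη fun k => le_rfl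
    have hh := hR.le_h η hη (pastOf H e)
    have hV1 := hV.one_le e
    simp only [hB₁, Real.norm_eq_abs, abs_div, abs_mul, abs_two]
    rw [abs_of_pos (hpos.trans_le hh), div_mul_eq_mul_div]
    have h5 : |D (pastOf H e)| ≤ 2 * V e := by
      have := abs_sub (f θ (pastOf H e)) (f η (pastOf H e))
      simp only [hD]; linarith
    calc 2 * |M θ (pastOf H e)| * |D (pastOf H e)| / hFun M η (pastOf H e)
        ≤ 2 * V e * (2 * V e) / h₀ := by gcongr
      _ = 4 * V e ^ 2 / h₀ := by ring
  have hB₂i : Integrable (fun e => B₂ (pastOf H e)) (innovLaw μ ξ) := by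
    refine Integrable.mono' ((hV2.const_mul (1 / h₀)).add (integrable_const 1))
      (hB₂m.comp hpm).aestronglyMeasurable ?_
    filter_upwards [hV.ae_dominated] with e h2
    obtain ⟨-, -, a3⟩ := IsEnvelope.abs_le hR h2 (hV.one_le e) hθ fun k => le_rfl
    have hh := hR.le_h η hη (pastOf H e)
    have hh' := hR.le_h θ hθ (pastOf H e)
    have hr0 : 0 ≤ r (pastOf H e) := div_nonneg (hpos.le.trans hh') (hpos.le.trans hh)
    have hr1 : r (pastOf H e) ≤ 1 / h₀ * V e ^ 2 := by
      calc r (pastOf H e) ≤ V e ^ 2 / h₀ := by simp only [hr]; gcongr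
        _ = _ := by ring
    simp only [hB₂, Real.norm_eq_abs, Pi.add_apply]
    rw [abs_le]
    constructor <;> linarith
  have hsq : Integrable (fun ω => ξ 0 ω ^ 2) μ := (hξ.memLp.mono_exponent (by norm_num)).integrable_sq
  -- the terms of the decomposition with the factors `ξ` and `ξ² - 1` have mean zero
  have h1 := hξ.integral_head_mul_tail (φ := fun x => x) measurable_id
    (hξ.memLp.integrable (by norm_num)) (B := fun e => B₁ (historyOf H e)) (hB₁m.comp hhist)
    (by simpa only [← pastOf_eq_historyOf] using hB₁i)
  have h2 := hξ.integral_head_mul_tail (φ := fun x => x ^ 2 - 1) (by fun_prop)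
    (hsq.sub (integrable_const 1)) (B := fun e => B₂ (historyOf H e)) (hB₂m.comp hhist)
    (by simpa only [← pastOf_eq_historyOf] using hB₂i)
  simp only [← pastOf_eq_historyOf] at h1 h2
  rw [hξ.mean, zero_mul] at h1
  rw [integral_sub hsq (integrable_const 1), hξ.variance] at h2
  simp only [integral_const, probReal_univ, one_smul, sub_self, zero_mul] at h2
  -- the remaining term is nonnegative, and it vanishes only if `D = 0` and `r = 1`
  set A : (ℕ → ℝ) → ℝ := fun y => D y ^ 2 / hFun M η y + (r y - 1 - Real.log (r y)) with hA
  have hA0 : ∀ y, 0 ≤ D y ^ 2 / hFun M η y ∧ 0 ≤ r y - 1 - Real.log (r y) := by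
    intro y
    have hh := hpos.trans_le (hR.le_h η hη y)
    have hh' := hpos.trans_le (hR.le_h θ hθ y)
    refine ⟨div_nonneg (sq_nonneg _) hh.le, ?_⟩
    have := Real.log_le_sub_one_of_pos (div_pos hh' hh)
    simp only [hr]; linarith
  have hid : ∀ᵐ e ∂(innovLaw μ ξ), quasiLik f M η (H e) (pastOf H e)
      - quasiLik f M θ (H e) (pastOf H e) = A (pastOf H e) + e 0 * B₁ (pastOf H e)
        + (e 0 ^ 2 - 1) * B₂ (pastOf H e) := by
    filter_upwards [hS.model] with e he
    have hh := hpos.trans_le (hR.le_h η hη (pastOf H e))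
    have hh' := hpos.trans_le (hR.le_h θ hθ (pastOf H e))
    have hM0 : M θ (pastOf H e) ≠ 0 := fun h0 => by simp [hFun, h0] at hh'
    have h3 := quasiLik_sub_eq (D := D (pastOf H e)) (e := e 0) hM0 hh
    have h4 : M θ (pastOf H e) * e 0 + D (pastOf H e) = H e - f η (pastOf H e) := by
      rw [he]; simp only [hD]; ring
    have h5 : M θ (pastOf H e) * e 0 = H e - f θ (pastOf H e) := by rw [he]; ring
    rw [h4, h5] at h3
    exact h3
  have hAeq : ∀ᵐ e ∂(innovLaw μ ξ), A (pastOf H e) = (quasiLik f M η (H e) (pastOf H e)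
      - quasiLik f M θ (H e) (pastOf H e)) - e 0 * B₁ (pastOf H e)
        - (e 0 ^ 2 - 1) * B₂ (pastOf H e) := by
    filter_upwards [hid] with e he
    rw [he]; ring
  have hAi : Integrable (fun e => A (pastOf H e)) (innovLaw μ ξ) :=
    (((iη.sub iθ).sub h1.1).sub h2.1).congr (by
      filter_upwards [hAeq] with e he; rw [he]; rfl)
  have hAint : ∫ e, A (pastOf H e) ∂(innovLaw μ ξ)
      = ∫ e, quasiLik f M η (H e) (pastOf H e) ∂(innovLaw μ ξ)
        - ∫ e, quasiLik f M θ (H e) (pastOf H e) ∂(innovLaw μ ξ) := by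
    have i1 : Integrable (fun e => quasiLik f M η (H e) (pastOf H e)
        - quasiLik f M θ (H e) (pastOf H e)) (innovLaw μ ξ) := iη.sub iθ
    have i2 : Integrable (fun e => quasiLik f M η (H e) (pastOf H e)
        - quasiLik f M θ (H e) (pastOf H e) - e 0 * B₁ (pastOf H e)) (innovLaw μ ξ) := i1.sub h1.1
    rw [integral_congr_ae hAeq, integral_sub i2 h2.1, h2.2, integral_sub i1 h1.1, h1.2,
      integral_sub iη iθ]
    ring
  rw [← sub_pos, ← hAint]
  refine lt_of_le_of_ne (integral_nonneg fun e => add_nonneg (hA0 _).1 (hA0 _).2) fun h0 => hne ?_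
  have hz := (integral_eq_zero_iff_of_nonneg (fun e => add_nonneg (hA0 _).1 (hA0 _).2) hAi).1 h0.symm
  refine hI.eq_of_ae_eq η hη θ hθ ?_
  filter_upwards [hz] with e he
  have he' : A (pastOf H e) = 0 := he
  have hh := hpos.trans_le (hR.le_h η hη (pastOf H e))
  have hh' := hpos.trans_le (hR.le_h θ hθ (pastOf H e))
  have c1 : D (pastOf H e) ^ 2 / hFun M η (pastOf H e) = 0 := by
    have := (hA0 (pastOf H e)).1
    have := (hA0 (pastOf H e)).2
    simp only [hA] at he'; linarith
  have c2 : r (pastOf H e) - 1 - Real.log (r (pastOf H e)) = 0 := by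
    simp only [hA] at he'; linarith
  have c3 : D (pastOf H e) = 0 := by
    rcases div_eq_zero_iff.1 c1 with h | h
    · exact pow_eq_zero_iff (two_ne_zero) |>.1 h
    · exact absurd h hh.ne'
  have c4 : r (pastOf H e) = 1 := by
    by_contra hr1
    have := Real.log_lt_sub_one_of_pos (div_pos hh' hh) hr1
    simp only [hr] at c2
    linarith
  refine ⟨(sub_eq_zero.1 c3).symm, ?_⟩
  simp only [hr] at c4
  rw [div_eq_one_iff_eq hh.ne'] at c4
  exact c4.symm

end

/-! ### Consistency of the quasi-likelihood estimators -/

section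

variable {Ω : Type*} [MeasurableSpace Ω] {μ : Measure Ω} [IsProbabilityMeasure μ] {ξ : ℤ → Ω → ℝ}
variable {d : ℕ} {f M : Family d} {Θ : Set (Param d)} {αf αv : ℕ → ℕ → ℝ} {h₀ : ℝ}
variable {θ : Param d} {H : (ℕ → ℝ) → ℝ}

/-- The path `x`, replaced with `0` at the times `t ≤ 0`. -/
def zeroBefore (x : ℤ → ℝ) : ℤ → ℝ := fun t => if 1 ≤ t then x t else 0

theorem truncPast_eq_past (x : ℤ → ℝ) (t : ℕ) : truncPast x t = past (zeroBefore x) t := by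
  funext i
  simp only [truncPast, past, zeroBefore]
  have : i + 1 < t ↔ (1 : ℤ) ≤ (t : ℤ) - 1 - i := by omega
  simp only [this]

theorem qHat_eq_quasiLik (x : ℤ → ℝ) (t : ℕ) (θ : Param d) :
    qHat f M x t θ = quasiLik f M θ (x t) (truncPast x t) := rfl

/-- The observed part of the path `x` is close to the path `z` on the segment `(a, b]`, with errors
`w_m` from `m` time units after the beginning of the segment. The error `w_0` is for all the times
up to `b`, including those before the segment. -/
def IsCloseOn (w : ℕ → ℤ → ℝ) (z x : ℤ → ℝ) (a b : ℕ) : Prop :=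
  ∀ (m : ℕ) (t : ℤ), t ≤ b → m = 0 ∨ (a : ℤ) + m ≤ t → |zeroBefore x t - z t| ≤ w m t

/-- On long segments, the observable quasi-likelihood is close in the mean to the one computed with
the stationary process. -/
theorem ae_exists_qHat_sub_le (hξ : IsInnovation μ ξ) (hR : IsRegular f M Θ αf αv h₀)
    (hHm : Measurable H) (hH : MemLp H 4 (innovLaw μ ξ)) {w : ℕ → (ℕ → ℝ) → ℝ}
    (hw : IsVanishing (innovLaw μ ξ) 4 w) :
    ∀ᵐ ω ∂μ, ∀ (x : ℕ → ℤ → ℝ) (a b : ℕ → ℕ), IsLongSegment a b →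
      (∀ n, IsCloseOn (fun m t => w m (innovPast ξ t ω)) (fun t => H (innovPast ξ t ω))
        (x n) (a n) (b n)) →
      ∃ r : ℕ → ℕ → ℝ,
        (∀ n, ∀ t ∈ Finset.Icc (a n + 1) (b n), ∀ η ∈ Θ, |qHat f M (x n) t η
          - quasiLik f M η (H (innovPast ξ t ω)) (pastOf H (innovPast ξ t ω))| ≤ r n t) ∧
        Tendsto (fun n => (∑ t ∈ Finset.Icc (a n + 1) (b n), r n t) / ((b n : ℝ) - a n))
          atTop (𝓝 0) := by
  obtain ⟨ε, hε, hεb⟩ := exists_isVanishing_quasiLik hξ hR hHm hH hw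
  have h1 : ∀ᵐ ω ∂μ, ∀ m, Tendsto
      (fun n : ℕ => (∑ t ∈ Finset.Icc 1 n, ε m (innovPast ξ t ω)) / n) atTop
      (𝓝 (∫ e, ε m e ∂(innovLaw μ ξ))) :=
    ae_all_iff.2 fun m => hξ.ae_tendsto_average (hε.measurable m) (hε.integrable m)
  have h2 := ae_all_iff.2 fun t : ℤ =>
    (hξ.measurePreserving_innovPast t).quasiMeasurePreserving.ae hεb
  filter_upwards [h1, h2] with ω hω1 hω2 x a b hs hx
  -- the bound at time `t` is the best of those which its distance to the beginning of the segment
  -- allows; after `2m` time units the errors of the path at the `m` most recent lags are below `w m`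
  set A : ℕ → ℕ → Type := fun n t => {m : ℕ // m = 0 ∨ a n + 2 * m ≤ t} with hA
  have hne : ∀ n t, Nonempty (A n t) := fun n t => ⟨⟨0, Or.inl rfl⟩⟩
  refine ⟨fun n t => ⨅ m : A n t, ε m.1 (innovPast ξ t ω), fun n t ht η hη => ?_, ?_⟩
  · have := hne n t
    refine le_ciInf fun m => ?_
    obtain ⟨m, hm⟩ := m
    rw [Finset.mem_Icc] at ht
    rw [qHat_eq_quasiLik, truncPast_eq_past]
    refine hω2 t (x n t) _ m ?_ (fun k => ?_) η hη
    · have h3 := hx n m t (by omega) (by omega)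
      have h4 : zeroBefore (x n) t = x n t := if_pos (by omega)
      rwa [h4] at h3
    · rw [dropFirst_innovPast, pastOf_innovPast]
      simp only [past]
      have h5 : (t : ℤ) - ((k + 1 : ℕ) : ℤ) = t - 1 - k := by push_cast; ring
      rw [h5]
      split_ifs with hk
      · exact hx n m _ (by omega) (by omega)
      · exact hx n 0 _ (by omega) (Or.inl rfl)
  · refine hs.tendsto_average_zero (c := fun m t => ε m (innovPast ξ t ω))
      (fun m t => hε.nonneg _ _) hω1 hε.tendsto_integral
      (fun n t => Real.iInf_nonneg fun m => hε.nonneg _ _) fun n m t ht hm => ?_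
    exact ciInf_le (f := fun m : A n t => ε m.1 (innovPast ξ t ω))
      ⟨0, by rintro _ ⟨m, rfl⟩; exact hε.nonneg _ _⟩ ⟨m, hm⟩

theorem continuousOn_quasiLik (hR : IsRegular f M Θ αf αv h₀) (u : ℝ) (y : ℕ → ℝ) :
    ContinuousOn (fun p => quasiLik f M p u y) Θ := by
  have hf : ContinuousOn (fun p => f p y) Θ := fun p hp =>
    (hR.smooth_f y p hp).continuousAt.continuousWithinAt
  have hM : ContinuousOn (fun p => hFun M p y) Θ := fun p hp =>
    ((hR.smooth_M y p hp).continuousAt.pow 2).continuousWithinAt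
  have h0 : ∀ p ∈ Θ, hFun M p y ≠ 0 := fun p hp => (hR.pos.trans_le (hR.le_h p hp y)).ne'
  exact (((continuousOn_const.sub hf).pow 2).div hM h0).add (hM.log h0)

theorem IsQLME.sum_qHat_le {x : ℤ → ℝ} {T : Finset ℕ} {p η : Param d} (h : IsQLME f M Θ x T p)
    (hη : η ∈ Θ) : ∑ t ∈ T, qHat f M x t p ≤ ∑ t ∈ T, qHat f M x t η := by
  have h1 : LHat f M x T η ≤ LHat f M x T p := h.2 hη
  unfold LHat at h1
  linarith

/-- Along long segments on which the path is close to a stationary solution of the model, the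
quasi-likelihood estimators converge to the parameter of this solution. -/
theorem IsSolution.ae_tendsto_of_isQLME (hξ : IsInnovation μ ξ) (hR : IsRegular f M Θ αf αv h₀)
    (hS : IsSolution μ ξ f M θ H) (hθ : θ ∈ Θ) (hI : IsIdentified (innovLaw μ ξ) f M Θ H)
    {w : ℕ → (ℕ → ℝ) → ℝ} (hw : IsVanishing (innovLaw μ ξ) 4 w) :
    ∀ᵐ ω ∂μ, ∀ (x : ℕ → ℤ → ℝ) (a b : ℕ → ℕ) (est : ℕ → Param d), IsLongSegment a b →
      (∀ n, IsCloseOn (fun m t => w m (innovPast ξ t ω)) (fun t => H (innovPast ξ t ω))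
        (x n) (a n) (b n)) →
      (∀ n, IsQLME f M Θ (x n) (Finset.Icc (a n + 1) (b n)) (est n)) →
      Tendsto est atTop (𝓝 θ) := by
  have := hξ.isProbabilityMeasure_innovLaw
  -- the estimators eventually leave every compact set of parameters which does not contain `θ`
  have key : ∀ K : Set (Param d), IsCompact K → K ⊆ Θ \ {θ} →
      ∀ᵐ ω ∂μ, ∀ (x : ℕ → ℤ → ℝ) (a b : ℕ → ℕ) (est : ℕ → Param d), IsLongSegment a b →
      (∀ n, IsCloseOn (fun m t => w m (innovPast ξ t ω)) (fun t => H (innovPast ξ t ω))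
        (x n) (a n) (b n)) →
      (∀ n, IsQLME f M Θ (x n) (Finset.Icc (a n + 1) (b n)) (est n)) →
      ∀ᶠ n in atTop, est n ∉ K := by
    intro K hK hKΘ
    refine hK.induction_on (p := fun K => ∀ᵐ ω ∂μ, ∀ (x : ℕ → ℤ → ℝ) (a b : ℕ → ℕ)
      (est : ℕ → Param d), IsLongSegment a b →
      (∀ n, IsCloseOn (fun m t => w m (innovPast ξ t ω)) (fun t => H (innovPast ξ t ω))
        (x n) (a n) (b n)) →
      (∀ n, IsQLME f M Θ (x n) (Finset.Icc (a n + 1) (b n)) (est n)) →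
      ∀ᶠ n in atTop, est n ∉ K) ?_ ?_ ?_ ?_
    · exact Eventually.of_forall fun ω x a b est _ _ _ => by simp
    · intro s t hst ht
      filter_upwards [ht] with ω hω x a b est h1 h2 h3
      filter_upwards [hω x a b est h1 h2 h3] with n hn hmem using hn (hst hmem)
    · intro s t hs ht
      filter_upwards [hs, ht] with ω h₁ h₂ x a b est h1 h2 h3
      filter_upwards [h₁ x a b est h1 h2 h3, h₂ x a b est h1 h2 h3] with n n1 n2 hmem
      exact hmem.elim n1 n2
    -- near `η ≠ θ` the mean of the quasi-likelihood exceeds the one at `θ`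
    · intro η hη
      obtain ⟨hηΘ, hηne⟩ := hKΘ hη
      obtain ⟨U, hU, T, ψ, hψm, hψi, hψc, hψ⟩ := exists_integrable_lower_bound_of_continuousOn
        (P := innovLaw μ ξ) (K := Θ) (Φ := fun _ p e => quasiLik f M p (H e) (pastOf H e))
        (fun _ p hp => measurable_quasiLik hR hS.measurable hp)
        (fun _ e => continuousOn_quasiLik hR _ _) (g := fun _ => |Real.log h₀|) measurable_const
        (integrable_const _)
        (Eventually.of_forall fun e _ p hp => by
          have hh := hR.le_h p hp (pastOf H e)
          have h1 := Real.log_le_log hR.pos hh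
          have h2 := neg_abs_le (Real.log h₀)
          have h3 : 0 ≤ (H e - f p (pastOf H e)) ^ 2 / hFun M p (pastOf H e) :=
            div_nonneg (sq_nonneg _) (hR.pos.le.trans hh)
          unfold quasiLik
          linarith) hηΘ (measurable_quasiLik hR hS.measurable hηΘ)
        (integrable_quasiLik hξ hR hS.measurable hS.memLp hηΘ)
        (Eventually.of_forall fun e =>
          Tendsto.comp (continuousOn_quasiLik hR (H e) (pastOf H e) η hηΘ) tendsto_snd)
        (hS.integral_quasiLik_lt hξ hR hθ hI hηΘ hηne)
      refine ⟨U ∩ K, inter_mem (mem_nhdsWithin_of_mem_nhds hU) self_mem_nhdsWithin, ?_⟩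
      filter_upwards [ae_exists_qHat_sub_le hξ hR hS.measurable hS.memLp hw,
        hξ.ae_tendsto_average hψm hψi,
        hξ.ae_tendsto_average (measurable_quasiLik hR hS.measurable hθ)
          (integrable_quasiLik hξ hR hS.measurable hS.memLp hθ),
        ae_all_iff.2 fun t : ℤ => (hξ.measurePreserving_innovPast t).quasiMeasurePreserving.ae hψ]
        with ω hω1 hω2 hω3 hω4 x a b est hs hx hest
      obtain ⟨r, hr, hr0⟩ := hω1 x a b hs hx
      have hlim := ((hs.tendsto_average hω2).sub (hs.tendsto_average hω3)).sub (hr0.const_mul 2)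
      rw [mul_zero, sub_zero] at hlim
      filter_upwards [hlim.eventually_const_lt (sub_pos.2 hψc), hs.tendsto.eventually_gt_atTop 0]
        with n hn hN hmem
      set N := (b n : ℝ) - a n
      set I := Finset.Icc (a n + 1) (b n)
      have hp : est n ∈ Θ := (hKΘ hmem.2).1
      have s1 := (hest n).sum_qHat_le hθ
      have s2 : ∑ t ∈ I, (ψ (innovPast ξ t ω) - r n t) ≤ ∑ t ∈ I, qHat f M (x n) t (est n) := by
        refine Finset.sum_le_sum fun t ht => ?_
        have e1 := (abs_le.1 (hr n t ht _ hp)).1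
        have e2 := hω4 t T le_rfl _ hmem.1 hp
        linarith
      have s3 : ∑ t ∈ I, qHat f M (x n) t θ ≤ ∑ t ∈ I, (quasiLik f M θ (H (innovPast ξ t ω))
          (pastOf H (innovPast ξ t ω)) + r n t) := by
        refine Finset.sum_le_sum fun t ht => ?_
        have e1 := (abs_le.1 (hr n t ht _ hθ)).2
        linarith
      rw [Finset.sum_sub_distrib] at s2
      rw [Finset.sum_add_distrib] at s3
      have hn' : 0 < (∑ t ∈ I, ψ (innovPast ξ t ω) - ∑ t ∈ I, quasiLik f M θ
          (H (innovPast ξ t ω)) (pastOf H (innovPast ξ t ω)) - 2 * ∑ t ∈ I, r n t) / N := by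
        rw [sub_div, sub_div, mul_div_assoc]
        exact hn
      rw [lt_div_iff₀ hN, zero_mul] at hn'
      linarith
  have hcpt : ∀ j : ℕ, IsCompact (Θ \ Metric.ball θ (1 / ((j : ℝ) + 1))) := fun j =>
    hR.compact.diff Metric.isOpen_ball
  have hall := ae_all_iff.2 fun j : ℕ => key _ (hcpt j) fun p hp =>
    ⟨hp.1, fun h => hp.2 (by
      rw [Set.mem_singleton_iff.1 h]
      exact Metric.mem_ball_self (by positivity))⟩
  filter_upwards [hall] with ω hω x a b est hs hx hest
  rw [Metric.tendsto_nhds]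
  intro δ hδ
  obtain ⟨j, hj⟩ := exists_nat_one_div_lt hδ
  filter_upwards [hω j x a b est hs hx hest] with n hn
  by_contra hfar
  refine hn ⟨(hest n).1, fun hb => hfar ?_⟩
  exact (Metric.mem_ball.1 hb).trans hj

end

/-! ### Derivatives of the quasi-likelihood -/

section

section Calculus

/-- The derivative of `z² / g + log g`, where `z` and `g` have the derivatives `z₁` and `g₁`. -/
def score (z z₁ g g₁ : ℝ) : ℝ := 2 * z * z₁ / g - z ^ 2 * g₁ / g ^ 2 + g₁ / g

/-- The second derivative of `z² / g + log g`, where `z` and `g` have the first derivatives `z₁`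
and `g₁` and the second derivatives `z₂` and `g₂`. -/
def scoreDeriv (z z₁ z₂ g g₁ g₂ : ℝ) : ℝ :=
  2 * z₁ ^ 2 / g + 2 * z * z₂ / g - 4 * z * z₁ * g₁ / g ^ 2 + 2 * z ^ 2 * g₁ ^ 2 / g ^ 3
    - z ^ 2 * g₂ / g ^ 2 + g₂ / g - g₁ ^ 2 / g ^ 2

theorem hasDerivAt_sq_div_add_log {z g : ℝ → ℝ} {z₁ g₁ s : ℝ} (hz : HasDerivAt z z₁ s)
    (hg : HasDerivAt g g₁ s) (hpos : 0 < g s) :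
    HasDerivAt (fun s => z s ^ 2 / g s + Real.log (g s)) (score (z s) z₁ (g s) g₁) s := by
  refine (((hz.pow 2).div hg hpos.ne').add (hg.log hpos.ne')).congr_deriv ?_
  unfold score
  simp only [Pi.pow_apply]
  field_simp
  push_cast
  ring

theorem hasDerivAt_score {z z₁ g g₁ : ℝ → ℝ} {z₂ g₂ s : ℝ} (hz : HasDerivAt z (z₁ s) s)
    (hz₁ : HasDerivAt z₁ z₂ s) (hg : HasDerivAt g (g₁ s) s) (hg₁ : HasDerivAt g₁ g₂ s)
    (hpos : 0 < g s) :
    HasDerivAt (fun s => score (z s) (z₁ s) (g s) (g₁ s))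
      (scoreDeriv (z s) (z₁ s) z₂ (g s) (g₁ s) g₂) s := by
  have h := ((((hz.const_mul 2).mul hz₁).div hg hpos.ne').sub
    (((hz.pow 2).mul hg₁).div (hg.pow 2) (pow_pos hpos 2).ne')).add (hg₁.div hg hpos.ne')
  refine h.congr_deriv ?_
  unfold scoreDeriv
  simp only [Pi.pow_apply, Pi.mul_apply]
  field_simp
  push_cast
  ring

variable {E : Type*} [NormedAddCommGroup E] [NormedSpace ℝ E]

theorem _root_.ContDiffAt.differentiableAt_fderiv_two {a : E → ℝ} {θ : E} (h : ContDiffAt ℝ 2 a θ) :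
    DifferentiableAt ℝ (fderiv ℝ a) θ :=
  (h.fderiv_right (m := 1) (by norm_num)).differentiableAt (by norm_num)

theorem hasLineDerivAt_fderiv_apply {a : E → ℝ} {θ : E} (h : ContDiffAt ℝ 2 a θ) (v : E) :
    HasLineDerivAt ℝ (fun η => fderiv ℝ a η v) (fderiv ℝ (fderiv ℝ a) θ v v) θ v :=
  ((h.differentiableAt_fderiv_two.hasFDerivAt.clm_apply (hasFDerivAt_const v θ)).hasLineDerivAt
    v).congr_deriv (by simp)

variable {a g : E → ℝ} {θ : E}

theorem contDiffAt_sq_div_add_log (u : ℝ) (ha : ContDiffAt ℝ 2 a θ) (hg : ContDiffAt ℝ 2 g θ)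
    (hpos : 0 < g θ) :
    ContDiffAt ℝ 2 (fun η => (u - a η) ^ 2 / g η + Real.log (g η)) θ :=
  (((contDiffAt_const.sub ha).pow 2).div hg hpos.ne').add (hg.log hpos.ne')

theorem fderiv_sq_div_add_log (u : ℝ) (ha : ContDiffAt ℝ 2 a θ) (hg : ContDiffAt ℝ 2 g θ)
    (hpos : 0 < g θ) (v : E) :
    fderiv ℝ (fun η => (u - a η) ^ 2 / g η + Real.log (g η)) θ v
      = score (u - a θ) (-fderiv ℝ a θ v) (g θ) (fderiv ℝ g θ v) := by
  have h1 := ((contDiffAt_sq_div_add_log u ha hg hpos).differentiableAt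
    (by norm_num)).hasFDerivAt.hasLineDerivAt v
  have h2 := (ha.differentiableAt (by norm_num)).hasFDerivAt.hasLineDerivAt v
  have h3 := (hg.differentiableAt (by norm_num)).hasFDerivAt.hasLineDerivAt v
  have h4 := hasDerivAt_sq_div_add_log (z := fun s : ℝ => u - a (θ + s • v))
    (HasDerivAt.const_sub u h2) h3 (by simpa using hpos)
  have h5 := HasDerivAt.unique h1 h4
  simpa using h5

theorem fderiv_fderiv_sq_div_add_log (u : ℝ) (ha : ContDiffAt ℝ 2 a θ) (hg : ContDiffAt ℝ 2 g θ)
    (hpos : 0 < g θ) (v : E) :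
    fderiv ℝ (fderiv ℝ fun η => (u - a η) ^ 2 / g η + Real.log (g η)) θ v v
      = scoreDeriv (u - a θ) (-fderiv ℝ a θ v) (-fderiv ℝ (fderiv ℝ a) θ v v) (g θ)
        (fderiv ℝ g θ v) (fderiv ℝ (fderiv ℝ g) θ v v) := by
  have h1 := hasLineDerivAt_fderiv_apply (contDiffAt_sq_div_add_log u ha hg hpos) v
  have hev : ∀ᶠ η in 𝓝 θ, fderiv ℝ (fun η => (u - a η) ^ 2 / g η + Real.log (g η)) η v
      = score (u - a η) (-fderiv ℝ a η v) (g η) (fderiv ℝ g η v) := by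
    filter_upwards [ha.eventually (by simp), hg.eventually (by simp),
      hg.continuousAt.eventually_const_lt hpos] with η e1 e2 e3
    exact fderiv_sq_div_add_log u e1 e2 e3 v
  have hline : Tendsto (fun s : ℝ => θ + s • v) (𝓝 0) (𝓝 θ) := by
    have : Continuous fun s : ℝ => θ + s • v := by fun_prop
    simpa using this.tendsto 0
  have h1' : HasDerivAt (fun s : ℝ => fderiv ℝ (fun η => (u - a η) ^ 2 / g η + Real.log (g η))
      (θ + s • v) v) _ 0 := h1
  have h2 : HasDerivAt (fun s : ℝ => score (u - a (θ + s • v)) (-fderiv ℝ a (θ + s • v) v)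
      (g (θ + s • v)) (fderiv ℝ g (θ + s • v) v)) _ 0 :=
    h1'.congr_of_eventuallyEq (Filter.EventuallyEq.symm (hline.eventually hev))
  have b1 := (ha.differentiableAt (by norm_num)).hasFDerivAt.hasLineDerivAt v
  have b2 := (hg.differentiableAt (by norm_num)).hasFDerivAt.hasLineDerivAt v
  have h3 := hasDerivAt_score (s := 0) (z := fun s : ℝ => u - a (θ + s • v))
    (z₁ := fun s : ℝ => -fderiv ℝ a (θ + s • v) v) (g := fun s : ℝ => g (θ + s • v))
    (g₁ := fun s : ℝ => fderiv ℝ g (θ + s • v) v)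
    (by simpa using HasDerivAt.const_sub u b1) (hasLineDerivAt_fderiv_apply ha v).neg
    (by
      have b3 : HasDerivAt (fun s : ℝ => g (θ + s • v)) (fderiv ℝ g θ v) 0 := b2
      simpa using b3) (hasLineDerivAt_fderiv_apply hg v) (by simpa using hpos)
  have h4 := HasDerivAt.unique h2 h3
  simpa using h4

/-- The derivatives of `h = M²`. -/
theorem fderiv_sq {m : E → ℝ} (hm : DifferentiableAt ℝ m θ) :
    fderiv ℝ (fun η => m η ^ 2) θ = (2 * m θ) • fderiv ℝ m θ := by
  have h := (hm.hasFDerivAt.pow 2).fderiv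
  rw [h]
  ext v
  simp

theorem fderiv_fderiv_sq {m : E → ℝ} (hm : ContDiffAt ℝ 2 m θ) :
    fderiv ℝ (fderiv ℝ fun η => m η ^ 2) θ = (2 * m θ) • fderiv ℝ (fderiv ℝ m) θ
      + ((2 : ℝ) • fderiv ℝ m θ).smulRight (fderiv ℝ m θ) := by
  have hev : (fderiv ℝ fun η => m η ^ 2) =ᶠ[𝓝 θ] fun η => (2 * m η) • fderiv ℝ m η := by
    filter_upwards [hm.eventually (by simp)] with η e1
    exact fderiv_sq (e1.differentiableAt (by norm_num))
  rw [hev.fderiv_eq]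
  have h1 := (hm.differentiableAt (by norm_num)).hasFDerivAt.const_mul 2
  have h2 := hm.differentiableAt_fderiv_two.hasFDerivAt
  exact (h1.smul h2).fderiv

end Calculus

section Bounds

/-- Bounds for the residual `z`, for the conditional variance `g` and for their derivatives. The
alternative for `g₂` reflects the alternative in the assumptions: a bound for the second derivative
either of `h` or of `M`. -/
structure HasScoreBound (h₀ V z z₁ z₂ g g₁ g₂ : ℝ) : Prop where
  one_le : 1 ≤ V
  le_g : h₀ ≤ g
  abs_z : |z| ≤ 2 * V
  abs_z₁ : |z₁| ≤ V
  abs_z₂ : |z₂| ≤ V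
  abs_g₁ : |g₁| ≤ 2 * V ^ 2
  abs_g₂ : |g₂| ≤ V ^ 2 ∨ ∃ m m₁ m₂ : ℝ, g = m ^ 2 ∧ |m| ≤ V ∧ g₁ = 2 * m * m₁ ∧
    g₂ = 2 * m₁ ^ 2 + 2 * m * m₂ ∧ |m₂| ≤ V

/-- A lower bound for the second derivative. If only the second derivative of `M` is bounded, the
term `M'²` of `h'' = 2 M'² + 2 M M''` may exceed `V²`, but it is compensated by the term
`2 z² h'² / h³`. -/
theorem HasScoreBound.le_scoreDeriv {h₀ V z z₁ z₂ g g₁ g₂ : ℝ} (h0 : 0 < h₀)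
    (h : HasScoreBound h₀ V z z₁ z₂ g g₁ g₂) :
    -((6 / h₀ + 28 / h₀ ^ 2) * V ^ 4) ≤ scoreDeriv z z₁ z₂ g g₁ g₂ := by
  obtain ⟨hV, hg, hz, hz₁, hz₂, hg₁, h2⟩ := h
  have hg0 : 0 < g := h0.trans_le hg
  have hV0 : 0 < V := by linarith
  have hV24 : V ^ 2 ≤ V ^ 4 := pow_le_pow_right₀ hV (by norm_num)
  have e1 : |2 * z * z₂ / g| ≤ 4 / h₀ * V ^ 4 := by
    rw [abs_div, abs_mul, abs_mul, abs_two, abs_of_pos hg0]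
    calc 2 * |z| * |z₂| / g ≤ 2 * (2 * V) * V / h₀ := by gcongr
      _ = 4 / h₀ * V ^ 2 := by ring
      _ ≤ 4 / h₀ * V ^ 4 := by gcongr
  have e2 : |4 * z * z₁ * g₁ / g ^ 2| ≤ 16 / h₀ ^ 2 * V ^ 4 := by
    rw [abs_div, abs_mul, abs_mul, abs_mul, abs_of_pos (pow_pos hg0 2),
      abs_of_pos (show (0 : ℝ) < 4 by norm_num)]
    calc 4 * |z| * |z₁| * |g₁| / g ^ 2 ≤ 4 * (2 * V) * V * (2 * V ^ 2) / h₀ ^ 2 := by gcongr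
      _ = 16 / h₀ ^ 2 * V ^ 4 := by ring
  have e3 : g₁ ^ 2 / g ^ 2 ≤ 4 / h₀ ^ 2 * V ^ 4 := by
    rw [← sq_abs g₁]
    calc |g₁| ^ 2 / g ^ 2 ≤ (2 * V ^ 2) ^ 2 / h₀ ^ 2 := by gcongr
      _ = 4 / h₀ ^ 2 * V ^ 4 := by ring
  have e4 : 0 ≤ 2 * z₁ ^ 2 / g := by positivity
  have hzz : z ^ 2 ≤ 4 * V ^ 2 := by
    rw [← sq_abs z]
    calc |z| ^ 2 ≤ (2 * V) ^ 2 := by gcongr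
      _ = 4 * V ^ 2 := by ring
  -- the terms with the second derivative of `h`
  have e5 : -(2 / h₀ * V ^ 4 + 8 / h₀ ^ 2 * V ^ 4)
      ≤ 2 * z ^ 2 * g₁ ^ 2 / g ^ 3 - z ^ 2 * g₂ / g ^ 2 + g₂ / g := by
    have bound : ∀ b : ℝ, |b| ≤ 2 * V ^ 2 →
        -(2 / h₀ * V ^ 4 + 8 / h₀ ^ 2 * V ^ 4) ≤ - (z ^ 2 * b / g ^ 2) + b / g := by
      intro b hb
      have c1 : |z ^ 2 * b / g ^ 2| ≤ 8 / h₀ ^ 2 * V ^ 4 := by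
        rw [abs_div, abs_mul, abs_of_pos (pow_pos hg0 2), abs_of_nonneg (sq_nonneg z)]
        calc z ^ 2 * |b| / g ^ 2 ≤ 4 * V ^ 2 * (2 * V ^ 2) / h₀ ^ 2 := by gcongr
          _ = 8 / h₀ ^ 2 * V ^ 4 := by ring
      have c2 : |b / g| ≤ 2 / h₀ * V ^ 4 := by
        rw [abs_div, abs_of_pos hg0]
        calc |b| / g ≤ 2 * V ^ 2 / h₀ := by gcongr
          _ = 2 / h₀ * V ^ 2 := by ring
          _ ≤ 2 / h₀ * V ^ 4 := by gcongr
      have := (abs_le.1 c1).2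
      have := (abs_le.1 c2).1
      linarith
    rcases h2 with h2 | ⟨m, m₁, m₂, rfl, hm, rfl, rfl, hm₂⟩
    · have := bound g₂ (by nlinarith)
      have : 0 ≤ 2 * z ^ 2 * g₁ ^ 2 / g ^ 3 := by positivity
      linarith
    · have := bound (2 * m * m₂) (by
        rw [abs_mul, abs_mul, abs_two]
        calc 2 * |m| * |m₂| ≤ 2 * V * V := by gcongr
          _ = 2 * V ^ 2 := by ring)
      have hm0 : m ≠ 0 := by rintro rfl; simp at hg0
      have h3 : 2 * z ^ 2 * (2 * m * m₁) ^ 2 / (m ^ 2) ^ 3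
          - z ^ 2 * (2 * m₁ ^ 2 + 2 * m * m₂) / (m ^ 2) ^ 2 + (2 * m₁ ^ 2 + 2 * m * m₂) / m ^ 2
          = 6 * z ^ 2 * m₁ ^ 2 / (m ^ 2) ^ 2 + 2 * m₁ ^ 2 / m ^ 2
            + (-(z ^ 2 * (2 * m * m₂) / (m ^ 2) ^ 2) + (2 * m * m₂) / m ^ 2) := by
        field_simp
        ring
      rw [h3]
      have : 0 ≤ 6 * z ^ 2 * m₁ ^ 2 / (m ^ 2) ^ 2 + 2 * m₁ ^ 2 / m ^ 2 := by positivity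
      linarith
  have h6 : (6 / h₀ + 28 / h₀ ^ 2) * V ^ 4 = 4 / h₀ * V ^ 4 + 16 / h₀ ^ 2 * V ^ 4
      + 4 / h₀ ^ 2 * V ^ 4 + (2 / h₀ * V ^ 4 + 8 / h₀ ^ 2 * V ^ 4) := by ring
  have := (abs_le.1 e1).1
  have := (abs_le.1 e2).2
  unfold scoreDeriv
  linarith

theorem HasScoreBound.abs_score_le {h₀ V z z₁ z₂ g g₁ g₂ : ℝ} (h0 : 0 < h₀)
    (h : HasScoreBound h₀ V z z₁ z₂ g g₁ g₂) :
    |score z z₁ g g₁| ≤ (6 / h₀ + 8 / h₀ ^ 2) * V ^ 4 := by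
  obtain ⟨hV, hg, hz, hz₁, -, hg₁, -⟩ := h
  have hg0 : 0 < g := h0.trans_le hg
  have hV0 : 0 < V := by linarith
  have hV24 : V ^ 2 ≤ V ^ 4 := pow_le_pow_right₀ hV (by norm_num)
  have e1 : |2 * z * z₁ / g| ≤ 4 / h₀ * V ^ 4 := by
    rw [abs_div, abs_mul, abs_mul, abs_two, abs_of_pos hg0]
    calc 2 * |z| * |z₁| / g ≤ 2 * (2 * V) * V / h₀ := by gcongr
      _ = 4 / h₀ * V ^ 2 := by ring
      _ ≤ 4 / h₀ * V ^ 4 := by gcongr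
  have hzz : z ^ 2 ≤ 4 * V ^ 2 := by
    rw [← sq_abs z]
    calc |z| ^ 2 ≤ (2 * V) ^ 2 := by gcongr
      _ = 4 * V ^ 2 := by ring
  have e2 : |z ^ 2 * g₁ / g ^ 2| ≤ 8 / h₀ ^ 2 * V ^ 4 := by
    rw [abs_div, abs_mul, abs_of_pos (pow_pos hg0 2), abs_of_nonneg (sq_nonneg z)]
    calc z ^ 2 * |g₁| / g ^ 2 ≤ 4 * V ^ 2 * (2 * V ^ 2) / h₀ ^ 2 := by gcongr
      _ = 8 / h₀ ^ 2 * V ^ 4 := by ring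
  have e3 : |g₁ / g| ≤ 2 / h₀ * V ^ 4 := by
    rw [abs_div, abs_of_pos hg0]
    calc |g₁| / g ≤ 2 * V ^ 2 / h₀ := by gcongr
      _ = 2 / h₀ * V ^ 2 := by ring
      _ ≤ 2 / h₀ * V ^ 4 := by gcongr
  rw [abs_le] at e1 e2 e3 ⊢
  unfold score
  have h6 : (6 / h₀ + 8 / h₀ ^ 2) * V ^ 4 = 4 / h₀ * V ^ 4 + 8 / h₀ ^ 2 * V ^ 4
      + 2 / h₀ * V ^ 4 := by ring
  constructor <;> linarith

end Bounds

section Measurability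

variable {α E : Type*} [MeasurableSpace α] [NormedAddCommGroup E] [NormedSpace ℝ E]

/-- A directional derivative with respect to a parameter of measurable functions is measurable. -/
theorem measurable_fderiv_apply_param {F : E → α → ℝ} {U : Set E} (hU : IsOpen U)
    (hm : ∀ η ∈ U, Measurable (F η)) (hd : ∀ x, ∀ η ∈ U, DifferentiableAt ℝ (fun η => F η x) η)
    (v : E) {η : E} (hη : η ∈ U) : Measurable fun x => fderiv ℝ (fun η => F η x) η v := by
  have hc : Tendsto (fun n : ℕ => (n : ℝ) + 1) atTop atTop :=
    tendsto_atTop_add_const_right _ _ tendsto_natCast_atTop_atTop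
  have hline : Tendsto (fun n : ℕ => η + ((n : ℝ) + 1)⁻¹ • v) atTop (𝓝 η) := by
    simpa using (hc.inv_tendsto_atTop.smul_const v).const_add η
  obtain ⟨N, hN⟩ := eventually_atTop.1 (hline.eventually (hU.mem_nhds hη))
  refine measurable_of_tendsto_metrizable (f := fun n : ℕ => fun x =>
    (((n + N : ℕ) : ℝ) + 1) * (F (η + (((n + N : ℕ) : ℝ) + 1)⁻¹ • v) x - F η x))
    (fun n => ((hm _ (hN _ (by omega))).sub (hm η hη)).const_mul _) ?_
  rw [tendsto_pi_nhds]
  intro x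
  exact (hd x η hη).hasFDerivAt.lim v (c := fun n : ℕ => ((n + N : ℕ) : ℝ) + 1)
    (tendsto_norm_atTop_atTop.comp (hc.comp (tendsto_add_atTop_nat N)))

/-- The corresponding property of second derivatives. -/
theorem measurable_fderiv_fderiv_apply_param {F : E → α → ℝ} {U : Set E} (hU : IsOpen U)
    (hm : ∀ η ∈ U, Measurable (F η)) (hd : ∀ x, ∀ η ∈ U, ContDiffAt ℝ 2 (fun η => F η x) η)
    (v : E) {η : E} (hη : η ∈ U) :
    Measurable fun x => fderiv ℝ (fderiv ℝ fun η => F η x) η v v := by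
  have h1 : ∀ x, ∀ η ∈ U, HasFDerivAt (fun η => fderiv ℝ (fun η => F η x) η v)
      ((fderiv ℝ (fderiv ℝ fun η => F η x) η).flip v) η := fun x η hη =>
    ((hd x η hη).differentiableAt_fderiv_two.hasFDerivAt.clm_apply
      (hasFDerivAt_const v η)).congr_fderiv (by ext; simp)
  have h2 := measurable_fderiv_apply_param (F := fun η x => fderiv ℝ (fun η => F η x) η v) hU
    (fun η hη => measurable_fderiv_apply_param hU hm
      (fun x η hη => (hd x η hη).differentiableAt (by norm_num)) v hη)
    (fun x η hη => (h1 x η hη).differentiableAt) v hη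
  have h3 : (fun x => fderiv ℝ (fun η => fderiv ℝ (fun η => F η x) η v) η v)
      = fun x => fderiv ℝ (fderiv ℝ fun η => F η x) η v v := by
    funext x
    rw [(h1 x η hη).fderiv]
    simp
  rw [← h3]
  exact h2

end Measurability

end

/-! ### Truncation of the past: convergence of the derivatives -/

section

section Joint

variable {ι E F : Type*} [NormedAddCommGroup E] [NormedSpace ℝ E] [NormedAddCommGroup F]
  [NormedSpace ℝ F] {l : Filter ι} {U : Set E}

/-- Continuous convergence `G_i → G₀` on `U`, which behaves well in algebraic expressions. -/
def JointTendsto (l : Filter ι) (G : ι → E → F) (G₀ : E → F) (U : Set E) : Prop :=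
  ∀ p ∈ U, Tendsto (fun q : ι × E => G q.1 q.2) (l ×ˢ 𝓝 p) (𝓝 (G₀ p))

theorem JointTendsto.of_norm_sub_le {G : ι → E → F} {G₀ : E → F} (hU : IsOpen U)
    (hG₀ : ContinuousOn G₀ U) {F' : Type*} [NormedAddCommGroup F'] {K : ι → E → F'} {K₀ : E → F'}
    (hle : ∀ i, ∀ θ ∈ U, ‖G i θ - G₀ θ‖ ≤ ‖K i θ - K₀ θ‖) (h : TendstoUniformlyOn K K₀ l U) :
    JointTendsto l G G₀ U := by
  intro p hp
  have h1 : Tendsto (fun q : ι × E => G q.1 q.2 - G₀ q.2) (l ×ˢ 𝓝 p) (𝓝 0) := by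
    rw [Metric.tendsto_nhds]
    intro δ hδ
    filter_upwards [(Metric.tendstoUniformlyOn_iff.1 h δ hδ).prod_inl (𝓝 p),
      (hU.eventually_mem hp).prod_inr l] with q q1 q2
    rw [dist_zero_right]
    refine (hle q.1 q.2 q2).trans_lt ?_
    rw [← dist_eq_norm, dist_comm]
    exact q1 q.2 q2
  have h2 : Tendsto (fun q : ι × E => G₀ q.2) (l ×ˢ 𝓝 p) (𝓝 (G₀ p)) :=
    ((hG₀ p hp).continuousAt (hU.mem_nhds hp)).tendsto.comp tendsto_snd
  simpa using h1.add h2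

/-- If functions and their derivatives converge continuously, then the limit of the derivatives is
the derivative of the limit. -/
theorem JointTendsto.fderiv_eq [NeBot l] (hU : IsOpen U) {G : ι → E → F} {G₀ : E → F}
    {G' : ι → E → E →L[ℝ] F} {K : E → E →L[ℝ] F}
    (hG : ∀ i, ∀ θ ∈ U, HasFDerivAt (G i) (G' i θ) θ) (h : JointTendsto l G G₀ U)
    (h' : JointTendsto l G' K U) (hK : ContinuousOn K U) {p : E} (hp : p ∈ U) :
    fderiv ℝ G₀ p = K p := by
  refine (hasFDerivAt_of_tendstoLocallyUniformlyOn hU (f := G) (l := l) (f' := G') ?_ hG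
    (fun x hx => ?_) hp).fderiv
  · refine hU.tendstoLocallyUniformlyOn_iff_forall_tendsto.2 fun x hx => ?_
    have h1 : Tendsto (fun q : ι × E => K q.2) (l ×ˢ 𝓝 x) (𝓝 (K x)) :=
      ((hK x hx).continuousAt (hU.mem_nhds hx)).tendsto.comp tendsto_snd
    exact (h1.prodMk_nhds (h' x hx)).mono_right (nhds_le_uniformity (K x))
  · have h1 : Tendsto (fun i : ι => (i, x)) l (l ×ˢ 𝓝 x) :=
      tendsto_id.prodMk tendsto_const_nhds
    exact (h x hx).comp h1

theorem JointTendsto.congr_right {G : ι → E → F} {G₀ G₁ : E → F} (h : JointTendsto l G G₀ U)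
    (he : ∀ p ∈ U, G₀ p = G₁ p) : JointTendsto l G G₁ U := fun p hp => by
  rw [← he p hp]; exact h p hp

end Joint

section Sign

variable {ι E : Type*} [NormedAddCommGroup E] [NormedSpace ℝ E] {l : Filter ι} {U : Set E}
  {N : ι → E → ℝ} {N₀ : E → ℝ} {σ : ℝ}

/-- Either the functions or their squares converge, together with the derivatives up to order 2, in
the sense that for each order, the derivatives of this order of either the functions or their
squares converge. Then the derivatives of the squares converge, provided that the functions `N_i`
have the sign of `σ N₀`. If this sign is wrong, the convergence of derivatives of the functions
shows that these derivatives vanish in the limit. -/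
theorem jointTendsto_fderiv_sq_of_sign (hU : IsOpen U) (hN : ∀ i, ∀ θ ∈ U, ContDiffAt ℝ 2 (N i) θ)
    (hN₀ : ∀ θ ∈ U, ContDiffAt ℝ 2 N₀ θ) (hne : ∀ i, ∀ θ ∈ U, N i θ ≠ 0)
    (hne₀ : ∀ θ ∈ U, N₀ θ ≠ 0) (hσ : σ * σ = 1)
    (hsign : ∀ᶠ i in l, ∀ θ ∈ U, 0 < σ * (N i θ * N₀ θ))
    (h0 : JointTendsto l (fun i θ => N i θ ^ 2) (fun θ => N₀ θ ^ 2) U)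
    (h1 : JointTendsto l (fun i => fderiv ℝ (N i)) (fderiv ℝ N₀) U ∨
      JointTendsto l (fun i => fderiv ℝ fun θ => N i θ ^ 2) (fderiv ℝ fun θ => N₀ θ ^ 2) U)
    (h2 : JointTendsto l (fun i => fderiv ℝ (fderiv ℝ (N i))) (fderiv ℝ (fderiv ℝ N₀)) U ∨
      JointTendsto l (fun i => fderiv ℝ (fderiv ℝ fun θ => N i θ ^ 2))
        (fderiv ℝ (fderiv ℝ fun θ => N₀ θ ^ 2)) U) :
    JointTendsto l (fun i => fderiv ℝ fun θ => N i θ ^ 2) (fderiv ℝ fun θ => N₀ θ ^ 2) U ∧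
    JointTendsto l (fun i => fderiv ℝ (fderiv ℝ fun θ => N i θ ^ 2))
        (fderiv ℝ (fderiv ℝ fun θ => N₀ θ ^ 2)) U := by
  rcases l.eq_or_neBot with rfl | hl
  · constructor <;> intro p hp <;> simp
  have hmem : ∀ {p}, p ∈ U → ∀ᶠ q : ι × E in l ×ˢ 𝓝 p, q.2 ∈ U := fun hp =>
    (hU.eventually_mem hp).prod_inr l
  have hc₀ : ∀ p ∈ U, Tendsto (fun q : ι × E => N₀ q.2) (l ×ˢ 𝓝 p) (𝓝 (N₀ p)) := fun p hp =>
    (hN₀ p hp).continuousAt.tendsto.comp tendsto_snd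
  have hcd₁ : ContinuousOn (fderiv ℝ N₀) U := fun p hp =>
    (hN₀ p hp).differentiableAt_fderiv_two.continuousAt.continuousWithinAt
  have hcd₂ : ContinuousOn (fderiv ℝ (fderiv ℝ N₀)) U := fun p hp =>
    (((hN₀ p hp).fderiv_right (m := 1) (by norm_num)).fderiv_right (m := 0)
      (by norm_num)).continuousAt.continuousWithinAt
  have hd : ∀ i, ∀ θ ∈ U, HasFDerivAt (N i) (fderiv ℝ (N i) θ) θ := fun i θ hθ =>
    ((hN i θ hθ).differentiableAt (by norm_num)).hasFDerivAt
  have hd₂ : ∀ i, ∀ θ ∈ U, HasFDerivAt (fderiv ℝ (N i)) (fderiv ℝ (fderiv ℝ (N i)) θ) θ :=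
    fun i θ hθ => (hN i θ hθ).differentiableAt_fderiv_two.hasFDerivAt
  -- the functions themselves converge to `σ N₀`
  have k0 : JointTendsto l N (fun θ => σ * N₀ θ) U := by
    intro p hp
    have e1 : Tendsto (fun q : ι × E => σ * (√(N q.1 q.2 ^ 2) * √(N₀ q.2 ^ 2)) / N₀ q.2)
        (l ×ˢ 𝓝 p) (𝓝 (σ * (√(N₀ p ^ 2) * √(N₀ p ^ 2)) / N₀ p)) :=
      (((h0 p hp).sqrt.mul ((hc₀ p hp).pow 2).sqrt).const_mul σ).div (hc₀ p hp) (hne₀ p hp)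
    have e2 : σ * (√(N₀ p ^ 2) * √(N₀ p ^ 2)) / N₀ p = σ * N₀ p := by
      rw [Real.mul_self_sqrt (sq_nonneg _)]
      field_simp [hne₀ p hp]
    rw [e2] at e1
    refine e1.congr' ?_
    filter_upwards [hsign.prod_inl (𝓝 p), hmem hp] with q q1 q2
    have q3 := q1 q.2 q2
    have q4 : √(N q.1 q.2 ^ 2) * √(N₀ q.2 ^ 2) = σ * (N q.1 q.2 * N₀ q.2) := by
      rw [Real.sqrt_sq_eq_abs, Real.sqrt_sq_eq_abs, ← abs_mul, ← abs_of_pos q3, abs_mul σ]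
      have : |σ| = 1 := by
        have h3 : |σ| * |σ| = 1 := by rw [← abs_mul, hσ, abs_one]
        nlinarith [abs_nonneg σ]
      rw [this, one_mul]
    rw [q4, ← mul_assoc, hσ, one_mul, mul_div_cancel_right₀ _ (hne₀ _ q2)]
  have hfd : ∀ p ∈ U, fderiv ℝ (fun θ => σ * N₀ θ) p = σ • fderiv ℝ N₀ p := fun p hp =>
    fderiv_const_mul ((hN₀ p hp).differentiableAt (by norm_num)) σ
  have hfd₂ : ∀ p ∈ U, fderiv ℝ (fun θ => σ • fderiv ℝ N₀ θ) p = σ • fderiv ℝ (fderiv ℝ N₀) p :=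
    fun p hp => fderiv_const_smul (hN₀ p hp).differentiableAt_fderiv_two σ
  have hne2 : ∀ p ∈ U, 2 * (σ * N₀ p) ≠ 0 := fun p hp =>
    mul_ne_zero two_ne_zero (mul_ne_zero (fun h => by simp [h] at hσ) (hne₀ p hp))
  have hσi : ∀ p ∈ U, (2 * (σ * N₀ p))⁻¹ * (2 * N₀ p) = σ := fun p hp => by
    have := hne₀ p hp
    have hσ0 : σ ≠ 0 := fun h => by simp [h] at hσ
    field_simp
    linarith [hσ]
  -- the first derivatives
  have k1 : JointTendsto l (fun i => fderiv ℝ (N i)) (fun θ => σ • fderiv ℝ N₀ θ) U := by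
    rcases h1 with h1 | h1
    · refine h1.congr_right fun p hp => ?_
      rw [← hfd p hp, JointTendsto.fderiv_eq hU hd k0 h1 hcd₁ hp]
    · intro p hp
      have e1 := (((k0 p hp).const_mul 2).inv₀ (hne2 p hp)).smul (h1 p hp)
      rw [fderiv_sq ((hN₀ p hp).differentiableAt (by norm_num)), smul_smul, hσi p hp] at e1
      refine e1.congr' ?_
      filter_upwards [hmem hp] with q hq
      rw [fderiv_sq ((hN q.1 q.2 hq).differentiableAt (by norm_num)), smul_smul,
        inv_mul_cancel₀ (mul_ne_zero two_ne_zero (hne _ _ hq)), one_smul]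
  have hsr : ∀ (φ : ι × E → E →L[ℝ] ℝ) (φ₀ : E →L[ℝ] ℝ) (L : Filter (ι × E)),
      Tendsto φ L (𝓝 φ₀) → Tendsto (fun q => ((2 : ℝ) • φ q).smulRight (φ q)) L
        (𝓝 (((2 : ℝ) • φ₀).smulRight φ₀)) := by
    intro φ φ₀ L h
    have hcont : Continuous fun c : E →L[ℝ] ℝ => ((2 : ℝ) • c).smulRight c := by
      have : Continuous fun c : E →L[ℝ] ℝ =>
          ContinuousLinearMap.smulRightL ℝ E (E →L[ℝ] ℝ) ((2 : ℝ) • c) c := by fun_prop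
      exact this
    exact (hcont.tendsto φ₀).comp h
  have hσs : ∀ c : E →L[ℝ] ℝ, ((2 : ℝ) • σ • c).smulRight (σ • c) = ((2 : ℝ) • c).smulRight c := by
    intro c
    ext v w
    simp only [ContinuousLinearMap.smulRight_apply, smul_apply, smul_eq_mul]
    linear_combination (2 * c v * c w) * hσ
  -- the second derivatives
  have k2 : JointTendsto l (fun i => fderiv ℝ (fderiv ℝ (N i)))
      (fun θ => σ • fderiv ℝ (fderiv ℝ N₀) θ) U := by
    rcases h2 with h2 | h2
    · refine h2.congr_right fun p hp => ?_
      rw [← hfd₂ p hp, JointTendsto.fderiv_eq hU hd₂ k1 h2 hcd₂ hp]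
    · intro p hp
      have e1 := (((k0 p hp).const_mul 2).inv₀ (hne2 p hp)).smul
        ((h2 p hp).sub (hsr _ _ _ (k1 p hp)))
      rw [fderiv_fderiv_sq (hN₀ p hp), hσs, add_sub_cancel_right, smul_smul, hσi p hp] at e1
      refine e1.congr' ?_
      filter_upwards [hmem hp] with q hq
      rw [fderiv_fderiv_sq (hN q.1 q.2 hq), add_sub_cancel_right, smul_smul,
        inv_mul_cancel₀ (mul_ne_zero two_ne_zero (hne _ _ hq)), one_smul]
  constructor
  · intro p hp
    have e1 := ((k0 p hp).const_mul 2).smul (k1 p hp)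
    have e2 : (2 * (σ * N₀ p)) • σ • fderiv ℝ N₀ p = fderiv ℝ (fun θ => N₀ θ ^ 2) p := by
      rw [fderiv_sq ((hN₀ p hp).differentiableAt (by norm_num)), smul_smul]
      congr 1
      linear_combination (2 * N₀ p) * hσ
    rw [e2] at e1
    refine e1.congr' ?_
    filter_upwards [hmem hp] with q hq
    rw [fderiv_sq ((hN q.1 q.2 hq).differentiableAt (by norm_num))]
  · intro p hp
    have e1 := (((k0 p hp).const_mul 2).smul (k2 p hp)).add (hsr _ _ _ (k1 p hp))
    have e2 : (2 * (σ * N₀ p)) • σ • fderiv ℝ (fderiv ℝ N₀) p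
        + ((2 : ℝ) • σ • fderiv ℝ N₀ p).smulRight (σ • fderiv ℝ N₀ p)
        = fderiv ℝ (fderiv ℝ fun θ => N₀ θ ^ 2) p := by
      rw [fderiv_fderiv_sq (hN₀ p hp), smul_smul, hσs]
      congr 2
      linear_combination (2 * N₀ p) * hσ
    rw [e2] at e1
    refine e1.congr' ?_
    filter_upwards [hmem hp] with q hq
    rw [fderiv_fderiv_sq (hN q.1 q.2 hq)]

theorem JointTendsto.mono {F : Type*} [NormedAddCommGroup F] [NormedSpace ℝ F] {l' : Filter ι}
    {G : ι → E → F} {G₀ : E → F} (h : JointTendsto l G G₀ U) (hl : l' ≤ l) :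
    JointTendsto l' G G₀ U := fun p hp => (h p hp).mono_left (prod_mono_left _ hl)

theorem JointTendsto.of_inf_principal {F : Type*} [NormedAddCommGroup F] [NormedSpace ℝ F]
    {G : ι → E → F} {G₀ : E → F} {S : Set ι} (h : JointTendsto (l ⊓ 𝓟 S) G G₀ U)
    (h' : JointTendsto (l ⊓ 𝓟 Sᶜ) G G₀ U) : JointTendsto l G G₀ U := fun p hp => by
  have := (h p hp).sup (h' p hp)
  rwa [← Filter.sup_prod, ← inf_sup_left, sup_principal, Set.union_compl_self, principal_univ,
    inf_top_eq] at this

/-- The same, without an assumption on the signs: on a connected set, the indices split into those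
with the same and those with the opposite sign. -/
theorem jointTendsto_fderiv_sq (hU : IsOpen U) (hUc : IsPreconnected U)
    (hN : ∀ i, ∀ θ ∈ U, ContDiffAt ℝ 2 (N i) θ)
    (hN₀ : ∀ θ ∈ U, ContDiffAt ℝ 2 N₀ θ) (hne : ∀ i, ∀ θ ∈ U, N i θ ≠ 0)
    (hne₀ : ∀ θ ∈ U, N₀ θ ≠ 0)
    (h0 : JointTendsto l (fun i θ => N i θ ^ 2) (fun θ => N₀ θ ^ 2) U)
    (h1 : JointTendsto l (fun i => fderiv ℝ (N i)) (fderiv ℝ N₀) U ∨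
      JointTendsto l (fun i => fderiv ℝ fun θ => N i θ ^ 2) (fderiv ℝ fun θ => N₀ θ ^ 2) U)
    (h2 : JointTendsto l (fun i => fderiv ℝ (fderiv ℝ (N i))) (fderiv ℝ (fderiv ℝ N₀)) U ∨
      JointTendsto l (fun i => fderiv ℝ (fderiv ℝ fun θ => N i θ ^ 2))
        (fderiv ℝ (fderiv ℝ fun θ => N₀ θ ^ 2)) U) :
    JointTendsto l (fun i => fderiv ℝ fun θ => N i θ ^ 2) (fderiv ℝ fun θ => N₀ θ ^ 2) U ∧
    JointTendsto l (fun i => fderiv ℝ (fderiv ℝ fun θ => N i θ ^ 2))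
        (fderiv ℝ (fderiv ℝ fun θ => N₀ θ ^ 2)) U := by
  rcases U.eq_empty_or_nonempty with rfl | ⟨p₀, hp₀⟩
  · constructor <;> intro p hp <;> exact absurd hp (Set.notMem_empty p)
  -- by the intermediate value theorem, the sign at `p₀` is the sign on all of `U`
  set S : Set ι := {i | 0 < N i p₀ * N₀ p₀} with hS
  have hcont : ∀ i, ContinuousOn (fun θ => N i θ * N₀ θ) U := fun i θ hθ =>
    ((hN i θ hθ).continuousAt.mul (hN₀ θ hθ).continuousAt).continuousWithinAt
  have hnz : ∀ i, ∀ θ ∈ U, N i θ * N₀ θ ≠ 0 := fun i θ hθ => mul_ne_zero (hne i θ hθ) (hne₀ θ hθ)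
  have hpos : ∀ i ∈ S, ∀ θ ∈ U, 0 < 1 * (N i θ * N₀ θ) := by
    intro i hi θ hθ
    simp only [hS, Set.mem_ofPred_eq] at hi
    by_contra hneg
    rw [one_mul, not_lt] at hneg
    obtain ⟨c, hc, hc0⟩ := hUc.intermediate_value hθ hp₀ (hcont i) ⟨hneg, hi.le⟩
    exact hnz i c hc hc0
  have hneg : ∀ i ∈ Sᶜ, ∀ θ ∈ U, 0 < (-1) * (N i θ * N₀ θ) := by
    intro i hi θ hθ
    simp only [hS, Set.mem_compl_iff, Set.mem_ofPred_eq, not_lt] at hi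
    by_contra hle
    have hle' : 0 ≤ N i θ * N₀ θ := by linarith
    obtain ⟨c, hc, hc0⟩ := hUc.intermediate_value hp₀ hθ (hcont i) ⟨hi, hle'⟩
    exact hnz i c hc hc0
  have r1 := jointTendsto_fderiv_sq_of_sign (l := l ⊓ 𝓟 S) hU hN hN₀ hne hne₀ (one_mul 1)
    (mem_inf_of_right hpos) (h0.mono inf_le_left)
    (h1.imp (fun h => h.mono inf_le_left) fun h => h.mono inf_le_left)
    (h2.imp (fun h => h.mono inf_le_left) fun h => h.mono inf_le_left)
  have r2 := jointTendsto_fderiv_sq_of_sign (l := l ⊓ 𝓟 Sᶜ) hU hN hN₀ hne hne₀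
    (show (-1 : ℝ) * -1 = 1 by norm_num)
    (mem_inf_of_right hneg) (h0.mono inf_le_left)
    (h1.imp (fun h => h.mono inf_le_left) fun h => h.mono inf_le_left)
    (h2.imp (fun h => h.mono inf_le_left) fun h => h.mono inf_le_left)
  exact ⟨r1.1.of_inf_principal r2.1, r1.2.of_inf_principal r2.2⟩

end Sign

section Cutoff

variable {Ω : Type*} [MeasurableSpace Ω] {μ : Measure Ω} [IsProbabilityMeasure μ] {ξ : ℤ → Ω → ℝ}
variable {d : ℕ} {f M : Family d} {Θ : Set (Param d)} {αf αv : ℕ → ℕ → ℝ} {h₀ : ℝ}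
variable {H : (ℕ → ℝ) → ℝ}

/-- The sequence `(z_0, …, z_{m-1}, 0, 0, …)`. -/
def cutoff (m : ℕ) (z : ℕ → ℝ) : ℕ → ℝ := fun i => if i < m then z i else 0

theorem measurable_cutoff (m : ℕ) : Measurable (cutoff m) := by
  refine measurable_pi_lambda _ fun i => ?_
  unfold cutoff
  split_ifs
  · exact measurable_pi_apply i
  · exact measurable_const

theorem abs_cutoff_le (m : ℕ) (z : ℕ → ℝ) (k : ℕ) : |cutoff m z k| ≤ |z k| := by
  unfold cutoff
  split_ifs
  · exact le_rfl
  · simp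

theorem truncPast_eq_cutoff (x : ℤ → ℝ) (t : ℕ) : truncPast x t = cutoff (t - 1) (past x t) := by
  funext i
  simp only [truncPast, cutoff, past]
  have : i + 1 < t ↔ i < t - 1 := by omega
  simp only [this]

/-- Truncation of the past is negligible in functions which are Lipschitz in the past. -/
theorem LipschitzWithCoeff.ae_tendstoUniformlyOn_cutoff (hξ : IsInnovation μ ξ) {g : ℝ → ℝ}
    (hg : Measurable g) (hg0 : g 0 = 0) {p : ℝ} (hp : 1 ≤ p) (hHm : Measurable H)
    (hgH : MemLp (fun e => g (H e)) (ENNReal.ofReal p) (innovLaw μ ξ)) {Ψ : Family d} {i : ℕ}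
    {a : ℕ → ℝ} (hA : LipschitzWithCoeff g Ψ Θ i a) :
    ∀ᵐ e ∂(innovLaw μ ξ), TendstoUniformlyOn
      (fun m θ => iteratedFDeriv ℝ i (fun η => Ψ η (cutoff m (pastOf H e))) θ)
      (fun θ => iteratedFDeriv ℝ i (fun η => Ψ η (pastOf H e)) θ) atTop Θ := by
  set r : ℕ → (ℕ → ℝ) → ℝ := fun m e => if m = 0 then |g (H e)| else 0 with hr
  have hgm : Measurable fun e => |g (H e)| := (hg.comp hHm).abs
  have hv : IsVanishing (innovLaw μ ξ) (ENNReal.ofReal p) r := by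
    refine ⟨fun m => ?_, fun m x => ?_, fun m x => ?_, ?_, Eventually.of_forall fun x => ?_⟩
    · simp only [hr]; split_ifs
      · exact hgm
      · exact measurable_const
    · simp only [hr]; split_ifs
      · exact abs_nonneg _
      · exact le_rfl
    · simp only [hr, if_true]; split_ifs
      · exact le_rfl
      · exact abs_nonneg _
    · simp only [hr, if_true]
      exact hgH.abs
    · refine tendsto_const_nhds.congr' ?_
      filter_upwards [eventually_ge_atTop 1] with m hm
      simp only [hr]
      rw [if_neg (by omega)]
  obtain ⟨R, hR, hRe⟩ := hv.lagSum hξ hp hA.1 hA.2.1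
  filter_upwards [hRe, hR.tendsto] with e he1 he2
  rw [Metric.tendstoUniformlyOn_iff]
  intro δ hδ
  filter_upwards [he2.eventually_lt_const hδ, eventually_ge_atTop 1] with m hm hm1 θ hθ
  have h1 := hA.edist_le hθ (cutoff m (pastOf H e)) (pastOf H e)
  have h2 : ∑' k, ENNReal.ofReal (a k) * edist (g (cutoff m (pastOf H e) k)) (g (pastOf H e k))
      ≤ ENNReal.ofReal (R m e) := by
    rw [← he1 m]
    refine ENNReal.tsum_le_tsum fun k => ?_
    gcongr
    unfold cutoff
    split_ifs with hk
    · simp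
    · rw [hg0, edist_dist, Real.dist_eq, zero_sub, abs_neg]
      simp only [hr, if_true, pastOf]
      exact le_rfl
  have h3 := h1.trans h2
  rw [edist_dist] at h3
  rw [dist_comm]
  exact ((ENNReal.ofReal_le_ofReal_iff (hR.nonneg _ _)).1 h3).trans_lt hm

section Norms

variable {E : Type*} [NormedAddCommGroup E] [NormedSpace ℝ E]

theorem norm_fderiv_sub_le (a b : E → ℝ) (θ : E) :
    ‖fderiv ℝ a θ - fderiv ℝ b θ‖ ≤ ‖iteratedFDeriv ℝ 1 a θ - iteratedFDeriv ℝ 1 b θ‖ := by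
  refine ContinuousLinearMap.opNorm_le_bound _ (norm_nonneg _) fun v => ?_
  have h := (iteratedFDeriv ℝ 1 a θ - iteratedFDeriv ℝ 1 b θ).le_opNorm ![v]
  simpa [iteratedFDeriv_one_apply] using h

theorem norm_fderiv_fderiv_sub_le (a b : E → ℝ) (θ : E) :
    ‖fderiv ℝ (fderiv ℝ a) θ - fderiv ℝ (fderiv ℝ b) θ‖
      ≤ ‖iteratedFDeriv ℝ 2 a θ - iteratedFDeriv ℝ 2 b θ‖ := by
  refine ContinuousLinearMap.opNorm_le_bound₂ _ (norm_nonneg _) fun v w => ?_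
  have h := (iteratedFDeriv ℝ 2 a θ - iteratedFDeriv ℝ 2 b θ).le_opNorm ![v, w]
  simpa [iteratedFDeriv_two_apply, Fin.prod_univ_two, mul_assoc] using h

theorem abs_fderiv_apply_le {a : E → ℝ} {θ v : E} {b : ℝ} (h : ‖iteratedFDeriv ℝ 1 a θ‖ ≤ b)
    (hv : ‖v‖ ≤ 1) : |fderiv ℝ a θ v| ≤ b := by
  have h1 := (iteratedFDeriv ℝ 1 a θ).le_opNorm ![v]
  simp only [iteratedFDeriv_one_apply, Matrix.cons_val_zero, Finset.univ_unique, Fin.default_eq_zero,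
    Finset.prod_singleton, Real.norm_eq_abs] at h1
  refine h1.trans ((mul_le_of_le_one_right (norm_nonneg _) ?_).trans h)
  simpa using hv

theorem abs_fderiv_fderiv_apply_le {a : E → ℝ} {θ v : E} {b : ℝ}
    (h : ‖iteratedFDeriv ℝ 2 a θ‖ ≤ b) (hv : ‖v‖ ≤ 1) : |fderiv ℝ (fderiv ℝ a) θ v v| ≤ b := by
  have h1 := (iteratedFDeriv ℝ 2 a θ).le_opNorm ![v, v]
  simp only [iteratedFDeriv_two_apply, Fin.prod_univ_two, Matrix.cons_val_zero, Matrix.cons_val_one,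
    Real.norm_eq_abs] at h1
  refine h1.trans ((mul_le_of_le_one_right (norm_nonneg _) ?_).trans h)
  exact mul_le_one₀ hv (norm_nonneg _) hv

end Norms

/-- The functions `f_θ` and `h_θ` of the truncated past converge, with their derivatives up to
order 2, continuously in `θ ∈ U`. -/
structure HasCutoffLimit (f M : Family d) (U : Set (Param d)) (z : ℕ → ℝ) : Prop where
  f₀ : JointTendsto atTop (fun m θ => f θ (cutoff m z)) (fun θ => f θ z) U
  f₁ : JointTendsto atTop (fun m => fderiv ℝ fun θ => f θ (cutoff m z)) (fderiv ℝ fun θ => f θ z) U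
  f₂ : JointTendsto atTop (fun m => fderiv ℝ (fderiv ℝ fun θ => f θ (cutoff m z)))
    (fderiv ℝ (fderiv ℝ fun θ => f θ z)) U
  h₀ : JointTendsto atTop (fun m θ => hFun M θ (cutoff m z)) (fun θ => hFun M θ z) U
  h₁ : JointTendsto atTop (fun m => fderiv ℝ fun θ => hFun M θ (cutoff m z))
    (fderiv ℝ fun θ => hFun M θ z) U
  h₂ : JointTendsto atTop (fun m => fderiv ℝ (fderiv ℝ fun θ => hFun M θ (cutoff m z)))
    (fderiv ℝ (fderiv ℝ fun θ => hFun M θ z)) U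

theorem ae_hasCutoffLimit (hξ : IsInnovation μ ξ) (hR : IsRegular f M Θ αf αv h₀)
    (hHm : Measurable H) (hH : MemLp H 4 (innovLaw μ ξ)) {U : Set (Param d)} (hU : IsOpen U)
    (hUc : IsPreconnected U) (hUΘ : U ⊆ Θ) :
    ∀ᵐ e ∂(innovLaw μ ξ), HasCutoffLimit f M U (pastOf H e) := by
  have h4 : MemLp (fun e => (fun u => u) (H e)) (ENNReal.ofReal 4) (innovLaw μ ξ) := by simpa using hH
  have h2 : MemLp (fun e => (fun u : ℝ => u ^ 2) (H e)) (ENNReal.ofReal 2) (innovLaw μ ξ) := by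
    have := hH.mul' (r := 2) hH
    simpa [sq] using this
  have hf : ∀ i ≤ 2, ∀ᵐ e ∂(innovLaw μ ξ), TendstoUniformlyOn
      (fun m θ => iteratedFDeriv ℝ i (fun η => f η (cutoff m (pastOf H e))) θ)
      (fun θ => iteratedFDeriv ℝ i (fun η => f η (pastOf H e)) θ) atTop U := fun i hi => by
    filter_upwards [(hR.lip_f i hi).ae_tendstoUniformlyOn_cutoff hξ measurable_id rfl
      (by norm_num) hHm h4] with e he using he.mono hUΘ
  have hM : ∀ i ≤ 2, ∀ᵐ e ∂(innovLaw μ ξ), TendstoUniformlyOn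
      (fun m θ => iteratedFDeriv ℝ i (fun η => M η (cutoff m (pastOf H e))) θ)
      (fun θ => iteratedFDeriv ℝ i (fun η => M η (pastOf H e)) θ) atTop U ∨ TendstoUniformlyOn
      (fun m θ => iteratedFDeriv ℝ i (fun η => hFun M η (cutoff m (pastOf H e))) θ)
      (fun θ => iteratedFDeriv ℝ i (fun η => hFun M η (pastOf H e)) θ) atTop U := fun i hi => by
    rcases hR.lip_M i hi with hA | hA
    · filter_upwards [hA.ae_tendstoUniformlyOn_cutoff hξ measurable_id rfl
        (by norm_num) hHm h4] with e he using Or.inl (he.mono hUΘ)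
    · filter_upwards [hA.ae_tendstoUniformlyOn_cutoff hξ (measurable_id.pow_const 2) (by simp)
        (by norm_num) hHm h2] with e he using Or.inr (he.mono hUΘ)
  have cont₀ : ∀ (Ψ : Param d → ℝ), (∀ θ ∈ U, ContDiffAt ℝ 2 Ψ θ) → ContinuousOn Ψ U :=
    fun Ψ h θ hθ => (h θ hθ).continuousAt.continuousWithinAt
  have cont₁ : ∀ (Ψ : Param d → ℝ), (∀ θ ∈ U, ContDiffAt ℝ 2 Ψ θ) → ContinuousOn (fderiv ℝ Ψ) U :=
    fun Ψ h θ hθ => (h θ hθ).differentiableAt_fderiv_two.continuousAt.continuousWithinAt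
  have cont₂ : ∀ (Ψ : Param d → ℝ), (∀ θ ∈ U, ContDiffAt ℝ 2 Ψ θ) →
      ContinuousOn (fderiv ℝ (fderiv ℝ Ψ)) U := fun Ψ h θ hθ =>
    (((h θ hθ).fderiv_right (m := 1) (by norm_num)).fderiv_right (m := 0)
      (by norm_num)).continuousAt.continuousWithinAt
  have norm₀ : ∀ (a b : Param d → ℝ) (θ : Param d),
      ‖a θ - b θ‖ ≤ ‖iteratedFDeriv ℝ 0 a θ - iteratedFDeriv ℝ 0 b θ‖ := fun a b θ => by
    have := edist_iteratedFDeriv_zero a b θ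
    rw [← dist_eq_norm, ← dist_eq_norm, dist_edist, dist_edist, this]
  filter_upwards [hf 0 (by norm_num), hf 1 (by norm_num), hf 2 le_rfl, hM 0 (by norm_num),
    hM 1 (by norm_num), hM 2 le_rfl] with e f0 f1 f2 M0 M1 M2
  have sf : ∀ y, ∀ θ ∈ U, ContDiffAt ℝ 2 (fun η => f η y) θ := fun y θ hθ =>
    hR.smooth_f y θ (hUΘ hθ)
  have sM : ∀ y, ∀ θ ∈ U, ContDiffAt ℝ 2 (fun η => M η y) θ := fun y θ hθ =>
    hR.smooth_M y θ (hUΘ hθ)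
  have sh : ∀ y, ∀ θ ∈ U, ContDiffAt ℝ 2 (fun η => hFun M η y) θ := fun y θ hθ =>
    (sM y θ hθ).pow 2
  have hne : ∀ y, ∀ θ ∈ U, M θ y ≠ 0 := fun y θ hθ h0 => by
    have := hR.pos.trans_le (hR.le_h θ (hUΘ hθ) y)
    simp [hFun, h0] at this
  have hh₀ : JointTendsto atTop (fun m θ => hFun M θ (cutoff m (pastOf H e)))
      (fun θ => hFun M θ (pastOf H e)) U := by
    rcases M0 with M0 | M0
    · have h := JointTendsto.of_norm_sub_le (G := fun m θ => M θ (cutoff m (pastOf H e)))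
        (G₀ := fun θ => M θ (pastOf H e)) hU (cont₀ _ (sM _)) (fun m θ _ =>
      norm₀ (fun θ => M θ (cutoff m (pastOf H e))) (fun θ => M θ (pastOf H e)) θ) M0
      exact fun p hp => (h p hp).pow 2
    · exact JointTendsto.of_norm_sub_le hU (cont₀ _ (sh _)) (fun m θ _ =>
      norm₀ (fun θ => hFun M θ (cutoff m (pastOf H e))) (fun θ => hFun M θ (pastOf H e)) θ) M0
  -- the alternative in the assumptions may be decided differently for each order of derivation
  have hres := jointTendsto_fderiv_sq (l := atTop) (N := fun m θ => M θ (cutoff m (pastOf H e)))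
    (N₀ := fun θ => M θ (pastOf H e)) hU hUc (fun m => sM _) (sM _) (fun m => hne _) (hne _) hh₀
    (M1.imp
      (fun h => JointTendsto.of_norm_sub_le hU (cont₁ _ (sM _))
        (fun m θ _ => norm_fderiv_sub_le _ _ θ) h)
      fun h => JointTendsto.of_norm_sub_le hU (cont₁ _ (sh _))
        (fun m θ _ => norm_fderiv_sub_le _ _ θ) h)
    (M2.imp
      (fun h => JointTendsto.of_norm_sub_le hU (cont₂ _ (sM _))
        (fun m θ _ => norm_fderiv_fderiv_sub_le _ _ θ) h)
      fun h => JointTendsto.of_norm_sub_le hU (cont₂ _ (sh _))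
        (fun m θ _ => norm_fderiv_fderiv_sub_le _ _ θ) h)
  exact ⟨JointTendsto.of_norm_sub_le hU (cont₀ _ (sf _)) (fun m θ _ =>
      norm₀ (fun θ => f θ (cutoff m (pastOf H e))) (fun θ => f θ (pastOf H e)) θ) f0,
    JointTendsto.of_norm_sub_le hU (cont₁ _ (sf _)) (fun m θ _ => norm_fderiv_sub_le _ _ θ) f1,
    JointTendsto.of_norm_sub_le hU (cont₂ _ (sf _)) (fun m θ _ => norm_fderiv_fderiv_sub_le _ _ θ) f2,
    hh₀, hres.1, hres.2⟩

end Cutoff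

end

/-! ### Lower bounds for the sums of derivatives of the quasi-likelihood -/

section

variable {Ω : Type*} [MeasurableSpace Ω] {μ : Measure Ω} [IsProbabilityMeasure μ] {ξ : ℤ → Ω → ℝ}
variable {d : ℕ} {f M : Family d} {Θ : Set (Param d)} {αf αv : ℕ → ℕ → ℝ} {h₀ : ℝ}
variable {θ : Param d} {H : (ℕ → ℝ) → ℝ}

theorem IsEnvelope.hasScoreBound (hR : IsRegular f M Θ αf αv h₀) {V : (ℕ → ℝ) → ℝ} {e : ℕ → ℝ}
    (hd : IsDominated f M Θ αv (pastOf H e) (V e)) (h1 : 1 ≤ V e) (hH : |H e| ≤ V e)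
    (hθ : θ ∈ Θ) {y : ℕ → ℝ} (hy : ∀ k, |y k| ≤ |pastOf H e k|) {v : Param d} (hv : ‖v‖ ≤ 1) :
    HasScoreBound h₀ (V e) (H e - f θ y) (-fderiv ℝ (fun η => f η y) θ v)
      (-fderiv ℝ (fderiv ℝ fun η => f η y) θ v v) (hFun M θ y)
      (fderiv ℝ (fun η => hFun M η y) θ v) (fderiv ℝ (fderiv ℝ fun η => hFun M η y) θ v v) := by
  obtain ⟨b1, b2, -⟩ := IsEnvelope.abs_le hR hd h1 hθ hy
  have hs := hR.smooth_M y θ hθ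
  have hg1 : fderiv ℝ (fun η => hFun M η y) θ v = 2 * M θ y * fderiv ℝ (fun η => M η y) θ v := by
    have := fderiv_sq (hs.differentiableAt (by norm_num))
    have h2 : fderiv ℝ (fun η => hFun M η y) θ = (2 * M θ y) • fderiv ℝ (fun η => M η y) θ := this
    rw [h2]; rfl
  have hg2 : fderiv ℝ (fderiv ℝ fun η => hFun M η y) θ v v
      = 2 * fderiv ℝ (fun η => M η y) θ v ^ 2
        + 2 * M θ y * fderiv ℝ (fderiv ℝ fun η => M η y) θ v v := by
    have := fderiv_fderiv_sq hs
    have h2 : fderiv ℝ (fderiv ℝ fun η => hFun M η y) θ = (2 * M θ y)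
        • fderiv ℝ (fderiv ℝ fun η => M η y) θ + ((2 : ℝ) • fderiv ℝ (fun η => M η y) θ).smulRight
          (fderiv ℝ (fun η => M η y) θ) := this
    rw [h2]
    simp only [add_apply, smul_apply,
      ContinuousLinearMap.smulRight_apply, smul_eq_mul]
    ring
  refine ⟨h1, hR.le_h θ hθ y, ?_, ?_, ?_, ?_, ?_⟩
  · have := abs_sub (H e) (f θ y); linarith
  · rw [abs_neg]; exact abs_fderiv_apply_le (hd 1 (by norm_num) θ hθ y hy).1 hv
  · rw [abs_neg]; exact abs_fderiv_fderiv_apply_le (hd 2 le_rfl θ hθ y hy).1 hv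
  · rcases hR.lip_M 1 (by norm_num) with hA | hA
    · have h3 := abs_fderiv_apply_le ((hd 1 (by norm_num) θ hθ y hy).2.1 hA) hv
      rw [hg1, abs_mul, abs_mul, abs_two]
      calc 2 * |M θ y| * |fderiv ℝ (fun η => M η y) θ v| ≤ 2 * V e * V e := by gcongr
        _ = 2 * V e ^ 2 := by ring
    · have h3 := abs_fderiv_apply_le ((hd 1 (by norm_num) θ hθ y hy).2.2 hA) hv
      have := sq_nonneg (V e)
      linarith
  · rcases hR.lip_M 2 le_rfl with hA | hA
    · exact Or.inr ⟨M θ y, fderiv ℝ (fun η => M η y) θ v,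
        fderiv ℝ (fderiv ℝ fun η => M η y) θ v v, rfl, b2, hg1, hg2,
        abs_fderiv_fderiv_apply_le ((hd 2 le_rfl θ hθ y hy).2.1 hA) hv⟩
    · exact Or.inl (abs_fderiv_fderiv_apply_le ((hd 2 le_rfl θ hθ y hy).2.2 hA) hv)

theorem IsRegular.contDiffAt_h (hR : IsRegular f M Θ αf αv h₀) (y : ℕ → ℝ) (hθ : θ ∈ Θ) :
    ContDiffAt ℝ 2 (fun η => hFun M η y) θ :=
  (hR.smooth_M y θ hθ).pow 2

theorem IsRegular.contDiffAt_quasiLik (hR : IsRegular f M Θ αf αv h₀) (u : ℝ) (y : ℕ → ℝ)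
    (hθ : θ ∈ Θ) :
    ContDiffAt ℝ 2 (fun η => quasiLik f M η u y) θ :=
  contDiffAt_sq_div_add_log u (hR.smooth_f y θ hθ) (hR.contDiffAt_h y hθ)
    (hR.pos.trans_le (hR.le_h θ hθ y))

theorem IsRegular.fderiv_quasiLik (hR : IsRegular f M Θ αf αv h₀) (u : ℝ) (y : ℕ → ℝ)
    (hθ : θ ∈ Θ) (v : Param d) :
    fderiv ℝ (fun η => quasiLik f M η u y) θ v = score (u - f θ y)
      (-fderiv ℝ (fun η => f η y) θ v) (hFun M θ y) (fderiv ℝ (fun η => hFun M η y) θ v) :=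
  fderiv_sq_div_add_log u (hR.smooth_f y θ hθ) (hR.contDiffAt_h y hθ)
    (hR.pos.trans_le (hR.le_h θ hθ y)) v

theorem IsRegular.fderiv_fderiv_quasiLik (hR : IsRegular f M Θ αf αv h₀) (u : ℝ) (y : ℕ → ℝ)
    (hθ : θ ∈ Θ) (v : Param d) :
    fderiv ℝ (fderiv ℝ fun η => quasiLik f M η u y) θ v v = scoreDeriv (u - f θ y)
      (-fderiv ℝ (fun η => f η y) θ v) (-fderiv ℝ (fderiv ℝ fun η => f η y) θ v v) (hFun M θ y)
      (fderiv ℝ (fun η => hFun M η y) θ v) (fderiv ℝ (fderiv ℝ fun η => hFun M η y) θ v v) :=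
  fderiv_fderiv_sq_div_add_log u (hR.smooth_f y θ hθ) (hR.contDiffAt_h y hθ)
    (hR.pos.trans_le (hR.le_h θ hθ y)) v

/-- The term of the quasi-likelihood at time `t` with the past truncated as in the observations,
for the process `H(ξ_t, ξ_{t-1}, …)` with the innovations `e`. -/
def truncLik (f M : Family d) (H : (ℕ → ℝ) → ℝ) (t : ℕ) (θ : Param d) (e : ℕ → ℝ) : ℝ :=
  quasiLik f M θ (H e) (cutoff (t - 1) (pastOf H e))

theorem qHat_eq_truncLik (H : (ℕ → ℝ) → ℝ) (t : ℕ) (θ : Param d) (ω : Ω) :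
    qHat f M (fun s => H (innovPast ξ s ω)) t θ = truncLik f M H t θ (innovPast ξ t ω) := by
  rw [qHat_eq_quasiLik, truncPast_eq_cutoff, truncLik, pastOf_innovPast]

theorem measurable_truncLik (hR : IsRegular f M Θ αf αv h₀) (hHm : Measurable H) (t : ℕ)
    (hθ : θ ∈ Θ) : Measurable (truncLik f M H t θ) := by
  have hp := (measurable_cutoff (t - 1)).comp (measurable_pastOf hHm)
  have h1 : Measurable fun e => f θ (cutoff (t - 1) (pastOf H e)) := (hR.measurable_f θ hθ).comp hp
  have h2 : Measurable fun e => hFun M θ (cutoff (t - 1) (pastOf H e)) :=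
    ((hR.measurable_M θ hθ).comp hp).pow_const 2
  exact ((hHm.sub h1).pow_const 2 |>.div h2).add (Real.measurable_log.comp h2)

section LowerBound

/-- Lower bound of a sum over time, for functions with a parameter near `p₀`. -/
theorem IsInnovation.exists_sum_ge (hξ : IsInnovation μ ξ) {X : Type*} [PseudoMetricSpace X]
    [SecondCountableTopology X] {K : Set X} {Φ : ℕ → X → (ℕ → ℝ) → ℝ}
    (hm : ∀ t, ∀ p ∈ K, Measurable (Φ t p)) (hcont : ∀ t e, ContinuousOn (fun p => Φ t p e) K)
    {g Φ₀ : (ℕ → ℝ) → ℝ} (hgm : Measurable g) (hg : Integrable g (innovLaw μ ξ))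
    (hlow : ∀ᵐ e ∂(innovLaw μ ξ), ∀ t, ∀ p ∈ K, -g e ≤ Φ t p e) {p₀ : X} (hp₀ : p₀ ∈ K)
    (hm₀ : Measurable Φ₀) (h₀ : Integrable Φ₀ (innovLaw μ ξ))
    (hlim : ∀ᵐ e ∂(innovLaw μ ξ),
      Tendsto (fun q : ℕ × X => Φ q.1 q.2 e) (atTop ×ˢ 𝓝[K] p₀) (𝓝 (Φ₀ e)))
    (hpos : 0 < ∫ e, Φ₀ e ∂(innovLaw μ ξ)) :
    ∃ W ∈ 𝓝 p₀, ∃ c > 0, ∀ᵐ ω ∂μ, ∀ᶠ k : ℕ in atTop, ∀ p ∈ W, p ∈ K →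
      c * k ≤ ∑ t ∈ Finset.Icc 1 k, Φ t p (innovPast ξ t ω) := by
  obtain ⟨W, hW, T, ψ, hψm, hψi, hψc, hψ⟩ :=
    exists_integrable_lower_bound_of_continuousOn hm hcont hgm hg hlow hp₀ hm₀ h₀ hlim hpos
  refine ⟨W, hW, (∫ e, ψ e ∂(innovLaw μ ξ)) / 2, half_pos hψc, ?_⟩
  filter_upwards [hξ.ae_tendsto_average hψm hψi,
    ae_all_iff.2 fun t : ℤ => (hξ.measurePreserving_innovPast t).quasiMeasurePreserving.ae hψ,
    ae_all_iff.2 fun t : ℤ => (hξ.measurePreserving_innovPast t).quasiMeasurePreserving.ae hlow]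
    with ω h1 h2 h3
  set I := ∫ e, ψ e ∂(innovLaw μ ξ)
  -- `b` pays for the terms before time `T`
  set b : ℕ → ℝ := fun t => |g (innovPast ξ t ω)| + |ψ (innovPast ξ t ω)|
  set B := ∑ t ∈ Finset.range T, b t
  have hb0 : ∀ t, 0 ≤ b t := fun t => add_nonneg (abs_nonneg _) (abs_nonneg _)
  filter_upwards [h1.eventually_const_lt (show 3 / 4 * I < I by linarith),
    tendsto_natCast_atTop_atTop.eventually_gt_atTop (4 * B / I), eventually_ge_atTop 1]
    with k hk hkB hk1 p hpW hpK
  have hk0 : (0 : ℝ) < k := by exact_mod_cast hk1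
  have hterm : ∀ t ∈ Finset.Icc 1 k, ψ (innovPast ξ t ω) - (if t < T then b t else 0)
      ≤ Φ t p (innovPast ξ t ω) := by
    intro t _
    split_ifs with ht
    · have e1 := h3 t t p hpK
      have e2 := le_abs_self (g (innovPast ξ t ω))
      have e3 := le_abs_self (ψ (innovPast ξ t ω))
      simp only [b]
      linarith
    · rw [sub_zero]
      exact h2 t t (by omega) p hpW hpK
  have hsum := Finset.sum_le_sum hterm
  rw [Finset.sum_sub_distrib, ← Finset.sum_filter] at hsum
  have hB : ∑ t ∈ Finset.Icc 1 k with t < T, b t ≤ B :=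
    Finset.sum_le_sum_of_subset_of_nonneg (fun t ht => by
      simp only [Finset.mem_filter, Finset.mem_range] at ht ⊢
      exact ht.2) fun t _ _ => hb0 t
  rw [lt_div_iff₀ hk0] at hk
  rw [div_lt_iff₀ hψc] at hkB
  linarith

/-- Uniformity over the unit sphere of directions. -/
theorem exists_sum_ge_sphere {Φ : ℕ → Param d × Param d → Ω → ℝ} {U : Set (Param d)}
    (hU : U ∈ 𝓝 θ)
    (h : ∀ u ∈ Metric.sphere (0 : Param d) 1, ∃ W ∈ 𝓝 (θ, u), ∃ c > 0, ∀ᵐ ω ∂μ, ∀ᶠ k : ℕ in atTop,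
      ∀ p ∈ W, p ∈ U ×ˢ Metric.closedBall (0 : Param d) 1 →
        c * k ≤ ∑ t ∈ Finset.Icc 1 k, Φ t p ω) :
    ∃ W ∈ 𝓝 θ, ∃ c > 0, ∀ᵐ ω ∂μ, ∀ᶠ k : ℕ in atTop, ∀ η ∈ W,
      ∀ u ∈ Metric.sphere (0 : Param d) 1, c * k ≤ ∑ t ∈ Finset.Icc 1 k, Φ t (η, u) ω := by
  refine (isCompact_sphere (0 : Param d) 1).induction_on (p := fun S => ∃ W ∈ 𝓝 θ, ∃ c : ℝ,
    c > 0 ∧ ∀ᵐ ω ∂μ, ∀ᶠ k : ℕ in atTop, ∀ η ∈ W, ∀ u ∈ S,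
      c * k ≤ ∑ t ∈ Finset.Icc 1 k, Φ t (η, u) ω) ?_ ?_ ?_ ?_
  · exact ⟨Set.univ, univ_mem, 1, one_pos, Eventually.of_forall fun ω =>
      Eventually.of_forall fun k η _ u hu => absurd hu (Set.notMem_empty u)⟩
  · rintro s t hst ⟨W, hW, c, hc, h⟩
    refine ⟨W, hW, c, hc, ?_⟩
    filter_upwards [h] with ω hω
    filter_upwards [hω] with k hk η hη u hu using hk η hη u (hst hu)
  · rintro s t ⟨W, hW, c, hc, h⟩ ⟨W', hW', c', hc', h'⟩
    refine ⟨W ∩ W', inter_mem hW hW', min c c', lt_min hc hc', ?_⟩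
    filter_upwards [h, h'] with ω hω hω'
    filter_upwards [hω, hω'] with k hk hk' η hη u hu
    have hk0 : (0 : ℝ) ≤ k := Nat.cast_nonneg k
    rcases hu with hu | hu
    · exact (mul_le_mul_of_nonneg_right (min_le_left _ _) hk0).trans (hk η hη.1 u hu)
    · exact (mul_le_mul_of_nonneg_right (min_le_right _ _) hk0).trans (hk' η hη.2 u hu)
  · intro u hu
    obtain ⟨W, hW, c, hc, h⟩ := h u hu
    obtain ⟨A, hA, B, hB, hAB⟩ := mem_nhds_prod_iff.1 hW
    refine ⟨B ∩ Metric.sphere 0 1, inter_mem (mem_nhdsWithin_of_mem_nhds hB) self_mem_nhdsWithin,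
      A ∩ U, inter_mem hA hU, c, hc, ?_⟩
    filter_upwards [h] with ω hω
    filter_upwards [hω] with k hk η hη w hw
    exact hk _ (hAB ⟨hη.1, hw.1⟩) ⟨hη.2, Metric.sphere_subset_closedBall hw.2⟩

end LowerBound

end

/-! ### Positivity of the limits -/

section

variable {Ω : Type*} [MeasurableSpace Ω] {μ : Measure Ω} [IsProbabilityMeasure μ] {ξ : ℤ → Ω → ℝ}
variable {d : ℕ} {f M : Family d} {Θ : Set (Param d)} {αf αv : ℕ → ℕ → ℝ} {h₀ : ℝ}
variable {θ : Param d} {H : (ℕ → ℝ) → ℝ}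

/-- Since the law of the innovations is not concentrated on two points, `ξ` and `1 - ξ²` are
linearly independent, even with coefficients which depend on the past. -/
theorem IsInnovation.ae_eq_zero_of_head_tail (hξ : IsInnovation μ ξ) {A B : (ℕ → ℝ) → ℝ}
    (hA : Measurable A) (hB : Measurable B)
    (h : ∀ᵐ e ∂(innovLaw μ ξ), e 0 * A (dropFirst 1 e) + (1 - e 0 ^ 2) * B (dropFirst 1 e) = 0) :
    ∀ᵐ e ∂(innovLaw μ ξ), A (dropFirst 1 e) = 0 ∧ B (dropFirst 1 e) = 0 := by
  have := hξ.isProbabilityMeasure_innovLaw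
  have := hξ.isProbabilityMeasure_map
  have hmp := hξ.measurePreserving_head_tail
  have hset : MeasurableSet {q : ℝ × (ℕ → ℝ) | q.1 * A q.2 + (1 - q.1 ^ 2) * B q.2 = 0} :=
    measurableSet_eq_fun ((measurable_fst.mul (hA.comp measurable_snd)).add
      ((measurable_const.sub (measurable_fst.pow_const 2)).mul (hB.comp measurable_snd)))
      measurable_const
  have h1 : ∀ᵐ q ∂((μ.map (ξ 0)).prod (innovLaw μ ξ)),
      q.1 * A q.2 + (1 - q.1 ^ 2) * B q.2 = 0 := by
    rw [← hmp.map_eq, ae_map_iff hmp.measurable.aemeasurable hset]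
    exact h
  have h2 : ∀ᵐ q ∂((innovLaw μ ξ).prod (μ.map (ξ 0))),
      q.2 * A q.1 + (1 - q.2 ^ 2) * B q.1 = 0 :=
    (Measure.measurePreserving_swap (μ := innovLaw μ ξ) (ν := μ.map (ξ 0))).quasiMeasurePreserving.ae h1
  have h3 := Measure.ae_ae_of_ae_prod h2
  refine (hξ.measurePreserving_dropFirst 1).quasiMeasurePreserving.ae (p := fun e => A e = 0 ∧ B e = 0) ?_
  filter_upwards [h3] with e he
  have h4 := ae_of_ae_map (hξ.measurable 0).aemeasurable he
  by_cases hB0 : B e = 0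
  · refine ⟨?_, hB0⟩
    by_contra hA0
    refine hξ.not_two_points 0 0 ?_
    filter_upwards [h4] with ω hω
    simp only [hB0, mul_zero, add_zero] at hω
    exact Or.inl ((mul_eq_zero.1 hω).resolve_right hA0)
  · exfalso
    -- the innovation would be a root of `x² - s x - 1`
    set s := A e / B e with hs
    have hdisc : 0 ≤ s ^ 2 + 4 := by positivity
    refine hξ.not_two_points ((s + √(s ^ 2 + 4)) / 2) ((s - √(s ^ 2 + 4)) / 2) ?_
    filter_upwards [h4] with ω hω
    have h5 : (ξ 0 ω - (s + √(s ^ 2 + 4)) / 2) * (ξ 0 ω - (s - √(s ^ 2 + 4)) / 2) = 0 := by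
      have h6 := Real.sq_sqrt hdisc
      have h7 : A e = s * B e := by rw [hs]; field_simp
      rw [h7] at hω
      have h8 : ξ 0 ω * s + (1 - ξ 0 ω ^ 2) = 0 := by
        have : (ξ 0 ω * s + (1 - ξ 0 ω ^ 2)) * B e = 0 := by linarith
        exact (mul_eq_zero.1 this).resolve_right hB0
      nlinarith
    rcases mul_eq_zero.1 h5 with h | h
    · exact Or.inl (sub_eq_zero.1 h)
    · exact Or.inr (sub_eq_zero.1 h)

section Functions

variable {U : Set (Param d)}

theorem IsRegular.measurable_fderiv_f (hR : IsRegular f M Θ αf αv h₀) (hU : IsOpen U) (hUΘ : U ⊆ Θ)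
    (hθ : θ ∈ U) (u : Param d) : Measurable fun y => fderiv ℝ (fun η => f η y) θ u :=
  measurable_fderiv_apply_param hU (fun η hη => hR.measurable_f η (hUΘ hη))
    (fun y η hη => (hR.smooth_f y η (hUΘ hη)).differentiableAt (by norm_num)) u hθ

theorem IsRegular.measurable_fderiv_fderiv_f (hR : IsRegular f M Θ αf αv h₀) (hU : IsOpen U)
    (hUΘ : U ⊆ Θ) (hθ : θ ∈ U) (u : Param d) :
    Measurable fun y => fderiv ℝ (fderiv ℝ fun η => f η y) θ u u :=
  measurable_fderiv_fderiv_apply_param hU (fun η hη => hR.measurable_f η (hUΘ hη))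
    (fun y η hη => hR.smooth_f y η (hUΘ hη)) u hθ

theorem IsRegular.measurable_fderiv_h (hR : IsRegular f M Θ αf αv h₀) (hU : IsOpen U) (hUΘ : U ⊆ Θ)
    (hθ : θ ∈ U) (u : Param d) : Measurable fun y => fderiv ℝ (fun η => hFun M η y) θ u :=
  measurable_fderiv_apply_param hU (fun η hη => (hR.measurable_M η (hUΘ hη)).pow_const 2)
    (fun y η hη => (hR.contDiffAt_h y (hUΘ hη)).differentiableAt (by norm_num)) u hθ

theorem IsRegular.measurable_fderiv_fderiv_h (hR : IsRegular f M Θ αf αv h₀) (hU : IsOpen U)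
    (hUΘ : U ⊆ Θ) (hθ : θ ∈ U) (u : Param d) :
    Measurable fun y => fderiv ℝ (fderiv ℝ fun η => hFun M η y) θ u u :=
  measurable_fderiv_fderiv_apply_param hU (fun η hη => (hR.measurable_M η (hUΘ hη)).pow_const 2)
    (fun y _ hη => hR.contDiffAt_h y (hUΘ hη)) u hθ

end Functions

theorem score_eq_of_model {m e a₁ g₁ : ℝ} (hm : m ≠ 0) :
    score (m * e) (-a₁) (m ^ 2) g₁ = e * (-2 * a₁ / m) + (1 - e ^ 2) * (g₁ / m ^ 2) := by
  unfold score
  field_simp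
  ring

theorem scoreDeriv_eq_of_model {m e a₁ a₂ g₁ g₂ : ℝ} (hm : m ≠ 0) :
    scoreDeriv (m * e) (-a₁) (-a₂) (m ^ 2) g₁ g₂ = (2 * a₁ ^ 2 / m ^ 2 + g₁ ^ 2 / (m ^ 2) ^ 2)
      + e * (-2 * m * a₂ / m ^ 2 + 4 * m * a₁ * g₁ / (m ^ 2) ^ 2)
      + (e ^ 2 - 1) * (2 * g₁ ^ 2 / (m ^ 2) ^ 2 - g₂ / m ^ 2) := by
  unfold scoreDeriv
  field_simp
  ring

/-- Bounds for the coefficients in `scoreDeriv_eq_of_model`. -/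
theorem HasScoreBound.coeff_le {h₀ V z z₁ z₂ m g₁ g₂ : ℝ} (h0 : 0 < h₀)
    (h : HasScoreBound h₀ V z z₁ z₂ (m ^ 2) g₁ g₂) (hm : |m| ≤ V) :
    |2 * z₁ ^ 2 / m ^ 2 + g₁ ^ 2 / (m ^ 2) ^ 2| ≤ (4 / h₀ + 16 / h₀ ^ 2) * V ^ 4 ∧
    |-2 * m * (-z₂) / m ^ 2 + 4 * m * (-z₁) * g₁ / (m ^ 2) ^ 2| ≤ (4 / h₀ + 16 / h₀ ^ 2) * V ^ 4 ∧
    |2 * g₁ ^ 2 / (m ^ 2) ^ 2 - g₂ / m ^ 2| ≤ (4 / h₀ + 16 / h₀ ^ 2) * V ^ 4 := by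
  obtain ⟨hV, hg, -, hz₁, hz₂, hg₁, h2⟩ := h
  have hV24 : V ^ 2 ≤ V ^ 4 := pow_le_pow_right₀ hV (by norm_num)
  have hg0 : 0 < m ^ 2 := h0.trans_le hg
  have hV4 : 0 ≤ V ^ 4 := by positivity
  have i1 : 0 ≤ 1 / h₀ * V ^ 4 := by positivity
  have i2 : 0 ≤ 1 / h₀ ^ 2 * V ^ 4 := by positivity
  have hsplit : (4 / h₀ + 16 / h₀ ^ 2) * V ^ 4 = 4 * (1 / h₀ * V ^ 4) + 16 * (1 / h₀ ^ 2 * V ^ 4) := by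
    ring
  rw [hsplit]
  have e1 : g₁ ^ 2 / (m ^ 2) ^ 2 ≤ 4 * (1 / h₀ ^ 2 * V ^ 4) := by
    rw [← sq_abs g₁]
    calc |g₁| ^ 2 / (m ^ 2) ^ 2 ≤ (2 * V ^ 2) ^ 2 / h₀ ^ 2 := by gcongr
      _ = 4 * (1 / h₀ ^ 2 * V ^ 4) := by ring
  have e1' : 0 ≤ g₁ ^ 2 / (m ^ 2) ^ 2 := by positivity
  have hdiv : ∀ b c : ℝ, |b| ≤ c * V ^ 2 → 0 ≤ c → |b / m ^ 2| ≤ c * (1 / h₀ * V ^ 4) := by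
    intro b c hb hc
    rw [abs_div, abs_of_pos hg0]
    calc |b| / m ^ 2 ≤ c * V ^ 2 / h₀ := by gcongr
      _ ≤ c * V ^ 4 / h₀ := by gcongr
      _ = _ := by ring
  refine ⟨?_, ?_, ?_⟩
  · have e2 : 2 * z₁ ^ 2 / m ^ 2 ≤ 2 * (1 / h₀ * V ^ 4) := by
      refine (le_abs_self _).trans (hdiv _ 2 ?_ (by norm_num))
      rw [abs_of_nonneg (by positivity), ← sq_abs z₁]
      gcongr
    rw [abs_of_nonneg (by positivity)]
    linarith
  · have e2 : |-2 * m * (-z₂) / m ^ 2| ≤ 2 * (1 / h₀ * V ^ 4) := by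
      refine hdiv _ 2 ?_ (by norm_num)
      rw [abs_mul, abs_mul, abs_neg, abs_neg, abs_two]
      calc 2 * |m| * |z₂| ≤ 2 * V * V := by gcongr
        _ = 2 * V ^ 2 := by ring
    have e3 : |4 * m * (-z₁) * g₁ / (m ^ 2) ^ 2| ≤ 8 * (1 / h₀ ^ 2 * V ^ 4) := by
      rw [abs_div, abs_mul, abs_mul, abs_mul, abs_neg, abs_of_pos (pow_pos hg0 2),
        abs_of_pos (show (0 : ℝ) < 4 by norm_num)]
      calc 4 * |m| * |z₁| * |g₁| / (m ^ 2) ^ 2 ≤ 4 * V * V * (2 * V ^ 2) / h₀ ^ 2 := by gcongr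
        _ = _ := by ring
    refine (abs_add_le _ _).trans ?_
    linarith
  · have e2 : |g₂ / m ^ 2| ≤ 2 * (1 / h₀ * V ^ 4) + 2 * (1 / h₀ ^ 2 * V ^ 4) := by
      rcases h2 with h2 | ⟨m', m₁, m₂, hmm, hm', rfl, rfl, hm₂⟩
      · have := hdiv g₂ 1 (by linarith) (by norm_num)
        linarith
      · have h3 : (2 * m₁ ^ 2 + 2 * m' * m₂) / m ^ 2
            = (2 * m' * m₁) ^ 2 / (m ^ 2) ^ 2 / 2 + 2 * m' * m₂ / m ^ 2 := by
          have : m' ≠ 0 := by rintro rfl; rw [hmm] at hg0; simp at hg0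
          rw [hmm]
          field_simp
        have h4 := hdiv (2 * m' * m₂) 2 (by
          rw [abs_mul, abs_mul, abs_two]
          calc 2 * |m'| * |m₂| ≤ 2 * V * V := by gcongr
            _ = 2 * V ^ 2 := by ring) (by norm_num)
        rw [h3]
        refine (abs_add_le _ _).trans ?_
        rw [abs_of_nonneg (by positivity)]
        linarith
    have e3 : |2 * g₁ ^ 2 / (m ^ 2) ^ 2| ≤ 8 * (1 / h₀ ^ 2 * V ^ 4) := by
      rw [abs_of_nonneg (by positivity), mul_div_assoc]
      linarith
    have := abs_sub (2 * g₁ ^ 2 / (m ^ 2) ^ 2) (g₂ / m ^ 2)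
    linarith

section Positivity

variable {U : Set (Param d)} {u : Param d}

/-- At the parameter of the solution, the mean of the second derivative of the quasi-likelihood is
positive. -/
theorem IsSolution.integral_fderiv_fderiv_pos (hξ : IsInnovation μ ξ)
    (hR : IsRegular f M Θ αf αv h₀) (hS : IsSolution μ ξ f M θ H)
    (hI : IsIdentified (innovLaw μ ξ) f M Θ H) (hU : IsOpen U) (hUΘ : U ⊆ Θ) (hθ : θ ∈ U)
    (hu0 : u ≠ 0) (hu : ‖u‖ ≤ 1) :
    Integrable (fun e => fderiv ℝ (fderiv ℝ fun η => quasiLik f M η (H e) (pastOf H e)) θ u u)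
      (innovLaw μ ξ) ∧
    0 < ∫ e, fderiv ℝ (fderiv ℝ fun η => quasiLik f M η (H e) (pastOf H e)) θ u u
      ∂(innovLaw μ ξ) := by
  have := hξ.isProbabilityMeasure_innovLaw
  have hpos := hR.pos
  obtain ⟨V, hV⟩ := exists_isEnvelope hξ hR hS.measurable hS.memLp
  have hV4 : Integrable (fun e => V e ^ 4) (innovLaw μ ξ) := by
    have := hV.memLp.integrable_norm_pow (by norm_num)
    refine this.congr (Eventually.of_forall fun e => ?_)
    simp only [Real.norm_eq_abs]
    exact Even.pow_abs (by decide) _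
  set a₁ : (ℕ → ℝ) → ℝ := fun y => fderiv ℝ (fun η => f η y) θ u with ha₁
  set a₂ : (ℕ → ℝ) → ℝ := fun y => fderiv ℝ (fderiv ℝ fun η => f η y) θ u u with ha₂
  set g₁ : (ℕ → ℝ) → ℝ := fun y => fderiv ℝ (fun η => hFun M η y) θ u with hg₁
  set g₂ : (ℕ → ℝ) → ℝ := fun y => fderiv ℝ (fderiv ℝ fun η => hFun M η y) θ u u with hg₂
  have ma₁ : Measurable a₁ := hR.measurable_fderiv_f hU hUΘ hθ u
  have ma₂ : Measurable a₂ := hR.measurable_fderiv_fderiv_f hU hUΘ hθ u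
  have mg₁ : Measurable g₁ := hR.measurable_fderiv_h hU hUΘ hθ u
  have mg₂ : Measurable g₂ := hR.measurable_fderiv_fderiv_h hU hUΘ hθ u
  have mM : Measurable (M θ) := hR.measurable_M θ (hUΘ hθ)
  have hM0 : ∀ y, M θ y ≠ 0 := fun y h0 => by
    have := hpos.trans_le (hR.le_h θ (hUΘ hθ) y)
    simp [hFun, h0] at this
  -- the decomposition of the second derivative as `A + ξ B₁ + (ξ² - 1) B₂`
  set A : (ℕ → ℝ) → ℝ := fun y => 2 * a₁ y ^ 2 / M θ y ^ 2 + g₁ y ^ 2 / (M θ y ^ 2) ^ 2 with hA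
  set B₁ : (ℕ → ℝ) → ℝ := fun y => -2 * M θ y * a₂ y / M θ y ^ 2
    + 4 * M θ y * a₁ y * g₁ y / (M θ y ^ 2) ^ 2 with hB₁
  set B₂ : (ℕ → ℝ) → ℝ := fun y => 2 * g₁ y ^ 2 / (M θ y ^ 2) ^ 2 - g₂ y / M θ y ^ 2 with hB₂
  have mA : Measurable A := by fun_prop
  have mB₁ : Measurable B₁ := by fun_prop
  have mB₂ : Measurable B₂ := by fun_prop
  have hpm := measurable_pastOf hS.measurable
  have hhist := measurable_historyOf hS.measurable
  have hbound : ∀ᵐ e ∂(innovLaw μ ξ), |A (pastOf H e)| ≤ (4 / h₀ + 16 / h₀ ^ 2) * V e ^ 4 ∧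
      |B₁ (pastOf H e)| ≤ (4 / h₀ + 16 / h₀ ^ 2) * V e ^ 4 ∧
      |B₂ (pastOf H e)| ≤ (4 / h₀ + 16 / h₀ ^ 2) * V e ^ 4 := by
    filter_upwards [hV.ae_le, hV.ae_dominated] with e h1 h2
    have h3 := (IsEnvelope.hasScoreBound hR h2 (hV.one_le e) h1 (hUΘ hθ) (fun k => le_rfl)
      hu).coeff_le hpos (IsEnvelope.abs_le hR h2 (hV.one_le e) (hUΘ hθ) (fun k => le_rfl)).2.1
    simpa only [neg_neg, neg_sq] using h3
  have iA : Integrable (fun e => A (pastOf H e)) (innovLaw μ ξ) :=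
    (hV4.const_mul _).mono' (mA.comp hpm).aestronglyMeasurable (hbound.mono fun e he => he.1)
  have iB₁ : Integrable (fun e => B₁ (pastOf H e)) (innovLaw μ ξ) :=
    (hV4.const_mul _).mono' (mB₁.comp hpm).aestronglyMeasurable (hbound.mono fun e he => he.2.1)
  have iB₂ : Integrable (fun e => B₂ (pastOf H e)) (innovLaw μ ξ) :=
    (hV4.const_mul _).mono' (mB₂.comp hpm).aestronglyMeasurable (hbound.mono fun e he => he.2.2)
  have hsq : Integrable (fun ω => ξ 0 ω ^ 2) μ :=
    (hξ.memLp.mono_exponent (by norm_num)).integrable_sq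
  have h1 := hξ.integral_head_mul_tail (φ := fun x => x) measurable_id
    (hξ.memLp.integrable (by norm_num)) (B := fun e => B₁ (historyOf H e)) (mB₁.comp hhist)
    (by simpa only [← pastOf_eq_historyOf] using iB₁)
  have h2 := hξ.integral_head_mul_tail (φ := fun x => x ^ 2 - 1) (by fun_prop)
    (hsq.sub (integrable_const 1)) (B := fun e => B₂ (historyOf H e)) (mB₂.comp hhist)
    (by simpa only [← pastOf_eq_historyOf] using iB₂)
  simp only [← pastOf_eq_historyOf] at h1 h2
  rw [hξ.mean, zero_mul] at h1
  rw [integral_sub hsq (integrable_const 1), hξ.variance] at h2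
  simp only [integral_const, probReal_univ, one_smul, sub_self, zero_mul] at h2
  have hid : ∀ᵐ e ∂(innovLaw μ ξ),
      fderiv ℝ (fderiv ℝ fun η => quasiLik f M η (H e) (pastOf H e)) θ u u
        = A (pastOf H e) + e 0 * B₁ (pastOf H e) + (e 0 ^ 2 - 1) * B₂ (pastOf H e) := by
    filter_upwards [hS.model] with e he
    rw [hR.fderiv_fderiv_quasiLik _ _ (hUΘ hθ)]
    have h5 : H e - f θ (pastOf H e) = M θ (pastOf H e) * e 0 := by rw [he]; ring
    rw [h5]
    exact scoreDeriv_eq_of_model (hM0 _)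
  have i1 : Integrable (fun e => A (pastOf H e) + e 0 * B₁ (pastOf H e)) (innovLaw μ ξ) := iA.add h1.1
  have i2 : Integrable (fun e => A (pastOf H e) + e 0 * B₁ (pastOf H e)
      + (e 0 ^ 2 - 1) * B₂ (pastOf H e)) (innovLaw μ ξ) := i1.add h2.1
  refine ⟨i2.congr (by filter_upwards [hid] with e he using he.symm), ?_⟩
  rw [integral_congr_ae hid, integral_add i1 h2.1, integral_add iA h1.1, h1.2, h2.2, add_zero,
    add_zero]
  have hA0 : ∀ y, 0 ≤ A y := fun y => by simp only [hA]; positivity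
  refine lt_of_le_of_ne (integral_nonneg fun e => hA0 _) fun h0 => hu0 ?_
  have hz := (integral_eq_zero_iff_of_nonneg (fun e => hA0 _) iA).1 h0.symm
  refine hI.eq_zero_of_fderiv θ (hUΘ hθ) u ?_
  filter_upwards [hz] with e he
  have he' : A (pastOf H e) = 0 := he
  have hMp := hM0 (pastOf H e)
  have c1 : 0 ≤ 2 * a₁ (pastOf H e) ^ 2 / M θ (pastOf H e) ^ 2 := by positivity
  have c2 : 0 ≤ g₁ (pastOf H e) ^ 2 / (M θ (pastOf H e) ^ 2) ^ 2 := by positivity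
  simp only [hA] at he'
  have c3 : 2 * a₁ (pastOf H e) ^ 2 / M θ (pastOf H e) ^ 2 = 0 := by linarith
  have c4 : g₁ (pastOf H e) ^ 2 / (M θ (pastOf H e) ^ 2) ^ 2 = 0 := by linarith
  have d1 := (div_eq_zero_iff.1 c3).resolve_right (pow_ne_zero 2 hMp)
  have d2 := (div_eq_zero_iff.1 c4).resolve_right (pow_ne_zero 2 (pow_ne_zero 2 hMp))
  refine ⟨?_, pow_eq_zero_iff (two_ne_zero) |>.1 d2⟩
  have : a₁ (pastOf H e) ^ 2 = 0 := by linarith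
  exact pow_eq_zero_iff (two_ne_zero) |>.1 this

/-- The scores at the parameter of the solution do not degenerate. They need not be square
integrable, hence the truncation. -/
theorem IsSolution.integral_min_score_sq_pos (hξ : IsInnovation μ ξ)
    (hR : IsRegular f M Θ αf αv h₀) (hS : IsSolution μ ξ f M θ H)
    (hI : IsIdentified (innovLaw μ ξ) f M Θ H) (hU : IsOpen U) (hUΘ : U ⊆ Θ) (hθ : θ ∈ U)
    (hu0 : u ≠ 0) :
    (Measurable fun e => min (fderiv ℝ (fun η => quasiLik f M η (H e) (pastOf H e)) θ u ^ 2) 1) ∧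
    0 < ∫ e, min (fderiv ℝ (fun η => quasiLik f M η (H e) (pastOf H e)) θ u ^ 2) 1
      ∂(innovLaw μ ξ) := by
  have := hξ.isProbabilityMeasure_innovLaw
  have hm : Measurable fun e => fderiv ℝ (fun η => quasiLik f M η (H e) (pastOf H e)) θ u :=
    measurable_fderiv_apply_param (F := fun η e => quasiLik f M η (H e) (pastOf H e)) hU
      (fun η hη => measurable_quasiLik hR hS.measurable (hUΘ hη))
      (fun e η hη => (hR.contDiffAt_quasiLik _ _ (hUΘ hη)).differentiableAt (by norm_num)) u hθ
  have hm' : Measurable fun e =>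
      min (fderiv ℝ (fun η => quasiLik f M η (H e) (pastOf H e)) θ u ^ 2) 1 :=
    (hm.pow_const 2).min measurable_const
  refine ⟨hm', ?_⟩
  have hnn : ∀ e, 0 ≤ min (fderiv ℝ (fun η => quasiLik f M η (H e) (pastOf H e)) θ u ^ 2) 1 :=
    fun e => le_min (sq_nonneg _) zero_le_one
  have hint : Integrable (fun e => min (fderiv ℝ (fun η => quasiLik f M η (H e) (pastOf H e)) θ u ^ 2)
      1) (innovLaw μ ξ) := by
    refine (integrable_const (1 : ℝ)).mono' hm'.aestronglyMeasurable (Eventually.of_forall fun e => ?_)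
    rw [Real.norm_eq_abs, abs_of_nonneg (hnn e)]
    exact min_le_right _ _
  refine lt_of_le_of_ne (integral_nonneg hnn) fun h0 => hu0 ?_
  have hz := (integral_eq_zero_iff_of_nonneg hnn hint).1 h0.symm
  have hM0 : ∀ y, M θ y ≠ 0 := fun y h0 => by
    have := hR.pos.trans_le (hR.le_h θ (hUΘ hθ) y)
    simp [hFun, h0] at this
  have mM : Measurable (M θ) := hR.measurable_M θ (hUΘ hθ)
  have ma₁ := hR.measurable_fderiv_f hU hUΘ hθ u
  have mg₁ := hR.measurable_fderiv_h hU hUΘ hθ u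
  -- the decomposition of the score as `ξ A + (1 - ξ²) B`
  set A : (ℕ → ℝ) → ℝ := fun y => -2 * fderiv ℝ (fun η => f η y) θ u / M θ y with hA
  set B : (ℕ → ℝ) → ℝ := fun y => fderiv ℝ (fun η => hFun M η y) θ u / M θ y ^ 2 with hB
  have mA : Measurable A := by fun_prop
  have mB : Measurable B := by fun_prop
  have hhist := measurable_historyOf hS.measurable
  have hAB := hξ.ae_eq_zero_of_head_tail (A := fun e => A (historyOf H e))
    (B := fun e => B (historyOf H e)) (mA.comp hhist) (mB.comp hhist) (by
      simp only [← pastOf_eq_historyOf]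
      filter_upwards [hz, hS.model] with e he hmod
      have he' : min (fderiv ℝ (fun η => quasiLik f M η (H e) (pastOf H e)) θ u ^ 2) 1 = 0 := he
      have h1 : fderiv ℝ (fun η => quasiLik f M η (H e) (pastOf H e)) θ u ^ 2 = 0 := by
        rcases min_choice (fderiv ℝ (fun η => quasiLik f M η (H e) (pastOf H e)) θ u ^ 2) 1
          with h | h
        · rw [h] at he'; exact he'
        · rw [h] at he'; exact absurd he' one_ne_zero
      have h2 := pow_eq_zero_iff (two_ne_zero) |>.1 h1
      rw [hR.fderiv_quasiLik _ _ (hUΘ hθ)] at h2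
      have h5 : H e - f θ (pastOf H e) = M θ (pastOf H e) * e 0 := by rw [hmod]; ring
      rw [h5] at h2
      rw [← h2]
      exact (score_eq_of_model (hM0 _)).symm)
  simp only [← pastOf_eq_historyOf] at hAB
  refine hI.eq_zero_of_fderiv θ (hUΘ hθ) u ?_
  filter_upwards [hAB] with e he
  have c1 := (div_eq_zero_iff.1 he.1).resolve_right (hM0 _)
  have c2 := (div_eq_zero_iff.1 he.2).resolve_right (pow_ne_zero 2 (hM0 _))
  exact ⟨(mul_eq_zero.1 c1).resolve_left (by norm_num), c2⟩

end Positivity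

end

/-! ### The derivatives along the path of a stationary solution -/

section

variable {Ω : Type*} [MeasurableSpace Ω] {μ : Measure Ω} [IsProbabilityMeasure μ] {ξ : ℤ → Ω → ℝ}
variable {d : ℕ} {f M : Family d} {Θ : Set (Param d)} {αf αv : ℕ → ℕ → ℝ} {h₀ : ℝ}
variable {θ : Param d} {H : (ℕ → ℝ) → ℝ} {U : Set (Param d)} {u : Param d}

section Limits

variable {ι : Type*} {l : Filter ι}

theorem tendsto_score {z z₁ g g₁ : ι → ℝ} {z' z₁' g' g₁' : ℝ} (hz : Tendsto z l (𝓝 z'))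
    (hz₁ : Tendsto z₁ l (𝓝 z₁')) (hg : Tendsto g l (𝓝 g')) (hg₁ : Tendsto g₁ l (𝓝 g₁'))
    (h0 : g' ≠ 0) :
    Tendsto (fun i => score (z i) (z₁ i) (g i) (g₁ i)) l (𝓝 (score z' z₁' g' g₁')) :=
  ((((hz.const_mul 2).mul hz₁).div hg h0).sub
    (((hz.pow 2).mul hg₁).div (hg.pow 2) (pow_ne_zero 2 h0))).add (hg₁.div hg h0)

theorem tendsto_scoreDeriv {z z₁ z₂ g g₁ g₂ : ι → ℝ} {z' z₁' z₂' g' g₁' g₂' : ℝ}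
    (hz : Tendsto z l (𝓝 z')) (hz₁ : Tendsto z₁ l (𝓝 z₁')) (hz₂ : Tendsto z₂ l (𝓝 z₂'))
    (hg : Tendsto g l (𝓝 g')) (hg₁ : Tendsto g₁ l (𝓝 g₁')) (hg₂ : Tendsto g₂ l (𝓝 g₂'))
    (h0 : g' ≠ 0) :
    Tendsto (fun i => scoreDeriv (z i) (z₁ i) (z₂ i) (g i) (g₁ i) (g₂ i)) l
      (𝓝 (scoreDeriv z' z₁' z₂' g' g₁' g₂')) :=
  (((((((hz₁.pow 2).const_mul 2).div hg h0).add (((hz.const_mul 2).mul hz₂).div hg h0)).sub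
    ((((hz.const_mul 4).mul hz₁).mul hg₁).div (hg.pow 2) (pow_ne_zero 2 h0))).add
    ((((hz.pow 2).const_mul 2).mul (hg₁.pow 2)).div (hg.pow 3) (pow_ne_zero 3 h0))).sub
    (((hz.pow 2).mul hg₂).div (hg.pow 2) (pow_ne_zero 2 h0))).add (hg₂.div hg h0) |>.sub
    ((hg₁.pow 2).div (hg.pow 2) (pow_ne_zero 2 h0))

theorem tendsto_clm_apply {E F : Type*} [NormedAddCommGroup E] [NormedSpace ℝ E]
    [NormedAddCommGroup F] [NormedSpace ℝ F] {φ : ι → E →L[ℝ] F} {φ' : E →L[ℝ] F} {v : ι → E}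
    {v' : E} (hφ : Tendsto φ l (𝓝 φ')) (hv : Tendsto v l (𝓝 v')) :
    Tendsto (fun i => φ i (v i)) l (𝓝 (φ' v')) :=
  (isBoundedBilinearMap_apply.continuous.tendsto (φ', v')).comp (hφ.prodMk_nhds hv)

theorem tendsto_truncation {K : Set (Param d × Param d)} :
    Tendsto (fun q : ℕ × (Param d × Param d) => (q.1 - 1, q.2.1)) (atTop ×ˢ 𝓝[K] (θ, u))
      (atTop ×ˢ 𝓝 θ) := by
  refine Tendsto.prodMk ((tendsto_sub_atTop_nat 1).comp tendsto_fst) ?_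
  have h : Tendsto (fun q : Param d × Param d => q.1) (𝓝[K] (θ, u)) (𝓝 θ) :=
    (continuous_fst.tendsto (θ, u)).mono_left nhdsWithin_le_nhds
  exact h.comp tendsto_snd

theorem tendsto_direction {K : Set (Param d × Param d)} :
    Tendsto (fun q : ℕ × (Param d × Param d) => q.2.2) (atTop ×ˢ 𝓝[K] (θ, u)) (𝓝 u) := by
  have h : Tendsto (fun q : Param d × Param d => q.2) (𝓝[K] (θ, u)) (𝓝 u) :=
    (continuous_snd.tendsto (θ, u)).mono_left nhdsWithin_le_nhds
  exact h.comp tendsto_snd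

theorem JointTendsto.comp_truncation {F : Type*} [NormedAddCommGroup F] [NormedSpace ℝ F]
    {G : ℕ → Param d → F} {G₀ : Param d → F} (h : JointTendsto atTop G G₀ U) (hθ : θ ∈ U)
    {K : Set (Param d × Param d)} :
    Tendsto (fun q : ℕ × (Param d × Param d) => G (q.1 - 1) q.2.1) (atTop ×ˢ 𝓝[K] (θ, u))
      (𝓝 (G₀ θ)) :=
  (h θ hθ).comp tendsto_truncation

theorem HasCutoffLimit.tendsto_fderiv (hR : IsRegular f M Θ αf αv h₀) (hUΘ : U ⊆ Θ)
    (hθ : θ ∈ U) {e : ℕ → ℝ} (h : HasCutoffLimit f M U (pastOf H e)) {B : Set (Param d)} :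
    Tendsto (fun q : ℕ × (Param d × Param d) =>
      fderiv ℝ (fun η => truncLik f M H q.1 η e) q.2.1 q.2.2) (atTop ×ˢ 𝓝[U ×ˢ B] (θ, u))
      (𝓝 (fderiv ℝ (fun η => quasiLik f M η (H e) (pastOf H e)) θ u)) := by
  have hd := tendsto_direction (θ := θ) (u := u) (K := U ×ˢ B)
  rw [hR.fderiv_quasiLik _ _ (hUΘ hθ)]
  refine (tendsto_score (tendsto_const_nhds.sub (h.f₀.comp_truncation hθ))
    (tendsto_clm_apply (h.f₁.comp_truncation hθ) hd).neg (h.h₀.comp_truncation hθ)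
    (tendsto_clm_apply (h.h₁.comp_truncation hθ) hd)
    (hR.pos.trans_le (hR.le_h θ (hUΘ hθ) _)).ne').congr' ?_
  filter_upwards [(eventually_mem_nhdsWithin (a := (θ, u)) (s := U ×ˢ B)).prod_inr (atTop : Filter ℕ)]
    with q hq
  exact (hR.fderiv_quasiLik _ _ (hUΘ hq.1) _).symm

theorem HasCutoffLimit.tendsto_fderiv_fderiv (hR : IsRegular f M Θ αf αv h₀)
    (hUΘ : U ⊆ Θ) (hθ : θ ∈ U) {e : ℕ → ℝ} (h : HasCutoffLimit f M U (pastOf H e))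
    {B : Set (Param d)} :
    Tendsto (fun q : ℕ × (Param d × Param d) =>
      fderiv ℝ (fderiv ℝ fun η => truncLik f M H q.1 η e) q.2.1 q.2.2 q.2.2)
      (atTop ×ˢ 𝓝[U ×ˢ B] (θ, u))
      (𝓝 (fderiv ℝ (fderiv ℝ fun η => quasiLik f M η (H e) (pastOf H e)) θ u u)) := by
  have hd := tendsto_direction (θ := θ) (u := u) (K := U ×ˢ B)
  rw [hR.fderiv_fderiv_quasiLik _ _ (hUΘ hθ)]
  refine (tendsto_scoreDeriv (tendsto_const_nhds.sub (h.f₀.comp_truncation hθ))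
    (tendsto_clm_apply (h.f₁.comp_truncation hθ) hd).neg
    (tendsto_clm_apply (tendsto_clm_apply (h.f₂.comp_truncation hθ) hd) hd).neg
    (h.h₀.comp_truncation hθ) (tendsto_clm_apply (h.h₁.comp_truncation hθ) hd)
    (tendsto_clm_apply (tendsto_clm_apply (h.h₂.comp_truncation hθ) hd) hd)
    (hR.pos.trans_le (hR.le_h θ (hUΘ hθ) _)).ne').congr' ?_
  filter_upwards [(eventually_mem_nhdsWithin (a := (θ, u)) (s := U ×ˢ B)).prod_inr (atTop : Filter ℕ)]
    with q hq
  exact (hR.fderiv_fderiv_quasiLik _ _ (hUΘ hq.1) _).symm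

end Limits

theorem integrable_pow_four (hξ : IsInnovation μ ξ) {V : (ℕ → ℝ) → ℝ}
    (hV : IsEnvelope (innovLaw μ ξ) f M Θ αv H V) : Integrable (fun e => V e ^ 4) (innovLaw μ ξ) := by
  have := hξ.isProbabilityMeasure_innovLaw
  have := hV.memLp.integrable_norm_pow (by norm_num)
  refine this.congr (Eventually.of_forall fun e => ?_)
  simp only [Real.norm_eq_abs]
  exact Even.pow_abs (by decide) _

theorem abs_fderiv_truncLik_le (hR : IsRegular f M Θ αf αv h₀) {V : (ℕ → ℝ) → ℝ} {e : ℕ → ℝ}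
    (hd : IsDominated f M Θ αv (pastOf H e) (V e)) (h1 : 1 ≤ V e) (hH : |H e| ≤ V e)
    (hθ : θ ∈ Θ) (hu : ‖u‖ ≤ 1) (t : ℕ) :
    |fderiv ℝ (fun η => truncLik f M H t η e) θ u| ≤ (6 / h₀ + 8 / h₀ ^ 2) * V e ^ 4 := by
  have h2 : fderiv ℝ (fun η => truncLik f M H t η e) θ u = _ := hR.fderiv_quasiLik _ _ hθ u
  rw [h2]
  exact (IsEnvelope.hasScoreBound hR hd h1 hH hθ (abs_cutoff_le _ _) hu).abs_score_le hR.pos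

/-- The second derivatives of the quasi-likelihood of a long path of a stationary solution are
bounded from below, uniformly near its parameter. -/
theorem IsSolution.exists_sum_fderiv_fderiv_ge (hξ : IsInnovation μ ξ)
    (hR : IsRegular f M Θ αf αv h₀) (hS : IsSolution μ ξ f M θ H)
    (hI : IsIdentified (innovLaw μ ξ) f M Θ H) (hθ : θ ∈ interior Θ) :
    ∃ W ∈ 𝓝 θ, ∃ c > 0, ∀ᵐ ω ∂μ, ∀ᶠ k : ℕ in atTop, ∀ η ∈ W,
      ∀ u ∈ Metric.sphere (0 : Param d) 1, c * k ≤ ∑ t ∈ Finset.Icc 1 k,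
        fderiv ℝ (fderiv ℝ fun η => truncLik f M H t η (innovPast ξ t ω)) η u u := by
  obtain ⟨r, hr, hball⟩ := Metric.mem_nhds_iff.1 (mem_interior_iff_mem_nhds.1 hθ)
  have hU : IsOpen (Metric.ball θ r) := Metric.isOpen_ball
  have hθU : θ ∈ Metric.ball θ r := Metric.mem_ball_self hr
  obtain ⟨V, hV⟩ := exists_isEnvelope hξ hR hS.measurable hS.memLp
  refine exists_sum_ge_sphere (Φ := fun t p ω => fderiv ℝ (fderiv ℝ fun η =>
    truncLik f M H t η (innovPast ξ t ω)) p.1 p.2 p.2) (Metric.ball_mem_nhds θ hr) fun u hu => ?_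
  have hu1 : ‖u‖ = 1 := by simpa using hu
  have hu0 : u ≠ 0 := fun h => by simp [h] at hu1
  obtain ⟨hint, hpos⟩ := hS.integral_fderiv_fderiv_pos hξ hR hI hU hball hθU hu0 hu1.le
  refine hξ.exists_sum_ge (K := Metric.ball θ r ×ˢ Metric.closedBall (0 : Param d) 1)
    (Φ := fun t p e => fderiv ℝ (fderiv ℝ fun η => truncLik f M H t η e) p.1 p.2 p.2)
    (fun t p hp => measurable_fderiv_fderiv_apply_param hU
      (fun η hη => measurable_truncLik hR hS.measurable t (hball hη))
      (fun e η hη => hR.contDiffAt_quasiLik _ _ (hball hη)) p.2 hp.1)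
    (fun t e => ?_) (g := fun e => (6 / h₀ + 28 / h₀ ^ 2) * V e ^ 4)
    ((hV.measurable.pow_const 4).const_mul _) ((integrable_pow_four hξ hV).const_mul _) ?_
    ⟨hθU, by simp [hu1]⟩ ?_ hint ?_ hpos
  · intro p hp
    have h1 : ContinuousAt (fun η => fderiv ℝ (fderiv ℝ fun η => truncLik f M H t η e) η) p.1 :=
      (((hR.contDiffAt_quasiLik _ _ (hball hp.1)).fderiv_right (m := 1) (by norm_num)).fderiv_right
        (m := 0) (by norm_num)).continuousAt
    have h2 : ContinuousAt (fun p : Param d × Param d =>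
        fderiv ℝ (fderiv ℝ fun η => truncLik f M H t η e) p.1) p := h1.comp continuousAt_fst
    exact ((h2.clm_apply continuousAt_snd).clm_apply continuousAt_snd).continuousWithinAt
  · filter_upwards [hV.ae_le, hV.ae_dominated] with e h1 h2 t p hp
    have h3 : fderiv ℝ (fderiv ℝ fun η => truncLik f M H t η e) p.1 p.2 p.2 = _ :=
      hR.fderiv_fderiv_quasiLik _ _ (hball hp.1) p.2
    rw [h3]
    exact (IsEnvelope.hasScoreBound hR h2 (hV.one_le e) h1 (hball hp.1) (abs_cutoff_le _ _)
      (by simpa using hp.2)).le_scoreDeriv hR.pos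
  · exact measurable_fderiv_fderiv_apply_param
      (F := fun η e => quasiLik f M η (H e) (pastOf H e)) hU
      (fun η hη => measurable_quasiLik hR hS.measurable (hball hη))
      (fun e η hη => hR.contDiffAt_quasiLik _ _ (hball hη)) u hθU
  · filter_upwards [ae_hasCutoffLimit hξ hR hS.measurable hS.memLp hU
      (convex_ball θ r).isPreconnected hball] with e he
    exact he.tendsto_fderiv_fderiv hR hball hθU

/-- The scores of a long path do not degenerate. -/
theorem IsSolution.exists_sum_fderiv_sq_ge (hξ : IsInnovation μ ξ)
    (hR : IsRegular f M Θ αf αv h₀) (hS : IsSolution μ ξ f M θ H)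
    (hI : IsIdentified (innovLaw μ ξ) f M Θ H) (hθ : θ ∈ interior Θ) :
    ∃ W ∈ 𝓝 θ, ∃ c > 0, ∀ᵐ ω ∂μ, ∀ᶠ k : ℕ in atTop, ∀ η ∈ W,
      ∀ u ∈ Metric.sphere (0 : Param d) 1, c * k ≤ ∑ t ∈ Finset.Icc 1 k,
        fderiv ℝ (fun η => truncLik f M H t η (innovPast ξ t ω)) η u ^ 2 := by
  have := hξ.isProbabilityMeasure_innovLaw
  obtain ⟨r, hr, hball⟩ := Metric.mem_nhds_iff.1 (mem_interior_iff_mem_nhds.1 hθ)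
  have hU : IsOpen (Metric.ball θ r) := Metric.isOpen_ball
  have hθU : θ ∈ Metric.ball θ r := Metric.mem_ball_self hr
  have key := exists_sum_ge_sphere (μ := μ) (θ := θ) (Φ := fun t p ω => min (fderiv ℝ (fun η =>
    truncLik f M H t η (innovPast ξ t ω)) p.1 p.2 ^ 2) 1) (Metric.ball_mem_nhds θ hr) fun u hu => by
    have hu1 : ‖u‖ = 1 := by simpa using hu
    have hu0 : u ≠ 0 := fun h => by simp [h] at hu1
    obtain ⟨hm, hpos⟩ := hS.integral_min_score_sq_pos hξ hR hI hU hball hθU hu0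
    have hnn : ∀ s : ℝ, 0 ≤ min (s ^ 2) 1 := fun s => le_min (sq_nonneg _) zero_le_one
    refine hξ.exists_sum_ge (K := Metric.ball θ r ×ˢ Metric.closedBall (0 : Param d) 1)
      (Φ := fun t p e => min (fderiv ℝ (fun η => truncLik f M H t η e) p.1 p.2 ^ 2) 1)
      (fun t p hp => ((measurable_fderiv_apply_param hU
        (fun η hη => measurable_truncLik hR hS.measurable t (hball hη))
        (fun e η hη => (hR.contDiffAt_quasiLik _ _ (hball hη)).differentiableAt (by norm_num))
        p.2 hp.1).pow_const 2).min measurable_const)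
      (fun t e => ?_) (g := fun _ => 0) measurable_const (integrable_const 0)
      (Eventually.of_forall fun e t p hp => by simpa using hnn _)
      ⟨hθU, by simp [hu1]⟩ hm ?_ ?_ hpos
    · intro p hp
      have h1 : ContinuousAt (fun η => fderiv ℝ (fun η => truncLik f M H t η e) η) p.1 :=
        ((hR.contDiffAt_quasiLik _ _ (hball hp.1)).differentiableAt_fderiv_two).continuousAt
      have h2 : ContinuousAt (fun p : Param d × Param d =>
          fderiv ℝ (fun η => truncLik f M H t η e) p.1) p := h1.comp continuousAt_fst
      have h3 : ContinuousAt (fun p : Param d × Param d =>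
          min (fderiv ℝ (fun η => truncLik f M H t η e) p.1 p.2 ^ 2) 1) p :=
        ((h2.clm_apply continuousAt_snd).pow 2).min continuousAt_const
      exact h3.continuousWithinAt
    · refine (integrable_const (1 : ℝ)).mono' hm.aestronglyMeasurable
        (Eventually.of_forall fun e => ?_)
      rw [Real.norm_eq_abs, abs_of_nonneg (hnn _)]
      exact min_le_right _ _
    · filter_upwards [ae_hasCutoffLimit hξ hR hS.measurable hS.memLp hU
        (convex_ball θ r).isPreconnected hball] with e he
      exact ((he.tendsto_fderiv hR hball hθU).pow 2).min tendsto_const_nhds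
  obtain ⟨W, hW, c, hc, h⟩ := key
  refine ⟨W, hW, c, hc, ?_⟩
  filter_upwards [h] with ω hω
  filter_upwards [hω] with k hk η hη u hu
  exact (hk η hη u hu).trans (Finset.sum_le_sum fun t _ => min_le_left _ _)

/-- If the averages of `a` converge, the sums of `a²` over `n` terms are `o(n²)`. -/
theorem tendsto_sum_sq_div_sq {a : ℕ → ℝ} {L : ℝ} (ha : ∀ t, 0 ≤ a t)
    (h : Tendsto (fun n : ℕ => (∑ t ∈ Finset.Icc 1 n, a t) / n) atTop (𝓝 L)) :
    Tendsto (fun n : ℕ => (∑ t ∈ Finset.Icc 1 n, a t ^ 2) / (n : ℝ) ^ 2) atTop (𝓝 0) := by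
  rw [Metric.tendsto_nhds]
  intro δ hδ
  have hL0 : 0 ≤ L := ge_of_tendsto' h fun n =>
    div_nonneg (Finset.sum_nonneg fun t _ => ha t) (Nat.cast_nonneg n)
  set ε := δ / (8 * (L + 1)) with hε
  have hε0 : 0 < ε := by positivity
  obtain ⟨K, hK⟩ := exists_abs_sum_segment_sub_le h hε0
  -- a single term is a segment of length one
  have hterm : ∀ n : ℕ, ∀ t ∈ Finset.Icc 1 n, a t ≤ 2 * ε * n + (K + L) := by
    intro n t ht
    rw [Finset.mem_Icc] at ht
    obtain ⟨s, rfl⟩ : ∃ s, t = s + 1 := ⟨t - 1, by omega⟩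
    have h1 := (abs_le.1 (hK s (s + 1) (by omega))).2
    rw [Finset.Icc_self, Finset.sum_singleton] at h1
    push_cast at h1
    have h2 : (s : ℝ) + 1 ≤ n := by exact_mod_cast ht.2
    have h3 : ε * ((s : ℝ) + (s + 1)) ≤ 2 * ε * n := by nlinarith
    linarith
  filter_upwards [h.eventually_lt_const (show L < L + 1 by linarith), eventually_ge_atTop 1,
    tendsto_natCast_atTop_atTop.eventually_gt_atTop ((K + L) / ε)] with n h1 h2 h3
  have hn : (0 : ℝ) < n := by exact_mod_cast h2
  rw [div_lt_iff₀ hε0] at h3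
  rw [div_lt_iff₀ hn] at h1
  rw [Real.dist_eq, sub_zero, abs_of_nonneg (div_nonneg (Finset.sum_nonneg fun t _ => sq_nonneg _)
    (sq_nonneg _)), div_lt_iff₀ (pow_pos hn 2)]
  calc ∑ t ∈ Finset.Icc 1 n, a t ^ 2 ≤ ∑ t ∈ Finset.Icc 1 n, (3 * ε * n) * a t := by
        refine Finset.sum_le_sum fun t ht => ?_
        have := hterm n t ht
        rw [sq]
        exact mul_le_mul_of_nonneg_right (by linarith) (ha t)
    _ = (3 * ε * n) * ∑ t ∈ Finset.Icc 1 n, a t := by rw [Finset.mul_sum]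
    _ ≤ (3 * ε * n) * ((L + 1) * n) := by gcongr
    _ = 3 / 8 * δ * (n : ℝ) ^ 2 := by rw [hε]; field_simp
    _ < δ * (n : ℝ) ^ 2 := by nlinarith [pow_pos hn 2]

/-- The sums of the squared scores over paths of length `k` are `o(k²)`. The scores are dominated by
a multiple of `V⁴`, which is integrable, but they need not be square integrable, so the sums need
not be `O(k)`. -/
theorem IsSolution.ae_sum_fderiv_sq_le (hξ : IsInnovation μ ξ)
    (hR : IsRegular f M Θ αf αv h₀) (hS : IsSolution μ ξ f M θ H) :
    ∀ᵐ ω ∂μ, ∀ δ > 0, ∀ᶠ k : ℕ in atTop, ∀ η ∈ Θ, ∀ u : Param d, ‖u‖ ≤ 1 →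
      ∑ t ∈ Finset.Icc 1 k, fderiv ℝ (fun η => truncLik f M H t η (innovPast ξ t ω)) η u ^ 2
        ≤ δ * (k : ℝ) ^ 2 := by
  obtain ⟨V, hV⟩ := exists_isEnvelope hξ hR hS.measurable hS.memLp
  filter_upwards [hξ.ae_tendsto_average (hV.measurable.pow_const 4) (integrable_pow_four hξ hV),
    ae_all_iff.2 fun t : ℤ => (hξ.measurePreserving_innovPast t).quasiMeasurePreserving.ae hV.ae_le,
    ae_all_iff.2 fun t : ℤ =>
      (hξ.measurePreserving_innovPast t).quasiMeasurePreserving.ae hV.ae_dominated]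
    with ω h1 h2 h3 δ hδ
  have h4 := (tendsto_sum_sq_div_sq (fun t => by positivity) h1).const_mul
    ((6 / h₀ + 8 / h₀ ^ 2) ^ 2)
  rw [mul_zero] at h4
  filter_upwards [h4.eventually_lt_const hδ, eventually_ge_atTop 1] with k hk hk1 η hη u hu
  have hk0 : (0 : ℝ) < k := by exact_mod_cast hk1
  rw [← mul_div_assoc, div_lt_iff₀ (pow_pos hk0 2)] at hk
  refine le_trans ?_ hk.le
  rw [Finset.mul_sum]
  refine Finset.sum_le_sum fun t _ => ?_
  rw [← mul_pow, ← sq_abs]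
  exact pow_le_pow_left₀ (abs_nonneg _)
    (abs_fderiv_truncLik_le hR (h3 t) (hV.one_le _) (h2 t) hη hu t) 2

end

/-! ### The weight matrices of the statistic -/

section

section MatrixForms

variable {ι : Type*} [Fintype ι] [DecidableEq ι]

/-- With `y = G⁻¹ F u`, the quadratic form of `F G⁻¹ F` at `u` is the one of `G` at `y`, and
`u' G y = u' F u`. -/
theorem dotProduct_sandwich {F G : Matrix ι ι ℝ} (hF : Fᵀ = F) (hG : G.det ≠ 0) (u : ι → ℝ) :
    u ⬝ᵥ ((F * G⁻¹ * F) *ᵥ u) = (G⁻¹ *ᵥ (F *ᵥ u)) ⬝ᵥ (G *ᵥ (G⁻¹ *ᵥ (F *ᵥ u))) ∧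
      u ⬝ᵥ (G *ᵥ (G⁻¹ *ᵥ (F *ᵥ u))) = u ⬝ᵥ (F *ᵥ u) := by
  have hGy : G *ᵥ (G⁻¹ *ᵥ (F *ᵥ u)) = F *ᵥ u := by
    rw [Matrix.mulVec_mulVec, Matrix.mul_nonsing_inv _ (isUnit_iff_ne_zero.2 hG), Matrix.one_mulVec]
  refine ⟨?_, by rw [hGy]⟩
  rw [hGy, ← Matrix.mulVec_mulVec, ← Matrix.mulVec_mulVec, Matrix.dotProduct_mulVec,
    ← Matrix.mulVec_transpose, hF]
  exact dotProduct_comm _ _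

/-- The bilinear form of a matrix of averaged products. -/
theorem dotProduct_mulVec_average {T : Finset ℕ} (D : ℕ → ι → ℝ) (N : ℝ) (u w : ι → ℝ) :
    u ⬝ᵥ ((Matrix.of fun i j => N * ∑ t ∈ T, D t i * D t j) *ᵥ w)
      = N * ∑ t ∈ T, (u ⬝ᵥ D t) * (w ⬝ᵥ D t) := by
  simp only [dotProduct, Matrix.mulVec, Matrix.of_apply, Finset.mul_sum, Finset.sum_mul]
  conv_lhs => rw [Finset.sum_comm]
  rw [Finset.sum_comm (s := T)]
  refine Finset.sum_congr rfl fun i _ => ?_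
  rw [Finset.sum_comm (s := T)]
  refine Finset.sum_congr rfl fun j _ => Finset.sum_congr rfl fun t _ => ?_
  ring

end MatrixForms

section Hat

variable {d : ℕ} {f M : Family d} {Θ : Set (Param d)} {αf αv : ℕ → ℕ → ℝ} {h₀ : ℝ}
variable {x : ℤ → ℝ} {T : Finset ℕ} {η : Param d}

theorem dotProduct_pderiv (g : Param d → ℝ) (η u : Param d) :
    (fun i => u i) ⬝ᵥ (fun i => pderiv i g η) = fderiv ℝ g η u := by
  have hsum : ∑ i, u i • (EuclideanSpace.single i (1 : ℝ) : Param d) = u := by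
    ext j
    simp [Finset.sum_apply, Pi.single_apply]
  conv_rhs => rw [← hsum, map_sum]
  simp only [dotProduct, pderiv, map_smul, smul_eq_mul]

theorem dotProduct_GHat (u w : Param d) :
    (fun i => u i) ⬝ᵥ (GHat f M x T η *ᵥ fun i => w i) = (1 / (T.card : ℝ)) *
      ∑ t ∈ T, fderiv ℝ (qHat f M x t) η u * fderiv ℝ (qHat f M x t) η w := by
  simp only [← dotProduct_pderiv]
  exact dotProduct_mulVec_average (fun t i => pderiv i (qHat f M x t) η) _ _ _

theorem IsRegular.contDiffAt_qHat (hR : IsRegular f M Θ αf αv h₀) (x : ℤ → ℝ) (t : ℕ) (hη : η ∈ Θ) :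
    ContDiffAt ℝ 2 (qHat f M x t) η := hR.contDiffAt_quasiLik (x t) (truncPast x t) hη

theorem IsRegular.contDiffAt_LHat (hR : IsRegular f M Θ αf αv h₀) (x : ℤ → ℝ) (T : Finset ℕ)
    (hη : η ∈ Θ) : ContDiffAt ℝ 2 (LHat f M x T) η :=
  contDiffAt_const.mul (ContDiffAt.sum fun t _ => hR.contDiffAt_qHat x t hη)

theorem pderiv_pderiv {g : Param d → ℝ} (hg : ContDiffAt ℝ 2 g η) (i j : Fin d) :
    pderiv i (pderiv j g) η = fderiv ℝ (fderiv ℝ g) η (EuclideanSpace.single i 1)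
      (EuclideanSpace.single j 1) := by
  have h : HasFDerivAt (fun θ => fderiv ℝ g θ (EuclideanSpace.single j (1 : ℝ)))
      ((fderiv ℝ (fderiv ℝ g) η).flip (EuclideanSpace.single j 1)) η :=
    (hg.differentiableAt_fderiv_two.hasFDerivAt.clm_apply
      (hasFDerivAt_const _ η)).congr_fderiv (by ext; simp)
  have h2 : pderiv i (pderiv j g) η = fderiv ℝ (fun θ => fderiv ℝ g θ
    (EuclideanSpace.single j (1 : ℝ))) η (EuclideanSpace.single i 1) := rfl
  rw [h2, h.fderiv]
  rfl

theorem FHat_transpose (hR : IsRegular f M Θ αf αv h₀) (hη : η ∈ Θ) :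
    (FHat f M x T η)ᵀ = FHat f M x T η := by
  have hL := hR.contDiffAt_LHat x T hη
  ext i j
  simp only [FHat, Matrix.transpose_apply, Matrix.of_apply]
  rw [pderiv_pderiv hL, pderiv_pderiv hL, (hL.isSymmSndFDerivAt (by simp)).eq]

theorem fderiv_fderiv_LHat (hR : IsRegular f M Θ αf αv h₀) (hη : η ∈ interior Θ) (u : Param d) :
    fderiv ℝ (fderiv ℝ (LHat f M x T)) η u u
      = -(1 / 2) * ∑ t ∈ T, fderiv ℝ (fderiv ℝ (qHat f M x t)) η u u := by
  have hev : fderiv ℝ (LHat f M x T) =ᶠ[𝓝 η]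
      fun θ => (-(1 / 2) : ℝ) • ∑ t ∈ T, fderiv ℝ (qHat f M x t) θ := by
    filter_upwards [mem_interior_iff_mem_nhds.1 hη] with θ hθ
    have h1 : HasFDerivAt (fun θ => ∑ t ∈ T, qHat f M x t θ)
        (∑ t ∈ T, fderiv ℝ (qHat f M x t) θ) θ := HasFDerivAt.fun_sum fun t _ =>
      ((hR.contDiffAt_qHat x t hθ).differentiableAt (by norm_num)).hasFDerivAt
    exact (h1.const_mul _).fderiv
  have h2 : HasFDerivAt (fun θ => ∑ t ∈ T, fderiv ℝ (qHat f M x t) θ)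
      (∑ t ∈ T, fderiv ℝ (fderiv ℝ (qHat f M x t)) η) η := HasFDerivAt.fun_sum fun t _ =>
    (hR.contDiffAt_qHat x t (interior_subset hη)).differentiableAt_fderiv_two.hasFDerivAt
  have h3 : fderiv ℝ (fun θ => (-(1 / 2) : ℝ) • ∑ t ∈ T, fderiv ℝ (qHat f M x t) θ) η = _ :=
    (h2.const_smul (-(1 / 2) : ℝ)).fderiv
  rw [hev.fderiv_eq, h3]
  simp [sum_apply]

theorem dotProduct_FHat (hR : IsRegular f M Θ αf αv h₀) (hη : η ∈ interior Θ) (u : Param d) :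
    (fun i => u i) ⬝ᵥ (FHat f M x T η *ᵥ fun i => u i) = (1 / (T.card : ℝ)) *
      ∑ t ∈ T, fderiv ℝ (fderiv ℝ (qHat f M x t)) η u u := by
  have hL := hR.contDiffAt_LHat x T (interior_subset hη)
  have hsum : ∑ i, u i • (EuclideanSpace.single i (1 : ℝ) : Param d) = u := by
    ext j
    simp [Finset.sum_apply, Pi.single_apply]
  have h1 : fderiv ℝ (fderiv ℝ (LHat f M x T)) η u u = ∑ i, ∑ j, u i * (u j *
      fderiv ℝ (fderiv ℝ (LHat f M x T)) η (EuclideanSpace.single i 1)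
        (EuclideanSpace.single j 1)) := by
    conv_lhs => rw [← hsum]
    simp only [map_sum, map_smul, sum_apply, smul_apply, smul_eq_mul,
      Finset.mul_sum]
    rw [Finset.sum_comm]
    refine Finset.sum_congr rfl fun i _ => Finset.sum_congr rfl fun j _ => ?_
    ring
  have h2 : (fun i => u i) ⬝ᵥ (FHat f M x T η *ᵥ fun i => u i)
      = -(2 / (T.card : ℝ)) * fderiv ℝ (fderiv ℝ (LHat f M x T)) η u u := by
    rw [h1]
    simp only [dotProduct, Matrix.mulVec, FHat, Matrix.of_apply, Finset.mul_sum, pderiv_pderiv hL]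
    refine Finset.sum_congr rfl fun i _ => Finset.sum_congr rfl fun j _ => ?_
    ring
  rw [h2, fderiv_fderiv_LHat hR hη]
  ring

theorem dotProduct_sandwich_nonneg (hR : IsRegular f M Θ αf αv h₀) (hη : η ∈ Θ) (u : Fin d → ℝ) :
    0 ≤ u ⬝ᵥ (sandwich f M x T η *ᵥ u) := by
  classical
  unfold sandwich
  split_ifs with hdet
  · rw [(dotProduct_sandwich (FHat_transpose hR hη) hdet u).1]
    have h := dotProduct_GHat (f := f) (M := M) (x := x) (T := T) (η := η)
      (WithLp.toLp 2 ((GHat f M x T η)⁻¹ *ᵥ (FHat f M x T η *ᵥ u)))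
      (WithLp.toLp 2 ((GHat f M x T η)⁻¹ *ᵥ (FHat f M x T η *ᵥ u)))
    refine le_of_le_of_eq ?_ h.symm
    exact mul_nonneg (by positivity) (Finset.sum_nonneg fun t _ => mul_self_nonneg _)
  · simp

/-- The weight of the difference of two estimates is large if the second derivatives of the
quasi-likelihood are large and the scores are small (without degenerating). -/
theorem le_dotProduct_sandwich (hR : IsRegular f M Θ αf αv h₀) (hη : η ∈ interior Θ) {c δ : ℝ}
    (hc : 0 < c) (hδ : 0 < δ) (hT : T.Nonempty)
    (hF : ∀ u : Param d, ‖u‖ = 1 →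
      c * T.card ≤ ∑ t ∈ T, fderiv ℝ (fderiv ℝ (qHat f M x t)) η u u)
    (hG0 : ∀ u : Param d, ‖u‖ = 1 → 0 < ∑ t ∈ T, fderiv ℝ (qHat f M x t) η u ^ 2)
    (hG : ∀ u : Param d, ‖u‖ = 1 →
      ∑ t ∈ T, fderiv ℝ (qHat f M x t) η u ^ 2 ≤ δ * (T.card : ℝ) ^ 2) (u : Param d) :
    c ^ 2 * ‖u‖ ^ 2 / (δ * T.card) ≤ (fun i => u i) ⬝ᵥ (sandwich f M x T η *ᵥ fun i => u i) := by
  classical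
  have hN : (0 : ℝ) < T.card := by exact_mod_cast hT.card_pos
  set N : ℝ := (T.card : ℝ) with hNdef
  rcases eq_or_ne u 0 with rfl | hu0
  · simp
  -- reduction to the unit sphere
  have hnorm : ∀ u : Param d, u ≠ 0 → ‖‖u‖⁻¹ • u‖ = 1 := fun u hu => by
    rw [norm_smul, norm_inv, norm_norm, inv_mul_cancel₀ (norm_ne_zero_iff.2 hu)]
  have hscale : ∀ u : Param d, u ≠ 0 → ∀ t, fderiv ℝ (qHat f M x t) η u
      = ‖u‖ * fderiv ℝ (qHat f M x t) η (‖u‖⁻¹ • u) := fun u hu t => by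
    rw [map_smul, smul_eq_mul, mul_inv_cancel_left₀ (norm_ne_zero_iff.2 hu)]
  have hsq : ∀ u : Param d, u ≠ 0 → ∑ t ∈ T, fderiv ℝ (qHat f M x t) η u ^ 2
      = ‖u‖ ^ 2 * ∑ t ∈ T, fderiv ℝ (qHat f M x t) η (‖u‖⁻¹ • u) ^ 2 := fun u hu => by
    rw [Finset.mul_sum]
    exact Finset.sum_congr rfl fun t _ => by rw [hscale u hu t, mul_pow]
  -- without degeneration of the scores, the junk case of the definition of the weight is excluded
  have hdet : (GHat f M x T η).det ≠ 0 := by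
    intro hdet
    obtain ⟨w, hw, hGw⟩ := Matrix.exists_mulVec_eq_zero_iff.2 hdet
    have hw' : WithLp.toLp 2 w ≠ (0 : Param d) := fun h => hw (by
      have := congrArg WithLp.ofLp h
      simpa using this)
    have h1 := dotProduct_GHat (f := f) (M := M) (x := x) (T := T) (η := η)
      (WithLp.toLp 2 w) (WithLp.toLp 2 w)
    have h2 : (GHat f M x T η *ᵥ fun i => (WithLp.toLp 2 w : Param d) i) = 0 := hGw
    rw [h2, dotProduct_zero] at h1
    simp only [← sq] at h1
    rw [hsq _ hw'] at h1
    have h3 := hG0 _ (hnorm _ hw')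
    have h4 : 0 < ‖(WithLp.toLp 2 w : Param d)‖ := norm_pos_iff.2 hw'
    have : 0 < 1 / N * (‖(WithLp.toLp 2 w : Param d)‖ ^ 2 * ∑ t ∈ T,
        fderiv ℝ (qHat f M x t) η (‖(WithLp.toLp 2 w : Param d)‖⁻¹ • WithLp.toLp 2 w) ^ 2) := by
      positivity
    linarith
  have hS : sandwich f M x T η = FHat f M x T η * (GHat f M x T η)⁻¹ * FHat f M x T η := by
    unfold sandwich
    rw [if_pos hdet]
  obtain ⟨e1, e2⟩ := dotProduct_sandwich (FHat_transpose (x := x) (T := T) hR (interior_subset hη))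
    hdet (fun i => u i)
  rw [hS, e1]
  set y : Param d := WithLp.toLp 2 ((GHat f M x T η)⁻¹ *ᵥ (FHat f M x T η *ᵥ fun i => u i)) with hy
  have g1 := dotProduct_GHat (f := f) (M := M) (x := x) (T := T) (η := η) y y
  have g2 := dotProduct_GHat (f := f) (M := M) (x := x) (T := T) (η := η) u y
  have g3 := dotProduct_FHat (x := x) (T := T) hR hη u
  have g2' := (g2.symm.trans e2).trans g3
  refine le_of_le_of_eq ?_ g1.symm
  -- the Cauchy-Schwarz inequality for the form of `G`
  have hCS := Finset.sum_mul_sq_le_sq_mul_sq T (fun t => fderiv ℝ (qHat f M x t) η u)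
    (fun t => fderiv ℝ (qHat f M x t) η y)
  set A := ∑ t ∈ T, fderiv ℝ (qHat f M x t) η u * fderiv ℝ (qHat f M x t) η y with hA
  set B := ∑ t ∈ T, fderiv ℝ (qHat f M x t) η u ^ 2 with hB
  have hup : 0 < ‖u‖ := norm_pos_iff.2 hu0
  have hBle : B ≤ δ * N ^ 2 * ‖u‖ ^ 2 := by
    rw [hB, hsq u hu0, mul_comm]
    exact mul_le_mul_of_nonneg_right (hG _ (hnorm u hu0)) (sq_nonneg _)
  have hAge : c * N * ‖u‖ ^ 2 ≤ A := by
    have h1 := hF _ (hnorm u hu0)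
    have h2 : ∑ t ∈ T, fderiv ℝ (fderiv ℝ (qHat f M x t)) η u u = ‖u‖ ^ 2 * ∑ t ∈ T,
        fderiv ℝ (fderiv ℝ (qHat f M x t)) η (‖u‖⁻¹ • u) (‖u‖⁻¹ • u) := by
      rw [Finset.mul_sum]
      refine Finset.sum_congr rfl fun t _ => ?_
      simp only [map_smul, smul_apply, smul_eq_mul]
      field_simp
    have h3 : A = ∑ t ∈ T, fderiv ℝ (fderiv ℝ (qHat f M x t)) η u u :=
      mul_left_cancel₀ (by positivity : (1 / N : ℝ) ≠ 0) g2'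
    rw [h3, h2, mul_comm]
    exact mul_le_mul_of_nonneg_left h1 (sq_nonneg _)
  have hY0 : 0 ≤ ∑ t ∈ T, fderiv ℝ (qHat f M x t) η y ^ 2 := Finset.sum_nonneg fun t _ => sq_nonneg _
  simp only [← sq]
  set Y := ∑ t ∈ T, fderiv ℝ (qHat f M x t) η y ^ 2 with hYd
  have h5 : (c * N * ‖u‖ ^ 2) ^ 2 ≤ δ * N ^ 2 * ‖u‖ ^ 2 * Y :=
    (pow_le_pow_left₀ (by positivity) hAge 2).trans
      (hCS.trans (mul_le_mul_of_nonneg_right hBle hY0))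
  have h6 : (c * N * ‖u‖ ^ 2) ^ 2 = (N ^ 2 * ‖u‖ ^ 2) * (c ^ 2 * ‖u‖ ^ 2) := by ring
  have h7 : δ * N ^ 2 * ‖u‖ ^ 2 * Y = (N ^ 2 * ‖u‖ ^ 2) * (δ * Y) := by ring
  rw [h6, h7] at h5
  have h8 : c ^ 2 * ‖u‖ ^ 2 ≤ δ * Y := le_of_mul_le_mul_left h5 (by positivity)
  rw [div_le_iff₀ (by positivity)]
  calc c ^ 2 * ‖u‖ ^ 2 ≤ δ * Y := h8
    _ = 1 / N * Y * (δ * N) := by field_simp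

end Hat

end

/-! ### Divergence of the statistic -/

section

section Path

variable {d : ℕ} {f M : Family d} {Θ : Set (Param d)} {αf αv : ℕ → ℕ → ℝ} {h₀ : ℝ}
variable {θ₁ θ₂ : Param d}

theorem quadDiff_eq (S : Matrix (Fin d) (Fin d) ℝ) (a b : Param d) :
    quadDiff S a b = (fun i => (a - b) i) ⬝ᵥ (S *ᵥ fun i => (a - b) i) := rfl

theorem bddAbove_image_PiSet (g : ℕ → ℝ) (v : ℕ → ℝ) (n : ℕ) : BddAbove (g '' PiSet v n) := by
  refine Set.Finite.bddAbove (Set.Finite.image g ((Set.finite_le_nat ⌈(n : ℝ) - v n⌉₊).subset ?_))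
  intro k hk
  have h1 : (k : ℝ) ≤ ⌈(n : ℝ) - v n⌉₊ := hk.2.trans (Nat.le_ceil _)
  have h2 : k ≤ ⌈(n : ℝ) - v n⌉₊ := by exact_mod_cast h1
  exact h2

theorem max_le_QStat {v : ℕ → ℝ} {x : ℤ → ℝ} {est : Finset ℕ → Param d} {n k : ℕ}
    (hk : k ∈ PiSet v n) : max (Q1 f M x est n k) (Q2 f M x est n k) ≤ QStat f M v x est n :=
  max_le_max (le_csSup (bddAbove_image_PiSet _ v n) (Set.mem_image_of_mem _ hk))
    (le_csSup (bddAbove_image_PiSet _ v n) (Set.mem_image_of_mem _ hk))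

/-- The quadratic form of `Σ̂_{n,k}` is bounded from below by the contribution of the observations
before `k`. -/
theorem le_quadDiff_SigmaHat (hR : IsRegular f M Θ αf αv h₀) {x : ℤ → ℝ} {est : Finset ℕ → Param d}
    {n k : ℕ} (hkn : k ≤ n) (hest : est (Ttail n k) ∈ Θ) (a b : Param d) {B : ℝ}
    (hB : B ≤ (fun i => (a - b) i) ⬝ᵥ (sandwich f M x (Tinit k) (est (Tinit k)) *ᵥ
      fun i => (a - b) i)) :
    (k : ℝ) / n * B ≤ quadDiff (SigmaHat f M x est n k) a b := by
  have h1 := dotProduct_sandwich_nonneg (x := x) (T := Ttail n k) hR hest (fun i => (a - b) i)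
  have hkn' : (k : ℝ) ≤ n := by exact_mod_cast hkn
  rw [quadDiff_eq, SigmaHat, Matrix.add_mulVec, Matrix.smul_mulVec, Matrix.smul_mulVec,
    dotProduct_add, dotProduct_smul, dotProduct_smul, smul_eq_mul, smul_eq_mul]
  have h2 : 0 ≤ ((n : ℝ) - k) / n := div_nonneg (by linarith) (Nat.cast_nonneg n)
  have h3 := mul_nonneg h2 h1
  have h4 := mul_le_mul_of_nonneg_left hB (div_nonneg (Nat.cast_nonneg k) (Nat.cast_nonneg n) :
    (0 : ℝ) ≤ (k : ℝ) / n)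
  linarith

/-- If the estimates before and after time `k_n` have different limits, and if the derivatives of
the quasi-likelihood before time `k_n` behave, then the statistic diverges: since the two estimates
differ, one of them differs from the estimate computed on all the observations. -/
theorem tendsto_QStat_atTop (hR : IsRegular f M Θ αf αv h₀) {x : ℕ → ℤ → ℝ}
    {est : ℕ → Finset ℕ → Param d} {k : ℕ → ℕ} {v : ℕ → ℝ} (hne : θ₁ ≠ θ₂)
    (hθ : θ₁ ∈ interior Θ) (hest : ∀ n, est n (Ttail n (k n)) ∈ Θ)
    (h₁ : Tendsto (fun n => est n (Tinit (k n))) atTop (𝓝 θ₁))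
    (h₂ : Tendsto (fun n => est n (Ttail n (k n))) atTop (𝓝 θ₂)) {κ : ℝ} (hκ : 0 < κ)
    (hk₁ : ∀ᶠ n : ℕ in atTop, κ * n ≤ k n) (hk₂ : ∀ᶠ n : ℕ in atTop, κ * n ≤ (n : ℝ) - k n)
    (hv : Tendsto (fun n : ℕ => v n / n) atTop (𝓝 0)) {W W' : Set (Param d)} (hW : W ∈ 𝓝 θ₁)
    (hW' : W' ∈ 𝓝 θ₁) {c : ℝ} (hc : 0 < c)
    (hF : ∀ᶠ n in atTop, ∀ η ∈ W, ∀ u : Param d, ‖u‖ = 1 → c * k n ≤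
      ∑ t ∈ Tinit (k n), fderiv ℝ (fderiv ℝ (qHat f M (x n) t)) η u u)
    (hG0 : ∀ᶠ n in atTop, ∀ η ∈ W', ∀ u : Param d, ‖u‖ = 1 →
      0 < ∑ t ∈ Tinit (k n), fderiv ℝ (qHat f M (x n) t) η u ^ 2)
    (hG : ∀ δ > 0, ∀ᶠ n in atTop, ∀ η ∈ Θ, ∀ u : Param d, ‖u‖ = 1 →
      ∑ t ∈ Tinit (k n), fderiv ℝ (qHat f M (x n) t) η u ^ 2 ≤ δ * (k n : ℝ) ^ 2) :
    Tendsto (fun n => QStat f M v (x n) (est n) n) atTop atTop := by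
  rw [tendsto_atTop]
  intro C
  set Δ := ‖θ₁ - θ₂‖ with hΔ
  have hΔ0 : 0 < Δ := norm_pos_iff.2 (sub_ne_zero.2 hne)
  -- the lower bound is `κ² c² Δ² / (16 δ)`
  set δ := κ ^ 2 * c ^ 2 * Δ ^ 2 / (16 * (|C| + 1)) with hδ
  have hδ0 : 0 < δ := by positivity
  have hdiff : Tendsto (fun n => ‖est n (Tinit (k n)) - est n (Ttail n (k n))‖) atTop (𝓝 Δ) :=
    (h₁.sub h₂).norm
  filter_upwards [hF, hG0, hG δ hδ0, hk₁, hk₂, h₁.eventually hW, h₁.eventually hW',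
    h₁.eventually (isOpen_interior.mem_nhds hθ),
    hdiff.eventually_const_lt (show Δ / 2 < Δ by linarith), hv.eventually_lt_const hκ,
    eventually_ge_atTop 1] with n hF hG0 hG hk₁ hk₂ eW eW' eΘ hdiff hv hn1
  have hn : (0 : ℝ) < n := by exact_mod_cast hn1
  have hk0 : (0 : ℝ) < k n := lt_of_lt_of_le (by positivity) hk₁
  have hk1 : 1 ≤ k n := by
    have : 0 < k n := by exact_mod_cast hk0
    omega
  have hkn : k n ≤ n := by
    have : (k n : ℝ) ≤ n := by
      have : 0 ≤ κ * n := by positivity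
      linarith
    exact_mod_cast this
  rw [div_lt_iff₀ hn] at hv
  -- of all the indices in the maximum, only `k n` is used
  have hmem : k n ∈ PiSet v n := ⟨by linarith, by linarith⟩
  refine le_trans ?_ (max_le_QStat hmem)
  set a := est n (Tinit (k n)) with ha
  set b := est n (Ttail n (k n)) with hb
  set g := est n (Tinit n) with hg
  have hcard : (Tinit (k n)).card = k n := by simp [Tinit]
  have hlow : ∀ u : Param d, c ^ 2 * ‖u‖ ^ 2 / (δ * k n) ≤
      (fun i => u i) ⬝ᵥ (sandwich f M (x n) (Tinit (k n)) a *ᵥ fun i => u i) := by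
    intro u
    have := le_dotProduct_sandwich (x := x n) (T := Tinit (k n)) hR eΘ hc hδ0
      (Finset.card_pos.1 (by omega))
      (fun u hu => by rw [hcard]; exact hF a eW u hu) (fun u hu => hG0 a eW' u hu)
      (fun u hu => by rw [hcard]; exact hG a (interior_subset eΘ) u hu) u
    rwa [hcard] at this
  have hquad : ∀ p : Param d, c ^ 2 * ‖p - g‖ ^ 2 / (δ * n)
      ≤ quadDiff (SigmaHat f M (x n) (est n) n (k n)) p g := by
    intro p
    refine le_of_eq_of_le ?_ (le_quadDiff_SigmaHat hR hkn (hest n) p g (hlow (p - g)))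
    field_simp
  have hscale : ∀ (p : Param d) (s : ℝ), κ * n ≤ s → Δ / 4 ≤ ‖p - g‖ →
      C ≤ s ^ 2 / n * quadDiff (SigmaHat f M (x n) (est n) n (k n)) p g := by
    intro p s hs hp
    have h3 : (κ * n) ^ 2 ≤ s ^ 2 := pow_le_pow_left₀ (by positivity) hs 2
    have h4 : c ^ 2 * (Δ / 4) ^ 2 / (δ * n) ≤ c ^ 2 * ‖p - g‖ ^ 2 / (δ * n) := by gcongr
    calc C ≤ |C| + 1 := by linarith [le_abs_self C]
      _ = (κ * n) ^ 2 / n * (c ^ 2 * (Δ / 4) ^ 2 / (δ * n)) := by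
        rw [hδ]; field_simp; norm_num
      _ ≤ s ^ 2 / n * quadDiff (SigmaHat f M (x n) (est n) n (k n)) p g :=
        mul_le_mul (by gcongr) (h4.trans (hquad p)) (by positivity) (by positivity)
  have htri : Δ / 2 ≤ ‖a - g‖ + ‖b - g‖ := by
    have := norm_sub_le (a - g) (b - g)
    rw [sub_sub_sub_cancel_right] at this
    linarith
  rcases le_total (Δ / 4) ‖a - g‖ with h | h
  · exact (hscale a (k n) hk₁ h).trans (le_max_left _ _)
  · exact (hscale b ((n : ℝ) - k n) hk₂ (by linarith)).trans (le_max_right _ _)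

/-- The quasi-likelihood at time `t` depends on the path up to time `t` only. -/
theorem qHat_congr {x y : ℤ → ℝ} {t : ℕ} (h : ∀ s ≤ (t : ℤ), x s = y s) :
    qHat f M x t = qHat f M y t := by
  have h1 : truncPast x t = truncPast y t := by
    funext i
    unfold truncPast
    split_ifs
    · exact h _ (by omega)
    · rfl
  funext θ
  rw [qHat_eq_quasiLik, qHat_eq_quasiLik, h1, h t le_rfl]

end Path

section Hypotheses

variable {Ω : Type*} [MeasurableSpace Ω] {μ : Measure Ω} {ξ : ℤ → Ω → ℝ}
variable {d : ℕ} {f M : Family d} {Θ : Set (Param d)} {θ : Param d}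

theorem thetaSet_subset {r : ℝ} : ThetaSet μ ξ f M Θ r ⊆ Θ := by
  rintro θ (h | h)
  · exact h.1
  · exact h.1

theorem exists_isRegular (hΘ : IsCompact Θ) (hfm : ∀ θ ∈ Θ, Measurable (f θ))
    (hMm : ∀ θ ∈ Θ, Measurable (M θ))
    (hfs : ∀ x, ∀ θ ∈ Θ, ContDiffAt ℝ 2 (fun η => f η x) θ)
    (hMs : ∀ x, ∀ θ ∈ Θ, ContDiffAt ℝ 2 (fun η => M η x) θ) (hD : AssumptionD M Θ)
    (hK : AssumptionK f M Θ) : ∃ αf αv h₀, IsRegular f M Θ αf αv h₀ := by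
  obtain ⟨h₀, hpos, hle⟩ := hD
  obtain ⟨l, -, hK⟩ := hK
  choose αf αv hf hv _ using hK
  refine ⟨fun i => if h : i ≤ 2 then αf i h else 0, fun i => if h : i ≤ 2 then αv i h else 0, h₀,
    hΘ, hfm, hMm, hfs, hMs, hpos, fun θ hθ x => ?_, fun i hi => ?_, fun i hi => ?_⟩
  · have := hle θ hθ x
    have h0 : 0 ≤ hFun M θ x := sq_nonneg _
    rwa [abs_of_nonneg h0] at this
  · simp only [dif_pos hi]
    exact hf i hi
  · simp only [dif_pos hi]
    exact hv i hi

/-- The errors which are made if the process is observed exactly, but only at positive times. -/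
theorem isVanishing_abs {P : Measure (ℕ → ℝ)} {H : (ℕ → ℝ) → ℝ} (hHm : Measurable H)
    (hH : MemLp H 4 P) : IsVanishing P 4 fun m e => if m = 0 then |H e| else 0 := by
  refine ⟨fun m => ?_, fun m x => ?_, fun m x => ?_, ?_, Eventually.of_forall fun x => ?_⟩
  · split_ifs
    · exact hHm.abs
    · exact measurable_const
  · split_ifs
    · exact abs_nonneg _
    · exact le_rfl
  · rw [if_pos rfl]
    split_ifs
    · exact le_rfl
    · exact abs_nonneg _
  · simp only [if_true]
    exact hH.abs
  · refine tendsto_const_nhds.congr' ?_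
    filter_upwards [eventually_ge_atTop 1] with m hm
    rw [if_neg (by omega)]

/-- Truncation of the observations at time `0` adds an error at the times `t ≤ 0` only. -/
theorem isCloseOn_of_le {u : ℕ → ℤ → ℝ} {z x : ℤ → ℝ} {a b : ℕ} (hu : ∀ m t, 0 ≤ u m t)
    (h : ∀ (m : ℕ) (t : ℤ), t ≤ b → m = 0 ∨ (a : ℤ) + m ≤ t → |x t - z t| ≤ u m t) :
    IsCloseOn (fun m t => u m t + if m = 0 then |z t| else 0) z x a b := by
  intro m t htb hm
  unfold zeroBefore
  by_cases h1 : 1 ≤ t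
  · rw [if_pos h1]
    refine (h m t htb hm).trans (le_add_of_nonneg_right ?_)
    split_ifs
    · exact abs_nonneg _
    · exact le_rfl
  · rw [if_neg h1, zero_sub, abs_neg]
    simp only [show m = 0 by omega, if_true]
    exact le_add_of_nonneg_left (hu 0 t)

end Hypotheses

theorem isLongSegment_floor {τ : ℝ} (hτ : τ ∈ Set.Ioo (0 : ℝ) 1) :
    IsLongSegment (fun _ => 0) (fun n => ⌊(n : ℝ) * τ⌋₊) ∧
      IsLongSegment (fun n => ⌊(n : ℝ) * τ⌋₊) (fun n => n) := by
  obtain ⟨h0, h1⟩ := hτ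
  refine ⟨⟨?_, 1, Eventually.of_forall fun n => by simp⟩, ?_, 1 / (1 - τ), ?_⟩
  · simp only [Nat.cast_zero, sub_zero]
    exact tendsto_natCast_atTop_atTop.comp (tendsto_nat_floor_atTop.comp
      (tendsto_natCast_atTop_atTop.atTop_mul_const h0))
  · refine tendsto_atTop_mono (f := fun n : ℕ => (n : ℝ) * (1 - τ)) (fun n => ?_)
      (tendsto_natCast_atTop_atTop.atTop_mul_const (by linarith))
    have := Nat.floor_le (show (0 : ℝ) ≤ n * τ by positivity)
    linarith
  · refine Eventually.of_forall fun n => ?_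
    have := Nat.floor_le (show (0 : ℝ) ≤ n * τ by positivity)
    have h2 : 0 < 1 - τ := by linarith
    rw [div_mul_eq_mul_div, one_mul, le_div_iff₀ h2]
    linarith

/-- Almost sure divergence implies divergence in probability, also for functions which are not
measurable. -/
theorem tendsto_measure_gt_of_ae_tendsto_atTop {Ω : Type*} [MeasurableSpace Ω] {μ : Measure Ω}
    [IsProbabilityMeasure μ] {Q : ℕ → Ω → ℝ} (h : ∀ᵐ ω ∂μ, Tendsto (fun n => Q n ω) atTop atTop)
    (C : ℝ) : Tendsto (fun n => μ {ω | C < Q n ω}) atTop (𝓝 1) := by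
  set A : ℕ → Set Ω := fun N => {ω | ∀ n ≥ N, C < Q n ω} with hA
  have hmono : Monotone A := fun N N' hN ω hω n hn => hω n (hN.trans hn)
  have h1 := tendsto_measure_iUnion_atTop (μ := μ) hmono
  have h2 : μ (⋃ N, A N) = 1 := by
    rw [← measure_univ (μ := μ)]
    refine measure_congr (eventuallyEq_univ.2 ?_)
    filter_upwards [h] with ω hω
    obtain ⟨N, hN⟩ := eventually_atTop.1 (hω.eventually_gt_atTop C)
    exact Set.mem_iUnion.2 ⟨N, hN⟩
  rw [h2] at h1
  exact tendsto_of_tendsto_of_tendsto_of_le_of_le h1 tendsto_const_nhds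
    (fun n => measure_mono fun ω hω => hω n le_rfl) fun n => prob_le_one

end

/-! ### The statistic under the alternative -/

section

variable {Ω : Type*} [MeasurableSpace Ω] {μ : Measure Ω} [IsProbabilityMeasure μ] {ξ : ℤ → Ω → ℝ}
variable {d : ℕ} {f M : Family d} {Θ : Set (Param d)} {αf αv : ℕ → ℕ → ℝ} {h₀ : ℝ}
variable {θ₁ θ₂ : Param d} {H₁ H₂ : (ℕ → ℝ) → ℝ} {τ : ℝ} {X : ℕ → ℤ → Ω → ℝ}
variable {est : ℕ → Finset ℕ → Ω → Param d} {v : ℕ → ℝ}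

/-- The processes of the alternative, in terms of the functionals `H₁` and `H₂` which generate the
stationary solutions. After the change the process approaches the stationary solution for `θ₂`,
with an error bounded by a stationary process for every distance to the change. -/
theorem LocalAlternative.exists_isVanishing (hξ : IsInnovation μ ξ) (hτ : 0 < τ)
    (hfm : Measurable (f θ₁)) (hMm : Measurable (M θ₁)) (hX : LocalAlternative μ ξ f M τ θ₁ θ₂ X)
    (h₂ : IsAttracting μ ξ f M θ₂ H₂) :
    ∃ Y, IsStationarySolution μ ξ f M θ₁ Y ∧ ∃ H₁, IsSolution μ ξ f M θ₁ H₁ ∧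
      (∀ᵐ ω ∂μ, ∀ t, Y t ω = H₁ (innovPast ξ t ω)) ∧
      ∃ u, IsVanishing (innovLaw μ ξ) 4 u ∧ ∀ᵐ ω ∂μ, ∀ n : ℕ,
        (∀ t ≤ (⌊(n : ℝ) * τ⌋₊ : ℤ), X n t ω = H₁ (innovPast ξ t ω)) ∧
        ∀ (m : ℕ) (t : ℤ), m = 0 ∨ (⌊(n : ℝ) * τ⌋₊ : ℤ) + m ≤ t →
          |X n t ω - H₂ (innovPast ξ t ω)| ≤ u m (innovPast ξ t ω) := by
  obtain ⟨⟨Y, hY, hXY⟩, hmod⟩ := hX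
  obtain ⟨H₁, hS, hYH⟩ := hY.exists_isSolution hξ hfm hMm
  obtain ⟨u, hu, hatt⟩ := h₂.attracts H₁ hS.measurable hS.memLp
  refine ⟨Y, hY, H₁, hS, hYH, u, hu, ?_⟩
  have hfl : ∀ n : ℕ, ⌊(n : ℝ) * τ⌋ = (⌊(n : ℝ) * τ⌋₊ : ℤ) := fun n =>
    (Int.natCast_floor_eq_floor (by positivity)).symm
  have e₁ : ∀ᵐ ω ∂μ, ∀ (n : ℕ) (t : ℤ), t ≤ ⌊(n : ℝ) * τ⌋ → X n t ω = Y t ω := by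
    simp only [ae_all_iff]
    exact hXY
  have e₂ : ∀ᵐ ω ∂μ, ∀ (n : ℕ) (t : ℤ), ⌊(n : ℝ) * τ⌋ < t → X n t ω =
      M θ₂ (past (fun s => X n s ω) t) * ξ t ω + f θ₂ (past (fun s => X n s ω) t) := by
    simp only [ae_all_iff]
    exact hmod
  filter_upwards [hatt, hYH, e₁, e₂] with ω hatt hYH e₁ e₂ n
  have hle : ∀ t ≤ (⌊(n : ℝ) * τ⌋₊ : ℤ), X n t ω = H₁ (innovPast ξ t ω) := fun t ht =>
    (e₁ n t (by rwa [hfl])).trans (hYH t)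
  exact ⟨hle, hatt (fun t => X n t ω) _ hle fun t ht => e₂ n t (by rwa [hfl])⟩

theorem LocalAlternative.ae_tendsto_QStat (hξ : IsInnovation μ ξ)
    (hR : IsRegular f M Θ αf αv h₀) (hne : θ₁ ≠ θ₂)
    (h₁ : θ₁ ∈ interior (ThetaSet μ ξ f M Θ 4)) (h₂ : θ₂ ∈ interior (ThetaSet μ ξ f M Θ 4))
    (hId : ∀ θ, θ = θ₁ ∨ θ = θ₂ → ∀ Y : ℤ → Ω → ℝ,
      IsStationarySolution μ ξ f M θ Y → AssumptionId μ f M Θ Y)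
    (hVar : ∀ θ, θ = θ₁ ∨ θ = θ₂ → ∀ Y : ℤ → Ω → ℝ,
      IsStationarySolution μ ξ f M θ Y → AssumptionVar μ f M Θ Y)
    (hτ : τ ∈ Set.Ioo (0 : ℝ) 1) (hX : LocalAlternative μ ξ f M τ θ₁ θ₂ X)
    (hest : ∀ n : ℕ, ∀ T ⊆ Finset.Icc 1 n, ∀ ω, IsQLME f M Θ (fun t => X n t ω) T (est n T ω))
    (hv : Tendsto (fun n : ℕ => v n / n) atTop (𝓝 0)) :
    ∀ᵐ ω ∂μ, Tendsto (fun n => QStat f M v (fun t => X n t ω) (fun T => est n T ω) n)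
      atTop atTop := by
  have hΘ₁ : θ₁ ∈ interior Θ := interior_mono thetaSet_subset h₁
  have hΘ₂ : θ₂ ∈ Θ := thetaSet_subset (interior_subset h₂)
  obtain ⟨H₂, hA₂⟩ := exists_isAttracting hξ (hR.measurable_f θ₂ hΘ₂) (hR.measurable_M θ₂ hΘ₂)
    (interior_subset h₂)
  have hS₂ := hA₂.isSolution
  have hY₂ := hS₂.isStationarySolution hξ
  have hI₂ : IsIdentified (innovLaw μ ξ) f M Θ H₂ := .of_stationarySolution hξ
    (Eventually.of_forall fun _ _ => rfl) (hId θ₂ (Or.inr rfl) _ hY₂) (hVar θ₂ (Or.inr rfl) _ hY₂)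
  obtain ⟨Y, hY, H₁, hS₁, hYH, u, hu, hpath⟩ := hX.exists_isVanishing hξ hτ.1
    (hR.measurable_f θ₁ (interior_subset hΘ₁)) (hR.measurable_M θ₁ (interior_subset hΘ₁)) hA₂
  have hI₁ : IsIdentified (innovLaw μ ξ) f M Θ H₁ := .of_stationarySolution hξ hYH
    (hId θ₁ (Or.inl rfl) _ hY) (hVar θ₁ (Or.inl rfl) _ hY)
  obtain ⟨W, hW, c, hc, hF⟩ := hS₁.exists_sum_fderiv_fderiv_ge hξ hR hI₁ hΘ₁
  obtain ⟨W', hW', c', hc', hG0⟩ := hS₁.exists_sum_fderiv_sq_ge hξ hR hI₁ hΘ₁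
  obtain ⟨hseg₁, hseg₂⟩ := isLongSegment_floor hτ
  set k : ℕ → ℕ := fun n => ⌊(n : ℝ) * τ⌋₊ with hk
  have hkt : Tendsto k atTop atTop := tendsto_nat_floor_atTop.comp
    (tendsto_natCast_atTop_atTop.atTop_mul_const hτ.1)
  have hkle : ∀ n, (k n : ℝ) ≤ n * τ := fun n => Nat.floor_le (mul_nonneg n.cast_nonneg hτ.1.le)
  have hkn : ∀ n, k n ≤ n := fun n => by
    have : (k n : ℝ) ≤ n := (hkle n).trans (mul_le_of_le_one_right n.cast_nonneg hτ.2.le)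
    exact_mod_cast this
  have hτ1 : 0 < 1 - τ := sub_pos.2 hτ.2
  filter_upwards [hpath, hF, hG0, hS₁.ae_sum_fderiv_sq_le hξ hR,
    hS₁.ae_tendsto_of_isQLME hξ hR (interior_subset hΘ₁) hI₁
      (isVanishing_abs hS₁.measurable hS₁.memLp),
    hS₂.ae_tendsto_of_isQLME hξ hR hΘ₂ hI₂
      (hu.add (isVanishing_abs hS₂.measurable hS₂.memLp))] with ω hpath hF hG0 hG hc₁ hc₂
  -- up to the change the likelihood contributions are those of the stationary solution
  have hq : ∀ n, ∀ t ∈ Finset.Icc 1 (k n), qHat f M (fun s => X n s ω) t =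
      fun η => truncLik f M H₁ t η (innovPast ξ t ω) := by
    intro n t ht
    rw [Finset.mem_Icc] at ht
    rw [qHat_congr (y := fun s => H₁ (innovPast ξ s ω)) fun s hs =>
      (hpath n).1 s (by simp only [hk] at ht; omega)]
    exact funext fun η => qHat_eq_truncLik H₁ t η ω
  refine tendsto_QStat_atTop (k := k) (κ := min (τ / 2) (1 - τ)) (W := W) (W' := W') (c := c) hR hne hΘ₁
    (fun n => (hest n _ (Finset.Icc_subset_Icc (by omega) le_rfl) ω).1)
    (hc₁ (fun n s => X n s ω) (fun _ => 0) k _ hseg₁ (fun n => ?_) fun n => ?_)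
    (hc₂ (fun n s => X n s ω) k (fun n => n) _ hseg₂ (fun n => ?_) fun n => ?_)
    (lt_min (half_pos hτ.1) hτ1) ?_ (Eventually.of_forall fun n => ?_) hv hW hW' hc ?_ ?_ ?_
  · have := isCloseOn_of_le (u := fun _ _ => 0) (z := fun t => H₁ (innovPast ξ t ω))
      (x := fun s => X n s ω) (a := 0) (b := k n) (fun _ _ => le_rfl)
      fun m t ht _ => by rw [(hpath n).1 t ht, sub_self, abs_zero]
    simpa only [zero_add] using this
  · exact hest n _ (Finset.Icc_subset_Icc (by omega) (hkn n)) ω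
  · exact isCloseOn_of_le (fun m t => hu.nonneg m _) fun m t _ hm => (hpath n).2 m t hm
  · exact hest n _ (Finset.Icc_subset_Icc (by omega) le_rfl) ω
  · filter_upwards [(tendsto_natCast_atTop_atTop (R := ℝ)).eventually_ge_atTop (2 / τ)] with n hn
    rw [div_le_iff₀ hτ.1] at hn
    have h3 := Nat.lt_floor_add_one ((n : ℝ) * τ)
    have h4 : min (τ / 2) (1 - τ) * n ≤ τ / 2 * n :=
      mul_le_mul_of_nonneg_right (min_le_left _ _) n.cast_nonneg
    simp only [hk]
    linarith
  · have h4 : min (τ / 2) (1 - τ) * n ≤ (1 - τ) * n :=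
      mul_le_mul_of_nonneg_right (min_le_right _ _) n.cast_nonneg
    linarith [hkle n]
  · filter_upwards [hkt.eventually hF] with n hn η hη u hu
    refine (hn η hη u (by simpa using hu)).trans_eq (Finset.sum_congr rfl fun t ht => ?_)
    rw [hq n t ht]
  · filter_upwards [hkt.eventually hG0, hkt.eventually_ge_atTop 1] with n hn h1 η hη u hu
    have h1' : (0 : ℝ) < k n := by exact_mod_cast h1
    refine ((mul_pos hc' h1').trans_le (hn η hη u (by simpa using hu))).trans_eq
      (Finset.sum_congr rfl fun t ht => ?_)
    rw [hq n t ht]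
  · intro δ hδ
    filter_upwards [hkt.eventually (hG δ hδ)] with n hn η hη u hu
    refine (Finset.sum_congr rfl fun t ht => ?_).trans_le (hn η hη u hu.le)
    rw [hq n t ht]

end

end CausalChange

end

theorem theorem2 {Ω : Type*} [MeasurableSpace Ω] (μ : Measure Ω) [IsProbabilityMeasure μ]
    {d : ℕ} (ξ : ℤ → Ω → ℝ) (hξ : CausalChange.IsInnovation μ ξ)
    (Θ : Set (CausalChange.Param d)) (hΘ : IsCompact Θ)
    (f M : CausalChange.Family d)
    (hfm : ∀ θ ∈ Θ, Measurable (f θ)) (hMm : ∀ θ ∈ Θ, Measurable (M θ))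
    (hfs : ∀ x, ∀ θ ∈ Θ, ContDiffAt ℝ 2 (fun η => f η x) θ)
    (hMs : ∀ x, ∀ θ ∈ Θ, ContDiffAt ℝ 2 (fun η => M η x) θ)
    (hD : CausalChange.AssumptionD M Θ)
    (hK : CausalChange.AssumptionK f M Θ)
    (θ₁ θ₂ : CausalChange.Param d) (hne : θ₁ ≠ θ₂)
    (h₁ : θ₁ ∈ interior (CausalChange.ThetaSet μ ξ f M Θ 4))
    (h₂ : θ₂ ∈ interior (CausalChange.ThetaSet μ ξ f M Θ 4))
    (hId : ∀ θ, θ = θ₁ ∨ θ = θ₂ → ∀ Y : ℤ → Ω → ℝ,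
      CausalChange.IsStationarySolution μ ξ f M θ Y → CausalChange.AssumptionId μ f M Θ Y)
    (hVar : ∀ θ, θ = θ₁ ∨ θ = θ₂ → ∀ Y : ℤ → Ω → ℝ,
      CausalChange.IsStationarySolution μ ξ f M θ Y → CausalChange.AssumptionVar μ f M Θ Y)
    (τ : ℝ) (hτ : τ ∈ Set.Ioo (0 : ℝ) 1)
    (X : ℕ → ℤ → Ω → ℝ) (hX : CausalChange.LocalAlternative μ ξ f M τ θ₁ θ₂ X)
    (est : ℕ → Finset ℕ → Ω → CausalChange.Param d)
    (hest : ∀ n : ℕ, ∀ T ⊆ Finset.Icc 1 n, ∀ ω,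
      CausalChange.IsQLME f M Θ (fun t => X n t ω) T (est n T ω))
    (v : ℕ → ℝ) (hv : Tendsto v atTop atTop)
    (hvn : Tendsto (fun n : ℕ => v n / n) atTop (𝓝 0)) :
    (∀ᵐ ω ∂μ, Tendsto
      (fun n => CausalChange.QStat f M v (fun t => X n t ω) (fun T => est n T ω) n)
      atTop atTop) ∧
    ∀ C : ℝ, Tendsto
      (fun n => μ {ω | C < CausalChange.QStat f M v (fun t => X n t ω)
        (fun T => est n T ω) n})
      atTop (𝓝 1) := by
  obtain ⟨αf, αv, h₀, hR⟩ := CausalChange.exists_isRegular hΘ hfm hMm hfs hMs hD hK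
  have h := CausalChange.LocalAlternative.ae_tendsto_QStat hξ hR hne h₁ h₂ hId hVar hτ hX hest hvn
  exact ⟨h, CausalChange.tendsto_measure_gt_of_ae_tendsto_atTop h⟩
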